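/- Let $l\ge 3$ be an odd integer, $\Bbbk$ a field of characteristic $0$ (for instance $\mathbb{Q}(q)$ or $\mathbb{C}$) and $q\in\Bbbk$ a primitive $2l$-th root of unity. Let $U_q(\mathfrak{sl}_2)$ be the quantum group with divided powers over $\Bbbk$, i.e. the specialization at $v=q$ of the $\mathbb{Z}[v,v^{-1}]$-subalgebra of $U_v(\mathfrak{sl}_2)$ generated by $K^{\pm1}$ and the divided powers $E^{(n)},F^{(n)}$, $n\ge 0$. For $k\ge 0$ let $T(k)$ be the indecomposable tilting $U_q(\mathfrak{sl}_2)$-module of highest weight $k$ (type $\mathbf 1$), let $\mathrm{ch}_{T(k)}(x)=\sum_{n\in\mathbb{Z}}\dim T(k)_n\,x^n$ be its character, where $T(k)_n$ is the subspace of weight $n$, and let $M_k(N)$ be the multiplicity of $T(k)$ as a direct summand of $T(1)^{\otimes N}$, where $T(1)$ is the two-dimensional simple module. Define the character measure on $\mathbb{Z}_{\ge0}$ by $$p_N(k;t)=\frac{M_k(N)\,\mathrm{ch}_{T(k)}(e^t)}{\mathrm{ch}_{T(1)}(e^t)^N}.$$ Fix a real $t>0$ and $N_0\in\{0,1,\dots,2l-1\}$,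 put $\xi_0=\tanh t$ and $N=2lN_1+N_0$. Write $k=k_1l+k_0$ with $0\le k_0\le l-1$ and put $\alpha=\dfrac{k_1-2N_1\xi_0}{\sqrt{2N_1}}$. Then $p_N(\cdot\,;t)$ is a probability measure, and as $N_1\to\infty$ the law of $(k_0,\alpha)$ under $p_N(\cdot\,;t)$ converges weakly on $\{0,\dots,l-1\}\times\mathbb{R}$ to the product measure $p_1(\cdot\,;t)\otimes p_2(\cdot\,;t)$. Here $p_1(\cdot\,;t)$ is the probability distribution on $\{0,\dots,l-1\}$ given by $$p_1(k_0;t)=\begin{cases}\dfrac{(e^{t(k_0+1)}+e^{-t(k_0+1)})(e^{t(l-1-k_0)}-e^{-t(l-1-k_0)})}{l\,(e^{tl}-e^{-tl})},&0\le k_0\le l-2,\\[2mm]\dfrac1l,&k_0=l-1,\end{cases}$$ and $p_2(\cdot\,;t)$ is the Gaussian distribution on $\mathbb{R}$ with mean $0$ and variance $1/(l\cosh^2 t)$, i.e. with density $$p_2(\alpha;t)=\sqrt{\frac{l}{2\pi}}\,\cosh(t)\,e^{-\frac{\alpha^2 l}{2}\cosh^2 t}.$$ -/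

import Mathlib

open scoped LaurentPolynomial TensorProduct Kronecker
open MeasureTheory

noncomputable section

namespace QuantumSl2

/-- The field `ℚ(v)`, as the field of fractions of `ℤ[v, v⁻¹]`. -/
abbrev Qv : Type := FractionRing ℤ[T;T⁻¹]

/-- The formal parameter `v`. -/
def v : Qv := algebraMap ℤ[T;T⁻¹] Qv (LaurentPolynomial.T 1)

theorem v_zpow (n : ℤ) : v ^ n = algebraMap ℤ[T;T⁻¹] Qv (LaurentPolynomial.T n) := by
  have h1 : v * algebraMap ℤ[T;T⁻¹] Qv (LaurentPolynomial.T (-1)) = 1 := by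
    rw [v, ← map_mul, ← LaurentPolynomial.T_add]; simp
  have h0 : v ≠ 0 := left_ne_zero_of_mul_eq_one h1
  have h2 : v⁻¹ = algebraMap ℤ[T;T⁻¹] Qv (LaurentPolynomial.T (-1)) :=
    (eq_inv_of_mul_eq_one_right h1).symm
  rcases n with n | n
  · rw [Int.ofNat_eq_natCast, zpow_natCast, v, ← map_pow, LaurentPolynomial.T_pow]; simp
  · rw [zpow_negSucc, ← inv_pow, h2, ← map_pow, LaurentPolynomial.T_pow]
    congr 2; push_cast; rw [Int.negSucc_eq]; ring

theorem v_ne_zero : v ≠ 0 := by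
  have h := v_zpow 0
  intro h0
  have h1 := v_zpow 1
  have h2 := v_zpow (-1)
  rw [zpow_one, h0] at h1
  have : algebraMap ℤ[T;T⁻¹] Qv (LaurentPolynomial.T 1 * LaurentPolynomial.T (-1)) = 0 := by
    rw [map_mul, ← h1, zero_mul]
  rw [← LaurentPolynomial.T_add] at this
  simp at this

theorem v_zpow_sub_ne_zero {n : ℤ} (hn : n ≠ 0) : v ^ n - v ^ (-n) ≠ 0 := by
  rw [sub_ne_zero, v_zpow, v_zpow]
  intro h
  have h' := IsFractionRing.injective ℤ[T;T⁻¹] Qv h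
  have := congrArg (fun p : ℤ[T;T⁻¹] => p.coeff n) h'
  simp [LaurentPolynomial.T_apply] at this
  omega

/-- The quantum integer `[n] = (vⁿ - v⁻ⁿ) / (v - v⁻¹)`. -/
def qInt (n : ℤ) : Qv := (v ^ n - v ^ (-n)) / (v - v⁻¹)

/-- The quantum factorial `[n]! = [1][2]⋯[n]`. -/
def qFact (n : ℕ) : Qv := ∏ s ∈ Finset.range n, qInt (s + 1)

/-- The divided power `xⁿ / [n]!`. -/
def divPow {B : Type*} [Ring B] [Algebra Qv B] (x : B) (n : ℕ) : B := (qFact n)⁻¹ • x ^ n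

theorem v_sub_ne_zero : v - v⁻¹ ≠ 0 := by
  simpa using v_zpow_sub_ne_zero (n := 1) one_ne_zero

theorem qInt_ne_zero {n : ℤ} (hn : n ≠ 0) : qInt n ≠ 0 :=
  div_ne_zero (v_zpow_sub_ne_zero hn) v_sub_ne_zero

theorem qFact_ne_zero (n : ℕ) : qFact n ≠ 0 :=
  Finset.prod_ne_zero_iff.2 fun s _ => qInt_ne_zero (by omega)

/-- The generators of the quantum group. -/
inductive Gen : Type
  | E | F | K | Kinv

open FreeAlgebra in
/-- The defining relations of `U_v(sl₂)`. -/
inductive Rel : FreeAlgebra Qv Gen → FreeAlgebra Qv Gen → Prop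
  | K_mul_Kinv : Rel (ι Qv Gen.K * ι Qv Gen.Kinv) 1
  | Kinv_mul_K : Rel (ι Qv Gen.Kinv * ι Qv Gen.K) 1
  | K_mul_E : Rel (ι Qv Gen.K * ι Qv Gen.E) (v ^ (2 : ℤ) • (ι Qv Gen.E * ι Qv Gen.K))
  | K_mul_F : Rel (ι Qv Gen.K * ι Qv Gen.F) (v ^ (-2 : ℤ) • (ι Qv Gen.F * ι Qv Gen.K))
  | E_F : Rel (ι Qv Gen.E * ι Qv Gen.F - ι Qv Gen.F * ι Qv Gen.E)
      ((v - v⁻¹)⁻¹ • (ι Qv Gen.K - ι Qv Gen.Kinv))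

/-- The `ℚ(v)`-algebra `U_v(sl₂)`. -/
def Uv : Type := RingQuot Rel

instance : Ring Uv := inferInstanceAs (Ring (RingQuot Rel))
instance : Algebra Qv Uv := inferInstanceAs (Algebra Qv (RingQuot Rel))
instance : Algebra ℤ[T;T⁻¹] Uv := inferInstanceAs (Algebra ℤ[T;T⁻¹] (RingQuot Rel))
instance : IsScalarTower ℤ[T;T⁻¹] Qv Uv :=
  inferInstanceAs (IsScalarTower ℤ[T;T⁻¹] Qv (RingQuot Rel))

namespace Uv

/-- The image of a generator in `U_v(sl₂)`. -/
def gen (g : Gen) : Uv := RingQuot.mkAlgHom Qv Rel (FreeAlgebra.ι Qv g)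

/-- The generator `E`. -/
abbrev E : Uv := gen Gen.E
/-- The generator `F`. -/
abbrev F : Uv := gen Gen.F
/-- The generator `K`. -/
abbrev K : Uv := gen Gen.K
/-- The generator `K⁻¹`. -/
abbrev Kinv : Uv := gen Gen.Kinv

theorem K_mul_Kinv : K * Kinv = 1 := by
  have := RingQuot.mkAlgHom_rel Qv Rel.K_mul_Kinv
  rwa [map_mul, map_one] at this

theorem Kinv_mul_K : Kinv * K = 1 := by
  have := RingQuot.mkAlgHom_rel Qv Rel.Kinv_mul_K
  rwa [map_mul, map_one] at this

theorem K_mul_E : K * E = v ^ (2 : ℤ) • (E * K) := by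
  have := RingQuot.mkAlgHom_rel Qv Rel.K_mul_E
  rwa [map_smul, map_mul, map_mul] at this

theorem K_mul_F : K * F = v ^ (-2 : ℤ) • (F * K) := by
  have := RingQuot.mkAlgHom_rel Qv Rel.K_mul_F
  rwa [map_smul, map_mul, map_mul] at this

theorem E_F : E * F - F * E = (v - v⁻¹)⁻¹ • (K - Kinv) := by
  have := RingQuot.mkAlgHom_rel Qv Rel.E_F
  rwa [map_smul, map_sub, map_sub, map_mul, map_mul] at this

section lift

variable {B : Type*} [Ring B] [Algebra Qv B] (e f k k' : B)

/-- The algebra homomorphism out of `U_v(sl₂)` given by the images of the generators. -/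
def lift (h₁ : k * k' = 1) (h₂ : k' * k = 1) (h₃ : k * e = v ^ (2 : ℤ) • (e * k))
    (h₄ : k * f = v ^ (-2 : ℤ) • (f * k)) (h₅ : e * f - f * e = (v - v⁻¹)⁻¹ • (k - k')) :
    Uv →ₐ[Qv] B :=
  RingQuot.liftAlgHom Qv ⟨FreeAlgebra.lift Qv fun
      | Gen.E => e
      | Gen.F => f
      | Gen.K => k
      | Gen.Kinv => k', by
    intro x y h
    cases h <;> simpa⟩

variable {e f k k'} (h₁ : k * k' = 1) (h₂ : k' * k = 1) (h₃ : k * e = v ^ (2 : ℤ) • (e * k))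
    (h₄ : k * f = v ^ (-2 : ℤ) • (f * k)) (h₅ : e * f - f * e = (v - v⁻¹)⁻¹ • (k - k'))

theorem lift_E : lift e f k k' h₁ h₂ h₃ h₄ h₅ E = e := by
  exact (RingQuot.liftAlgHom_mkAlgHom_apply ..).trans (by simp)
theorem lift_F : lift e f k k' h₁ h₂ h₃ h₄ h₅ F = f := by
  exact (RingQuot.liftAlgHom_mkAlgHom_apply ..).trans (by simp)
theorem lift_K : lift e f k k' h₁ h₂ h₃ h₄ h₅ K = k := by
  exact (RingQuot.liftAlgHom_mkAlgHom_apply ..).trans (by simp)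
theorem lift_Kinv : lift e f k k' h₁ h₂ h₃ h₄ h₅ Kinv = k' := by
  exact (RingQuot.liftAlgHom_mkAlgHom_apply ..).trans (by simp)

end lift

theorem Kinv_mul_E : Kinv * E = v ^ (-2 : ℤ) • (E * Kinv) := by
  have h : E * Kinv = v ^ (2 : ℤ) • (Kinv * E) := by
    calc E * Kinv = Kinv * (K * E) * Kinv := by rw [← mul_assoc, Kinv_mul_K, one_mul]
      _ = _ := by
        rw [K_mul_E, mul_smul_comm, smul_mul_assoc, mul_assoc, mul_assoc, K_mul_Kinv, mul_one]
  rw [h, smul_smul, ← zpow_add₀ v_ne_zero]; simp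

theorem Kinv_mul_F : Kinv * F = v ^ (2 : ℤ) • (F * Kinv) := by
  have h : F * Kinv = v ^ (-2 : ℤ) • (Kinv * F) := by
    calc F * Kinv = Kinv * (K * F) * Kinv := by rw [← mul_assoc, Kinv_mul_K, one_mul]
      _ = _ := by
        rw [K_mul_F, mul_smul_comm, smul_mul_assoc, mul_assoc, mul_assoc, K_mul_Kinv, mul_one]
  rw [h, smul_smul, ← zpow_add₀ v_ne_zero]; simp

/-- The coproduct of `U_v(sl₂)`: `E ↦ E ⊗ 1 + K ⊗ E`, `F ↦ F ⊗ K⁻¹ + 1 ⊗ F`,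
`K^{±1} ↦ K^{±1} ⊗ K^{±1}`. -/
def comul : Uv →ₐ[Qv] Uv ⊗[Qv] Uv :=
  lift (E ⊗ₜ 1 + K ⊗ₜ E) (F ⊗ₜ Kinv + 1 ⊗ₜ F) (K ⊗ₜ K) (Kinv ⊗ₜ Kinv)
    (by rw [Algebra.TensorProduct.tmul_mul_tmul, K_mul_Kinv]; rfl)
    (by rw [Algebra.TensorProduct.tmul_mul_tmul, Kinv_mul_K]; rfl)
    (by
      simp only [mul_add, add_mul, Algebra.TensorProduct.tmul_mul_tmul, K_mul_E, smul_add,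
        TensorProduct.smul_tmul', TensorProduct.tmul_smul, mul_one, one_mul])
    (by
      simp only [mul_add, add_mul, Algebra.TensorProduct.tmul_mul_tmul, K_mul_F, smul_add,
        TensorProduct.smul_tmul', TensorProduct.tmul_smul, mul_one, one_mul, K_mul_Kinv,
        Kinv_mul_K])
    (by
      have hE := sub_eq_iff_eq_add.1 E_F
      have hEK : E * Kinv = v ^ (2 : ℤ) • (Kinv * E) := by
        rw [Kinv_mul_E, smul_smul, ← zpow_add₀ v_ne_zero]; simp
      simp only [mul_add, add_mul, Algebra.TensorProduct.tmul_mul_tmul, mul_one, one_mul, hE,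
        K_mul_F, hEK, TensorProduct.add_tmul, TensorProduct.tmul_add,
        ← TensorProduct.smul_tmul', TensorProduct.tmul_smul, smul_smul,
        ← zpow_add₀ v_ne_zero, TensorProduct.sub_tmul, TensorProduct.tmul_sub, smul_sub]
      simp only [Int.reduceNeg, add_neg_cancel, zpow_zero, one_smul]
      abel)

/-- The antipode of `U_v(sl₂)`: `E ↦ -K⁻¹E`, `F ↦ -FK`, `K^{±1} ↦ K^{∓1}`,
an antihomomorphism. -/
def antipode : Uv →ₐ[Qv] Uvᵐᵒᵖ :=
  lift (MulOpposite.op (-(Kinv * E))) (MulOpposite.op (-(F * K))) (MulOpposite.op Kinv)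
    (MulOpposite.op K)
    (by rw [← MulOpposite.op_mul, K_mul_Kinv]; rfl)
    (by rw [← MulOpposite.op_mul, Kinv_mul_K]; rfl)
    (by
      rw [← MulOpposite.op_mul, ← MulOpposite.op_mul, ← MulOpposite.op_smul]
      congr 1
      rw [neg_mul, mul_neg, smul_neg, mul_assoc, Kinv_mul_E, mul_smul_comm, smul_smul,
        ← zpow_add₀ v_ne_zero]
      simp)
    (by
      rw [← MulOpposite.op_mul, ← MulOpposite.op_mul, ← MulOpposite.op_smul]
      congr 1
      rw [neg_mul, mul_neg, smul_neg, mul_assoc, K_mul_Kinv, mul_one, ← mul_assoc, Kinv_mul_F,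
        smul_mul_assoc, mul_assoc, Kinv_mul_K, smul_smul, ← zpow_add₀ v_ne_zero]
      simp)
    (by
      rw [← MulOpposite.op_mul, ← MulOpposite.op_mul, ← MulOpposite.op_sub,
        ← MulOpposite.op_sub, ← MulOpposite.op_smul]
      congr 1
      have h1 : -(F * K) * -(Kinv * E) = F * E := by
        rw [neg_mul_neg, mul_assoc, ← mul_assoc K, K_mul_Kinv, one_mul]
      have h2 : -(Kinv * E) * -(F * K) = E * F := by
        rw [neg_mul_neg, Kinv_mul_E, smul_mul_assoc, mul_assoc, ← mul_assoc Kinv, Kinv_mul_F,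
          smul_mul_assoc, mul_assoc F, Kinv_mul_K, mul_one, mul_smul_comm, smul_smul,
          ← zpow_add₀ v_ne_zero]
        simp
      rw [h1, h2, ← neg_sub (E * F), E_F, ← smul_neg, neg_sub])

/-- `[K; 0 \atop t] = ∏_{s=1}^t (K v^{1-s} - K⁻¹ v^{s-1}) / (v^s - v^{-s})`. -/
def kbin : ℕ → Uv
  | 0 => 1
  | t + 1 => kbin t * ((v ^ ((t : ℤ) + 1) - v ^ (-((t : ℤ) + 1)))⁻¹ •
      (v ^ (-(t : ℤ)) • K - v ^ (t : ℤ) • Kinv))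

end Uv

/-- The Gaussian binomial coefficient in `ℤ[v, v⁻¹]` with a natural number on top. -/
def gaussNat : ℕ → ℕ → ℤ[T;T⁻¹]
  | _, 0 => 1
  | 0, _ + 1 => 0
  | n + 1, t + 1 => LaurentPolynomial.T ((t : ℤ) + 1) * gaussNat n (t + 1) +
      LaurentPolynomial.T ((t : ℤ) - n) * gaussNat n t

/-- The Gaussian binomial coefficient
`[n \atop t] = ∏_{s=1}^t (v^{n-s+1} - v^{-n+s-1}) / (v^s - v^{-s})` in `ℤ[v, v⁻¹]`, for `n ∈ ℤ`. -/
def gauss : ℤ → ℕ → ℤ[T;T⁻¹]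
  | Int.ofNat n, t => gaussNat n t
  | Int.negSucc n, t => (-1) ^ t * gaussNat (n + t) t

theorem gaussNat_mul (n t : ℕ) : algebraMap ℤ[T;T⁻¹] Qv (gaussNat n t) *
    ∏ s ∈ Finset.range t, (v ^ ((s : ℤ) + 1) - v ^ (-((s : ℤ) + 1))) =
    ∏ s ∈ Finset.range t, (v ^ ((n : ℤ) - s) - v ^ (-((n : ℤ) - s))) := by
  induction n generalizing t with
  | zero =>
    cases t with
    | zero => simp [gaussNat]
    | succ t => rw [gaussNat, Finset.prod_range_succ' (n := t) (f := fun s : ℕ => v ^ (((0 : ℕ) : ℤ) - s) - _)]; simp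
  | succ n ih =>
    cases t with
    | zero => simp [gaussNat]
    | succ t =>
      have h1 := ih (t + 1)
      have h2 := ih t
      rw [Finset.prod_range_succ (n := t) (f := fun s : ℕ => v ^ ((n : ℤ) - s) - _), ← h2] at h1
      rw [Finset.prod_range_succ' (n := t) (f := fun s : ℕ => v ^ (((n + 1 : ℕ) : ℤ) - s) - _)]
      have h3 : ∏ s ∈ Finset.range t, (v ^ (((n + 1 : ℕ) : ℤ) - ((s + 1 : ℕ) : ℤ)) -
          v ^ (-(((n + 1 : ℕ) : ℤ) - ((s + 1 : ℕ) : ℤ)))) =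
          ∏ s ∈ Finset.range t, (v ^ ((n : ℤ) - s) - v ^ (-((n : ℤ) - s))) := by
        refine Finset.prod_congr rfl fun s _ => ?_
        congr 2 <;> push_cast <;> ring
      rw [h3, ← h2, gaussNat, map_add, map_mul, map_mul, ← v_zpow, ← v_zpow, add_mul, mul_assoc,
        h1, Finset.prod_range_succ]
      have e1 : v ^ ((t : ℤ) + 1) * (v ^ ((n : ℤ) - t) - v ^ (-((n : ℤ) - t))) +
          v ^ ((t : ℤ) - n) * (v ^ ((t : ℤ) + 1) - v ^ (-((t : ℤ) + 1))) =
          v ^ (((n + 1 : ℕ) : ℤ) - ((0 : ℕ) : ℤ)) - v ^ (-(((n + 1 : ℕ) : ℤ) - ((0 : ℕ) : ℤ))) := by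
        simp only [mul_sub, ← zpow_add₀ v_ne_zero]
        push_cast
        ring_nf
      rw [← e1]
      ring

theorem gauss_mul (n : ℤ) (t : ℕ) : algebraMap ℤ[T;T⁻¹] Qv (gauss n t) *
    ∏ s ∈ Finset.range t, (v ^ ((s : ℤ) + 1) - v ^ (-((s : ℤ) + 1))) =
    ∏ s ∈ Finset.range t, (v ^ (n - s) - v ^ (-(n - s))) := by
  rcases n with n | n
  · exact gaussNat_mul n t
  · rw [gauss, map_mul, mul_assoc, gaussNat_mul, ← Finset.prod_range_reflect, map_pow, map_neg,
      map_one, ← Finset.card_range t, ← Finset.prod_const, Finset.card_range,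
      ← Finset.prod_mul_distrib]
    refine Finset.prod_congr rfl fun s hs => ?_
    have := Finset.mem_range.1 hs
    have e : ((n + t : ℕ) : ℤ) - ((t - 1 - s : ℕ) : ℤ) = -(Int.negSucc n - (s : ℤ)) := by
      rw [Int.negSucc_eq]; omega
    rw [e, neg_neg]
    ring

theorem qFact_eq (n : ℕ) : qFact n * (v - v⁻¹) ^ n =
    ∏ s ∈ Finset.range n, (v ^ ((s : ℤ) + 1) - v ^ (-((s : ℤ) + 1))) := by
  rw [qFact, ← Finset.card_range n, ← Finset.prod_const, Finset.card_range,
    ← Finset.prod_mul_distrib]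
  exact Finset.prod_congr rfl fun s _ => div_mul_cancel₀ _ v_sub_ne_zero

theorem gauss_eq (n : ℤ) (t : ℕ) : algebraMap ℤ[T;T⁻¹] Qv (gauss n t) =
    (qFact t)⁻¹ * ∏ s ∈ Finset.range t, qInt (n - s) := by
  have h1 : (∏ s ∈ Finset.range t, qInt (n - s)) * (v - v⁻¹) ^ t =
      ∏ s ∈ Finset.range t, (v ^ (n - s) - v ^ (-(n - s))) := by
    nth_rewrite 2 [← Finset.card_range t]
    rw [← Finset.prod_const, ← Finset.prod_mul_distrib]
    exact Finset.prod_congr rfl fun s _ => div_mul_cancel₀ _ v_sub_ne_zero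
  rw [← gauss_mul, ← qFact_eq, ← mul_assoc] at h1
  have := mul_right_cancel₀ (pow_ne_zero t v_sub_ne_zero) h1
  rw [this, mul_comm, mul_assoc, mul_inv_cancel₀ (qFact_ne_zero t), mul_one]

/-- The quantum binomial theorem for divided powers. -/
theorem divPow_add {B : Type*} [Ring B] [Algebra Qv B] {x y : B}
    (h : y * x = v ^ (2 : ℤ) • (x * y)) (n : ℕ) : divPow (x + y) n =
    ∑ p ∈ Finset.HasAntidiagonal.antidiagonal n, v ^ ((p.1 : ℤ) * p.2) • (divPow x p.1 * divPow y p.2) := by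
  have hs (x : B) (n : ℕ) : qInt (n + 1) • divPow x (n + 1) = x * divPow x n := by
    have h1 := qInt_ne_zero (n := (n : ℤ) + 1) (by omega)
    rw [divPow, divPow, qFact, Finset.prod_range_succ, ← qFact, mul_inv, smul_smul, mul_comm,
      mul_assoc, inv_mul_cancel₀ h1, mul_one, pow_succ', mul_smul_comm]
  have hyx (a : ℕ) : y * divPow x a = v ^ (2 * (a : ℤ)) • (divPow x a * y) := by
    rw [divPow, mul_smul_comm, smul_mul_assoc, smul_comm]
    congr 1
    induction a with
    | zero => simp
    | succ a ih =>
      rw [pow_succ, ← mul_assoc, ih, smul_mul_assoc, mul_assoc, h, mul_smul_comm, smul_smul,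
        ← zpow_add₀ v_ne_zero, ← mul_assoc]
      push_cast; ring_nf
  induction n with
  | zero => simp [divPow, qFact]
  | succ n ih =>
    have h1 := qInt_ne_zero (n := (n : ℤ) + 1) (by omega)
    suffices qInt (n + 1) • divPow (x + y) (n + 1) = qInt (n + 1) •
        ∑ p ∈ Finset.HasAntidiagonal.antidiagonal (n + 1),
          v ^ ((p.1 : ℤ) * p.2) • (divPow x p.1 * divPow y p.2) from
      smul_right_injective B h1 this
    rw [hs, ih, add_mul, Finset.mul_sum, Finset.mul_sum]
    have hL : ∑ p ∈ Finset.HasAntidiagonal.antidiagonal n,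
        x * v ^ ((p.1 : ℤ) * p.2) • (divPow x p.1 * divPow y p.2) =
        ∑ p ∈ Finset.HasAntidiagonal.antidiagonal (n + 1), (v ^ (((p.1 : ℤ) - 1) * p.2) * qInt p.1) •
          (divPow x p.1 * divPow y p.2) := by
      rw [Finset.Nat.sum_antidiagonal_succ]
      simp only [Nat.cast_zero, Nat.cast_add, Nat.cast_one]
      rw [show qInt 0 = 0 by simp [qInt], mul_zero, zero_smul, zero_add]
      refine Finset.sum_congr rfl fun p _ => ?_
      rw [mul_smul_comm, ← mul_assoc, ← hs, smul_mul_assoc, smul_smul, add_sub_cancel_right]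
    have hR : ∑ p ∈ Finset.HasAntidiagonal.antidiagonal n,
        y * v ^ ((p.1 : ℤ) * p.2) • (divPow x p.1 * divPow y p.2) =
        ∑ p ∈ Finset.HasAntidiagonal.antidiagonal (n + 1), (v ^ ((p.1 : ℤ) * (p.2 + 1)) * qInt p.2) •
          (divPow x p.1 * divPow y p.2) := by
      rw [Finset.Nat.sum_antidiagonal_succ']
      simp only [Nat.cast_zero, Nat.cast_add, Nat.cast_one]
      rw [show qInt 0 = 0 by simp [qInt], mul_zero, zero_smul, zero_add]
      refine Finset.sum_congr rfl fun p _ => ?_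
      rw [mul_smul_comm, ← mul_assoc, hyx, smul_mul_assoc, mul_assoc, ← hs, mul_smul_comm,
        smul_smul, smul_smul, ← zpow_add₀ v_ne_zero]
      congr 3
      ring
    rw [hL, hR, ← Finset.sum_add_distrib, Finset.smul_sum]
    refine Finset.sum_congr rfl fun p hp => ?_
    rw [← add_smul, smul_smul]
    congr 1
    have hp' : (n : ℤ) + 1 = p.1 + p.2 := by
      have := Finset.HasAntidiagonal.mem_antidiagonal.1 hp; omega
    rw [hp', qInt, qInt, qInt, mul_div_assoc', mul_div_assoc', div_mul_eq_mul_div, ← add_div]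
    congr 1
    simp only [mul_sub, sub_mul, ← zpow_add₀ v_ne_zero]
    ring_nf

open Uv

/-- The `ℤ[v, v⁻¹]`-form of `U_v(sl₂)`, generated by the divided powers `E⁽ⁿ⁾`, `F⁽ⁿ⁾` and by
`K^{±1}`. (The elements `[K; 0 \atop t]` listed among the generators are redundant: they lie in
the subalgebra generated by the others.) -/
def UA : Subalgebra ℤ[T;T⁻¹] Uv :=
  Algebra.adjoin ℤ[T;T⁻¹]
    (Set.range (divPow E) ∪ Set.range (divPow F) ∪ {K, Kinv} ∪ Set.range kbin)

/-- The matrices over `ℚ(v)` with entries in `ℤ[v, v⁻¹]`. -/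
def intMat (ι : Type) [Fintype ι] [DecidableEq ι] : Subalgebra ℤ[T;T⁻¹] (Matrix ι ι Qv) :=
  (Algebra.ofId ℤ[T;T⁻¹] Qv).mapMatrix.range

theorem mem_intMat {ι : Type} [Fintype ι] [DecidableEq ι] {M : Matrix ι ι Qv} :
    M ∈ intMat ι ↔ ∀ i j, ∃ a, algebraMap ℤ[T;T⁻¹] Qv a = M i j := by
  constructor
  · rintro ⟨N, rfl⟩ i j
    exact ⟨N i j, rfl⟩
  · intro h
    choose N hN using h
    exact ⟨Matrix.of N, by ext i j; exact hN i j⟩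

theorem zpow_smul_mem_intMat {ι : Type} [Fintype ι] [DecidableEq ι] {M : Matrix ι ι Qv}
    (h : M ∈ intMat ι) (n : ℤ) : v ^ n • M ∈ intMat ι := by
  rw [v_zpow, algebraMap_smul]
  exact (intMat ι).smul_mem h _

theorem kronecker_mem_intMat {ι κ : Type} [Fintype ι] [DecidableEq ι] [Fintype κ] [DecidableEq κ]
    {M : Matrix ι ι Qv} {N : Matrix κ κ Qv} (hM : M ∈ intMat ι) (hN : N ∈ intMat κ) :
    M ⊗ₖ N ∈ intMat (ι × κ) := by
  rw [mem_intMat] at *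
  intro i j
  obtain ⟨a, ha⟩ := hM i.1 j.1
  obtain ⟨b, hb⟩ := hN i.2 j.2
  exact ⟨a * b, by rw [map_mul, ha, hb]; rfl⟩

theorem diagonal_mem_intMat {ι : Type} [Fintype ι] [DecidableEq ι] (d : ι → ℤ[T;T⁻¹]) :
    Matrix.diagonal (fun i => algebraMap ℤ[T;T⁻¹] Qv (d i)) ∈ intMat ι :=
  ⟨Matrix.diagonal d, by
    exact Matrix.diagonal_map (map_zero _)⟩

/-- A finite-dimensional representation of `U_v(sl₂)` in coordinates with respect to a basis of
weight vectors, such that the `ℤ[v, v⁻¹]`-lattice spanned by the basis is stable under the divided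
powers. -/
structure LatticeRep where
  /-- The index set of the basis. -/
  ι : Type
  /-- The basis is finite. -/
  [fintype : Fintype ι]
  /-- Decidable equality of indices. -/
  [decEq : DecidableEq ι]
  /-- The action. -/
  toHom : Uv →ₐ[Qv] Matrix ι ι Qv
  /-- The weights of the basis vectors. -/
  wt : ι → ℤ
  map_K : toHom K = Matrix.diagonal fun i => v ^ wt i
  int_E : ∀ n, toHom (divPow E n) ∈ intMat ι
  int_F : ∀ n, toHom (divPow F n) ∈ intMat ι

namespace LatticeRep

instance (V : LatticeRep) : Fintype V.ι := V.fintype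
instance (V : LatticeRep) : DecidableEq V.ι := V.decEq

theorem map_Kinv (V : LatticeRep) : V.toHom Kinv = Matrix.diagonal fun i => v ^ (-V.wt i) := by
  have h1 : V.toHom K * V.toHom Kinv = 1 := by rw [← map_mul, K_mul_Kinv, map_one]
  have h2 : (Matrix.diagonal fun i => v ^ (-V.wt i)) * V.toHom K = 1 := by
    rw [map_K, Matrix.diagonal_mul_diagonal, ← Matrix.diagonal_one]
    congr 1; ext i
    rw [← zpow_add₀ v_ne_zero]; simp
  exact (left_inv_eq_right_inv h2 h1).symm

theorem map_kbin (V : LatticeRep) (t : ℕ) : V.toHom (kbin t) =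
    Matrix.diagonal fun i => algebraMap ℤ[T;T⁻¹] Qv (gauss (V.wt i) t) := by
  have key (n : ℤ) (t : ℕ) : algebraMap ℤ[T;T⁻¹] Qv (gauss n t) =
      ∏ s ∈ Finset.range t, (v ^ (n - s) - v ^ (-(n - s))) *
        (v ^ ((s : ℤ) + 1) - v ^ (-((s : ℤ) + 1)))⁻¹ := by
    rw [Finset.prod_mul_distrib, ← gauss_mul, mul_assoc, ← Finset.prod_mul_distrib,
      Finset.prod_eq_one, mul_one]
    exact fun s _ => mul_inv_cancel₀ (v_zpow_sub_ne_zero (by omega))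
  induction t with
  | zero =>
    simp only [kbin, map_one, key, Finset.range_zero, Finset.prod_empty]
    exact Matrix.diagonal_one.symm
  | succ t ih =>
    rw [kbin, map_mul, ih, map_smul, map_sub, map_smul, map_smul, map_K, map_Kinv,
      ← Matrix.diagonal_smul, ← Matrix.diagonal_smul, Matrix.diagonal_sub, ← Matrix.diagonal_smul,
      Matrix.diagonal_mul_diagonal]
    congr 1; ext i
    rw [key, key, Finset.prod_range_succ]
    simp only [Pi.smul_apply, smul_eq_mul, ← zpow_add₀ v_ne_zero]
    rw [show -(t : ℤ) + V.wt i = V.wt i - t by ring,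
      show (t : ℤ) + -V.wt i = -(V.wt i - t) by ring]
    ring

theorem map_mem_intMat (V : LatticeRep) (u : UA) : V.toHom u ∈ intMat V.ι := by
  have h : UA ≤ (intMat V.ι).comap (V.toHom.restrictScalars ℤ[T;T⁻¹]) := by
    refine Algebra.adjoin_le ?_
    rintro _ (((⟨n, rfl⟩ | ⟨n, rfl⟩) | hK) | ⟨t, rfl⟩)
    · exact V.int_E n
    · exact V.int_F n
    · rcases hK with rfl | rfl
      · change V.toHom K ∈ intMat V.ι
        simp_rw [map_K, v_zpow]
        exact diagonal_mem_intMat _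
      · change V.toHom Kinv ∈ intMat V.ι
        simp_rw [map_Kinv, v_zpow]
        exact diagonal_mem_intMat _
    · change V.toHom (kbin t) ∈ intMat V.ι
      rw [map_kbin]
      exact diagonal_mem_intMat _
  exact h u.2

/-- The action of the integral form on the lattice, as matrices over `ℤ[v, v⁻¹]`. -/
def intHom (V : LatticeRep) : UA →ₐ[ℤ[T;T⁻¹]] Matrix V.ι V.ι ℤ[T;T⁻¹] :=
  (AlgEquiv.ofInjective (Algebra.ofId ℤ[T;T⁻¹] Qv).mapMatrix
    (Matrix.map_injective (IsFractionRing.injective ℤ[T;T⁻¹] Qv))).symm.toAlgHom.comp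
  (((V.toHom.restrictScalars ℤ[T;T⁻¹]).comp UA.val).codRestrict (intMat V.ι) V.map_mem_intMat)

end LatticeRep

theorem sum_fin_ite (m a : ℕ) (f : ℕ → Qv) :
    ∑ k : Fin m, (if (k : ℕ) = a then f k else 0) = if a < m then f a else 0 := by
  rw [Fin.sum_univ_eq_sum_range (fun k => if k = a then f k else 0), Finset.sum_ite_eq']
  simp

/-- The matrix of `E` on the Weyl module: `E F⁽ᵗ⁾x = [m - t + 1] F⁽ᵗ⁻¹⁾x`. -/
def weylE (m : ℕ) : Matrix (Fin (m + 1)) (Fin (m + 1)) Qv :=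
  Matrix.of fun i j => if (j : ℕ) = i + 1 then qInt ((m : ℤ) - j + 1) else 0

/-- The matrix of `F` on the Weyl module: `F F⁽ᵗ⁾x = [t + 1] F⁽ᵗ⁺¹⁾x`. -/
def weylF (m : ℕ) : Matrix (Fin (m + 1)) (Fin (m + 1)) Qv :=
  Matrix.of fun i j => if (i : ℕ) = j + 1 then qInt ((j : ℤ) + 1) else 0

theorem weylE_pow (m n : ℕ) : weylE m ^ n = Matrix.of fun (i j : Fin (m + 1)) =>
    if (j : ℕ) = i + n then ∏ s ∈ Finset.range n, qInt ((m : ℤ) - i - s) else 0 := by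
  induction n with
  | zero => ext i j; simp [Matrix.one_apply, Fin.ext_iff, eq_comm]
  | succ n ih =>
    ext i j
    rw [pow_succ', ih, Matrix.mul_apply]
    simp only [weylE, Matrix.of_apply, ite_mul, zero_mul]
    rw [sum_fin_ite (m + 1) (i + 1) (fun k => qInt ((m : ℤ) - k + 1) *
      if (j : ℕ) = k + n then ∏ s ∈ Finset.range n, qInt ((m : ℤ) - k - s) else 0)]
    have := j.2
    rw [Finset.prod_range_succ']
    have e : ∏ s ∈ Finset.range n, qInt ((m : ℤ) - (i : ℕ) - (s + 1 : ℕ)) =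
        ∏ s ∈ Finset.range n, qInt ((m : ℤ) - ((i : ℕ) + 1 : ℕ) - s) :=
      Finset.prod_congr rfl fun s _ => by congr 1; push_cast; ring
    rw [e]
    split_ifs with h1 h2 h3 h3
    · rw [mul_comm]; congr 2; push_cast; ring
    · omega
    · omega
    · simp
    · omega
    · rfl

theorem weylF_pow (m n : ℕ) : weylF m ^ n = Matrix.of fun (i j : Fin (m + 1)) =>
    if (i : ℕ) = j + n then ∏ s ∈ Finset.range n, qInt ((i : ℤ) - s) else 0 := by
  induction n with
  | zero => ext i j; simp [Matrix.one_apply, Fin.ext_iff]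
  | succ n ih =>
    ext i j
    rw [pow_succ, ih, Matrix.mul_apply]
    simp only [weylF, Matrix.of_apply, mul_ite, mul_zero]
    rw [sum_fin_ite (m + 1) (j + 1) (fun k =>
      (if (i : ℕ) = k + n then ∏ s ∈ Finset.range n, qInt ((i : ℤ) - s) else 0) *
        qInt ((j : ℤ) + 1))]
    have := i.2
    rw [Finset.prod_range_succ]
    split_ifs with h1 h2 h3 h3
    · congr 2; omega
    · omega
    · omega
    · simp
    · omega
    · rfl

theorem qInt_comm (m i : ℤ) :
    qInt (m - i) * qInt (i + 1) - qInt i * qInt (m - i + 1) = qInt (m - 2 * i) := by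
  have h := v_sub_ne_zero
  simp only [qInt]
  rw [div_mul_div_comm, div_mul_div_comm, ← sub_div, div_eq_div_iff (mul_ne_zero h h) h,
    ← mul_assoc]
  congr 1
  rw [← zpow_one v, ← zpow_neg]
  simp only [mul_sub, sub_mul, ← zpow_mul, ← zpow_add₀ v_ne_zero]
  ring_nf

/-- The Weyl module `W(m)`, `m ≥ 0`, in the basis `F⁽ᵗ⁾x`, `0 ≤ t ≤ m`. -/
def weyl (m : ℕ) : LatticeRep where
  ι := Fin (m + 1)
  toHom := Uv.lift (weylE m) (weylF m) (Matrix.diagonal fun t => v ^ ((m : ℤ) - 2 * (t : ℕ)))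
    (Matrix.diagonal fun t => v ^ (-((m : ℤ) - 2 * (t : ℕ))))
    (by
      rw [Matrix.diagonal_mul_diagonal, ← Matrix.diagonal_one]
      congr 1; ext i; rw [← zpow_add₀ v_ne_zero]; simp)
    (by
      rw [Matrix.diagonal_mul_diagonal, ← Matrix.diagonal_one]
      congr 1; ext i; rw [← zpow_add₀ v_ne_zero]; simp)
    (by
      ext i j
      rw [Matrix.diagonal_mul, Matrix.smul_apply, Matrix.mul_diagonal]
      simp only [weylE, Matrix.of_apply]
      split_ifs with h
      · rw [h, smul_eq_mul, mul_left_comm, ← zpow_add₀ v_ne_zero, mul_comm]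
        congr 2; push_cast; ring
      · simp)
    (by
      ext i j
      rw [Matrix.diagonal_mul, Matrix.smul_apply, Matrix.mul_diagonal]
      simp only [weylF, Matrix.of_apply]
      split_ifs with h
      · rw [h, smul_eq_mul, mul_left_comm, ← zpow_add₀ v_ne_zero, mul_comm]
        congr 2; push_cast; ring
      · simp)
    (by
      ext i j
      rw [Matrix.sub_apply, Matrix.mul_apply, Matrix.mul_apply, Matrix.smul_apply,
        Matrix.sub_apply]
      simp only [weylE, weylF, Matrix.of_apply]
      have e1 : ∑ k : Fin (m + 1), ((if (k : ℕ) = (i : ℕ) + 1 then qInt ((m : ℤ) - k + 1) else 0) *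
          if (k : ℕ) = (j : ℕ) + 1 then qInt ((j : ℤ) + 1) else 0) =
          if i = j then qInt ((m : ℤ) - i) * qInt ((i : ℤ) + 1) else 0 := by
        simp only [ite_mul, zero_mul]
        rw [sum_fin_ite (m + 1) (i + 1) (fun k => qInt ((m : ℤ) - k + 1) *
          if k = (j : ℕ) + 1 then qInt ((j : ℤ) + 1) else 0)]
        by_cases hij : i = j
        · subst hij
          simp only [if_true]
          split_ifs with h
          · congr 2; push_cast; ring
          · have : (m : ℤ) - (i : ℕ) = 0 := by have := i.2; omega
            rw [this]; simp [qInt]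
        · have : (i : ℕ) ≠ j := fun h => hij (Fin.ext h)
          simp [this, hij]
      have e2 : ∑ k : Fin (m + 1), ((if (i : ℕ) = (k : ℕ) + 1 then qInt ((k : ℤ) + 1) else 0) *
          if (j : ℕ) = (k : ℕ) + 1 then qInt ((m : ℤ) - j + 1) else 0) =
          if i = j then qInt (i : ℕ) * qInt ((m : ℤ) - i + 1) else 0 := by
        by_cases h0 : (i : ℕ) = 0
        · rw [Finset.sum_eq_zero, h0]
          · simp [qInt]
          · intro k _
            rw [if_neg (by omega), zero_mul]
        · obtain ⟨a, ha⟩ := Nat.exists_eq_succ_of_ne_zero h0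
          have : ∀ k : Fin (m + 1), ((i : ℕ) = (k : ℕ) + 1 ↔ (k : ℕ) = a) := fun k => by omega
          simp only [this, ite_mul, zero_mul]
          rw [sum_fin_ite (m + 1) a (fun k => qInt ((k : ℤ) + 1) *
            if (j : ℕ) = k + 1 then qInt ((m : ℤ) - j + 1) else 0),
            if_pos (by have := i.2; omega)]
          by_cases hij : i = j
          · subst hij
            rw [if_pos ha, if_pos rfl]
            congr 2; omega
          · rw [if_neg fun h => hij (Fin.ext (by omega)), if_neg hij, mul_zero]
      rw [e1, e2]
      by_cases hij : i = j
      · subst hij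
        simp only [if_true, Matrix.diagonal_apply_eq]
        rw [qInt_comm, qInt, smul_eq_mul, div_eq_inv_mul]
      · simp [hij])
  wt t := (m : ℤ) - 2 * (t : ℕ)
  map_K := Uv.lift_K ..
  int_E n := by
    rw [divPow, map_smul, map_pow, Uv.lift_E, weylE_pow, mem_intMat]
    intro i j
    by_cases h : (j : ℕ) = i + n
    · exact ⟨gauss ((m : ℤ) - i) n, by simp [h, gauss_eq]⟩
    · exact ⟨0, by simp [h]⟩
  int_F n := by
    rw [divPow, map_smul, map_pow, Uv.lift_F, weylF_pow, mem_intMat]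
    intro i j
    by_cases h : (i : ℕ) = j + n
    · exact ⟨gauss (i : ℕ) n, by simp [h, gauss_eq]⟩
    · exact ⟨0, by simp [h]⟩

theorem map_divPow {B C : Type*} [Ring B] [Algebra Qv B] [Ring C] [Algebra Qv C] (f : B →ₐ[Qv] C)
    (x : B) (n : ℕ) : f (divPow x n) = divPow (f x) n := by
  rw [divPow, divPow, map_smul, map_pow]

namespace LatticeRep

/-- The action on the tensor product of two representations, through the coproduct. -/
def tensorHom (V W : LatticeRep) : Uv →ₐ[Qv] Matrix (V.ι × W.ι) (V.ι × W.ι) Qv :=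
  ((Matrix.kroneckerAlgEquiv V.ι W.ι Qv).toAlgHom.comp
    (Algebra.TensorProduct.map V.toHom W.toHom)).comp Uv.comul

theorem tensorHom_E (V W : LatticeRep) :
    V.tensorHom W E = V.toHom E ⊗ₖ 1 + V.toHom K ⊗ₖ W.toHom E := by
  simp [tensorHom, Uv.comul, Uv.lift_E]

theorem tensorHom_F (V W : LatticeRep) :
    V.tensorHom W F = V.toHom F ⊗ₖ W.toHom Kinv + 1 ⊗ₖ W.toHom F := by
  simp [tensorHom, Uv.comul, Uv.lift_F]

theorem tensorHom_K (V W : LatticeRep) : V.tensorHom W K = V.toHom K ⊗ₖ W.toHom K := by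
  simp [tensorHom, Uv.comul, Uv.lift_K]

theorem K_pow_mem (V : LatticeRep) (n : ℕ) : V.toHom K ^ n ∈ intMat V.ι := by
  refine pow_mem ?_ n
  simp_rw [map_K, v_zpow]
  exact diagonal_mem_intMat _

theorem Kinv_pow_mem (V : LatticeRep) (n : ℕ) : V.toHom Kinv ^ n ∈ intMat V.ι := by
  refine pow_mem ?_ n
  simp_rw [map_Kinv, v_zpow]
  exact diagonal_mem_intMat _

theorem kronecker_pow {ι κ : Type} [Fintype ι] [DecidableEq ι] [Fintype κ] [DecidableEq κ]
    (M : Matrix ι ι Qv) (N : Matrix κ κ Qv) (n : ℕ) : (M ⊗ₖ N) ^ n = (M ^ n) ⊗ₖ (N ^ n) := by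
  induction n with
  | zero => simp
  | succ n ih => rw [pow_succ, pow_succ, pow_succ, ih, Matrix.mul_kronecker_mul]

/-- The tensor product of two representations. -/
def tensor (V W : LatticeRep) : LatticeRep where
  ι := V.ι × W.ι
  toHom := V.tensorHom W
  wt i := V.wt i.1 + W.wt i.2
  map_K := by
    rw [tensorHom_K, map_K, map_K, Matrix.diagonal_kronecker_diagonal]
    congr 1; ext i
    rw [zpow_add₀ v_ne_zero]
  int_E n := by
    rw [map_divPow, tensorHom_E, divPow_add]
    · refine sum_mem fun p _ => zpow_smul_mem_intMat (mul_mem ?_ ?_) _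
      · rw [divPow, kronecker_pow, one_pow, ← Matrix.smul_kronecker, ← divPow, ← map_divPow]
        exact kronecker_mem_intMat (V.int_E _) (one_mem _)
      · rw [divPow, kronecker_pow, ← Matrix.kronecker_smul, ← divPow, ← map_divPow]
        exact kronecker_mem_intMat (V.K_pow_mem _) (W.int_E _)
    · rw [← Matrix.mul_kronecker_mul, ← Matrix.mul_kronecker_mul, ← map_mul, K_mul_E, map_smul,
        Matrix.smul_kronecker, map_mul, one_mul, mul_one]
  int_F n := by
    rw [map_divPow, tensorHom_F, add_comm, divPow_add]
    · refine sum_mem fun p _ => zpow_smul_mem_intMat (mul_mem ?_ ?_) _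
      · rw [divPow, kronecker_pow, one_pow, ← Matrix.kronecker_smul, ← divPow, ← map_divPow]
        exact kronecker_mem_intMat (one_mem _) (W.int_F _)
      · rw [divPow, kronecker_pow, ← Matrix.smul_kronecker, ← divPow, ← map_divPow]
        exact kronecker_mem_intMat (V.int_F _) (W.Kinv_pow_mem _)
    · rw [← Matrix.mul_kronecker_mul, ← Matrix.mul_kronecker_mul, ← map_mul, Kinv_mul_F, map_smul,
        Matrix.kronecker_smul, map_mul, one_mul, mul_one]

/-- The action on the dual space in the dual basis, `(u f)(w) = f(S(u) w)`. -/
def dualHom (V : LatticeRep) : Uv →ₐ[Qv] Matrix V.ι V.ι Qv :=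
  ((Matrix.transposeAlgEquiv V.ι Qv Qv).symm.toAlgHom.comp (AlgHom.op V.toHom)).comp Uv.antipode

theorem dualHom_E (V : LatticeRep) :
    V.dualHom E = (V.toHom (-(Kinv * E))).transpose := by
  simp [dualHom, Uv.antipode, Uv.lift_E]

theorem dualHom_F (V : LatticeRep) :
    V.dualHom F = (V.toHom (-(F * K))).transpose := by
  simp [dualHom, Uv.antipode, Uv.lift_F]

theorem dualHom_K (V : LatticeRep) : V.dualHom K = (V.toHom Kinv).transpose := by
  simp [dualHom, Uv.antipode, Uv.lift_K]

theorem transpose_mem_intMat {ι : Type} [Fintype ι] [DecidableEq ι] {M : Matrix ι ι Qv}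
    (h : M ∈ intMat ι) : M.transpose ∈ intMat ι := by
  rw [mem_intMat] at *
  exact fun i j => h j i

/-- A power of a product of elements commuting up to a power of `v`. -/
theorem mul_pow_of_comm {B : Type*} [Ring B] [Algebra Qv B] {x y : B} {a : ℤ}
    (h : y * x = v ^ a • (x * y)) (n : ℕ) : ∃ b : ℤ, (x * y) ^ n = v ^ b • (x ^ n * y ^ n) := by
  have hyx (n : ℕ) : ∃ b : ℤ, y ^ n * x = v ^ b • (x * y ^ n) := by
    induction n with
    | zero => exact ⟨0, by simp⟩
    | succ n ih =>
      obtain ⟨b, hb⟩ := ih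
      refine ⟨a + b, ?_⟩
      rw [pow_succ, mul_assoc, h, mul_smul_comm, ← mul_assoc, hb, smul_mul_assoc, smul_smul,
        ← zpow_add₀ v_ne_zero, mul_assoc]
  induction n with
  | zero => exact ⟨0, by simp⟩
  | succ n ih =>
    obtain ⟨b, hb⟩ := ih
    obtain ⟨c, hc⟩ := hyx n
    refine ⟨b + c, ?_⟩
    rw [pow_succ, hb, smul_mul_assoc, mul_assoc, ← mul_assoc (y ^ n), hc, smul_mul_assoc,
      mul_smul_comm, smul_smul, ← zpow_add₀ v_ne_zero, ← mul_assoc, ← mul_assoc, mul_assoc,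
      ← pow_succ, ← pow_succ]

/-- The dual representation. -/
def dual (V : LatticeRep) : LatticeRep where
  ι := V.ι
  toHom := V.dualHom
  wt i := -V.wt i
  map_K := by rw [dualHom_K, map_Kinv, Matrix.diagonal_transpose]
  int_E n := by
    obtain ⟨b, hb⟩ := mul_pow_of_comm (x := Kinv) (y := E) (a := 2)
      (by rw [Kinv_mul_E, smul_smul, ← zpow_add₀ v_ne_zero]; simp) n
    rw [map_divPow, dualHom_E, divPow, ← Matrix.transpose_pow, ← Matrix.transpose_smul]
    refine transpose_mem_intMat ?_
    rw [← map_pow, neg_pow, hb, ← map_smul, mul_smul_comm, smul_comm, map_smul]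
    refine zpow_smul_mem_intMat ?_ b
    rw [← mul_smul_comm, ← mul_smul_comm, map_mul, map_mul, map_pow, map_neg, map_one, map_pow]
    exact mul_mem (pow_mem (neg_mem (one_mem _)) _) (mul_mem (V.Kinv_pow_mem n) (V.int_E n))
  int_F n := by
    obtain ⟨b, hb⟩ := mul_pow_of_comm (x := F) (y := K) (a := -2) K_mul_F n
    rw [map_divPow, dualHom_F, divPow, ← Matrix.transpose_pow, ← Matrix.transpose_smul]
    refine transpose_mem_intMat ?_
    rw [← map_pow, neg_pow, hb, ← map_smul, mul_smul_comm, smul_comm, map_smul]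
    refine zpow_smul_mem_intMat ?_ b
    rw [← mul_smul_comm, ← smul_mul_assoc, map_mul, map_mul, map_pow, map_neg, map_one, map_pow]
    exact mul_mem (pow_mem (neg_mem (one_mem _)) _) (mul_mem (V.int_F n) (V.K_pow_mem n))

/-- The tensor power `V^{⊗N}`; the empty tensor product is the trivial module `W(0)`. -/
def tensorPow (V : LatticeRep) : ℕ → LatticeRep
  | 0 => weyl 0
  | N + 1 => (V.tensorPow N).tensor V

end LatticeRep

section Modules

variable (𝕜 : Type*) [Field 𝕜] [Algebra ℤ[T;T⁻¹] 𝕜]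

/-- The quantum group `U_q(sl₂)` with divided powers, over a field `𝕜` which is a
`ℤ[v, v⁻¹]`-algebra through `v ↦ q`. -/
def Uq : Type _ := 𝕜 ⊗[ℤ[T;T⁻¹]] UA

instance : Ring (Uq 𝕜) := inferInstanceAs (Ring (𝕜 ⊗[ℤ[T;T⁻¹]] UA))
instance : Algebra 𝕜 (Uq 𝕜) := inferInstanceAs (Algebra 𝕜 (𝕜 ⊗[ℤ[T;T⁻¹]] UA))

/-- The specialization of an element of the integral form. -/
def toUq (u : UA) : Uq 𝕜 := (1 : 𝕜) ⊗ₜ[ℤ[T;T⁻¹]] u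

/-- The element `K` of the integral form. -/
def KA : UA := ⟨K, Algebra.subset_adjoin (by simp)⟩

/-- The element `[K; 0 \atop t]` of the integral form. -/
def kbinA (t : ℕ) : UA := ⟨kbin t, Algebra.subset_adjoin (by simp)⟩

namespace LatticeRep

variable (V : LatticeRep)

/-- The specialization to `v = q` of the action of the integral form on the lattice. -/
def specHom : Uq 𝕜 →ₐ[𝕜] Matrix V.ι V.ι 𝕜 :=
  Algebra.TensorProduct.lift (Algebra.ofId 𝕜 (Matrix V.ι V.ι 𝕜))
    ((Algebra.ofId ℤ[T;T⁻¹] 𝕜).mapMatrix.comp V.intHom)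
    fun x _ => Algebra.commutes x _

/-- The `U_q(sl₂)`-module obtained by specializing the lattice to `v = q`. -/
def Mod : Type _ := V.ι → 𝕜

instance : AddCommGroup (V.Mod 𝕜) := inferInstanceAs (AddCommGroup (V.ι → 𝕜))
instance : Module 𝕜 (V.Mod 𝕜) := inferInstanceAs (Module 𝕜 (V.ι → 𝕜))

instance : Module (Uq 𝕜) (V.Mod 𝕜) :=
  Module.compHom (V.ι → 𝕜)
    ((Matrix.toLinAlgEquiv' (R := 𝕜) (n := V.ι)).toAlgHom.comp (V.specHom 𝕜)).toRingHom

theorem smul_def (u : Uq 𝕜) (x : V.Mod 𝕜) : u • x = (V.specHom 𝕜 u).mulVec x := rfl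

instance : IsScalarTower 𝕜 (Uq 𝕜) (V.Mod 𝕜) where
  smul_assoc c u x := by
    rw [smul_def, smul_def, map_smul]
    exact Matrix.smul_mulVec c (V.specHom 𝕜 u) (show V.ι → 𝕜 from x)

end LatticeRep

variable (M : Type*) [AddCommGroup M] [Module (Uq 𝕜) M]

/-- `M` has a filtration `0 = M₀ ⊆ M₁ ⊆ ⋯ ⊆ M_n = M` by submodules with `M_{i+1} / M_i ≅ S(w_i)`,
where `w = (w₀, …, w_{n-1})`. -/
def HasFiltration (S : ℕ → LatticeRep) (w : List ℕ) : Prop :=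
  ∃ Fil : ℕ → Submodule (Uq 𝕜) M, Fil 0 = ⊥ ∧ Fil w.length = ⊤ ∧
    ∀ (i : ℕ) (hi : i < w.length), Fil i ≤ Fil (i + 1) ∧
      Nonempty ((Fil (i + 1) ⧸ (Fil i).submoduleOf (Fil (i + 1))) ≃ₗ[Uq 𝕜] (S w[i]).Mod 𝕜)

/-- `M` is a tilting module: it has a filtration by Weyl modules and a filtration by dual Weyl
modules. -/
def IsTilting : Prop :=
  (∃ w, HasFiltration 𝕜 M weyl w) ∧ ∃ w, HasFiltration 𝕜 M (fun m => (weyl m).dual) w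

/-- `M` is indecomposable. -/
def IsIndecomposable : Prop :=
  Nontrivial M ∧ ∀ P Q : Submodule (Uq 𝕜) M, IsCompl P Q → P = ⊥ ∨ Q = ⊥

/-- `M` is an indecomposable tilting module such that, in a Weyl filtration, `W(k)` occurs once and
no `W(k')` with `k' > k` occurs. -/
def IsIndecTilting (k : ℕ) : Prop :=
  IsIndecomposable 𝕜 M ∧ IsTilting 𝕜 M ∧
    ∃ w, HasFiltration 𝕜 M weyl w ∧ w.count k = 1 ∧ ∀ k' ∈ w, k' ≤ k

/-- The subspace of vectors of weight `n ∈ ℤ`: `K x = qⁿ x` and `[K; 0 \atop t] x = [n \atop t] x`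
for all `t`. -/
def weightSpace [Module 𝕜 M] [IsScalarTower 𝕜 (Uq 𝕜) M] (n : ℤ) : Submodule 𝕜 M where
  carrier := {x | toUq 𝕜 KA • x = algebraMap ℤ[T;T⁻¹] 𝕜 (LaurentPolynomial.T n) • x ∧
    ∀ t, toUq 𝕜 (kbinA t) • x = algebraMap ℤ[T;T⁻¹] 𝕜 (gauss n t) • x}
  zero_mem' := by simp
  add_mem' := fun {x y} hx hy =>
    ⟨by rw [smul_add, smul_add, hx.1, hy.1], fun t => by rw [smul_add, smul_add, hx.2, hy.2]⟩
  smul_mem' := fun c x hx =>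
    ⟨by rw [smul_algebra_smul_comm, hx.1, smul_comm],
      fun t => by rw [smul_algebra_smul_comm, hx.2, smul_comm]⟩

/-- The character `ch_M(x) = ∑_n dim(M_n) xⁿ`, as a function of `x`. -/
def character [Module 𝕜 M] [IsScalarTower 𝕜 (Uq 𝕜) M] (x : ℝ) : ℝ :=
  ∑ᶠ n : ℤ, (Module.finrank 𝕜 (weightSpace 𝕜 M n) : ℝ) * x ^ n

/-- The tensor power `T(1)^{⊗N}`, where `T(1) = L(1) = W(1)` is the two-dimensional module
`F v₁ = v₋₁`, `E v₋₁ = v₁`, `K v_{±1} = q^{±1} v_{±1}`. -/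
abbrev TensorPower (N : ℕ) : Type _ := ((weyl 1).tensorPow N).Mod 𝕜

/-- A submodule of `T(1)^{⊗k}` realizing `T(k)`: a direct summand which is an indecomposable tilting
module of highest weight `k`. -/
def tiltingSubmodule (k : ℕ) : Submodule (Uq 𝕜) (TensorPower 𝕜 k) :=
  Classical.epsilon fun P => IsIndecTilting 𝕜 P k ∧ ∃ Q, IsCompl P Q

/-- The indecomposable tilting module `T(k)`, which is unique up to isomorphism. -/
abbrev TiltingModule (k : ℕ) : Type _ := tiltingSubmodule 𝕜 k

/-- The multiplicity `M_k(N)` of `T(k)` in `T(1)^{⊗N}`: the largest `m` such that `T(k)^{⊕m}` is a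
direct summand of `T(1)^{⊗N}`. -/
def multiplicity (k N : ℕ) : ℕ :=
  sSup {m | ∃ (i : (Fin m → TiltingModule 𝕜 k) →ₗ[Uq 𝕜] TensorPower 𝕜 N)
    (p : TensorPower 𝕜 N →ₗ[Uq 𝕜] (Fin m → TiltingModule 𝕜 k)), p ∘ₗ i = LinearMap.id}

/-- The character measure `p_N(k; t) = M_k(N) ch_{T(k)}(e^t) / ch_{T(1)}(e^t)^N`. -/
def charDensity (N k : ℕ) (t : ℝ) : ℝ :=
  multiplicity 𝕜 k N * character 𝕜 (TiltingModule 𝕜 k) (Real.exp t) /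
    character 𝕜 ((weyl 1).Mod 𝕜) (Real.exp t) ^ N

/-- The character measure as a measure on `ℤ_{≥0}`. -/
def charMeasure (N : ℕ) (t : ℝ) : Measure ℕ :=
  Measure.sum fun k => ENNReal.ofReal (charDensity 𝕜 N k t) • Measure.dirac k

/-- The joint law of `k₀` and `α = (k₁ - 2N₁ξ₀) / √(2N₁)`, `ξ₀ = tanh t`, where `k = k₁ l + k₀` with
`0 ≤ k₀ < l` is distributed according to the character measure with `N = 2lN₁ + N₀`. -/
def rescaledCharMeasure (l : ℕ) (hl : 0 < l) (N₀ N₁ : ℕ) (t : ℝ) : Measure (Fin l × ℝ) :=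
  (charMeasure 𝕜 (2 * l * N₁ + N₀) t).map fun k =>
    (⟨k % l, Nat.mod_lt k hl⟩,
      (((k / l : ℕ) : ℝ) - 2 * (N₁ : ℝ) * Real.tanh t) / √(2 * (N₁ : ℝ)))

end Modules

/-- The density `p₁(k₀; t)` on `{0, …, l - 1}`. -/
def p₁ (l : ℕ) (t : ℝ) (k₀ : Fin l) : ℝ :=
  let L : ℝ := l
  let k : ℝ := (k₀ : ℕ)
  if (k₀ : ℕ) = l - 1 then 1 / L
  else (Real.exp (t * (k + 1)) + Real.exp (-(t * (k + 1)))) *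
      (Real.exp (t * (L - 1 - k)) - Real.exp (-(t * (L - 1 - k)))) /
    (L * (Real.exp (t * L) - Real.exp (-(t * L))))

/-- The discrete distribution on `{0, …, l - 1}` with density `p₁`. -/
def p₁Measure (l : ℕ) (t : ℝ) : Measure (Fin l) :=
  Measure.sum fun k₀ => ENNReal.ofReal (p₁ l t k₀) • Measure.dirac k₀

/-- The density `p₂(α; t)` on `ℝ`. -/
def p₂ (l : ℕ) (t α : ℝ) : ℝ :=
  √((l : ℝ) / (2 * Real.pi)) * Real.cosh t * Real.exp (-(α ^ 2 * l / 2 * Real.cosh t ^ 2))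

/-- The distribution on `ℝ` with density `p₂`. -/
def p₂Measure (l : ℕ) (t : ℝ) : Measure ℝ :=
  volume.withDensity fun α => ENNReal.ofReal (p₂ l t α)

end QuantumSl2
end

/-!
The representation theory enters through the characters of the modules `T(k)` and the multiplicities
`M_k(N)`; both are computed by translation functors. Let `V = T(1)` and let `W(k)` be the Weyl module.
The Casimir element `C` is central and acts on `W(k)` by `q^{k+1} + q^{-k-1}`. If it acts on `M` by
`qⁿ + q⁻ⁿ`, then on `M ⊗ V` it satisfies a quadratic equation with roots `q^{n±1} + q^{-n∓1}`
(`casPoly_smul_tv`). If these differ, `M ⊗ V` splits into two generalized eigenspaces; they coincide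
exactly if `n` is divisible by `l`, that is, on the walls `k = l b - 1`. Composing coevaluation
`M → M ⊗ V ⊗ V`, a polynomial in the Casimir element of `M ⊗ V`, and evaluation gives an endomorphism
of `M`, the partial trace. It is a scalar on Weyl modules, and for the projection to an eigenspace this
scalar is nonzero except next to a wall (`translation_scalar_ne_zero`). Hence `M` embeds into the
module obtained by translating it and translating back, and dimensions show that it is a summand
(`IsGlued.up`). On the wall, `W(k) ⊗ V` is a nonsplit extension of `W(k-1)` by `W(k+1)`, since `C` does
not act by a scalar, again because a partial trace is nonzero (`isGlued_tv_weyl`).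

By induction on `k` this determines `T(k)` inside `V^{⊗k}` (`hasShape_tiltingModule`): it is `W(k)` if
`k < l` or `k` is on a wall, and otherwise a nonsplit extension of `W(k')` by `W(k)`, with `k'` the
reflection of `k` at the wall below. The same analysis shows that `T(k) ⊗ V` is a direct sum of modules
`T(k'')`, hence so is `V^{⊗N}` (`isSumOfTilting_tensorPower`). The element `E⁽ᵏ⁾F⁽ᵏ⁾`, which acts on
`T(k)` with rank one, shows that `M_k(N)` is the number of summands `T(k)` in any such decomposition
(`multiplicity_eq`). Comparing dimensions of weight spaces for `k` and `k + 2` yields, with `w(k)` the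
number of `N`-step walks on `ℤ` from `0` to `k` and `k⁺` the reflection of `k` at the wall above,
`M_k + M_{k⁺} = w(k) - w(k+2)` off the walls and `M_k = w(k) - w(k+2)` on the walls
(`multiplicity_add`, `multiplicity_wall`).

Let `x = e^t`, `y = x⁻²`, `m(k) = M_k(N) x^k / (x + x⁻¹)^N`, and let `P` be the distribution after `N`
steps of the walk which moves by `±1` with probabilities proportional to `x^{±1}`; its drift is
`tanh t`. The relations become `m(k) + y^d m(k⁺) = P(k) - y P(k+2)` with `k⁺ = k + 2 d`. The total
variation `∑ |P(n) - P(n+2)|` is `O(N^{-1/2})` (`tsum_abs_walkProb_sub_le`), so in `ℓ¹` all shifts of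
`P` are asymptotically equal; as the reflection `k ↦ k⁺` is injective and `y < 1`, the relations are a
contraction, and `m(k)` is `ℓ¹`-close to a multiple of `P(k)` depending on `k` modulo `l` only
(`tsum_abs_sub_leadingFactor_mul_le`). Multiplication by `x^{-k} ch_{T(k)}(x)`, which also depends
asymptotically on `k` modulo `l` only, shows that the character measure has density close to
`l p₁(k mod l)` with respect to `P` (`tsum_abs_charDensity_sub_le`, `mul_p₁`).

What remains are two facts about the walk: its residue modulo `l` is asymptotically uniform and
independent of its rescaled position, again by smallness of the total variation and since `2` generates
`ℤ / l` for odd `l` (`tendsto_tsum_walkProb_residue`), and the rescaled position is asymptotically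
normal (`tendsto_charFun_walkLaw`).
-/

noncomputable section
set_option linter.unusedSectionVars false
set_option linter.unusedSimpArgs false
namespace QuantumSl2
open Uv

/-! ### Tensoring with the two-dimensional module -/

/-- Induction on the generators `E`, `F`, `K`, `K⁻¹` of `U_v(sl₂)`. -/
theorem Uv.induction {p : Uv → Prop} (hc : ∀ c : Qv, p (algebraMap Qv Uv c))
    (hE : p E) (hF : p F) (hK : p K) (hKinv : p Kinv) (hadd : ∀ a b, p a → p b → p (a + b))
    (hmul : ∀ a b, p a → p b → p (a * b)) (u : Uv) : p u := by
  obtain ⟨w, rfl⟩ := RingQuot.mkAlgHom_surjective Qv Rel u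
  induction w using FreeAlgebra.induction with
  | grade0 c => rw [AlgHom.commutes]; exact hc c
  | grade1 g => cases g <;> assumption
  | mul a b ha hb => rw [map_mul]; exact hmul _ _ ha hb
  | add a b ha hb => rw [map_add]; exact hadd _ _ ha hb

/-- The upper left entry of the relation `EF - FE = (K - K⁻¹) / (v - v⁻¹)` for the images of the
generators under `delta`. -/
theorem commutator_entry_zero_zero {k M : Type*} [Field k] [AddCommGroup M] [Module k M] {v w : k}
    (h : (v - v⁻¹) * w = 1) (x y z : M) :
    (v⁻¹ * w) • x - (v⁻¹ * w) • y + v⁻¹ • z + x - v⁻¹ • z = (w * v) • x - (w * v⁻¹) • y := by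
  match_scalars
  · linear_combination -h
  · ring
  · ring

/-- The lower right entry of the relation `EF - FE = (K - K⁻¹) / (v - v⁻¹)` for the images of the
generators under `delta`. -/
theorem commutator_entry_one_one {k M : Type*} [Field k] [AddCommGroup M] [Module k M] {v w : k}
    (h : (v - v⁻¹) * w = 1) (x y z : M) :
    (v * w) • x - (v * w) • y + v • z - (x + v • z) = (w * v⁻¹) • x - (w * v) • y := by
  match_scalars
  · linear_combination h
  · ring
  · ring

/-- The composite `U_v(sl₂) → U_v(sl₂) ⊗ End V = Mat₂(U_v(sl₂))` of the coproduct with the action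
on the second factor `V = W(1)`, in the basis `v₁, v₋₁`. -/
def delta : Uv →ₐ[Qv] Matrix (Fin 2) (Fin 2) Uv :=
  lift !![E, K; 0, E] !![v⁻¹ • F, 0; 1, v • F] !![v • K, 0; 0, v⁻¹ • K]
    !![v⁻¹ • Kinv, 0; 0, v • Kinv]
    (by simp [Matrix.mul_fin_two, K_mul_Kinv, Matrix.one_fin_two, smul_smul, v_ne_zero])
    (by simp [Matrix.mul_fin_two, Kinv_mul_K, Matrix.one_fin_two, smul_smul, v_ne_zero])
    (by
      have h := v_ne_zero
      simp only [Matrix.mul_fin_two, Matrix.smul_of, Matrix.smul_cons, Matrix.smul_empty, K_mul_E,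
        smul_mul_assoc, mul_smul_comm, mul_zero, zero_mul, add_zero, zero_add, smul_zero,
        smul_smul]
      congr 3 <;> field_simp)
    (by
      have h := v_ne_zero
      simp only [Matrix.mul_fin_two, Matrix.smul_of, Matrix.smul_cons, Matrix.smul_empty, K_mul_F,
        smul_mul_assoc, mul_smul_comm, mul_zero, zero_mul, add_zero, zero_add, smul_zero,
        smul_smul, one_mul, mul_one]
      congr 3 <;> field_simp)
    (by
      have h := v_ne_zero
      have h2 := v_sub_ne_zero
      have h1 := sub_eq_iff_eq_add.1 E_F
      simp only [Matrix.mul_fin_two, Matrix.smul_of, Matrix.smul_cons, Matrix.smul_empty,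
        smul_mul_assoc, mul_smul_comm, mul_zero, zero_mul, add_zero, zero_add, smul_zero,
        smul_smul, one_mul, mul_one, h1, K_mul_F, Matrix.of_sub_of, Matrix.sub_cons,
        Matrix.empty_sub_empty, Matrix.head_cons, Matrix.tail_cons, smul_add, smul_sub, sub_self,
        sub_zero]
      obtain ⟨w, hw, hw'⟩ : ∃ w, w = (v - v⁻¹)⁻¹ ∧ (v - v⁻¹) * w = 1 :=
        ⟨_, rfl, mul_inv_cancel₀ v_sub_ne_zero⟩
      rw [← hw]
      have e1 : v * v ^ (-2 : ℤ) = v⁻¹ := by field_simp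
      congr 3
      · exact commutator_entry_zero_zero hw' K Kinv (F * E)
      · congr 1
        rw [e1, sub_self]
        simp
      · congr 2
        exact commutator_entry_one_one hw' K Kinv (F * E))

theorem delta_E : delta E = !![E, K; 0, E] := lift_E ..
theorem delta_F : delta F = !![v⁻¹ • F, 0; 1, v • F] := lift_F ..
theorem delta_K : delta K = !![v • K, 0; 0, v⁻¹ • K] := lift_K ..
theorem delta_Kinv : delta Kinv = !![v⁻¹ • Kinv, 0; 0, v • Kinv] := lift_Kinv ..

theorem qFact_succ (n : ℕ) : qFact (n + 1) = qFact n * qInt (n + 1) := Finset.prod_range_succ ..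

/-- The coproduct of a divided power, with the second factor acting on `V`, where `E⁽²⁾ = 0`. -/
theorem delta_divPow_E_succ (n : ℕ) : delta (divPow E (n + 1)) =
    !![divPow E (n + 1), v ^ n • (divPow E n * K); 0, divPow E (n + 1)] := by
  have hKE (n : ℕ) : K * E ^ n = v ^ (2 * n) • (E ^ n * K) := by
    induction n with
    | zero => simp
    | succ n ih =>
      rw [pow_succ, ← mul_assoc, ih, smul_mul_assoc, mul_assoc, K_mul_E, mul_smul_comm, smul_smul,
        ← mul_assoc]
      congr 1
      exact (pow_add v (2 * n) 2).symm
  have h (n : ℕ) : (!![E, K; 0, E] : Matrix (Fin 2) (Fin 2) Uv) ^ (n + 1) =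
      !![E ^ (n + 1), (v ^ n * qInt (n + 1)) • (E ^ n * K); 0, E ^ (n + 1)] := by
    induction n with
    | zero => simp [qInt, v_sub_ne_zero]
    | succ n ih =>
      rw [pow_succ', ih, Matrix.mul_fin_two, hKE]
      have hq : v ^ n * qInt (n + 1) + v ^ (2 * (n + 1)) = v ^ (n + 1) * qInt ((n + 1 : ℕ) + 1) := by
        have h := v_ne_zero
        have h2 : v ^ 2 - 1 ≠ 0 := by
          intro h3
          apply v_sub_ne_zero
          field_simp
          rw [h3, mul_zero]
        simp only [qInt, neg_add, zpow_add₀ h, zpow_neg, zpow_natCast, Nat.cast_add, Nat.cast_one,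
          zpow_one]
        field_simp
        ring
      rw [← hq, add_smul]
      simp [pow_succ', mul_assoc]
  rw [map_divPow, delta_E, divPow, h, divPow, divPow]
  simp only [Matrix.smul_of, Matrix.smul_cons, Matrix.smul_empty, smul_zero, smul_smul,
    smul_mul_assoc]
  congr 5
  rw [qFact_succ]
  have := qInt_ne_zero (n := (n : ℤ) + 1) (by omega)
  field_simp

theorem delta_divPow_F_succ (n : ℕ) : delta (divPow F (n + 1)) =
    !![v⁻¹ ^ (n + 1) • divPow F (n + 1), 0; divPow F n, v ^ (n + 1) • divPow F (n + 1)] := by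
  have h (n : ℕ) : (!![v⁻¹ • F, 0; 1, v • F] : Matrix (Fin 2) (Fin 2) Uv) ^ (n + 1) =
      !![v⁻¹ ^ (n + 1) • F ^ (n + 1), 0; qInt (n + 1) • F ^ n, v ^ (n + 1) • F ^ (n + 1)] := by
    induction n with
    | zero => simp [qInt, v_sub_ne_zero]
    | succ n ih =>
      rw [pow_succ', ih, Matrix.mul_fin_two]
      have hq : v⁻¹ ^ (n + 1) + v * qInt (n + 1) = qInt ((n + 1 : ℕ) + 1) := by
        have h := v_ne_zero
        have h2 : v ^ 2 - 1 ≠ 0 := by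
          intro h3
          apply v_sub_ne_zero
          field_simp
          rw [h3, mul_zero]
        simp only [qInt, neg_add, zpow_add₀ h, zpow_neg, zpow_natCast, Nat.cast_add, Nat.cast_one,
          zpow_one, inv_pow]
        field_simp
        ring
      rw [← hq, add_smul]
      simp [pow_succ', smul_smul, mul_comm, mul_left_comm]
  rw [map_divPow, delta_F, divPow, h, divPow, divPow]
  simp only [Matrix.smul_of, Matrix.smul_cons, Matrix.smul_empty, smul_zero, smul_smul]
  have := qInt_ne_zero (n := (n : ℤ) + 1) (by omega)
  congr 3
  · rw [mul_comm]
  · congr 2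
    · rw [qFact_succ]; field_simp
    · rw [mul_comm]

/-- `[K; a \atop t]`, obtained from `[K; 0 \atop t]` by replacing `K` with `v^a K`. -/
def kbinShift (a : ℤ) : ℕ → Uv
  | 0 => 1
  | t + 1 => kbinShift a t * ((v ^ ((t : ℤ) + 1) - v ^ (-((t : ℤ) + 1)))⁻¹ •
      (v ^ (a - t) • K - v ^ (t - a) • Kinv))

theorem kbinShift_zero (t : ℕ) : kbinShift 0 t = kbin t := by
  induction t with
  | zero => rfl
  | succ t ih => simp [kbinShift, kbin, ih]

theorem delta_kbin (t : ℕ) : delta (kbin t) = !![kbinShift 1 t, 0; 0, kbinShift (-1) t] := by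
  induction t with
  | zero => simp [kbin, kbinShift, Matrix.one_fin_two]
  | succ t ih =>
    rw [kbin, map_mul, ih, map_smul, map_sub, map_smul, map_smul, delta_K, delta_Kinv]
    simp only [Matrix.smul_of, Matrix.smul_cons, Matrix.smul_empty, smul_zero, smul_smul,
      Matrix.of_sub_of, Matrix.sub_cons, Matrix.empty_sub_empty, Matrix.head_cons,
      Matrix.tail_cons, Matrix.mul_fin_two, sub_self, mul_zero, zero_mul, add_zero, zero_add,
      kbinShift]
    rw [sub_eq_add_neg (1 : ℤ), sub_eq_add_neg (-1 : ℤ), sub_eq_add_neg (t : ℤ),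
      sub_eq_add_neg (t : ℤ), zpow_add₀ v_ne_zero, zpow_add₀ v_ne_zero, zpow_add₀ v_ne_zero,
      zpow_add₀ v_ne_zero]
    simp [mul_comm, zpow_add₀ v_ne_zero, -neg_add_rev, neg_add]
    ext i
    fin_cases i
    rfl

theorem K_commute_Kinv : K * Kinv = Kinv * K := K_mul_Kinv.trans Kinv_mul_K.symm

/-- The product defining `kbinShift` with the first instead of the last factor split off. -/
theorem kbinShift_succ_succ (a : ℤ) (t : ℕ) : kbinShift (a + 1) (t + 1) =
    (v ^ ((t : ℤ) + 1) - v ^ (-((t : ℤ) + 1)))⁻¹ •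
      (kbinShift a t * (v ^ (a + 1) • K - v ^ (-(a + 1)) • Kinv)) := by
  induction t with
  | zero => simp [kbinShift]
  | succ t ih =>
    rw [kbinShift, ih, kbinShift, smul_mul_assoc, mul_smul_comm, smul_comm, mul_assoc,
      mul_assoc, smul_mul_assoc]
    simp only [mul_smul_comm, smul_smul]
    congr 2
    rw [show a + 1 - ((t + 1 : ℕ) : ℤ) = a - t by push_cast; ring,
      show ((t + 1 : ℕ) : ℤ) - (a + 1) = t - a by push_cast; ring]
    simp only [mul_sub, sub_mul, smul_mul_assoc, mul_smul_comm, K_commute_Kinv, smul_sub]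
    simp only [smul_comm (v ^ (a - t)), smul_comm (v ^ ((t : ℤ) - a))]
    abel

/-- The Pascal rule, which shows that the shifts of `[K; 0 \atop t]` by `±1` are integral. -/
theorem kbinShift_pascal (a : ℤ) (t : ℕ) : kbinShift (a + 1) (t + 1) =
    v ^ ((t : ℤ) + 1) • kbinShift a (t + 1) + v ^ (t - a) • (kbinShift a t * Kinv) := by
  have h := v_zpow_sub_ne_zero (n := (t : ℤ) + 1) (by omega)
  have e : v ^ (a + 1) • K - v ^ (-(a + 1)) • Kinv =
      v ^ ((t : ℤ) + 1) • (v ^ (a - t) • K - v ^ (t - a) • Kinv) +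
        (v ^ ((t : ℤ) + 1) - v ^ (-((t : ℤ) + 1))) • v ^ (t - a) • Kinv := by
    rw [smul_sub, smul_smul, smul_smul, smul_smul, ← zpow_add₀ v_ne_zero, ← zpow_add₀ v_ne_zero,
      sub_mul, ← zpow_add₀ v_ne_zero, ← zpow_add₀ v_ne_zero, sub_smul]
    rw [show (t : ℤ) + 1 + (a - t) = a + 1 by ring,
      show -((t : ℤ) + 1) + (t - a) = -(a + 1) by ring]
    abel
  rw [kbinShift_succ_succ, e, mul_add, smul_add, mul_smul_comm, mul_smul_comm, inv_smul_smul₀ h,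
    kbinShift, mul_smul_comm, mul_smul_comm, smul_comm]

theorem divPow_E_mem (n : ℕ) : divPow E n ∈ UA := Algebra.subset_adjoin (by simp)
theorem divPow_F_mem (n : ℕ) : divPow F n ∈ UA := Algebra.subset_adjoin (by simp)
theorem K_mem : K ∈ UA := Algebra.subset_adjoin (by simp)
theorem Kinv_mem : Kinv ∈ UA := Algebra.subset_adjoin (by simp)
theorem kbin_mem (t : ℕ) : kbin t ∈ UA := Algebra.subset_adjoin (by simp)

theorem zpow_smul_mem {u : Uv} (h : u ∈ UA) (n : ℤ) : v ^ n • u ∈ UA := by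
  rw [v_zpow, algebraMap_smul]
  exact UA.smul_mem h _

theorem kbinShift_one_mem (t : ℕ) : kbinShift 1 t ∈ UA := by
  cases t with
  | zero => exact one_mem _
  | succ t =>
    rw [show (1 : ℤ) = 0 + 1 by ring, kbinShift_pascal, kbinShift_zero, kbinShift_zero]
    exact add_mem (zpow_smul_mem (kbin_mem _) _)
      (zpow_smul_mem (mul_mem (kbin_mem _) Kinv_mem) _)

theorem kbinShift_neg_one_mem (t : ℕ) : kbinShift (-1) t ∈ UA := by
  induction t with
  | zero => exact one_mem _
  | succ t ih =>
    have h := kbinShift_pascal (-1) t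
    rw [neg_add_cancel, kbinShift_zero, ← sub_eq_iff_eq_add] at h
    have h2 : kbinShift (-1) (t + 1) = v ^ (-((t : ℤ) + 1)) •
        (kbin (t + 1) - v ^ ((t : ℤ) - -1) • (kbinShift (-1) t * Kinv)) := by
      rw [h, smul_smul, ← zpow_add₀ v_ne_zero, neg_add_cancel, zpow_zero, one_smul]
    rw [h2]
    exact zpow_smul_mem (sub_mem (kbin_mem _) (zpow_smul_mem (mul_mem ih Kinv_mem) _)) _

theorem inv_eq_zpow : v⁻¹ = v ^ (-1 : ℤ) := by simp

/-- The coproduct of the integral form has integral coefficients. -/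
theorem delta_apply_mem (u : UA) (i j : Fin 2) : delta u i j ∈ UA := by
  have h : UA ≤ (UA.matrix (n := Fin 2)).comap (delta.restrictScalars ℤ[T;T⁻¹]) := by
    have hn (n : ℕ) : v ^ n = v ^ (n : ℤ) := by simp
    refine Algebra.adjoin_le ?_
    rintro _ (((⟨n, rfl⟩ | ⟨n, rfl⟩) | hK) | ⟨t, rfl⟩)
    · change ∀ i j, delta (divPow E n) i j ∈ UA
      cases n with
      | zero => simp [divPow, qFact, Matrix.one_apply, ite_mem]
      | succ n =>
        rw [delta_divPow_E_succ, hn]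
        simp [Fin.forall_fin_two, divPow_E_mem]
        rw [← zpow_natCast]
        exact zpow_smul_mem (mul_mem (divPow_E_mem _) K_mem) _
    · change ∀ i j, delta (divPow F n) i j ∈ UA
      cases n with
      | zero => simp [divPow, qFact, Matrix.one_apply, ite_mem]
      | succ n =>
        rw [delta_divPow_F_succ, inv_pow, ← zpow_natCast, ← zpow_neg]
        simp [Fin.forall_fin_two, divPow_F_mem, -zpow_neg, -zpow_natCast]
        exact ⟨zpow_smul_mem (divPow_F_mem _) _, zpow_smul_mem (divPow_F_mem _) _⟩
    · rcases hK with rfl | rfl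
      · change ∀ i j, delta K i j ∈ UA
        have h1 := zpow_smul_mem K_mem 1
        have h2 := zpow_smul_mem K_mem (-1)
        rw [zpow_one] at h1
        rw [← inv_eq_zpow] at h2
        rw [delta_K]
        simp [Fin.forall_fin_two, h1, h2]
      · change ∀ i j, delta Kinv i j ∈ UA
        have h1 := zpow_smul_mem Kinv_mem 1
        have h2 := zpow_smul_mem Kinv_mem (-1)
        rw [zpow_one] at h1
        rw [← inv_eq_zpow] at h2
        rw [delta_Kinv]
        simp [Fin.forall_fin_two, h1, h2]
    · change ∀ i j, delta (kbin t) i j ∈ UA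
      rw [delta_kbin]
      simp [Fin.forall_fin_two, kbinShift_one_mem, kbinShift_neg_one_mem]
  exact h u.2 i j

/-- The coaction `UA → Mat₂(UA)` on the integral form. -/
def deltaA : UA →ₐ[ℤ[T;T⁻¹]] Matrix (Fin 2) (Fin 2) UA where
  toFun u := Matrix.of fun i j => ⟨delta u i j, delta_apply_mem u i j⟩
  map_one' := by ext i j; fin_cases i <;> fin_cases j <;> simp
  map_mul' a b := by ext i j; simp [Matrix.mul_apply]
  map_zero' := by ext i j; simp
  map_add' a b := by ext i j; simp
  commutes' r := by
    ext i j
    have : ((algebraMap ℤ[T;T⁻¹] UA r : UA) : Uv) = algebraMap Qv Uv (algebraMap ℤ[T;T⁻¹] Qv r) :=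
      IsScalarTower.algebraMap_apply ℤ[T;T⁻¹] Qv Uv r
    simp only [Matrix.of_apply, this, AlgHom.commutes, Matrix.algebraMap_matrix_apply]
    split_ifs
    · exact this.symm
    · rfl

theorem coe_deltaA (u : UA) (i j : Fin 2) : (deltaA u i j : Uv) = delta u i j := rfl

section

variable (𝕜 : Type*) [Field 𝕜] [Algebra ℤ[T;T⁻¹] 𝕜]

instance : Algebra ℤ[T;T⁻¹] (Uq 𝕜) := inferInstanceAs (Algebra ℤ[T;T⁻¹] (𝕜 ⊗[ℤ[T;T⁻¹]] UA))
instance : IsScalarTower ℤ[T;T⁻¹] 𝕜 (Uq 𝕜) :=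
  inferInstanceAs (IsScalarTower ℤ[T;T⁻¹] 𝕜 (𝕜 ⊗[ℤ[T;T⁻¹]] UA))

/-- Specialization as an algebra homomorphism. -/
def toUqHom : UA →ₐ[ℤ[T;T⁻¹]] Uq 𝕜 :=
  (Algebra.TensorProduct.includeRight : UA →ₐ[ℤ[T;T⁻¹]] 𝕜 ⊗[ℤ[T;T⁻¹]] UA)

theorem toUq_eq (u : UA) : toUq 𝕜 u = toUqHom 𝕜 u := rfl

variable {𝕜} in
theorem Uq.induction {p : Uq 𝕜 → Prop} (h0 : p 0) (h : ∀ (c : 𝕜) (u : UA), p (c • toUqHom 𝕜 u))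
    (hadd : ∀ a b, p a → p b → p (a + b)) (u : Uq 𝕜) : p u := by
  refine TensorProduct.induction_on (motive := p) u h0 (fun c u => ?_) hadd
  have := h c u
  rwa [← toUq_eq, show c • toUq 𝕜 u = (c ⊗ₜ[ℤ[T;T⁻¹]] u : 𝕜 ⊗[ℤ[T;T⁻¹]] UA) by
    rw [toUq]; exact (TensorProduct.smul_tmul' c 1 u).trans (by simp)] at this

/-- The coaction on `U_q(sl₂)`. -/
def deltaQ : Uq 𝕜 →ₐ[𝕜] Matrix (Fin 2) (Fin 2) (Uq 𝕜) :=
  Algebra.TensorProduct.lift (Algebra.ofId 𝕜 (Matrix (Fin 2) (Fin 2) (Uq 𝕜)))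
    ((toUqHom 𝕜).mapMatrix.comp deltaA) fun x _ => Algebra.commutes x _

theorem deltaQ_toUqHom (u : UA) : deltaQ 𝕜 (toUqHom 𝕜 u) = (toUqHom 𝕜).mapMatrix (deltaA u) := by
  refine (Algebra.TensorProduct.lift_tmul ..).trans ?_
  simp

variable {𝕜}

section Modules

variable {M N P : Type*} [AddCommGroup M] [Module 𝕜 M] [Module (Uq 𝕜) M] [IsScalarTower 𝕜 (Uq 𝕜) M]
  [AddCommGroup N] [Module 𝕜 N] [Module (Uq 𝕜) N] [IsScalarTower 𝕜 (Uq 𝕜) N]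
  [AddCommGroup P] [Module 𝕜 P] [Module (Uq 𝕜) P] [IsScalarTower 𝕜 (Uq 𝕜) P]

/-- A `𝕜`-linear map commuting with the integral form is `U_q(sl₂)`-linear. -/
def mkHom (f : M →ₗ[𝕜] N) (h : ∀ (u : UA) x, f (toUqHom 𝕜 u • x) = toUqHom 𝕜 u • f x) :
    M →ₗ[Uq 𝕜] N where
  toFun := f
  map_add' := map_add f
  map_smul' u x := by
    induction u using Uq.induction with
    | h0 => simp
    | h c u => simp [h]
    | hadd a b ha hb => simp_all [add_smul]

@[simp] theorem mkHom_apply (f : M →ₗ[𝕜] N) (h) (x : M) : mkHom f h x = f x := rfl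

variable (M) in
/-- The tensor product `M ⊗ V` with the two-dimensional module `V`; an element is given by its
components along `v₁`, `v₋₁`. -/
def TV : Type _ := Fin 2 → M

instance : AddCommGroup (TV M) := inferInstanceAs (AddCommGroup (Fin 2 → M))
instance : Module 𝕜 (TV M) := inferInstanceAs (Module 𝕜 (Fin 2 → M))
instance [FiniteDimensional 𝕜 M] : FiniteDimensional 𝕜 (TV M) :=
  inferInstanceAs (FiniteDimensional 𝕜 (Fin 2 → M))

open scoped Matrix.Module in
instance : Module (Uq 𝕜) (TV M) := Module.compHom (Fin 2 → M) (deltaQ 𝕜).toRingHom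

theorem TV.smul_apply (u : Uq 𝕜) (x : TV M) (i : Fin 2) :
    (u • x) i = deltaQ 𝕜 u i 0 • x 0 + deltaQ 𝕜 u i 1 • x 1 := by
  rw [← Fin.sum_univ_two (fun j => deltaQ 𝕜 u i j • x j)]
  rfl

theorem TV.toUqHom_smul_apply (u : UA) (x : TV M) (i : Fin 2) :
    (toUqHom 𝕜 u • x) i =
      toUqHom 𝕜 (deltaA u i 0) • x 0 + toUqHom 𝕜 (deltaA u i 1) • x 1 := by
  rw [TV.smul_apply, deltaQ_toUqHom]
  rfl

theorem TV.smul_apply' (c : 𝕜) (x : TV M) (i : Fin 2) : (c • x) i = c • x i := rfl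
theorem TV.add_apply (x y : TV M) (i : Fin 2) : (x + y) i = x i + y i := rfl

@[ext] theorem TV.ext {x y : TV M} (h₀ : x 0 = y 0) (h₁ : x 1 = y 1) : x = y := by
  funext i; fin_cases i <;> assumption

instance : IsScalarTower 𝕜 (Uq 𝕜) (TV M) where
  smul_assoc c u x := by
    ext <;> simp [TV.smul_apply, TV.smul_apply', smul_add]

/-- The functor `- ⊗ V` on morphisms. -/
def TV.map (f : M →ₗ[Uq 𝕜] N) : TV M →ₗ[Uq 𝕜] TV N where
  toFun x i := f (x i)
  map_add' x y := TV.ext (map_add f _ _) (map_add f _ _)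
  map_smul' u x := by
    have h (i : Fin 2) : f ((u • x) i) = deltaQ 𝕜 u i 0 • f (x 0) + deltaQ 𝕜 u i 1 • f (x 1) := by
      simp [TV.smul_apply]
    exact TV.ext ((h 0).trans (TV.smul_apply u (fun i => f (x i) : TV N) 0).symm)
      ((h 1).trans (TV.smul_apply u (fun i => f (x i) : TV N) 1).symm)

@[simp] theorem TV.map_apply (f : M →ₗ[Uq 𝕜] N) (x : TV M) (i : Fin 2) : TV.map f x i = f (x i) :=
  rfl

theorem TV.map_comp (f : N →ₗ[Uq 𝕜] P) (g : M →ₗ[Uq 𝕜] N) :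
    TV.map (f ∘ₗ g) = TV.map f ∘ₗ TV.map g := rfl

theorem TV.map_id : TV.map (LinearMap.id : M →ₗ[Uq 𝕜] M) = LinearMap.id := rfl

theorem TV.map_injective {f : M →ₗ[Uq 𝕜] N} (h : Function.Injective f) :
    Function.Injective (TV.map f) := fun _ _ hxy =>
  TV.ext (h (congrFun hxy 0)) (h (congrFun hxy 1))

theorem TV.map_surjective {f : M →ₗ[Uq 𝕜] N} (h : Function.Surjective f) :
    Function.Surjective (TV.map f) := fun y => by
  choose g hg using h
  exact ⟨fun i => g (y i), funext fun i => hg (y i)⟩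

theorem TV.map_exact {f : M →ₗ[Uq 𝕜] N} {g : N →ₗ[Uq 𝕜] P} (h : Function.Exact f g) :
    Function.Exact (TV.map f) (TV.map g) := fun y => by
  constructor
  · intro hy
    obtain ⟨a, ha⟩ := (h (y 0)).1 (congrFun hy 0)
    obtain ⟨b, hb⟩ := (h (y 1)).1 (congrFun hy 1)
    exact ⟨![a, b], TV.ext ha hb⟩
  · rintro ⟨x, rfl⟩
    exact funext fun i => (h _).2 ⟨x i, rfl⟩

/-- The isomorphism `M ⊗ V ≅ M' ⊗ V` induced by `M ≅ M'`. -/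
def TV.congr (f : M ≃ₗ[Uq 𝕜] N) : TV M ≃ₗ[Uq 𝕜] TV N :=
  LinearEquiv.ofLinearMap (TV.map f.toLinearMap) (TV.map f.symm.toLinearMap)
    (by ext <;> simp) (by ext <;> simp)

theorem TV.finrank_eq [FiniteDimensional 𝕜 M] : Module.finrank 𝕜 (TV M) = 2 * Module.finrank 𝕜 M := by
  have : Module.finrank 𝕜 (Fin 2 → M) = 2 * Module.finrank 𝕜 M := by
    rw [Module.finrank_pi_fintype]; simp
  exact this

end Modules

/-! ### Lattices -/

namespace LatticeRep

variable (V W : LatticeRep)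

theorem map_intHom (u : UA) : (V.intHom u).map (algebraMap ℤ[T;T⁻¹] Qv) = V.toHom u := by
  have h := AlgEquiv.apply_symm_apply (AlgEquiv.ofInjective (Algebra.ofId ℤ[T;T⁻¹] Qv).mapMatrix
    (Matrix.map_injective (IsFractionRing.injective ℤ[T;T⁻¹] Qv)))
    (((V.toHom.restrictScalars ℤ[T;T⁻¹]).comp UA.val).codRestrict (intMat V.ι) V.map_mem_intMat u)
  exact congrArg Subtype.val h

theorem algebraMap_intHom (u : UA) (i j : V.ι) :
    algebraMap ℤ[T;T⁻¹] Qv (V.intHom u i j) = V.toHom u i j :=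
  congrFun (congrFun (V.map_intHom u) i) j

theorem specHom_toUqHom (u : UA) :
    V.specHom 𝕜 (toUqHom 𝕜 u) = (V.intHom u).map (algebraMap ℤ[T;T⁻¹] 𝕜) := by
  refine (Algebra.TensorProduct.lift_tmul ..).trans ?_
  simp
  rfl

theorem toUqHom_smul (u : UA) (x : V.Mod 𝕜) :
    toUqHom 𝕜 u • x = ((V.intHom u).map (algebraMap ℤ[T;T⁻¹] 𝕜)).mulVec x := by
  rw [smul_def, specHom_toUqHom]

theorem weyl_toHom_E (m : ℕ) : (weyl m).toHom E = weylE m := by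
  unfold weyl
  dsimp only
  rw [lift_E]
theorem weyl_toHom_F (m : ℕ) : (weyl m).toHom F = weylF m := by
  unfold weyl
  dsimp only
  rw [lift_F]

/-- The action on `V ⊗ W(1)` is the action on `V` composed with `delta`. -/
theorem tensorHom_apply (u : Uv) (i j : V.ι) (a b : Fin 2) :
    (V.tensor (weyl 1)).toHom u (i, a) (j, b) = V.toHom (delta u a b) i j := by
  change V.tensorHom (weyl 1) u (i, a) (j, b) = _
  have tensorHom_Kinv : V.tensorHom (weyl 1) Kinv = V.toHom Kinv ⊗ₖ (weyl 1).toHom Kinv := by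
    simp [tensorHom, Uv.comul, Uv.lift_Kinv]
  have wE : (weyl 1).toHom E = (!![0, 1; 0, 0] : Matrix (Fin 2) (Fin 2) Qv) := by
    rw [weyl_toHom_E]
    ext a b
    fin_cases a <;> fin_cases b <;> simp [weylE, qInt, v_sub_ne_zero]
  have wF : (weyl 1).toHom F = (!![0, 0; 1, 0] : Matrix (Fin 2) (Fin 2) Qv) := by
    rw [weyl_toHom_F]
    ext a b
    fin_cases a <;> fin_cases b <;> simp [weylF, qInt, v_sub_ne_zero]
  have wK : (weyl 1).toHom K = (!![v, 0; 0, v⁻¹] : Matrix (Fin 2) (Fin 2) Qv) := by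
    refine (weyl 1).map_K.trans (?_ : Matrix.diagonal (fun a : Fin 2 => v ^ ((1 : ℕ) - 2 * ((a : ℕ) : ℤ) : ℤ)) = _)
    ext a b
    fin_cases a <;> fin_cases b <;> simp
  have wKinv : (weyl 1).toHom Kinv = (!![v⁻¹, 0; 0, v] : Matrix (Fin 2) (Fin 2) Qv) := by
    refine (weyl 1).map_Kinv.trans (?_ : Matrix.diagonal (fun a : Fin 2 => v ^ (-((1 : ℕ) - 2 * ((a : ℕ) : ℤ)) : ℤ)) = _)
    ext a b
    fin_cases a <;> fin_cases b <;> simp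
  induction u using Uv.induction generalizing i j a b with
  | hc c =>
    rw [AlgHom.commutes, AlgHom.commutes]
    change (if (i, a) = (j, b) then c else 0) = _
    rw [Matrix.algebraMap_matrix_apply]
    rcases eq_or_ne a b with rfl | h
    · simp [Matrix.algebraMap_matrix_apply]
    · simp [h]
  | hE =>
    rw [tensorHom_E, delta_E, wE]
    change V.toHom E i j * (1 : Matrix (Fin 2) (Fin 2) Qv) a b + V.toHom K i j *
      (!![0, 1; 0, 0] : Matrix (Fin 2) (Fin 2) Qv) a b = _
    fin_cases a <;> fin_cases b <;> simp
  | hF =>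
    rw [tensorHom_F, delta_F, wF, wKinv]
    change V.toHom F i j * (!![v⁻¹, 0; 0, v] : Matrix (Fin 2) (Fin 2) Qv) a b +
      (1 : Matrix V.ι V.ι Qv) i j * (!![0, 0; 1, 0] : Matrix (Fin 2) (Fin 2) Qv) a b = _
    fin_cases a <;> fin_cases b <;> simp [mul_comm]
  | hK =>
    rw [tensorHom_K, delta_K, wK]
    change V.toHom K i j * (!![v, 0; 0, v⁻¹] : Matrix (Fin 2) (Fin 2) Qv) a b = _
    fin_cases a <;> fin_cases b <;> simp [mul_comm]
  | hKinv =>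
    rw [tensorHom_Kinv, delta_Kinv, wKinv]
    change V.toHom Kinv i j * (!![v⁻¹, 0; 0, v] : Matrix (Fin 2) (Fin 2) Qv) a b = _
    fin_cases a <;> fin_cases b <;> simp [mul_comm]
  | hadd x y hx hy =>
    simp only [map_add, Matrix.add_apply]
    exact congrArg₂ (· + ·) (hx i j a b) (hy i j a b)
  | hmul x y hx hy =>
    simp only [map_mul, Matrix.mul_apply, map_sum]
    rw [Matrix.sum_apply]
    refine (Fintype.sum_prod_type_right' fun k c => V.tensorHom (weyl 1) x (i, a) (k, c) *
      V.tensorHom (weyl 1) y (k, c) (j, b)).trans ?_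
    exact Finset.sum_congr rfl fun c _ => by
      rw [Matrix.mul_apply]
      exact Finset.sum_congr rfl fun k _ => congrArg₂ (· * ·) (hx i k a c) (hy k j c b)

instance : FiniteDimensional 𝕜 (V.Mod 𝕜) := inferInstanceAs (FiniteDimensional 𝕜 (V.ι → 𝕜))

theorem finrank_mod : Module.finrank 𝕜 (V.Mod 𝕜) = Fintype.card V.ι :=
  Module.finrank_fintype_fun_eq_card 𝕜

/-- The module attached to `V ⊗ W(1)` is the tensor product of the module attached to `V` with the
two-dimensional module. -/
def tensorEquiv : (V.tensor (weyl 1)).Mod 𝕜 ≃ₗ[Uq 𝕜] TV (V.Mod 𝕜) where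
  toFun x a i := x (i, a)
  invFun y p := y p.2 p.1
  left_inv _ := rfl
  right_inv _ := rfl
  map_add' _ _ := rfl
  map_smul' := by
    have hent (u : UA) (i j : V.ι) (a b : Fin 2) : (V.tensor (weyl 1)).intHom u (i, a) (j, b) =
        V.intHom (deltaA u a b) i j := by
      apply IsFractionRing.injective ℤ[T;T⁻¹] Qv
      exact ((V.tensor (weyl 1)).algebraMap_intHom u _ _).trans
        ((V.tensorHom_apply u i j a b).trans (V.algebraMap_intHom (deltaA u a b) i j).symm)
    let f : (V.tensor (weyl 1)).Mod 𝕜 →ₗ[𝕜] TV (V.Mod 𝕜) :=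
      { toFun := fun x a i => x (i, a), map_add' := fun _ _ => rfl, map_smul' := fun _ _ => rfl }
    have hf (u : UA) (x) : f (toUqHom 𝕜 u • x) = toUqHom 𝕜 u • f x := by
      have key (a : Fin 2) : f (toUqHom 𝕜 u • x) a =
          toUqHom 𝕜 (deltaA u a 0) • f x 0 + toUqHom 𝕜 (deltaA u a 1) • f x 1 := by
        funext i
        rw [toUqHom_smul, toUqHom_smul, toUqHom_smul]
        refine (Fintype.sum_prod_type_right' fun (k : V.ι) (c : Fin 2) =>
          algebraMap ℤ[T;T⁻¹] 𝕜 ((V.tensor (weyl 1)).intHom u (i, a) (k, c)) * x (k, c)).trans ?_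
        rw [Fin.sum_univ_two]
        simp only [hent]
        rfl
      exact TV.ext ((key 0).trans (TV.toUqHom_smul_apply u (f x) 0).symm)
        ((key 1).trans (TV.toUqHom_smul_apply u (f x) 1).symm)
    exact (mkHom f hf).map_smul'

/-- A morphism of lattices: an integral matrix preserving weights and commuting with `E`, `F`. -/
structure Hom where
  /-- The matrix of the morphism. -/
  mat : Matrix W.ι V.ι ℤ[T;T⁻¹]
  comm_E : mat.map (algebraMap ℤ[T;T⁻¹] Qv) * V.toHom E = W.toHom E * mat.map (algebraMap _ Qv)
  comm_F : mat.map (algebraMap ℤ[T;T⁻¹] Qv) * V.toHom F = W.toHom F * mat.map (algebraMap _ Qv)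
  wt_eq : ∀ i j, mat i j ≠ 0 → W.wt i = V.wt j

variable {V W}

/-- A weight preserving map commuting with `E` and `F` commutes with all of `U_v(sl₂)`. -/
theorem Hom.comm (f : Hom V W) (u : Uv) : f.mat.map (algebraMap ℤ[T;T⁻¹] Qv) * V.toHom u =
    W.toHom u * f.mat.map (algebraMap _ Qv) := by
  induction u using Uv.induction with
  | hc c => rw [AlgHom.commutes, AlgHom.commutes, Matrix.algebraMap_eq_diagonal,
      Matrix.algebraMap_eq_diagonal]; ext; simp [mul_comm]
  | hE => exact f.comm_E
  | hF => exact f.comm_F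
  | hK =>
    rw [map_K, map_K]
    ext i j
    rw [Matrix.mul_diagonal, Matrix.diagonal_mul, Matrix.map_apply]
    by_cases h : f.mat i j = 0
    · simp [h]
    · rw [f.wt_eq i j h, mul_comm]
  | hKinv =>
    rw [map_Kinv, map_Kinv]
    ext i j
    rw [Matrix.mul_diagonal, Matrix.diagonal_mul, Matrix.map_apply]
    by_cases h : f.mat i j = 0
    · simp [h]
    · rw [f.wt_eq i j h, mul_comm]
  | hadd a b ha hb => rw [map_add, map_add, Matrix.mul_add, Matrix.add_mul, ha, hb]
  | hmul a b ha hb => rw [map_mul, map_mul, ← Matrix.mul_assoc, ha, Matrix.mul_assoc, hb,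
      Matrix.mul_assoc]

theorem Hom.comm_intHom (f : Hom V W) (u : UA) : f.mat * V.intHom u = W.intHom u * f.mat := by
  have h := f.comm u
  rw [← map_intHom, ← map_intHom, ← Matrix.map_mul, ← Matrix.map_mul] at h
  exact Matrix.map_injective (IsFractionRing.injective ℤ[T;T⁻¹] Qv) h

variable (𝕜) in
/-- The specialization of a morphism of lattices, as a map of vector spaces. -/
def Hom.lin (f : Hom V W) : V.Mod 𝕜 →ₗ[𝕜] W.Mod 𝕜 :=
  (Matrix.toLin' (f.mat.map (algebraMap ℤ[T;T⁻¹] 𝕜)) : (V.ι → 𝕜) →ₗ[𝕜] (W.ι → 𝕜))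

variable (𝕜) in
/-- The specialization of a morphism of lattices. -/
def Hom.spec (f : Hom V W) : V.Mod 𝕜 →ₗ[Uq 𝕜] W.Mod 𝕜 :=
  mkHom (f.lin 𝕜) fun u x => by
    rw [toUqHom_smul, toUqHom_smul]
    refine (Matrix.mulVec_mulVec _ _ _).trans ?_
    refine Eq.trans ?_ (Matrix.mulVec_mulVec _ _ _).symm
    rw [← Matrix.map_mul, ← Matrix.map_mul, f.comm_intHom]

end LatticeRep

end

/-! ### Morphisms between Weyl modules, dual Weyl modules and their tensor products -/

theorem v_sq_sub_one_ne_zero : v ^ 2 - 1 ≠ 0 := by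
  intro h
  apply v_sub_ne_zero
  have := v_ne_zero
  field_simp
  rw [h, mul_zero]

namespace LatticeRep

open Matrix

/-- A matrix commutes with two operators as soon as it does so on all vectors. -/
theorem mul_eq_mul_of_mulVec {ι κ R : Type*} [Fintype ι] [Fintype κ] [DecidableEq ι] [CommSemiring R]
    {f : Matrix κ ι R} {a : Matrix ι ι R} {b : Matrix κ κ R}
    (h : ∀ x i, (f *ᵥ (a *ᵥ x)) i = (b *ᵥ (f *ᵥ x)) i) : f * a = b * f := by
  refine Matrix.ext_of_mulVec_single fun i => ?_
  rw [← mulVec_mulVec, ← mulVec_mulVec]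
  exact funext (h _)

theorem weylE_mulVec (m : ℕ) (x : Fin (m + 1) → Qv) (i : Fin (m + 1)) :
    (weylE m *ᵥ x) i =
      if h : (i : ℕ) < m then qInt ((m : ℤ) - i) * x ⟨i + 1, by omega⟩ else 0 := by
  simp only [weylE, mulVec, dotProduct, Matrix.of_apply, ite_mul, zero_mul]
  split_ifs with h
  · rw [Finset.sum_eq_single ⟨(i : ℕ) + 1, by omega⟩]
    · rw [if_pos rfl]
      congr 2
      push_cast
      ring
    · intro b _ hb
      rw [if_neg fun h => hb (Fin.ext h)]
    · simp
  · exact Finset.sum_eq_zero fun b _ => if_neg (by omega)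

theorem weylF_mulVec (m : ℕ) (x : Fin (m + 1) → Qv) (i : Fin (m + 1)) :
    (weylF m *ᵥ x) i = if h : 0 < (i : ℕ) then qInt i * x ⟨i - 1, by omega⟩ else 0 := by
  simp only [weylF, mulVec, dotProduct, Matrix.of_apply, ite_mul, zero_mul]
  split_ifs with h
  · rw [Finset.sum_eq_single ⟨(i : ℕ) - 1, by omega⟩]
    · simp only
      rw [if_pos (by omega)]
      congr 2
      push_cast [h]
      omega
    · intro b _ hb
      rw [if_neg fun h => hb (Fin.ext (by simp only; omega))]
    · simp
  · exact Finset.sum_eq_zero fun b _ => if_neg (by omega)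

/-- The matrix of `E` on the dual of `W(m)`, in the basis dual to `F⁽ᵗ⁾x`. -/
def dualE (m : ℕ) : Matrix (Fin (m + 1)) (Fin (m + 1)) Qv := of fun i j =>
  if (i : ℕ) = j + 1 then -(v ^ (2 * ((i : ℤ) - 1) - m) * qInt ((m : ℤ) - i + 1)) else 0

/-- The matrix of `F` on the dual of `W(m)`, in the basis dual to `F⁽ᵗ⁾x`. -/
def dualF (m : ℕ) : Matrix (Fin (m + 1)) (Fin (m + 1)) Qv := of fun i j =>
  if (j : ℕ) = i + 1 then -(v ^ ((m : ℤ) - 2 * i) * qInt ((i : ℤ) + 1)) else 0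

theorem dual_weyl_toHom_E (m : ℕ) : (weyl m).dual.toHom E = dualE m := by
  refine (weyl m).dualHom_E.trans ?_
  rw [map_neg, map_mul, map_Kinv, weyl_toHom_E]
  refine Matrix.ext fun (i j : Fin (m + 1)) => ?_
  refine congrArg Neg.neg (diagonal_mul _ _ _ _) |>.trans ?_
  simp only [weylE, dualE, of_apply, mul_ite, mul_zero]
  split_ifs with h
  · congr 3
    change -((m : ℤ) - 2 * (j : ℕ)) = _
    omega
  · simp

theorem dual_weyl_toHom_F (m : ℕ) : (weyl m).dual.toHom F = dualF m := by
  refine (weyl m).dualHom_F.trans ?_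
  rw [map_neg, map_mul, map_K, weyl_toHom_F]
  refine Matrix.ext fun (i j : Fin (m + 1)) => ?_
  refine congrArg Neg.neg (mul_diagonal _ _ _ _) |>.trans ?_
  simp only [weylF, dualF, of_apply, ite_mul, zero_mul]
  split_ifs with h
  · rw [mul_comm]; rfl
  · simp

theorem dualE_mulVec (m : ℕ) (x : Fin (m + 1) → Qv) (i : Fin (m + 1)) :
    (dualE m *ᵥ x) i = if h : 0 < (i : ℕ) then
      -(v ^ (2 * ((i : ℤ) - 1) - m) * qInt ((m : ℤ) - i + 1)) * x ⟨i - 1, by omega⟩ else 0 := by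
  simp only [dualE, mulVec, dotProduct, of_apply, ite_mul, zero_mul]
  split_ifs with h
  · rw [Finset.sum_eq_single ⟨(i : ℕ) - 1, by omega⟩]
    · simp only
      rw [if_pos (by omega)]
    · intro b _ hb
      rw [if_neg fun h => hb (Fin.ext (by simp only; omega))]
    · simp
  · exact Finset.sum_eq_zero fun b _ => if_neg (by omega)

theorem dualF_mulVec (m : ℕ) (x : Fin (m + 1) → Qv) (i : Fin (m + 1)) :
    (dualF m *ᵥ x) i = if h : (i : ℕ) < m then
      -(v ^ ((m : ℤ) - 2 * i) * qInt ((i : ℤ) + 1)) * x ⟨i + 1, by omega⟩ else 0 := by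
  simp only [dualF, mulVec, dotProduct, of_apply, ite_mul, zero_mul]
  split_ifs with h
  · rw [Finset.sum_eq_single ⟨(i : ℕ) + 1, by omega⟩]
    · simp
    · intro b _ hb
      rw [if_neg fun h => hb (Fin.ext (by simp only; omega))]
    · simp
  · exact Finset.sum_eq_zero fun b _ => if_neg (by omega)

/-- A `2 × 2` block matrix, indexed by pairs. -/
def blockMat {ι : Type*} (A B C D : Matrix ι ι Qv) : Matrix (ι × Fin 2) (ι × Fin 2) Qv :=
  of fun p q => (!![A, B; C, D] p.2 q.2) p.1 q.1

theorem blockMat_mulVec {ι : Type*} [Fintype ι] (A B C D : Matrix ι ι Qv) (y : ι × Fin 2 → Qv)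
    (i : ι) : (blockMat A B C D *ᵥ y) (i, 0) =
        (A *ᵥ fun j => y (j, 0)) i + (B *ᵥ fun j => y (j, 1)) i ∧
      (blockMat A B C D *ᵥ y) (i, 1) =
        (C *ᵥ fun j => y (j, 0)) i + (D *ᵥ fun j => y (j, 1)) i := by
  constructor <;> simp [blockMat, mulVec, dotProduct, Fintype.sum_prod_type_right]

theorem tensor_toHom_E (V : LatticeRep) : (V.tensor (weyl 1)).toHom E =
    blockMat (V.toHom E) (V.toHom K) 0 (V.toHom E) := by
  refine Matrix.ext fun ⟨i, (a : Fin 2)⟩ ⟨j, (b : Fin 2)⟩ => (V.tensorHom_apply E i j a b).trans ?_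
  rw [delta_E]
  fin_cases a <;> fin_cases b <;> (simp; rfl)

theorem tensor_toHom_F (V : LatticeRep) : (V.tensor (weyl 1)).toHom F =
    blockMat (v⁻¹ • V.toHom F) 0 1 (v • V.toHom F) := by
  refine Matrix.ext fun ⟨i, (a : Fin 2)⟩ ⟨j, (b : Fin 2)⟩ => (V.tensorHom_apply F i j a b).trans ?_
  rw [delta_F]
  fin_cases a <;> fin_cases b <;> (simp; rfl)

section spec

variable {R : Type*} [CommRing R] (f : ℤ[T;T⁻¹] →+* R)

theorem map_single_mulVec {ι : Type*} [Fintype ι] [DecidableEq ι] (a : ι) (c : ℤ[T;T⁻¹]) (x : ι → R) :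
    ∑ j, f (Pi.single (M := fun _ : ι => ℤ[T;T⁻¹]) a c j) * x j = f c * x a := by
  rw [Finset.sum_eq_single a]
  · simp
  · intro b _ hb; simp [hb]
  · simp

/-- The matrix of the embedding `W(m+1) → W(m) ⊗ V`. -/
def inclMat (m : ℕ) : Matrix (Fin (m + 1) × Fin 2) (Fin (m + 2)) ℤ[T;T⁻¹] :=
  Matrix.of fun p => if p.2 = 0 then Pi.single p.1.castSucc (LaurentPolynomial.T (-(p.1 : ℕ)))
    else Pi.single p.1.succ 1

theorem inclMat_mulVec_zero (m : ℕ) (x : Fin (m + 2) → R) (i : Fin (m + 1)) :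
    ((inclMat m).map f *ᵥ x) (i, 0) = f (LaurentPolynomial.T (-(i : ℕ))) * x i.castSucc := by
  simp [inclMat, mulVec, dotProduct, map_single_mulVec]

theorem inclMat_mulVec_one (m : ℕ) (x : Fin (m + 2) → R) (i : Fin (m + 1)) :
    ((inclMat m).map f *ᵥ x) (i, 1) = x i.succ := by
  simp [inclMat, mulVec, dotProduct, map_single_mulVec]

/-- The matrix of the projection `W(m+1) ⊗ V → W(m)`. -/
def projMat (m : ℕ) : Matrix (Fin (m + 1)) (Fin (m + 2) × Fin 2) ℤ[T;T⁻¹] :=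
  Matrix.of fun i => Pi.single (i.castSucc, 1) (LaurentPolynomial.T (-(i : ℕ))) +
    Pi.single (i.succ, 0) (-LaurentPolynomial.T 1)

theorem projMat_mulVec (m : ℕ) (x : Fin (m + 2) × Fin 2 → R) (i : Fin (m + 1)) :
    ((projMat m).map f *ᵥ x) i = f (LaurentPolynomial.T (-(i : ℕ))) * x (i.castSucc, 1) -
      f (LaurentPolynomial.T 1) * x (i.succ, 0) := by
  simp only [projMat, mulVec, dotProduct, Matrix.map_apply, Matrix.of_apply, Pi.add_apply, map_add,
    add_mul, Finset.sum_add_distrib, map_single_mulVec, map_neg]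
  ring

end spec

theorem algebraMap_T (n : ℤ) : algebraMap ℤ[T;T⁻¹] Qv (LaurentPolynomial.T n) = v ^ n :=
  (v_zpow n).symm

/-- The weights of the Weyl module, with the index in a standard type. -/
def wWt (m : ℕ) (i : Fin (m + 1)) : ℤ := (m : ℤ) - 2 * (i : ℕ)

theorem weyl_toHom_K (m : ℕ) : (weyl m).toHom K = diagonal fun i => v ^ wWt m i := (weyl m).map_K
theorem dual_weyl_toHom_K (m : ℕ) : (weyl m).dual.toHom K = diagonal fun i => v ^ (-wWt m i) :=
  (weyl m).dual.map_K

theorem qInt_def' (n : ℤ) : qInt n = (v ^ n - (v ^ n)⁻¹) / (v - v⁻¹) := by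
  rw [qInt, _root_.zpow_neg]

theorem inclMat_comm_E (m : ℕ) : (inclMat m).map (algebraMap ℤ[T;T⁻¹] Qv) * weylE (m + 1) =
    blockMat (weylE m) (diagonal fun i => v ^ wWt m i) 0 (weylE m) *
      (inclMat m).map (algebraMap ℤ[T;T⁻¹] Qv) := by
  refine mul_eq_mul_of_mulVec ?_
  rintro x ⟨i, a⟩
  have h := v_ne_zero
  have h2 := v_sq_sub_one_ne_zero
  fin_cases a
  · refine (inclMat_mulVec_zero _ _ _ _).trans (((blockMat_mulVec _ _ _ _ _ _).1).trans ?_).symm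
    simp only [weylE_mulVec, mulVec_diagonal, inclMat_mulVec_zero, inclMat_mulVec_one,
      algebraMap_T, wWt, qInt_def', Fin.val_castSucc]
    have hi : (i : ℕ) < m + 1 := i.2
    rw [dif_pos hi]
    have e : (⟨(i : ℕ) + 1, by omega⟩ : Fin (m + 2)) = i.succ := rfl
    split_ifs with h3
    · have e' : (⟨(i : ℕ) + 1, by omega⟩ : Fin (m + 1)).castSucc = i.succ := rfl
      rw [e, e']
      simp only [zpow_sub₀ h, zpow_add₀ h, _root_.zpow_neg, two_mul, zpow_natCast, Nat.cast_add,
        Nat.cast_one, zpow_one]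
      field_simp
      ring
    · have e4 : (i : ℕ) = m := by omega
      rw [e, e4]
      simp only [zpow_sub₀ h, zpow_add₀ h, _root_.zpow_neg, two_mul, zpow_natCast, Nat.cast_add,
        Nat.cast_one, zpow_one]
      field_simp
      ring
  · refine (inclMat_mulVec_one _ _ _ _).trans (((blockMat_mulVec _ _ _ _ _ _).2).trans ?_).symm
    simp only [weylE_mulVec, inclMat_mulVec_one, zero_mulVec, Pi.zero_apply, zero_add,
      Fin.val_succ]
    split_ifs with h3 h4
    · have e : (⟨(i : ℕ) + 1, by omega⟩ : Fin (m + 1)).succ = ⟨(i : ℕ) + 1 + 1, by omega⟩ := rfl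
      rw [e]; congr 2; push_cast; ring
    · omega
    · omega
    · rfl

theorem inclMat_comm_F (m : ℕ) : (inclMat m).map (algebraMap ℤ[T;T⁻¹] Qv) * weylF (m + 1) =
    blockMat (v⁻¹ • weylF m) 0 1 (v • weylF m) * (inclMat m).map (algebraMap ℤ[T;T⁻¹] Qv) := by
  refine mul_eq_mul_of_mulVec ?_
  rintro x ⟨i, a⟩
  have h := v_ne_zero
  have h2 := v_sq_sub_one_ne_zero
  fin_cases a
  · refine (inclMat_mulVec_zero _ _ _ _).trans (((blockMat_mulVec _ _ _ _ _ _).1).trans ?_).symm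
    simp only [smul_mulVec, Pi.smul_apply, smul_eq_mul, weylF_mulVec, inclMat_mulVec_zero,
      zero_mulVec, Pi.zero_apply, algebraMap_T, Fin.val_castSucc, add_zero]
    split_ifs with h3
    · have e : (⟨(i : ℕ) - 1, by omega⟩ : Fin (m + 1)).castSucc = ⟨(i : ℕ) - 1, by omega⟩ := rfl
      rw [e]
      have : -(((i : ℕ) - 1 : ℕ) : ℤ) = -(i : ℕ) + 1 := by omega
      rw [this]
      simp only [zpow_add₀ h, zpow_one]
      field_simp
    · simp
  · refine (inclMat_mulVec_one _ _ _ _).trans (((blockMat_mulVec _ _ _ _ _ _).2).trans ?_).symm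
    simp only [smul_mulVec, Pi.smul_apply, smul_eq_mul, weylF_mulVec, inclMat_mulVec_zero,
      inclMat_mulVec_one, one_mulVec, algebraMap_T, Fin.val_succ, qInt_def']
    rw [dif_pos (by omega : 0 < (i : ℕ) + 1)]
    have e : (⟨(i : ℕ) + 1 - 1, by omega⟩ : Fin (m + 2)) = i.castSucc := rfl
    rw [e]
    split_ifs with h3
    · have e' : (⟨(i : ℕ) - 1, by omega⟩ : Fin (m + 1)).succ = i.castSucc :=
        Fin.ext (show (i : ℕ) - 1 + 1 = i by omega)
      rw [e']
      simp only [zpow_sub₀ h, zpow_add₀ h, _root_.zpow_neg, two_mul, zpow_natCast, Nat.cast_add,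
        Nat.cast_one, zpow_one]
      field_simp
      ring
    · have e4 : (i : ℕ) = 0 := by omega
      simp [e4, v_sub_ne_zero]

/-- The embedding `W(m+1) → W(m) ⊗ V`. -/
def weylIncl (m : ℕ) : Hom (weyl (m + 1)) ((weyl m).tensor (weyl 1)) where
  mat := inclMat m
  comm_E := by
    rw [weyl_toHom_E, tensor_toHom_E, weyl_toHom_E, weyl_toHom_K]
    exact inclMat_comm_E m
  comm_F := by
    rw [weyl_toHom_F, tensor_toHom_F, weyl_toHom_F]
    exact inclMat_comm_F m
  wt_eq := by
    rintro ⟨(i : Fin (m + 1)), (a : Fin 2)⟩ (j : Fin (m + 2)) hij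
    change ((m : ℤ) - 2 * (i : ℕ)) + ((1 : ℕ) - 2 * (a : ℕ)) = ((m + 1 : ℕ) : ℤ) - 2 * (j : ℕ)
    change inclMat m (i, a) j ≠ 0 at hij
    fin_cases a
    · by_cases h : j = i.castSucc
      · subst h; simp; ring
      · exact absurd (by simp [inclMat, h]) hij
    · by_cases h : j = i.succ
      · subst h; simp; ring
      · exact absurd (by simp [inclMat, h]) hij

theorem projMat_comm_E (m : ℕ) : (projMat m).map (algebraMap ℤ[T;T⁻¹] Qv) *
      blockMat (weylE (m + 1)) (diagonal fun i => v ^ wWt (m + 1) i) 0 (weylE (m + 1)) =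
    weylE m * (projMat m).map (algebraMap ℤ[T;T⁻¹] Qv) := by
  refine mul_eq_mul_of_mulVec ?_
  intro x i
  have h := v_ne_zero
  have h2 := v_sq_sub_one_ne_zero
  rw [projMat_mulVec, (blockMat_mulVec _ _ _ _ _ _).1, (blockMat_mulVec _ _ _ _ _ _).2]
  simp only [weylE_mulVec, mulVec_diagonal, projMat_mulVec, zero_mulVec, Pi.zero_apply, zero_add,
    algebraMap_T, wWt, qInt_def', Fin.val_castSucc, Fin.val_succ]
  have hi : (i : ℕ) < m + 1 := i.2
  rw [dif_pos hi]
  have e : (⟨(i : ℕ) + 1, by omega⟩ : Fin (m + 2)) = i.succ := rfl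
  rw [e]
  split_ifs with h3 h4 h4
  · have e' : (⟨(i : ℕ) + 1, by omega⟩ : Fin (m + 1)).castSucc = i.succ := rfl
    have e'' : (⟨(i : ℕ) + 1, by omega⟩ : Fin (m + 1)).succ = ⟨(i : ℕ) + 1 + 1, by omega⟩ := rfl
    rw [e', e'']
    simp only [zpow_sub₀ h, zpow_add₀ h, _root_.zpow_neg, two_mul, zpow_natCast, Nat.cast_add,
      Nat.cast_one, zpow_one]
    field_simp
    ring
  · omega
  · omega
  · have e4 : (i : ℕ) = m := by omega
    rw [e4]
    simp only [zpow_sub₀ h, zpow_add₀ h, _root_.zpow_neg, two_mul, zpow_natCast, Nat.cast_add,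
      Nat.cast_one, zpow_one]
    field_simp
    ring

theorem projMat_comm_F (m : ℕ) : (projMat m).map (algebraMap ℤ[T;T⁻¹] Qv) *
      blockMat (v⁻¹ • weylF (m + 1)) 0 1 (v • weylF (m + 1)) =
    weylF m * (projMat m).map (algebraMap ℤ[T;T⁻¹] Qv) := by
  refine mul_eq_mul_of_mulVec ?_
  intro x i
  have h := v_ne_zero
  have h2 := v_sq_sub_one_ne_zero
  rw [projMat_mulVec, (blockMat_mulVec _ _ _ _ _ _).1, (blockMat_mulVec _ _ _ _ _ _).2]
  simp only [smul_mulVec, Pi.smul_apply, smul_eq_mul, weylF_mulVec, projMat_mulVec, zero_mulVec,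
    Pi.zero_apply, add_zero, one_mulVec, algebraMap_T, qInt_def', Fin.val_castSucc, Fin.val_succ]
  rw [dif_pos (by omega : 0 < (i : ℕ) + 1)]
  have e : (⟨(i : ℕ) + 1 - 1, by omega⟩ : Fin (m + 2)) = i.castSucc := rfl
  rw [e]
  split_ifs with h3
  · have e' : (⟨(i : ℕ) - 1, by omega⟩ : Fin (m + 1)).succ = i.castSucc :=
      Fin.ext (by simp; omega)
    have e'' : (⟨(i : ℕ) - 1, by omega⟩ : Fin (m + 1)).castSucc = ⟨(i : ℕ) - 1, by omega⟩ := rfl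
    have e3 : -(((i : ℕ) - 1 : ℕ) : ℤ) = -(i : ℕ) + 1 := by omega
    rw [e', e'', e3]
    simp only [zpow_sub₀ h, zpow_add₀ h, _root_.zpow_neg, two_mul, zpow_natCast, Nat.cast_add,
      Nat.cast_one, zpow_one]
    field_simp
    ring
  · have e4 : (i : ℕ) = 0 := by omega
    rw [e4]
    simp
    field_simp
    ring

/-- The projection `W(m+1) ⊗ V → W(m)`. -/
def weylProj (m : ℕ) : Hom ((weyl (m + 1)).tensor (weyl 1)) (weyl m) where
  mat := projMat m
  comm_E := by
    rw [weyl_toHom_E, tensor_toHom_E, weyl_toHom_E, weyl_toHom_K]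
    exact projMat_comm_E m
  comm_F := by
    rw [weyl_toHom_F, tensor_toHom_F, weyl_toHom_F]
    exact projMat_comm_F m
  wt_eq := by
    rintro (i : Fin (m + 1)) ⟨(j : Fin (m + 2)), (a : Fin 2)⟩ hij
    change (m : ℤ) - 2 * (i : ℕ) = (((m + 1 : ℕ) : ℤ) - 2 * (j : ℕ)) + ((1 : ℕ) - 2 * (a : ℕ))
    change projMat m i (j, a) ≠ 0 at hij
    fin_cases a
    · by_cases h : j = i.succ
      · subst h; simp; ring
      · exact absurd (by simp [projMat, h, Pi.single_apply]) hij
    · by_cases h : j = i.castSucc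
      · subst h; simp; ring
      · exact absurd (by simp [projMat, h, Pi.single_apply]) hij

end LatticeRep

/-! ### Tensor products of dual Weyl modules with the two-dimensional module -/

namespace LatticeRep

open Matrix

section spec

variable {R : Type*} [CommRing R] (f : ℤ[T;T⁻¹] →+* R)

/-- The matrix of the embedding `W(m)* → W(m+1)* ⊗ V`. -/
def coinclMat (m : ℕ) : Matrix (Fin (m + 2) × Fin 2) (Fin (m + 1)) ℤ[T;T⁻¹] :=
  Matrix.of fun p => if p.2 = 0 then
    if h : (p.1 : ℕ) < m + 1 then Pi.single ⟨p.1, h⟩ (LaurentPolynomial.T (m + 2)) else 0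
    else if h : 0 < (p.1 : ℕ) then Pi.single ⟨p.1 - 1, by omega⟩ (LaurentPolynomial.T ((p.1 : ℕ) - 1))
    else 0

theorem coinclMat_mulVec_zero (m : ℕ) (x : Fin (m + 1) → R) (i : Fin (m + 2)) :
    ((coinclMat m).map f *ᵥ x) (i, 0) =
      if h : (i : ℕ) < m + 1 then f (LaurentPolynomial.T (m + 2)) * x ⟨i, h⟩ else 0 := by
  simp only [coinclMat, mulVec, dotProduct, Matrix.map_apply, of_apply, if_true]
  split_ifs with h
  · rw [map_single_mulVec]
  · simp

theorem coinclMat_mulVec_one (m : ℕ) (x : Fin (m + 1) → R) (i : Fin (m + 2)) :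
    ((coinclMat m).map f *ᵥ x) (i, 1) = if h : 0 < (i : ℕ) then
      f (LaurentPolynomial.T ((i : ℕ) - 1)) * x ⟨i - 1, by omega⟩ else 0 := by
  simp only [coinclMat, mulVec, dotProduct, Matrix.map_apply, of_apply, one_ne_zero, if_false]
  split_ifs with h
  · rw [map_single_mulVec]
  · simp

/-- The matrix of the projection `W(m)* ⊗ V → W(m+1)*`. -/
def coprojMat (m : ℕ) : Matrix (Fin (m + 2)) (Fin (m + 1) × Fin 2) ℤ[T;T⁻¹] :=
  Matrix.of fun i => (if h : 0 < (i : ℕ) then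
      Pi.single (⟨i - 1, by omega⟩, 0) (LaurentPolynomial.T ((i : ℕ) - 1)) else 0) +
    if h : (i : ℕ) < m + 1 then Pi.single (⟨i, h⟩, 1) (-LaurentPolynomial.T (m + 1)) else 0

theorem coprojMat_mulVec (m : ℕ) (x : Fin (m + 1) × Fin 2 → R) (i : Fin (m + 2)) :
    ((coprojMat m).map f *ᵥ x) i = (if h : 0 < (i : ℕ) then
        f (LaurentPolynomial.T ((i : ℕ) - 1)) * x (⟨i - 1, by omega⟩, 0) else 0) -
      if h : (i : ℕ) < m + 1 then f (LaurentPolynomial.T (m + 1)) * x (⟨i, h⟩, 1) else 0 := by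
  simp only [coprojMat, mulVec, dotProduct, Matrix.map_apply, Matrix.of_apply, Pi.add_apply,
    map_add, add_mul, Finset.sum_add_distrib]
  refine (congrArg₂ (fun a b : R => a + b) ?_ ?_).trans (sub_eq_add_neg _ _).symm
  · split_ifs with h
    · rw [map_single_mulVec]
    · simp
  · split_ifs with h
    · rw [map_single_mulVec, map_neg, neg_mul]
    · simp

/-- The coefficients of the canonical map `W(m) → W(m)*`. -/
def canCoeff (m j : ℕ) : ℤ[T;T⁻¹] :=
  (-1) ^ j * LaurentPolynomial.T ((j : ℤ) * (j + 1 - m)) * gauss m j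

/-- The matrix of the canonical map `W(m) → W(m)*`. -/
def canMat (m : ℕ) : Matrix (Fin (m + 1)) (Fin (m + 1)) ℤ[T;T⁻¹] :=
  Matrix.of fun i => Pi.single i.rev (canCoeff m i.rev)

theorem canMat_mulVec (m : ℕ) (x : Fin (m + 1) → R) (i : Fin (m + 1)) :
    ((canMat m).map f *ᵥ x) i = f (canCoeff m i.rev) * x i.rev := by
  simp only [canMat, mulVec, dotProduct, Matrix.map_apply, of_apply, map_single_mulVec]

end spec

theorem coinclMat_comm_E (m : ℕ) : (coinclMat m).map (algebraMap ℤ[T;T⁻¹] Qv) * dualE m =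
    blockMat (dualE (m + 1)) (diagonal fun i => v ^ (-wWt (m + 1) i)) 0 (dualE (m + 1)) *
      (coinclMat m).map (algebraMap ℤ[T;T⁻¹] Qv) := by
  refine mul_eq_mul_of_mulVec ?_
  rintro x ⟨i, a⟩
  have h := v_ne_zero
  have h2 := v_sq_sub_one_ne_zero
  have hi := i.2
  fin_cases a
  · refine (coinclMat_mulVec_zero _ _ _ _).trans (((blockMat_mulVec _ _ _ _ _ _).1).trans ?_).symm
    simp only [dualE_mulVec, mulVec_diagonal, coinclMat_mulVec_zero, coinclMat_mulVec_one,
      algebraMap_T, wWt, qInt_def']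
    by_cases h3 : 0 < (i : ℕ)
    · obtain ⟨n, hn⟩ : ∃ n, (i : ℕ) = n + 1 := ⟨i - 1, by omega⟩
      simp only [hn, Nat.succ_pos, dite_true, Nat.add_sub_cancel]
      rw [dif_pos (by omega : n < m + 1)]
      split_ifs with h4
      · simp only [zpow_sub₀ h, zpow_add₀ h, _root_.zpow_neg, two_mul, zpow_natCast, Nat.cast_add,
          Nat.cast_one, zpow_one]
        field_simp
        ring
      · obtain rfl : n = m := by omega
        simp only [zpow_sub₀ h, zpow_add₀ h, _root_.zpow_neg, two_mul, zpow_natCast, Nat.cast_add,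
          Nat.cast_one, zpow_one]
        field_simp
        ring
    · simp [h3]
  · refine (coinclMat_mulVec_one _ _ _ _).trans (((blockMat_mulVec _ _ _ _ _ _).2).trans ?_).symm
    simp only [dualE_mulVec, coinclMat_mulVec_one, zero_mulVec, Pi.zero_apply, zero_add,
      algebraMap_T, qInt_def']
    by_cases h3 : 0 < (i : ℕ)
    · obtain ⟨n, hn⟩ : ∃ n, (i : ℕ) = n + 1 := ⟨i - 1, by omega⟩
      simp only [hn, Nat.succ_pos, dite_true, Nat.add_sub_cancel]
      split_ifs with h4
      · obtain ⟨n, rfl⟩ : ∃ k, n = k + 1 := ⟨n - 1, by omega⟩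
        simp only [Nat.add_sub_cancel]
        simp only [zpow_sub₀ h, zpow_add₀ h, _root_.zpow_neg, two_mul, zpow_natCast, Nat.cast_add,
          Nat.cast_one, zpow_one]
        field_simp
      · simp
    · simp [h3]

theorem coinclMat_comm_F (m : ℕ) : (coinclMat m).map (algebraMap ℤ[T;T⁻¹] Qv) * dualF m =
    blockMat (v⁻¹ • dualF (m + 1)) 0 1 (v • dualF (m + 1)) *
      (coinclMat m).map (algebraMap ℤ[T;T⁻¹] Qv) := by
  refine mul_eq_mul_of_mulVec ?_
  rintro x ⟨i, a⟩
  have h := v_ne_zero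
  have h2 := v_sq_sub_one_ne_zero
  have hi := i.2
  fin_cases a
  · refine (coinclMat_mulVec_zero _ _ _ _).trans (((blockMat_mulVec _ _ _ _ _ _).1).trans ?_).symm
    simp only [smul_mulVec, Pi.smul_apply, smul_eq_mul, dualF_mulVec, coinclMat_mulVec_zero,
      zero_mulVec, Pi.zero_apply, add_zero, algebraMap_T, qInt_def']
    by_cases h3 : (i : ℕ) < m
    · rw [dif_pos (by omega), dif_pos (by omega), dif_pos (by omega), dif_pos h3]
      simp only [zpow_sub₀ h, zpow_add₀ h, _root_.zpow_neg, two_mul, zpow_natCast, Nat.cast_add,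
        Nat.cast_one, zpow_one]
      field_simp
    · by_cases h4 : (i : ℕ) < m + 1
      · rw [dif_pos h4, dif_neg (by omega), dif_pos h4, dif_neg h3]
        simp
      · rw [dif_neg h4, dif_neg h4]
        simp
  · refine (coinclMat_mulVec_one _ _ _ _).trans (((blockMat_mulVec _ _ _ _ _ _).2).trans ?_).symm
    simp only [smul_mulVec, Pi.smul_apply, smul_eq_mul, dualF_mulVec, coinclMat_mulVec_zero,
      coinclMat_mulVec_one, one_mulVec, algebraMap_T, qInt_def', Nat.succ_pos, dite_true,
      Nat.add_sub_cancel]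
    by_cases h3 : 0 < (i : ℕ)
    · obtain ⟨n, hn⟩ : ∃ n, (i : ℕ) = n + 1 := ⟨i - 1, by omega⟩
      simp only [hn, Nat.succ_pos, dite_true, Nat.add_sub_cancel]
      split_ifs with h4 h5 h5
      · simp only [zpow_sub₀ h, zpow_add₀ h, _root_.zpow_neg, two_mul, zpow_natCast, Nat.cast_add,
          Nat.cast_one, zpow_one]
        field_simp
        ring
      · omega
      · omega
      · simp
    · have h4 : (i : ℕ) = 0 := by omega
      simp only [h4, Nat.succ_pos, dite_true, lt_irrefl, dite_false]
      simp only [zpow_sub₀ h, zpow_add₀ h, zpow_natCast, Nat.cast_add, Nat.cast_one, zpow_one,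
        Nat.cast_zero, mul_zero, zero_add, zpow_zero]
      simp only [zpow_ofNat]
      field_simp
      ring

/-- The embedding `W(m)* → W(m+1)* ⊗ V`. -/
def dualIncl (m : ℕ) : Hom (weyl m).dual ((weyl (m + 1)).dual.tensor (weyl 1)) where
  mat := coinclMat m
  comm_E := by
    rw [dual_weyl_toHom_E, tensor_toHom_E, dual_weyl_toHom_E, dual_weyl_toHom_K]
    exact coinclMat_comm_E m
  comm_F := by
    rw [dual_weyl_toHom_F, tensor_toHom_F, dual_weyl_toHom_F]
    exact coinclMat_comm_F m
  wt_eq := by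
    rintro ⟨(i : Fin (m + 2)), (a : Fin 2)⟩ (j : Fin (m + 1)) hij
    change -(((m + 1 : ℕ) : ℤ) - 2 * (i : ℕ)) + ((1 : ℕ) - 2 * (a : ℕ)) = -((m : ℤ) - 2 * (j : ℕ))
    change coinclMat m (i, a) j ≠ 0 at hij
    fin_cases a
    · by_cases h : (j : ℕ) = i
      · simp only [h]; simp; ring
      · refine absurd ?_ hij
        simp only [coinclMat, of_apply, Fin.zero_eta, if_true]
        split_ifs with h'
        · exact Pi.single_eq_of_ne (fun e => h (by rw [e])) _
        · rfl
    · by_cases h : (j : ℕ) + 1 = i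
      · simp only [← h]; simp; ring
      · refine absurd ?_ hij
        simp only [coinclMat, of_apply, Fin.mk_one, one_ne_zero, if_false]
        split_ifs with h'
        · exact Pi.single_eq_of_ne (fun e => h (by rw [e]; simp only; omega)) _
        · rfl

theorem coprojMat_comm_E (m : ℕ) : (coprojMat m).map (algebraMap ℤ[T;T⁻¹] Qv) *
      blockMat (dualE m) (diagonal fun i => v ^ (-wWt m i)) 0 (dualE m) =
    dualE (m + 1) * (coprojMat m).map (algebraMap ℤ[T;T⁻¹] Qv) := by
  refine mul_eq_mul_of_mulVec ?_
  intro x i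
  have h := v_ne_zero
  have h2 := v_sq_sub_one_ne_zero
  have hi := i.2
  simp only [coprojMat_mulVec, (blockMat_mulVec _ _ _ _ _ _).1, (blockMat_mulVec _ _ _ _ _ _).2,
    dualE_mulVec, mulVec_diagonal, zero_mulVec, Pi.zero_apply, zero_add,
    algebraMap_T, wWt, qInt_def']
  by_cases h3 : 0 < (i : ℕ)
  · obtain ⟨n, hn⟩ : ∃ n, (i : ℕ) = n + 1 := ⟨i - 1, by omega⟩
    simp only [hn, Nat.succ_pos, dite_true, Nat.add_sub_cancel]
    rw [dif_pos (by omega : n < m + 1)]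
    by_cases h4 : 0 < n
    · obtain ⟨n, rfl⟩ : ∃ k, n = k + 1 := ⟨n - 1, by omega⟩
      simp only [Nat.succ_pos, dite_true, Nat.add_sub_cancel]
      split_ifs with h5
      · simp only [zpow_sub₀ h, zpow_add₀ h, _root_.zpow_neg, two_mul, zpow_natCast, Nat.cast_add,
          Nat.cast_one, zpow_one]
        field_simp
        ring
      · obtain rfl : n + 1 = m := by omega
        simp only [zpow_sub₀ h, zpow_add₀ h, _root_.zpow_neg, two_mul, zpow_natCast, Nat.cast_add,
          Nat.cast_one, zpow_one]
        field_simp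
        ring
    · obtain rfl : n = 0 := by omega
      simp only [lt_irrefl, dite_false]
      split_ifs with h5
      · simp only [zpow_sub₀ h, zpow_add₀ h, _root_.zpow_neg, zpow_natCast, Nat.cast_add,
          Nat.cast_one, zpow_one, Nat.cast_zero, zero_add, mul_zero, sub_zero, zpow_zero, mul_one, sub_self]
        field_simp
        ring
      · obtain rfl : m = 0 := by omega
        simp
        field_simp
  · simp [h3]

theorem coprojMat_comm_F (m : ℕ) : (coprojMat m).map (algebraMap ℤ[T;T⁻¹] Qv) *
      blockMat (v⁻¹ • dualF m) 0 1 (v • dualF m) =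
    dualF (m + 1) * (coprojMat m).map (algebraMap ℤ[T;T⁻¹] Qv) := by
  refine mul_eq_mul_of_mulVec ?_
  intro x i
  have h := v_ne_zero
  have h2 := v_sq_sub_one_ne_zero
  have hi := i.2
  simp only [coprojMat_mulVec, (blockMat_mulVec _ _ _ _ _ _).1, (blockMat_mulVec _ _ _ _ _ _).2,
    dualF_mulVec, smul_mulVec, Pi.smul_apply, smul_eq_mul, one_mulVec, zero_mulVec, Pi.zero_apply,
    add_zero, algebraMap_T, qInt_def', Nat.succ_pos, dite_true, Nat.add_sub_cancel]
  by_cases h3 : 0 < (i : ℕ)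
  · obtain ⟨n, hn⟩ : ∃ n, (i : ℕ) = n + 1 := ⟨i - 1, by omega⟩
    simp only [hn, Nat.succ_pos, dite_true, Nat.add_sub_cancel]
    by_cases h4 : n < m
    · rw [dif_pos h4, dif_pos (by omega : n + 1 < m + 1), dif_pos (by omega : n + 1 < m + 1)]
      split_ifs with h5 h6 h6
      · simp only [zpow_sub₀ h, zpow_add₀ h, _root_.zpow_neg, two_mul, zpow_natCast, Nat.cast_add,
          Nat.cast_one, zpow_one]
        field_simp
        ring
      · omega
      · omega
      · obtain rfl : m = n + 1 := by omega
        simp only [zpow_sub₀ h, zpow_add₀ h, _root_.zpow_neg, two_mul, zpow_natCast, Nat.cast_add,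
          Nat.cast_one, zpow_one]
        field_simp
        ring
    · simp [h4]
  · have h4 : (i : ℕ) = 0 := by omega
    simp only [h4, lt_irrefl, dite_false, Nat.succ_pos, dite_true, Nat.cast_zero, zero_add, zero_sub]
    by_cases h5 : 0 < m
    · rw [dif_pos h5, dif_pos (by omega : 1 < m + 1)]
      simp only [zpow_sub₀ h, zpow_add₀ h, _root_.zpow_neg, zpow_natCast, Nat.cast_add,
        Nat.cast_one, zpow_one, Nat.cast_zero, zero_add, mul_zero, sub_zero, zpow_zero, mul_one]
      field_simp
      ring
    · obtain rfl : m = 0 := by omega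
      simp
      field_simp
      simp

/-- The projection `W(m)* ⊗ V → W(m+1)*`. -/
def dualProj (m : ℕ) : Hom ((weyl m).dual.tensor (weyl 1)) (weyl (m + 1)).dual where
  mat := coprojMat m
  comm_E := by
    rw [dual_weyl_toHom_E, tensor_toHom_E, dual_weyl_toHom_E, dual_weyl_toHom_K]
    exact coprojMat_comm_E m
  comm_F := by
    rw [dual_weyl_toHom_F, tensor_toHom_F, dual_weyl_toHom_F]
    exact coprojMat_comm_F m
  wt_eq := by
    rintro (i : Fin (m + 2)) ⟨(j : Fin (m + 1)), (a : Fin 2)⟩ hij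
    change -(((m + 1 : ℕ) : ℤ) - 2 * (i : ℕ)) = -((m : ℤ) - 2 * (j : ℕ)) + ((1 : ℕ) - 2 * (a : ℕ))
    change coprojMat m i (j, a) ≠ 0 at hij
    fin_cases a
    · by_cases h : (j : ℕ) + 1 = i
      · simp only [← h]; simp; ring
      · refine absurd ?_ hij
        simp only [coprojMat, of_apply, Pi.add_apply, Fin.zero_eta]
        split_ifs with h1 h2 h2 <;> simp [Pi.single_apply, Fin.ext_iff]
        all_goals (intro h3; omega)
    · by_cases h : (j : ℕ) = i
      · simp only [h]; simp; ring
      · refine absurd ?_ hij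
        simp only [coprojMat, of_apply, Pi.add_apply, Fin.mk_one]
        split_ifs with h1 h2 h2 <;> simp [Pi.single_apply, Fin.ext_iff, h]

theorem canCoeff_succ (m j : ℕ) : algebraMap ℤ[T;T⁻¹] Qv (canCoeff m (j + 1)) * qInt (j + 1) =
    -(v ^ (2 * (j : ℤ) + 2 - m) * qInt ((m : ℤ) - j)) * algebraMap ℤ[T;T⁻¹] Qv (canCoeff m j) := by
  have h := v_ne_zero
  have h1 := qInt_ne_zero (n := (j : ℤ) + 1) (by omega)
  have h2 := qFact_ne_zero j
  simp only [canCoeff, map_mul, map_pow, map_neg, map_one, algebraMap_T, gauss_eq, qFact_succ,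
    Finset.prod_range_succ]
  have : v ^ (((j + 1 : ℕ) : ℤ) * ((j + 1 : ℕ) + 1 - m)) =
      v ^ (2 * (j : ℤ) + 2 - m) * v ^ ((j : ℤ) * (j + 1 - m)) := by
    rw [← zpow_add₀ h]; congr 1; push_cast; ring
  rw [this]
  field_simp
  ring

theorem canMat_comm_E (m : ℕ) : (canMat m).map (algebraMap ℤ[T;T⁻¹] Qv) * weylE m =
    dualE m * (canMat m).map (algebraMap ℤ[T;T⁻¹] Qv) := by
  refine mul_eq_mul_of_mulVec fun x i => ?_
  have hi := i.2
  simp only [canMat_mulVec, weylE_mulVec, dualE_mulVec, Fin.val_rev]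
  by_cases h : 0 < (i : ℕ)
  · obtain ⟨n, hn⟩ : ∃ n, (i : ℕ) = n + 1 := ⟨i - 1, by omega⟩
    rw [dif_pos (by omega), dif_pos h]
    have e : (⟨(i : ℕ) - 1, by omega⟩ : Fin (m + 1)).rev = ⟨m + 1 - (i + 1) + 1, by omega⟩ :=
      Fin.ext (by simp; omega)
    have e2 : m + 1 - ((i : ℕ) - 1 + 1) = m + 1 - (i + 1) + 1 := by omega
    have h3 := canCoeff_succ m (m + 1 - (i + 1))
    rw [e, e2, ← mul_assoc, ← mul_assoc]
    congr 1
    have e3 : ((m + 1 - ((i : ℕ) + 1) : ℕ) : ℤ) = m - i := by omega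
    rw [e3] at h3 ⊢
    have e4 : v ^ (2 * ((i : ℤ) - 1) - m) * v ^ (2 * ((m : ℤ) - i) + 2 - m) = 1 := by
      rw [← zpow_add₀ v_ne_zero, show 2 * ((i : ℤ) - 1) - m + (2 * ((m : ℤ) - i) + 2 - m) = 0 by ring,
        zpow_zero]
    linear_combination v ^ (2 * ((i : ℤ) - 1) - m) * h3 -
      algebraMap ℤ[T;T⁻¹] Qv (canCoeff m (m + 1 - (i + 1))) * qInt ((m : ℤ) - (m - i)) * e4
  · rw [dif_neg (by omega), dif_neg h, mul_zero]

theorem canMat_comm_F (m : ℕ) : (canMat m).map (algebraMap ℤ[T;T⁻¹] Qv) * weylF m =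
    dualF m * (canMat m).map (algebraMap ℤ[T;T⁻¹] Qv) := by
  refine mul_eq_mul_of_mulVec fun x i => ?_
  have hi := i.2
  simp only [canMat_mulVec, weylF_mulVec, dualF_mulVec, Fin.val_rev]
  by_cases h : (i : ℕ) < m
  · obtain ⟨j, hj⟩ : ∃ j, m = i + j + 1 := ⟨m - i - 1, by omega⟩
    rw [dif_pos (by omega), dif_pos h]
    have e : (⟨(i : ℕ) + 1, by omega⟩ : Fin (m + 1)).rev = ⟨m + 1 - (i + 1) - 1, by omega⟩ :=
      Fin.ext (by simp; omega)
    have h3 := canCoeff_succ m j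
    have e1 : m + 1 - ((i : ℕ) + 1) = j + 1 := by omega
    have e2 : m + 1 - ((i : ℕ) + 1 + 1) = j := by omega
    simp only [e, e2]
    rw [← mul_assoc, ← mul_assoc]
    congr 1
    rw [e1]
    push_cast at h3 ⊢
    rw [h3]
    congr 4 <;> omega
  · rw [dif_neg (by omega), dif_neg h, mul_zero]

/-- The canonical map `W(m) → W(m)*`. -/
def canHom (m : ℕ) : Hom (weyl m) (weyl m).dual where
  mat := canMat m
  comm_E := by
    rw [weyl_toHom_E, dual_weyl_toHom_E]
    exact canMat_comm_E m
  comm_F := by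
    rw [weyl_toHom_F, dual_weyl_toHom_F]
    exact canMat_comm_F m
  wt_eq := by
    intro (i : Fin (m + 1)) (j : Fin (m + 1)) hij
    change -((m : ℤ) - 2 * (i : ℕ)) = (m : ℤ) - 2 * (j : ℕ)
    change canMat m i j ≠ 0 at hij
    have hi := i.2
    by_cases h : j = i.rev
    · subst h; simp; omega
    · exact absurd (Pi.single_eq_of_ne h _) hij

end LatticeRep

/-! ### Short exact sequences -/

section

variable (𝕜 : Type*) [Field 𝕜] [Algebra ℤ[T;T⁻¹] 𝕜]

/-- There is a short exact sequence `0 → A → M → B → 0` of `U_q(sl₂)`-modules. -/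
def IsExtension (A M B : Type*) [AddCommGroup A] [Module (Uq 𝕜) A] [AddCommGroup M]
    [Module (Uq 𝕜) M] [AddCommGroup B] [Module (Uq 𝕜) B] : Prop :=
  ∃ (f : A →ₗ[Uq 𝕜] M) (g : M →ₗ[Uq 𝕜] B),
    Function.Injective f ∧ Function.Surjective g ∧ Function.Exact f g

variable {𝕜}

theorem mkHom_restrictScalars {M N : Type*} [AddCommGroup M] [Module 𝕜 M] [Module (Uq 𝕜) M]
    [IsScalarTower 𝕜 (Uq 𝕜) M] [AddCommGroup N] [Module 𝕜 N] [Module (Uq 𝕜) N]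
    [IsScalarTower 𝕜 (Uq 𝕜) N] (f : M →ₗ[Uq 𝕜] N) (c : 𝕜) (x : M) : f (c • x) = c • f x :=
  (f.restrictScalars 𝕜).map_smul c x

section

variable {A M B : Type*} [AddCommGroup A] [Module 𝕜 A] [Module (Uq 𝕜) A] [IsScalarTower 𝕜 (Uq 𝕜) A]
  [AddCommGroup M] [Module 𝕜 M] [Module (Uq 𝕜) M] [IsScalarTower 𝕜 (Uq 𝕜) M]
  [AddCommGroup B] [Module 𝕜 B] [Module (Uq 𝕜) B] [IsScalarTower 𝕜 (Uq 𝕜) B]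
  {A' M' B' : Type*} [AddCommGroup A'] [Module (Uq 𝕜) A']
  [AddCommGroup M'] [Module (Uq 𝕜) M'] [AddCommGroup B'] [Module (Uq 𝕜) B']

/-- A complex `0 → A → M → B → 0` which is exact at the ends is exact if the dimensions add up. -/
theorem exact_of_finrank [FiniteDimensional 𝕜 M] {f : A →ₗ[Uq 𝕜] M} {g : M →ₗ[Uq 𝕜] B}
    (hf : Function.Injective f) (hg : Function.Surjective g) (hgf : ∀ x, g (f x) = 0)
    (h : Module.finrank 𝕜 M = Module.finrank 𝕜 A + Module.finrank 𝕜 B) : Function.Exact f g := by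
  let f' := f.restrictScalars 𝕜
  let g' : M →ₗ[𝕜] B := g.restrictScalars 𝕜
  have h1 : f'.range ≤ g'.ker := by
    rintro _ ⟨x, rfl⟩
    exact hgf x
  have h2 := LinearMap.finrank_range_of_inj (f := f') hf
  have h3 := g'.finrank_range_add_finrank_ker
  rw [LinearMap.range_eq_top.2 (show Function.Surjective g' from hg), finrank_top] at h3
  have h4 := Submodule.eq_of_le_of_finrank_eq h1 (by omega)
  intro y
  exact ⟨fun hy => h4.ge hy, fun ⟨x, hx⟩ => hx ▸ hgf x⟩

theorem IsExtension.finrank_eq [FiniteDimensional 𝕜 M] (h : IsExtension 𝕜 A M B) :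
    Module.finrank 𝕜 M = Module.finrank 𝕜 A + Module.finrank 𝕜 B := by
  obtain ⟨f, g, hf, hg, hfg⟩ := h
  let f' := f.restrictScalars 𝕜
  let g' : M →ₗ[𝕜] B := g.restrictScalars 𝕜
  have h1 : f'.range = g'.ker := by
    ext y
    exact (hfg y).symm
  have h2 := LinearMap.finrank_range_of_inj (f := f') hf
  have h3 := g'.finrank_range_add_finrank_ker
  rw [LinearMap.range_eq_top.2 (show Function.Surjective g' from hg), finrank_top] at h3
  rw [← h1] at h3
  omega

theorem IsExtension.congr (h : IsExtension 𝕜 A M B) (a : A ≃ₗ[Uq 𝕜] A') (m : M ≃ₗ[Uq 𝕜] M')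
    (b : B ≃ₗ[Uq 𝕜] B') : IsExtension 𝕜 A' M' B' := by
  obtain ⟨f, g, hf, hg, hfg⟩ := h
  refine ⟨m.toLinearMap ∘ₗ f ∘ₗ a.symm.toLinearMap, b.toLinearMap ∘ₗ g ∘ₗ m.symm.toLinearMap,
    m.injective.comp (hf.comp a.symm.injective), b.surjective.comp (hg.comp m.symm.surjective), ?_⟩
  intro y
  have := hfg (m.symm y)
  simp only [LinearMap.comp_apply, LinearEquiv.coe_coe, LinearEquiv.map_eq_zero_iff, this]
  constructor
  · rintro ⟨x, hx⟩
    exact ⟨a x, by simp [hx]⟩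
  · rintro ⟨x, rfl⟩
    exact ⟨a.symm x, by simp⟩

theorem IsExtension.tv (h : IsExtension 𝕜 A M B) : IsExtension 𝕜 (TV A) (TV M) (TV B) := by
  obtain ⟨f, g, hf, hg, hfg⟩ := h
  exact ⟨TV.map f, TV.map g, TV.map_injective hf, TV.map_surjective hg, TV.map_exact hfg⟩

end

variable (𝕜) in
/-- The parameter `q`, the image of `v`. -/
abbrev qq : 𝕜 := algebraMap ℤ[T;T⁻¹] 𝕜 (LaurentPolynomial.T 1)

theorem qq_ne_zero : qq 𝕜 ≠ 0 := by
  have h : qq 𝕜 * algebraMap ℤ[T;T⁻¹] 𝕜 (LaurentPolynomial.T (-1)) = 1 := by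
    rw [← map_mul, ← LaurentPolynomial.T_add]
    simp
  exact left_ne_zero_of_mul_eq_one h

theorem algebraMap_T_eq (n : ℤ) : algebraMap ℤ[T;T⁻¹] 𝕜 (LaurentPolynomial.T n) = qq 𝕜 ^ n := by
  have key (n : ℕ) : algebraMap ℤ[T;T⁻¹] 𝕜 (LaurentPolynomial.T n) = qq 𝕜 ^ n := by
    rw [← map_pow, LaurentPolynomial.T_pow, mul_one]
  obtain ⟨n, rfl | rfl⟩ := n.eq_nat_or_neg
  · rw [key, zpow_natCast]
  · rw [zpow_neg, zpow_natCast, ← key]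
    refine eq_inv_of_mul_eq_one_left ?_
    rw [← map_mul, ← LaurentPolynomial.T_add]
    simp

variable (𝕜) in
/-- The Weyl module `W(k)` at `v = q`. -/
abbrev WMod (k : ℕ) : Type _ := (weyl k).Mod 𝕜

variable (𝕜) in
/-- The dual Weyl module `W(k)*` at `v = q`. -/
abbrev DMod (k : ℕ) : Type _ := (weyl k).dual.Mod 𝕜

theorem finrank_WMod (k : ℕ) : Module.finrank 𝕜 (WMod 𝕜 k) = k + 1 :=
  ((weyl k).finrank_mod).trans (Fintype.card_fin _)

theorem finrank_DMod (k : ℕ) : Module.finrank 𝕜 (DMod 𝕜 k) = k + 1 :=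
  ((weyl k).dual.finrank_mod).trans (Fintype.card_fin _)

open LatticeRep

variable (𝕜) in
/-- The embedding `W(m+1) → W(m) ⊗ V`. -/
def inclW (m : ℕ) : WMod 𝕜 (m + 1) →ₗ[Uq 𝕜] TV (WMod 𝕜 m) :=
  (tensorEquiv (𝕜 := 𝕜) (weyl m)).toLinearMap ∘ₗ (weylIncl m).spec 𝕜

theorem inclW_apply_zero (m : ℕ) (x : Fin (m + 2) → 𝕜) (i : Fin (m + 1)) :
    (inclW 𝕜 m x 0 : Fin (m + 1) → 𝕜) i = qq 𝕜 ^ (-(i : ℕ) : ℤ) * x i.castSucc := by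
  rw [← algebraMap_T_eq]
  exact inclMat_mulVec_zero _ m x i

theorem inclW_apply_one (m : ℕ) (x : Fin (m + 2) → 𝕜) (i : Fin (m + 1)) :
    (inclW 𝕜 m x 1 : Fin (m + 1) → 𝕜) i = x i.succ :=
  inclMat_mulVec_one _ m x i

variable (𝕜) in
/-- The projection `W(m+1) ⊗ V → W(m)`. -/
def projW (m : ℕ) : TV (WMod 𝕜 (m + 1)) →ₗ[Uq 𝕜] WMod 𝕜 m :=
  (weylProj m).spec 𝕜 ∘ₗ (tensorEquiv (𝕜 := 𝕜) (weyl (m + 1))).symm.toLinearMap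

theorem projW_apply (m : ℕ) (y : Fin 2 → Fin (m + 2) → 𝕜) (i : Fin (m + 1)) :
    (projW 𝕜 m y : Fin (m + 1) → 𝕜) i =
      qq 𝕜 ^ (-(i : ℕ) : ℤ) * y 1 i.castSucc - qq 𝕜 * y 0 i.succ := by
  rw [← algebraMap_T_eq]
  exact projMat_mulVec _ m (fun p => y p.2 p.1) i

variable (𝕜) in
/-- The embedding `W(m)* → W(m+1)* ⊗ V`. -/
def inclD (m : ℕ) : DMod 𝕜 m →ₗ[Uq 𝕜] TV (DMod 𝕜 (m + 1)) :=
  (tensorEquiv (𝕜 := 𝕜) (weyl (m + 1)).dual).toLinearMap ∘ₗ (dualIncl m).spec 𝕜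

theorem inclD_apply_zero (m : ℕ) (x : Fin (m + 1) → 𝕜) (i : Fin (m + 2)) :
    (inclD 𝕜 m x 0 : Fin (m + 2) → 𝕜) i =
      if h : (i : ℕ) < m + 1 then qq 𝕜 ^ (m + 2 : ℤ) * x ⟨i, h⟩ else 0 := by
  simp_rw [← algebraMap_T_eq]
  exact coinclMat_mulVec_zero _ m x i

theorem inclD_apply_one (m : ℕ) (x : Fin (m + 1) → 𝕜) (i : Fin (m + 2)) :
    (inclD 𝕜 m x 1 : Fin (m + 2) → 𝕜) i =
      if h : 0 < (i : ℕ) then qq 𝕜 ^ ((i : ℕ) - 1 : ℤ) * x ⟨i - 1, by omega⟩ else 0 := by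
  simp_rw [← algebraMap_T_eq]
  exact coinclMat_mulVec_one _ m x i

variable (𝕜) in
/-- The projection `W(m)* ⊗ V → W(m+1)*`. -/
def projD (m : ℕ) : TV (DMod 𝕜 m) →ₗ[Uq 𝕜] DMod 𝕜 (m + 1) :=
  (dualProj m).spec 𝕜 ∘ₗ (tensorEquiv (𝕜 := 𝕜) (weyl m).dual).symm.toLinearMap

theorem projD_apply (m : ℕ) (y : Fin 2 → Fin (m + 1) → 𝕜) (i : Fin (m + 2)) :
    (projD 𝕜 m y : Fin (m + 2) → 𝕜) i =
      (if h : 0 < (i : ℕ) then qq 𝕜 ^ ((i : ℕ) - 1 : ℤ) * y 0 ⟨i - 1, by omega⟩ else 0) -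
        if h : (i : ℕ) < m + 1 then qq 𝕜 ^ (m + 1 : ℤ) * y 1 ⟨i, h⟩ else 0 := by
  simp_rw [← algebraMap_T_eq]
  exact coprojMat_mulVec _ m (fun p => y p.2 p.1) i

theorem inclW_injective (m : ℕ) : Function.Injective (inclW 𝕜 m) := by
  rw [injective_iff_map_eq_zero]
  intro (x : Fin (m + 2) → 𝕜) hx
  have h0 (i : Fin (m + 1)) := inclW_apply_zero m x i
  have h1 (i : Fin (m + 1)) := inclW_apply_one m x i
  rw [hx] at h0 h1
  refine funext fun (i : Fin (m + 2)) => ?_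
  refine Fin.cases ?_ (fun i => (h1 i).symm) i
  have := (h0 0).symm
  exact (mul_eq_zero.1 this).resolve_left (zpow_ne_zero _ qq_ne_zero)

theorem projW_surjective (m : ℕ) : Function.Surjective (projW 𝕜 m) := by
  intro (w : Fin (m + 1) → 𝕜)
  refine ⟨(![0, fun i : Fin (m + 2) => if h : (i : ℕ) < m + 1 then qq 𝕜 ^ (i : ℕ) * w ⟨i, h⟩ else 0] :
    Fin 2 → Fin (m + 2) → 𝕜), funext fun (i : Fin (m + 1)) => (projW_apply m _ i).trans ?_⟩
  have := qq_ne_zero (𝕜 := 𝕜)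
  have hi : (i : ℕ) ≤ m := by omega
  simp [hi, this]

theorem projW_inclW (m : ℕ) (x) : projW 𝕜 m (inclW 𝕜 (m + 1) x) = 0 := by
  refine funext fun (i : Fin (m + 1)) => (projW_apply m _ i).trans ?_
  rw [inclW_apply_zero (m + 1) x, inclW_apply_one (m + 1) x]
  have := qq_ne_zero (𝕜 := 𝕜)
  simp only [Fin.val_succ, Nat.cast_add, Nat.cast_one, neg_add, zpow_add₀ this, zpow_neg_one,
    Fin.succ_castSucc]
  refine sub_eq_zero.2 ?_
  field_simp

variable (𝕜) in
/-- `0 → W(m+2) → W(m+1) ⊗ V → W(m) → 0`. -/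
theorem isExtension_weyl (m : ℕ) :
    IsExtension 𝕜 (WMod 𝕜 (m + 2)) (TV (WMod 𝕜 (m + 1))) (WMod 𝕜 m) :=
  ⟨inclW 𝕜 (m + 1), projW 𝕜 m, inclW_injective _, projW_surjective _,
    exact_of_finrank (inclW_injective _) (projW_surjective _) (projW_inclW m) (by
      rw [TV.finrank_eq, finrank_WMod, finrank_WMod, finrank_WMod]; ring)⟩

variable (𝕜) in
/-- `W(0) ⊗ V ≅ W(1)`. -/
theorem tv_weyl_zero : Nonempty (WMod 𝕜 1 ≃ₗ[Uq 𝕜] TV (WMod 𝕜 0)) := by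
  refine ⟨LinearEquiv.ofBijective (inclW 𝕜 0) ⟨inclW_injective _, ?_⟩⟩
  exact (LinearMap.injective_iff_surjective_of_finrank_eq_finrank
    (f := (inclW 𝕜 0).restrictScalars 𝕜)
    (by rw [TV.finrank_eq, finrank_WMod, finrank_WMod])).1 (inclW_injective _)

theorem inclD_injective (m : ℕ) : Function.Injective (inclD 𝕜 m) := by
  rw [injective_iff_map_eq_zero]
  intro (x : Fin (m + 1) → 𝕜) hx
  have h0 (i : Fin (m + 2)) := inclD_apply_zero m x i
  rw [hx] at h0
  refine funext fun (i : Fin (m + 1)) => ?_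
  have := (h0 i.castSucc).symm
  rw [dif_pos (show ((i.castSucc : Fin (m + 2)) : ℕ) < m + 1 from i.2)] at this
  exact (mul_eq_zero.1 this).resolve_left (zpow_ne_zero _ qq_ne_zero)

theorem projD_surjective (m : ℕ) : Function.Surjective (projD 𝕜 m) := by
  intro (w : Fin (m + 2) → 𝕜)
  have hq := qq_ne_zero (𝕜 := 𝕜)
  refine ⟨(![fun i => (qq 𝕜 ^ (i : ℕ))⁻¹ * w i.succ,
    fun i => if (i : ℕ) = 0 then -(qq 𝕜 ^ (m + 1 : ℤ))⁻¹ * w 0 else 0] :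
    Fin 2 → Fin (m + 1) → 𝕜), funext fun (i : Fin (m + 2)) => (projD_apply m _ i).trans ?_⟩
  have h2 : qq 𝕜 ^ (m + 1 : ℤ) ≠ 0 := zpow_ne_zero _ hq
  refine Fin.cases ?_ (fun i => ?_) i
  · simp [h2]
  · have : qq 𝕜 ^ (i : ℕ) ≠ 0 := pow_ne_zero _ hq
    simp [this]

theorem projD_inclD (m : ℕ) (x) : projD 𝕜 (m + 1) (inclD 𝕜 m x) = 0 := by
  refine funext fun (i : Fin (m + 3)) => (projD_apply (m + 1) _ i).trans ?_
  simp_rw [inclD_apply_zero m x, inclD_apply_one m x]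
  have hi := i.2
  have e : ((m + 1 : ℕ) : ℤ) + 1 = m + 2 := by push_cast; ring
  rw [e]
  change _ = (0 : 𝕜)
  by_cases h1 : 0 < (i : ℕ)
  · by_cases h2 : (i : ℕ) < m + 1 + 1
    · rw [dif_pos h1, dif_pos h2, dif_pos h1, dif_pos (by omega)]
      ring
    · rw [dif_pos h1, dif_neg h2, dif_neg (by omega)]
      ring
  · simp [h1]

variable (𝕜) in
/-- `0 → W(m)* → W(m+1)* ⊗ V → W(m+2)* → 0`. -/
theorem isExtension_dual (m : ℕ) :
    IsExtension 𝕜 (DMod 𝕜 m) (TV (DMod 𝕜 (m + 1))) (DMod 𝕜 (m + 2)) :=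
  ⟨inclD 𝕜 m, projD 𝕜 (m + 1), inclD_injective _, projD_surjective _,
    exact_of_finrank (inclD_injective _) (projD_surjective _) (projD_inclD m) (by
      rw [TV.finrank_eq, finrank_DMod, finrank_DMod, finrank_DMod]; ring)⟩

/-- The canonical map `W(m) → W(m)*` is an isomorphism when no Gaussian binomial coefficient
`[m \atop i]` vanishes. -/
theorem weyl_equiv_dual {m : ℕ} (h : ∀ i ≤ m, algebraMap ℤ[T;T⁻¹] 𝕜 (gauss m i) ≠ 0) :
    Nonempty (WMod 𝕜 m ≃ₗ[Uq 𝕜] DMod 𝕜 m) := by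
  have hinj : Function.Injective ((canHom m).spec 𝕜) := by
    rw [injective_iff_map_eq_zero]
    intro (x : Fin (m + 1) → 𝕜) hx
    refine funext fun (i : Fin (m + 1)) => ?_
    have h1 := congrFun hx i.rev
    have h2 : algebraMap ℤ[T;T⁻¹] 𝕜 (canCoeff m i.rev.rev) * x i.rev.rev = 0 :=
      (canMat_mulVec (algebraMap ℤ[T;T⁻¹] 𝕜) m x i.rev).symm.trans h1
    rw [Fin.rev_rev] at h2
    refine (mul_eq_zero.1 h2).resolve_left ?_
    rw [canCoeff, map_mul, map_mul, algebraMap_T_eq]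
    have := h i (by omega)
    simp [this, zpow_ne_zero, qq_ne_zero]
  exact ⟨LinearEquiv.ofBijective ((canHom m).spec 𝕜) ⟨hinj,
    (LinearMap.injective_iff_surjective_of_finrank_eq_finrank
      (f := ((canHom m).spec 𝕜).restrictScalars 𝕜)
      (by rw [finrank_WMod, finrank_DMod])).1 hinj⟩⟩

/-! ### The element `E⁽ᵏ⁾F⁽ᵏ⁾` -/

/-- The divided power `E⁽ⁿ⁾` in the integral form. -/
def EA (n : ℕ) : UA := ⟨divPow E n, divPow_E_mem n⟩

/-- The divided power `F⁽ⁿ⁾` in the integral form. -/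
def FA (n : ℕ) : UA := ⟨divPow F n, divPow_F_mem n⟩

variable (𝕜) in
/-- The element `E⁽ᵏ⁾F⁽ᵏ⁾`: on a module all of whose weights lie in `[-k, k]` its image consists of
vectors of weight `k`. -/
def topElt (k : ℕ) : Uq 𝕜 := toUqHom 𝕜 (EA k * FA k)

theorem gaussNat_eq_zero {n t : ℕ} (h : n < t) : gaussNat n t = 0 := by
  induction n generalizing t with
  | zero => obtain ⟨t, rfl⟩ := Nat.exists_eq_succ_of_ne_zero h.ne'; rfl
  | succ n ih =>
    obtain ⟨t, rfl⟩ := Nat.exists_eq_succ_of_ne_zero (by omega : t ≠ 0)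
    rw [gaussNat, ih (by omega), ih (by omega), mul_zero, mul_zero, add_zero]

theorem gaussNat_self (n : ℕ) : gaussNat n n = 1 := by
  induction n with
  | zero => rfl
  | succ n ih => simp [gaussNat, ih, gaussNat_eq_zero]

theorem weyl_intHom_FA (m n : ℕ) (i j : Fin (m + 1)) : (weyl m).intHom (FA n) i j =
    if (i : ℕ) = j + n then gauss (i : ℕ) n else 0 := by
  apply IsFractionRing.injective ℤ[T;T⁻¹] Qv
  refine ((weyl m).algebraMap_intHom _ _ _).trans ?_
  have : (weyl m).toHom (divPow F n) i j =
      ((qFact n)⁻¹ • (weylF m) ^ n) i j := by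
    rw [divPow, map_smul, map_pow, weyl_toHom_F]; rfl
  refine this.trans ?_
  rw [weylF_pow]
  split_ifs with h
  · rw [gauss_eq]; simp [h]
  · simp [h]

theorem weyl_intHom_EA (m n : ℕ) (i j : Fin (m + 1)) : (weyl m).intHom (EA n) i j =
    if (j : ℕ) = i + n then gauss ((m : ℤ) - i) n else 0 := by
  apply IsFractionRing.injective ℤ[T;T⁻¹] Qv
  refine ((weyl m).algebraMap_intHom _ _ _).trans ?_
  have : (weyl m).toHom (divPow E n) i j =
      ((qFact n)⁻¹ • (weylE m) ^ n) i j := by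
    rw [divPow, map_smul, map_pow, weyl_toHom_E]; rfl
  refine this.trans ?_
  rw [weylE_pow]
  split_ifs with h
  · rw [gauss_eq]; simp [h]
  · simp [h]

/-- The coordinates of a vector of a Weyl module. -/
def wCoord {m : ℕ} (x : WMod 𝕜 m) : Fin (m + 1) → 𝕜 := x

/-- The coordinates of a vector of the module attached to a lattice. -/
def LatticeRep.coord {V : LatticeRep} (x : V.Mod 𝕜) : V.ι → 𝕜 := x

variable (𝕜) in
/-- The highest weight vector of the Weyl module. -/
def hwv (m : ℕ) : WMod 𝕜 m := (Pi.single 0 1 : Fin (m + 1) → 𝕜)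

theorem hwv_ne_zero (m : ℕ) : hwv 𝕜 m ≠ 0 := by
  intro h
  have := congrFun h (0 : Fin (m + 1))
  exact one_ne_zero (((Pi.single_eq_same (M := fun _ : Fin (m + 1) => 𝕜) 0 1).symm.trans this))

theorem FA_smul_weyl (m n : ℕ) (x : WMod 𝕜 m) (i : Fin (m + 1)) :
    wCoord (toUqHom 𝕜 (FA n) • x) i =
    if h : n ≤ i then algebraMap ℤ[T;T⁻¹] 𝕜 (gauss (i : ℕ) n) * wCoord x ⟨i - n, by omega⟩
    else 0 := by
  refine (congrFun ((weyl m).toUqHom_smul (FA n) x) i).trans ?_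
  change ∑ j : Fin (m + 1), algebraMap ℤ[T;T⁻¹] 𝕜 ((weyl m).intHom (FA n) i j) * wCoord x j = _
  simp_rw [weyl_intHom_FA, apply_ite (algebraMap ℤ[T;T⁻¹] 𝕜), map_zero, ite_mul, zero_mul]
  split_ifs with h
  · rw [Finset.sum_eq_single ⟨i - n, by omega⟩]
    · simp [h]
    · intro j _ hj
      refine if_neg fun h' => hj (Fin.ext ?_)
      simp only; omega
    · simp
  · exact Finset.sum_eq_zero fun j _ => if_neg (by omega)

theorem EA_smul_weyl (m n : ℕ) (x : WMod 𝕜 m) (i : Fin (m + 1)) :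
    wCoord (toUqHom 𝕜 (EA n) • x) i =
    if h : i + n < m + 1 then algebraMap ℤ[T;T⁻¹] 𝕜 (gauss ((m : ℤ) - i) n) * wCoord x ⟨i + n, h⟩
    else 0 := by
  refine (congrFun ((weyl m).toUqHom_smul (EA n) x) i).trans ?_
  change ∑ j : Fin (m + 1), algebraMap ℤ[T;T⁻¹] 𝕜 ((weyl m).intHom (EA n) i j) * wCoord x j = _
  simp_rw [weyl_intHom_EA, apply_ite (algebraMap ℤ[T;T⁻¹] 𝕜), map_zero, ite_mul, zero_mul]
  split_ifs with h
  · rw [Finset.sum_eq_single ⟨i + n, by omega⟩]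
    · simp
    · intro j _ hj
      exact if_neg fun h' => hj (Fin.ext h')
    · simp
  · exact Finset.sum_eq_zero fun j _ => if_neg (by omega)

theorem FA_smul_hwv (m : ℕ) (n : Fin (m + 1)) :
    wCoord (toUqHom 𝕜 (FA n) • hwv 𝕜 m) = Pi.single n 1 := by
  refine funext fun (i : Fin (m + 1)) => (FA_smul_weyl m n _ i).trans ?_
  rcases lt_trichotomy i n with h | h | h
  · rw [dif_neg (by simpa using h), Pi.single_eq_of_ne h.ne]
  · subst h
    have : (⟨(i : ℕ) - i, by omega⟩ : Fin (m + 1)) = 0 := Fin.ext (by simp)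
    have h2 : gauss ((i : ℕ) : ℤ) i = 1 := gaussNat_self _
    rw [dif_pos le_rfl, this, h2]
    simp [wCoord, hwv]
  · rw [dif_pos (by exact h.le), Pi.single_eq_of_ne h.ne']
    refine mul_eq_zero_of_right _ (Pi.single_eq_of_ne (M := fun _ : Fin (m + 1) => 𝕜) ?_ _)
    intro e
    have := congrArg Fin.val e
    have h' : (n : ℕ) < i := h
    simp only [Fin.val_zero] at this
    omega

/-- The highest weight vector generates the Weyl module. -/
theorem mem_of_hwv_mem {m : ℕ} {P : Submodule (Uq 𝕜) (WMod 𝕜 m)} (h : hwv 𝕜 m ∈ P) : P = ⊤ := by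
  rw [eq_top_iff]
  intro x _
  have hx : x = ∑ n : Fin (m + 1), wCoord x n • (toUqHom 𝕜 (FA n) • hwv 𝕜 m) := by
    have h1 : wCoord x = ∑ n : Fin (m + 1), wCoord x n • wCoord (toUqHom 𝕜 (FA n) • hwv 𝕜 m) := by
      simp_rw [FA_smul_hwv]
      exact pi_eq_sum_univ' _
    exact h1
  rw [hx]
  refine Submodule.sum_mem P fun n _ => ?_
  rw [← smul_assoc]
  exact P.smul_mem _ h

/-- On `W(m)` the element `E⁽ᵐ⁾F⁽ᵐ⁾` is the projection onto the highest weight line. -/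
theorem topElt_smul_weyl (m : ℕ) (x : WMod 𝕜 m) : topElt 𝕜 m • x = wCoord x 0 • hwv 𝕜 m := by
  have h0 : topElt 𝕜 m • x = toUqHom 𝕜 (EA m) • toUqHom 𝕜 (FA m) • x := by
    rw [topElt, map_mul, mul_smul]
  refine h0.trans (funext fun (i : Fin (m + 1)) => (EA_smul_weyl m m _ i).trans ?_)
  change _ = wCoord x 0 * (Pi.single 0 1 : Fin (m + 1) → 𝕜) i
  rcases eq_or_ne i 0 with rfl | h
  · rw [dif_pos (by simp), FA_smul_weyl, dif_pos (by simp)]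
    have : (⟨((⟨((0 : Fin (m + 1)) : ℕ) + m, by simp⟩ : Fin (m + 1)) : ℕ) - m, by simp⟩ :
      Fin (m + 1)) = 0 := Fin.ext (by simp)
    rw [this]
    simp [gauss, gaussNat_self]
  · have h' : (i : ℕ) ≠ 0 := fun e => h (Fin.ext e)
    rw [dif_neg (by omega), Pi.single_eq_of_ne h, mul_zero]

theorem topElt_smul_hwv (m : ℕ) : topElt 𝕜 m • hwv 𝕜 m = hwv 𝕜 m := by
  have : wCoord (hwv 𝕜 m) 0 = 1 := Pi.single_eq_same (M := fun _ : Fin (m + 1) => 𝕜) 0 1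
  rw [topElt_smul_weyl, this, one_smul]

namespace LatticeRep

variable (V : LatticeRep)

theorem toHom_F_pow_eq_zero (n : ℕ) (i j : V.ι) (h : V.wt i ≠ V.wt j - 2 * n) :
    (V.toHom F ^ n) i j = 0 := by
  induction n generalizing j with
  | zero =>
    rw [pow_zero, Matrix.one_apply_ne]
    rintro rfl
    simp at h
  | succ n ih =>
    rw [pow_succ, Matrix.mul_apply]
    refine Finset.sum_eq_zero fun k _ => ?_
    by_cases hk : V.wt i = V.wt k - 2 * n
    · have h1 : V.toHom K * V.toHom F = v ^ (-2 : ℤ) • (V.toHom F * V.toHom K) := by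
        rw [← map_mul, K_mul_F, map_smul, map_mul]
      have h2 := congrFun (congrFun h1 k) j
      rw [map_K, Matrix.diagonal_mul, Matrix.smul_apply, Matrix.mul_diagonal, smul_eq_mul,
        mul_left_comm, ← zpow_add₀ v_ne_zero, mul_comm, ← sub_eq_zero, ← mul_sub, v_zpow, v_zpow,
        ← map_sub] at h2
      rcases mul_eq_zero.1 h2 with h3 | h3
      · rw [h3, mul_zero]
      · rw [map_eq_zero_iff _ (IsFractionRing.injective ℤ[T;T⁻¹] Qv), sub_eq_zero] at h3
        have := congrArg (fun p : ℤ[T;T⁻¹] => p.coeff (V.wt k)) h3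
        simp [LaurentPolynomial.T_apply] at this
        push_cast at h
        omega
    · rw [ih _ hk, zero_mul]

theorem intHom_FA_eq_zero (n : ℕ) (i j : V.ι) (h : V.wt i ≠ V.wt j - 2 * n) :
    V.intHom (FA n) i j = 0 := by
  apply IsFractionRing.injective ℤ[T;T⁻¹] Qv
  refine (V.algebraMap_intHom _ _ _).trans ?_
  have : V.toHom (FA n) = (qFact n)⁻¹ • V.toHom F ^ n := by
    change V.toHom ((qFact n)⁻¹ • F ^ n) = _
    rw [map_smul, map_pow]
  rw [map_zero, this, Matrix.smul_apply, V.toHom_F_pow_eq_zero n i j h, smul_zero]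

/-- `E⁽ᵏ⁾F⁽ᵏ⁾` vanishes on a module all of whose weights lie in `(-k, k)`. -/
theorem topElt_smul_eq_zero {k : ℕ} (h : ∀ i, |V.wt i| < k) (x : V.Mod 𝕜) : topElt 𝕜 k • x = 0 := by
  have h1 : V.intHom (FA k) = 0 := by
    refine Matrix.ext fun i j => V.intHom_FA_eq_zero k i j ?_
    have := abs_lt.1 (h i)
    have := abs_lt.1 (h j)
    omega
  have h2 : toUqHom 𝕜 (FA k) • x = 0 := by
    rw [toUqHom_smul, h1]
    change (((0 : Matrix V.ι V.ι ℤ[T;T⁻¹]).map (algebraMap ℤ[T;T⁻¹] 𝕜)).mulVec x : V.Mod 𝕜) = 0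
    rw [Matrix.map_zero _ (map_zero _)]
    exact Matrix.zero_mulVec _
  rw [topElt, map_mul, mul_smul, h2, smul_zero]

/-- `E⁽ᵏ⁾F⁽ᵏ⁾` has rank at most one on a module all of whose weights lie in `[-k, k]` and where
the weight `-k` occurs at most once. -/
theorem exists_topElt_smul_eq {k : ℕ} (h : ∀ i, |V.wt i| ≤ k) (b : V.ι)
    (hb : ∀ i, V.wt i = -k → i = b) :
    ∃ z : V.Mod 𝕜, ∀ x : V.Mod 𝕜, ∃ c : 𝕜, topElt 𝕜 k • x = c • z := by
  let e : V.Mod 𝕜 := (Pi.single b 1 : V.ι → 𝕜)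
  refine ⟨toUqHom 𝕜 (EA k) • e, fun x => ⟨coord (toUqHom 𝕜 (FA k) • x) b, ?_⟩⟩
  have : toUqHom 𝕜 (FA k) • x = coord (toUqHom 𝕜 (FA k) • x) b • e := by
    refine funext fun i => ?_
    change coord (toUqHom 𝕜 (FA k) • x) i =
      coord (toUqHom 𝕜 (FA k) • x) b * (Pi.single b 1 : V.ι → 𝕜) i
    rcases eq_or_ne i b with rfl | hi
    · simp
    · rw [Pi.single_eq_of_ne hi, mul_zero, toUqHom_smul]
      refine Finset.sum_eq_zero fun j _ => ?_
      refine mul_eq_zero_of_left ?_ _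
      refine (congrArg (algebraMap ℤ[T;T⁻¹] 𝕜) (V.intHom_FA_eq_zero k i j ?_)).trans (map_zero _)
      intro h'
      refine hi (hb i ?_)
      have := abs_le.1 (h i)
      have := abs_le.1 (h j)
      omega
  rw [topElt, map_mul, mul_smul]
  refine (congrArg (toUqHom 𝕜 (EA k) • ·) this).trans ?_
  exact smul_algebra_smul_comm _ _ _

end LatticeRep

theorem topElt_smul_dual_eq_zero {k m : ℕ} (h : m < k) (x : DMod 𝕜 m) : topElt 𝕜 k • x = 0 := by
  refine (weyl m).dual.topElt_smul_eq_zero ?_ x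
  intro (i : Fin (m + 1))
  change |-((m : ℤ) - 2 * (i : ℕ))| < k
  rw [abs_lt]
  omega

/-- The weights of `V^{⊗N}` lie in `[-N, N]`, and `-N` has multiplicity one. -/
theorem tensorPow_wt (N : ℕ) : (∀ i, |((weyl 1).tensorPow N).wt i| ≤ N) ∧
    ∃ b, ∀ i, ((weyl 1).tensorPow N).wt i = -N → i = b := by
  induction N with
  | zero =>
    constructor
    · intro (i : Fin 1)
      change |((0 : ℕ) : ℤ) - 2 * (i : ℕ)| ≤ _
      simp
    · exact ⟨(0 : Fin 1), fun (i : Fin 1) _ => Subsingleton.elim (α := Fin 1) _ _⟩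
  | succ N ih =>
    obtain ⟨h1, b, h2⟩ := ih
    have e (i : ((weyl 1).tensorPow N).ι) (a : Fin 2) : ((weyl 1).tensorPow (N + 1)).wt (i, a) =
      ((weyl 1).tensorPow N).wt i + ((1 : ℕ) - 2 * (a : ℕ)) := rfl
    constructor
    · rintro ⟨i, (a : Fin 2)⟩
      have := abs_le.1 (h1 i)
      rw [e, abs_le]
      push_cast
      omega
    · refine ⟨(b, (1 : Fin 2)), ?_⟩
      rintro ⟨i, (a : Fin 2)⟩ hi
      have := abs_le.1 (h1 i)
      rw [e] at hi
      push_cast at hi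
      have ha : a = 1 := Fin.ext (show (a : ℕ) = 1 by omega)
      subst ha
      have hi' : ((weyl 1).tensorPow N).wt i = -N := by
        simp at hi; omega
      rw [h2 i hi']

theorem topElt_smul_tensorPower {k N : ℕ} (h : N < k) (x : TensorPower 𝕜 N) :
    topElt 𝕜 k • x = 0 :=
  LatticeRep.topElt_smul_eq_zero _ (fun i => ((tensorPow_wt N).1 i).trans_lt (by exact_mod_cast h)) x

theorem exists_topElt_smul_tensorPower (k : ℕ) :
    ∃ z : TensorPower 𝕜 k, ∀ x : TensorPower 𝕜 k, ∃ c : 𝕜, topElt 𝕜 k • x = c • z := by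
  obtain ⟨h, b, hb⟩ := tensorPow_wt k
  exact LatticeRep.exists_topElt_smul_eq _ h b hb

end

/-! ### The Casimir element -/

section generic

variable {k B : Type*} [Field k] [Ring B] [Algebra k B] {v : k} {e f a b : B}

theorem casimir_mul_e (hv : v ≠ 0) (hv2 : v - v⁻¹ ≠ 0) (h₁ : a * e = v ^ (2 : ℤ) • (e * a))
    (h₂ : b * e = v ^ (-2 : ℤ) • (e * b)) (h₃ : e * f - f * e = (v - v⁻¹)⁻¹ • (a - b)) :
    ((v - v⁻¹) ^ 2 • (f * e) + v • a + v⁻¹ • b) * e =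
      e * ((v - v⁻¹) ^ 2 • (f * e) + v • a + v⁻¹ • b) := by
  have h : e * (f * e) = f * e * e + (v - v⁻¹)⁻¹ • (v ^ (2 : ℤ) • (e * a) - v ^ (-2 : ℤ) • (e * b)) := by
    rw [← mul_assoc, sub_eq_iff_eq_add.1 h₃, add_mul, smul_mul_assoc, sub_mul, h₁, h₂, add_comm]
  have hv2' : v ^ 2 - 1 ≠ 0 := by
    intro h; apply hv2; field_simp; rw [h, mul_zero]
  simp only [add_mul, mul_add, smul_mul_assoc, mul_smul_comm, h, h₁, h₂]
  match_scalars <;> simp [zpow_ofNat] <;> field_simp <;> ring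

theorem casimir_mul_f (hv : v ≠ 0) (hv2 : v - v⁻¹ ≠ 0) (h₁ : a * f = v ^ (-2 : ℤ) • (f * a))
    (h₂ : b * f = v ^ (2 : ℤ) • (f * b)) (h₃ : e * f - f * e = (v - v⁻¹)⁻¹ • (a - b)) :
    ((v - v⁻¹) ^ 2 • (f * e) + v • a + v⁻¹ • b) * f =
      f * ((v - v⁻¹) ^ 2 • (f * e) + v • a + v⁻¹ • b) := by
  have h : f * e * f = f * (f * e) + (v - v⁻¹)⁻¹ • (f * a - f * b) := by
    rw [mul_assoc, sub_eq_iff_eq_add.1 h₃, mul_add, mul_smul_comm, mul_sub, add_comm]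
  have hv2' : v ^ 2 - 1 ≠ 0 := by
    intro h; apply hv2; field_simp; rw [h, mul_zero]
  simp only [add_mul, mul_add, smul_mul_assoc, mul_smul_comm, h, h₁, h₂]
  match_scalars <;> simp [zpow_ofNat] <;> field_simp <;> ring

theorem casimir_mul_a (hv : v ≠ 0) (h₁ : a * e = v ^ (2 : ℤ) • (e * a))
    (h₂ : a * f = v ^ (-2 : ℤ) • (f * a)) (h₃ : a * b = b * a) :
    ((v - v⁻¹) ^ 2 • (f * e) + v • a + v⁻¹ • b) * a =
      a * ((v - v⁻¹) ^ 2 • (f * e) + v • a + v⁻¹ • b) := by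
  have h : a * (f * e) = f * e * a := by
    rw [← mul_assoc, h₂, smul_mul_assoc, mul_assoc, h₁, mul_smul_comm, smul_smul, ← zpow_add₀ hv,
      mul_assoc]
    simp
  simp only [add_mul, mul_add, smul_mul_assoc, mul_smul_comm, h, h₃]

/-- The identity behind the partial trace of the Casimir element of `M ⊗ V`. -/
theorem partialTrace_casimir_identity (hv : v ≠ 0) (x a b : B) :
    ((v - v⁻¹) ^ 2 * v⁻¹) • x + v ^ 2 • a + (v⁻¹) ^ 2 • b +
      v ^ (2 : ℤ) • ((v - v⁻¹) ^ 2 • (a + v • x) + a + b) =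
    (v ^ (3 : ℤ) + v ^ (-1 : ℤ)) • ((v - v⁻¹) ^ 2 • x + v • a + v⁻¹ • b) := by
  simp only [zpow_ofNat, zpow_neg_one]
  match_scalars <;> field_simp <;> ring

end generic

/-- The quantum Casimir element `(v - v⁻¹)² F E + v K + v⁻¹ K⁻¹`. -/
def casimir : Uv := (v - v⁻¹) ^ 2 • (F * E) + v • K + v⁻¹ • Kinv

/-- The Casimir element is central. -/
theorem casimir_commute (u : Uv) : casimir * u = u * casimir := by
  induction u using Uv.induction with
  | hc c => exact (Algebra.commutes c casimir).symm
  | hE => exact casimir_mul_e v_ne_zero v_sub_ne_zero K_mul_E Kinv_mul_E E_F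
  | hF => exact casimir_mul_f v_ne_zero v_sub_ne_zero K_mul_F Kinv_mul_F E_F
  | hK => exact casimir_mul_a v_ne_zero K_mul_E K_mul_F K_commute_Kinv
  | hKinv =>
    have h : casimir * K = K * casimir :=
      casimir_mul_a v_ne_zero K_mul_E K_mul_F K_commute_Kinv
    calc casimir * Kinv = Kinv * (K * casimir) * Kinv := by
          rw [← mul_assoc Kinv K, Kinv_mul_K, one_mul]
      _ = _ := by rw [← h, mul_assoc, mul_assoc, K_mul_Kinv, mul_one]
  | hadd a b ha hb => rw [mul_add, add_mul, ha, hb]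
  | hmul a b ha hb => rw [← mul_assoc, ha, mul_assoc, hb, mul_assoc]

theorem casimir_mem : casimir ∈ UA := by
  have h1 : E ∈ UA := by
    have := divPow_E_mem 1
    rwa [divPow, pow_one, show qFact 1 = 1 by simp [qFact, qInt, v_sub_ne_zero], inv_one,
      one_smul] at this
  have h2 : F ∈ UA := by
    have := divPow_F_mem 1
    rwa [divPow, pow_one, show qFact 1 = 1 by simp [qFact, qInt, v_sub_ne_zero], inv_one,
      one_smul] at this
  have h3 := mul_mem h2 h1
  have e : casimir = v ^ (2 : ℤ) • (F * E) + v ^ (-2 : ℤ) • (F * E) - (F * E) - (F * E) +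
      v ^ (1 : ℤ) • K + v ^ (-1 : ℤ) • Kinv := by
    have : (v - v⁻¹) ^ 2 = v ^ (2 : ℤ) + v ^ (-2 : ℤ) - 1 - 1 := by
      have := v_ne_zero
      simp [zpow_ofNat]
      field_simp
      ring
    rw [casimir, this, sub_smul, sub_smul, add_smul, one_smul, zpow_one, zpow_neg_one]
  rw [e]
  exact add_mem (add_mem (sub_mem (sub_mem (add_mem (zpow_smul_mem h3 _) (zpow_smul_mem h3 _)) h3)
    h3) (zpow_smul_mem K_mem _)) (zpow_smul_mem Kinv_mem _)

/-- The Casimir element in the integral form. -/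
def casA : UA := ⟨casimir, casimir_mem⟩

theorem delta_casimir : delta casimir =
    !![((v - v⁻¹) ^ 2 * v⁻¹) • (F * E) + v ^ 2 • K + (v⁻¹) ^ 2 • Kinv,
        ((v - v⁻¹) ^ 2 * v⁻¹) • (F * K);
      (v - v⁻¹) ^ 2 • E, (v - v⁻¹) ^ 2 • (K + v • (F * E)) + K + Kinv] := by
  have h := v_ne_zero
  rw [casimir, map_add, map_add, map_smul, map_smul, map_smul, map_mul, delta_E, delta_F, delta_K,
    delta_Kinv, Matrix.mul_fin_two]
  ext i j
  fin_cases i <;> fin_cases j <;> simp [smul_smul, pow_two, h, add_assoc]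

namespace LatticeRep

open Matrix

theorem toHom_casimir_mulVec (V : LatticeRep) (x : V.ι → Qv) (i : V.ι) :
    (V.toHom casimir *ᵥ x) i = (v - v⁻¹) ^ 2 * (V.toHom F *ᵥ (V.toHom E *ᵥ x)) i +
      (v * v ^ V.wt i + v⁻¹ * v ^ (-V.wt i)) * x i := by
  rw [casimir, map_add, map_add, map_smul, map_smul, map_smul, map_mul, map_K, map_Kinv,
    add_mulVec, add_mulVec, smul_mulVec, smul_mulVec, smul_mulVec, ← mulVec_mulVec]
  simp only [Pi.add_apply, Pi.smul_apply, mulVec_diagonal, smul_eq_mul]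
  ring

theorem casimir_mul_qInt (a b : ℤ) : (v - v⁻¹) ^ 2 * (qInt a * qInt b) =
    v ^ (a + b) + v ^ (-(a + b)) - v ^ (a - b) - v ^ (b - a) := by
  have h := v_sub_ne_zero
  have h' : (v - v⁻¹) ^ 2 * (qInt a * qInt b) = (v ^ a - v ^ (-a)) * (v ^ b - v ^ (-b)) := by
    rw [qInt, qInt, div_mul_div_comm, pow_two, mul_div_cancel₀ _ (mul_ne_zero h h)]
  rw [h', mul_sub, sub_mul, sub_mul, ← zpow_add₀ v_ne_zero, ← zpow_add₀ v_ne_zero,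
    ← zpow_add₀ v_ne_zero, ← zpow_add₀ v_ne_zero]
  ring_nf

theorem v_mul_zpow (n : ℤ) : v * v ^ n = v ^ (n + 1) := by
  rw [zpow_add_one₀ v_ne_zero, mul_comm]

theorem v_inv_mul_zpow (n : ℤ) : v⁻¹ * v ^ n = v ^ (n - 1) := by
  rw [zpow_sub_one₀ v_ne_zero, mul_comm]

/-- The Casimir element acts on `W(m)` by `v^{m+1} + v^{-m-1}`. -/
theorem weyl_casimir (m : ℕ) (x : Fin (m + 1) → Qv) (i : Fin (m + 1)) :
    ((weyl m).toHom casimir *ᵥ x) i = (v ^ (m + 1 : ℤ) + v ^ (-(m + 1 : ℤ))) * x i := by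
  refine ((weyl m).toHom_casimir_mulVec x i).trans ?_
  rw [weyl_toHom_E, weyl_toHom_F]
  have h1 : (weylF m *ᵥ (weylE m *ᵥ x)) i = qInt i * qInt ((m : ℤ) - i + 1) * x i := by
    rw [weylF_mulVec]
    split_ifs with h
    · rw [weylE_mulVec, dif_pos (by simp only; omega), mul_assoc]
      have e : (⟨(i : ℕ) - 1 + 1, by omega⟩ : Fin (m + 1)) = i := Fin.ext (by simp only; omega)
      have e2 : (m : ℤ) - ((i : ℕ) - 1 : ℕ) = m - i + 1 := by omega
      simp only [e, e2]
    · rw [show (i : ℕ) = 0 by omega]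
      simp [qInt]
  refine (congrArg₂ (fun a b : Qv => (v - v⁻¹) ^ 2 * a + b) h1 rfl).trans ?_
  change _ + (v * v ^ ((m : ℤ) - 2 * (i : ℕ)) + v⁻¹ * v ^ (-((m : ℤ) - 2 * (i : ℕ)))) * x i = _
  rw [← mul_assoc, casimir_mul_qInt, v_mul_zpow, v_inv_mul_zpow]
  ring_nf

/-- The Casimir element acts on `W(m)*` by `v^{m+1} + v^{-m-1}`. -/
theorem dual_casimir (m : ℕ) (x : Fin (m + 1) → Qv) (i : Fin (m + 1)) :
    ((weyl m).dual.toHom casimir *ᵥ x) i = (v ^ (m + 1 : ℤ) + v ^ (-(m + 1 : ℤ))) * x i := by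
  refine ((weyl m).dual.toHom_casimir_mulVec x i).trans ?_
  rw [dual_weyl_toHom_E, dual_weyl_toHom_F]
  have h1 : (dualF m *ᵥ (dualE m *ᵥ x)) i = qInt (i + 1) * qInt ((m : ℤ) - i) * x i := by
    rw [dualF_mulVec]
    split_ifs with h
    · rw [dualE_mulVec, dif_pos (by simp)]
      have e : (⟨(i : ℕ) + 1 - 1, by omega⟩ : Fin (m + 1)) = i := Fin.ext (by simp)
      simp only [e]
      have e3 : v ^ ((m : ℤ) - 2 * i) * v ^ (2 * (((i + 1 : ℕ) : ℤ) - 1) - m) = 1 := by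
        rw [← zpow_add₀ v_ne_zero]
        push_cast
        ring_nf
        simp
      have e4 : (m : ℤ) - ((i + 1 : ℕ) : ℤ) + 1 = m - i := by push_cast; ring
      rw [e4]
      linear_combination qInt (i + 1) * qInt ((m : ℤ) - i) * x i * e3
    · rw [show (i : ℕ) = m by omega]
      simp [qInt]
  refine (congrArg₂ (fun a b : Qv => (v - v⁻¹) ^ 2 * a + b) h1 rfl).trans ?_
  change _ + (v * v ^ (-((m : ℤ) - 2 * (i : ℕ))) + v⁻¹ * v ^ (- -((m : ℤ) - 2 * (i : ℕ)))) * x i = _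
  rw [← mul_assoc, casimir_mul_qInt, v_mul_zpow, v_inv_mul_zpow]
  ring_nf

end LatticeRep

section

variable (𝕜 : Type*) [Field 𝕜] [Algebra ℤ[T;T⁻¹] 𝕜]

/-- The Casimir element of `U_q(sl₂)`. -/
def cas : Uq 𝕜 := toUqHom 𝕜 casA

variable {𝕜} in
theorem cas_commute (u : Uq 𝕜) : Commute (cas 𝕜) u := by
  induction u using Uq.induction with
  | h0 => exact Commute.zero_right _
  | h c u =>
    have : casA * u = u * casA := Subtype.ext (casimir_commute u)
    refine Commute.smul_right ?_ c
    rw [cas, commute_iff_eq, ← map_mul, this, map_mul]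
  | hadd a b ha hb => exact ha.add_right hb

/-- The value `qⁿ + q⁻ⁿ`, by which the Casimir element acts on `W(n - 1)`. -/
def casVal (n : ℤ) : 𝕜 := qq 𝕜 ^ n + qq 𝕜 ^ (-n)

variable {𝕜}

theorem casVal_neg (n : ℤ) : casVal 𝕜 (-n) = casVal 𝕜 n := by
  rw [casVal, casVal, neg_neg, add_comm]

theorem LatticeRep.cas_smul {V : LatticeRep} {n : ℤ}
    (h : ∀ (x : V.ι → Qv) i, (V.toHom casimir).mulVec x i = (v ^ n + v ^ (-n)) * x i) (x : V.Mod 𝕜) :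
    cas 𝕜 • x = casVal 𝕜 n • x := by
  have h1 : V.intHom casA = Matrix.diagonal fun _ =>
      (LaurentPolynomial.T n + LaurentPolynomial.T (-n) : ℤ[T;T⁻¹]) := by
    refine Matrix.ext fun i j => ?_
    apply IsFractionRing.injective ℤ[T;T⁻¹] Qv
    refine (V.algebraMap_intHom _ _ _).trans ?_
    have := h (Pi.single j 1) i
    rw [Matrix.mulVec_single_one, Matrix.col_apply] at this
    refine this.trans ?_
    rcases eq_or_ne i j with rfl | hij
    · rw [Pi.single_eq_same, mul_one, Matrix.diagonal_apply_eq, map_add, v_zpow, v_zpow]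
    · simp [hij, Matrix.diagonal_apply_ne]
  refine (V.toUqHom_smul casA x).trans ?_
  rw [h1]
  refine funext fun i => ?_
  rw [Matrix.diagonal_map (map_zero _)]
  refine (Matrix.mulVec_diagonal _ (LatticeRep.coord x) i).trans ?_
  rw [map_add, algebraMap_T_eq, algebraMap_T_eq]
  rfl

theorem cas_smul_weyl (m : ℕ) (x : WMod 𝕜 m) : cas 𝕜 • x = casVal 𝕜 (m + 1) • x :=
  LatticeRep.cas_smul (LatticeRep.weyl_casimir m) x

theorem cas_smul_dual (m : ℕ) (x : DMod 𝕜 m) : cas 𝕜 • x = casVal 𝕜 (m + 1) • x :=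
  LatticeRep.cas_smul (LatticeRep.dual_casimir m) x

open Polynomial in
/-- A polynomial in the Casimir element. -/
def casPoly (p : 𝕜[X]) : Uq 𝕜 := aeval (cas 𝕜) p

open Polynomial in
/-- The polynomial `3u² - 2u³` in `u = (X - c₂) / (c₁ - c₂)`; on modules annihilated by
`((C - c₁)(C - c₂))²`, where `C` is the Casimir element, its value at `C` is the projection onto the
generalized eigenspace for `c₁` along that for `c₂`. -/
def eigProj (c₁ c₂ : 𝕜) : 𝕜[X] :=
  3 * (C (c₁ - c₂)⁻¹ * (X - C c₂)) ^ 2 - 2 * (C (c₁ - c₂)⁻¹ * (X - C c₂)) ^ 3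

section polynomials

open Polynomial

theorem casPoly_commute (p : 𝕜[X]) (u : Uq 𝕜) : Commute (casPoly p) u := by
  induction p using Polynomial.induction_on' with
  | add p q hp hq => rw [casPoly, map_add]; exact hp.add_left hq
  | monomial n a =>
    rw [casPoly, aeval_monomial]
    exact (Algebra.commute_algebraMap_left a u).mul_left ((cas_commute u).pow_left n)

variable {c₁ c₂ : 𝕜}

theorem C_inv_mul_sub (h : c₁ ≠ c₂) : C (c₁ - c₂)⁻¹ * (C c₁ - C c₂) = (1 : 𝕜[X]) := by
  rw [← C_sub, ← C_mul, inv_mul_cancel₀ (sub_ne_zero.2 h), C_1]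

theorem eigProj_add_eigProj (h : c₁ ≠ c₂) : eigProj c₁ c₂ + eigProj c₂ c₁ = 1 := by
  have h1 := C_inv_mul_sub h
  have h2 : C (c₂ - c₁)⁻¹ = -C (c₁ - c₂)⁻¹ := by rw [← neg_sub, inv_neg, C_neg]
  have h3 : C (c₂ - c₁)⁻¹ * (X - C c₁) = 1 - C (c₁ - c₂)⁻¹ * (X - C c₂) := by
    rw [h2]; linear_combination h1
  rw [eigProj, eigProj, h3]
  ring

theorem eval_eigProj_left (h : c₁ ≠ c₂) : (eigProj c₁ c₂).eval c₁ = 1 := by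
  have : (c₁ - c₂)⁻¹ * (c₁ - c₂) = 1 := inv_mul_cancel₀ (sub_ne_zero.2 h)
  simp [eigProj, this]
  norm_num

theorem eval_eigProj_right (c₁ c₂ : 𝕜) : (eigProj c₁ c₂).eval c₂ = 0 := by
  simp [eigProj]

theorem eigProj_eq (h : c₁ ≠ c₂) : eigProj c₁ c₂ = C (c₁ - c₂)⁻¹ * (X - C c₂) +
    (1 - 2 * (C (c₁ - c₂)⁻¹ * (X - C c₂))) * (C (c₁ - c₂)⁻¹) ^ 2 * ((X - C c₁) * (X - C c₂)) := by
  have h1 := C_inv_mul_sub h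
  have h2 : C (c₁ - c₂)⁻¹ * (X - C c₁) = C (c₁ - c₂)⁻¹ * (X - C c₂) - 1 := by
    linear_combination -h1
  have h3 : (1 - 2 * (C (c₁ - c₂)⁻¹ * (X - C c₂))) * (C (c₁ - c₂)⁻¹) ^ 2 * ((X - C c₁) * (X - C c₂)) =
      (1 - 2 * (C (c₁ - c₂)⁻¹ * (X - C c₂))) * ((C (c₁ - c₂)⁻¹ * (X - C c₁)) *
        (C (c₁ - c₂)⁻¹ * (X - C c₂))) := by ring
  rw [h3, h2, eigProj]
  ring

/-- `eigProj` is idempotent modulo `((X - c₁)(X - c₂))²`. -/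
theorem eigProj_mul_self (h : c₁ ≠ c₂) : eigProj c₁ c₂ * eigProj c₁ c₂ = eigProj c₁ c₂ +
    (4 * (C (c₁ - c₂)⁻¹ * (X - C c₂)) ^ 2 - 4 * (C (c₁ - c₂)⁻¹ * (X - C c₂)) - 3) *
      (C (c₁ - c₂)⁻¹) ^ 4 * ((X - C c₁) * (X - C c₂)) ^ 2 := by
  have h1 := C_inv_mul_sub h
  have h2 : C (c₁ - c₂)⁻¹ * (X - C c₁) = C (c₁ - c₂)⁻¹ * (X - C c₂) - 1 := by
    linear_combination -h1
  have h3 (w : 𝕜[X]) : w * (C (c₁ - c₂)⁻¹) ^ 4 * ((X - C c₁) * (X - C c₂)) ^ 2 =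
      w * ((C (c₁ - c₂)⁻¹ * (X - C c₁)) * (C (c₁ - c₂)⁻¹ * (X - C c₂))) ^ 2 := by ring
  rw [h3, h2, eigProj]
  ring

variable {M N : Type*} [AddCommGroup M] [Module 𝕜 M] [Module (Uq 𝕜) M] [IsScalarTower 𝕜 (Uq 𝕜) M]
  [AddCommGroup N] [Module (Uq 𝕜) N]

theorem casPoly_mul_smul (p r : 𝕜[X]) (x : M) : casPoly (p * r) • x = casPoly p • casPoly r • x := by
  rw [casPoly, map_mul, mul_smul]; rfl

theorem casPoly_add_smul (p r : 𝕜[X]) (x : M) :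
    casPoly (p + r) • x = casPoly p • x + casPoly r • x := by
  rw [casPoly, map_add, add_smul]; rfl

theorem casPoly_one_smul (x : M) : casPoly (1 : 𝕜[X]) • x = x := by
  rw [casPoly, map_one, one_smul]

theorem casPoly_C_smul (c : 𝕜) (x : M) : casPoly (C c) • x = c • x := by
  rw [casPoly, aeval_C, algebraMap_smul]

theorem casPoly_X_sub_C_smul (c : 𝕜) (x : M) : casPoly (X - C c) • x = cas 𝕜 • x - c • x := by
  rw [casPoly, map_sub, aeval_X, aeval_C, sub_smul, algebraMap_smul]

theorem casPoly_smul_of_eq {c : 𝕜} {x : M} (hx : cas 𝕜 • x = c • x) (p : 𝕜[X]) :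
    casPoly p • x = p.eval c • x := by
  induction p using Polynomial.induction_on' with
  | add p q hp hq => rw [casPoly_add_smul, hp, hq, eval_add, add_smul]
  | monomial n a =>
    rw [casPoly, aeval_monomial, eval_monomial, mul_smul, mul_smul, algebraMap_smul]
    congr 1
    induction n with
    | zero => simp
    | succ n ih => rw [pow_succ, mul_smul, hx, smul_algebra_smul_comm, ih, smul_smul, pow_succ, mul_comm]

variable (M) in
/-- A polynomial in the Casimir element as an endomorphism of a module. -/
def casHom (p : 𝕜[X]) : M →ₗ[Uq 𝕜] M where
  toFun x := casPoly p • x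
  map_add' := smul_add _
  map_smul' u x := by
    rw [RingHom.id_apply, ← mul_smul, ← mul_smul, (casPoly_commute p u).eq]

theorem casHom_apply (p : 𝕜[X]) (x : M) : casHom M p x = casPoly p • x := rfl

end polynomials

/-! ### Coevaluation and evaluation for the two-dimensional module -/

/-- The action on the two-fold tensor product with `V`, in coordinates. -/
def delta₂ (u : Uv) (b a b' a' : Fin 2) : Uv := delta (delta u b b') a a'

theorem delta₂_mul (u w : Uv) (b a b' a' : Fin 2) : delta₂ (u * w) b a b' a' =
    delta₂ u b a 0 0 * delta₂ w 0 0 b' a' + delta₂ u b a 0 1 * delta₂ w 0 1 b' a' +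
    (delta₂ u b a 1 0 * delta₂ w 1 0 b' a' + delta₂ u b a 1 1 * delta₂ w 1 1 b' a') := by
  simp [delta₂, Matrix.mul_apply, Fin.sum_univ_two]

/-- The vector `v₁ ⊗ v₋₁ - v v₋₁ ⊗ v₁` of `V ⊗ V`; the first index stands for the second factor. -/
def cupVec (b a : Fin 2) : Qv := if b = a then 0 else if b = 0 then -v else 1

/-- The coevaluation vector is invariant under `U_v(sl₂)`. -/
theorem delta₂_cup (u : Uv) (b a : Fin 2) :
    delta₂ u b a 1 0 - v • delta₂ u b a 0 1 = cupVec b a • u := by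
  have hv := v_ne_zero
  induction u using Uv.induction generalizing b a with
  | hc c => fin_cases b <;> fin_cases a <;>
      simp [delta₂, cupVec, Matrix.algebraMap_matrix_apply]
  | hE => fin_cases b <;> fin_cases a <;> simp [delta₂, cupVec, delta_E, delta_K, smul_smul, hv]
  | hF => fin_cases b <;> fin_cases a <;> simp [delta₂, cupVec, delta_F, smul_smul, hv]
  | hK => fin_cases b <;> fin_cases a <;> simp [delta₂, cupVec, delta_K, smul_smul, hv]
  | hKinv => fin_cases b <;> fin_cases a <;> simp [delta₂, cupVec, delta_Kinv, smul_smul, hv]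
  | hadd x y hx hy =>
    have e (b' a' : Fin 2) : delta₂ (x + y) b a b' a' = delta₂ x b a b' a' + delta₂ y b a b' a' := by
      simp [delta₂]
    rw [e, e, smul_add, smul_add, ← hx, ← hy]
    abel
  | hmul x y hx hy =>
    have h00 := hy 0 0
    have h01 := hy 0 1
    have h10 := hy 1 0
    have h11 := hy 1 1
    simp only [cupVec, if_true, zero_smul, one_smul, one_ne_zero, zero_ne_one, if_false] at h00 h01 h10 h11
    rw [delta₂_mul, delta₂_mul, ← smul_mul_assoc, ← hx]
    have : ∀ p q r s : Uv, p - v • q = r → p = r + v • q := fun p q r s h => by rw [← h]; abel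
    rw [this _ _ _ 0 h00, this _ _ _ 0 h01, this _ _ _ 0 h10, this _ _ _ 0 h11]
    simp only [zero_add, mul_add, smul_add, mul_smul_comm, sub_mul, neg_smul, mul_neg, smul_mul_assoc]
    abel

/-- The evaluation form is invariant under `U_v(sl₂)`. -/
theorem delta₂_cap (u : Uv) (b' a' : Fin 2) :
    delta₂ u 1 0 b' a' - v • delta₂ u 0 1 b' a' = cupVec b' a' • u := by
  have hv := v_ne_zero
  induction u using Uv.induction generalizing b' a' with
  | hc c => fin_cases b' <;> fin_cases a' <;>
      simp [delta₂, cupVec, Matrix.algebraMap_matrix_apply]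
  | hE => fin_cases b' <;> fin_cases a' <;> simp [delta₂, cupVec, delta_E, delta_K, smul_smul, hv]
  | hF => fin_cases b' <;> fin_cases a' <;> simp [delta₂, cupVec, delta_F, smul_smul, hv]
  | hK => fin_cases b' <;> fin_cases a' <;> simp [delta₂, cupVec, delta_K, smul_smul, hv]
  | hKinv => fin_cases b' <;> fin_cases a' <;> simp [delta₂, cupVec, delta_Kinv, smul_smul, hv]
  | hadd x y hx hy =>
    have e (b a : Fin 2) : delta₂ (x + y) b a b' a' = delta₂ x b a b' a' + delta₂ y b a b' a' := by
      simp [delta₂]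
    rw [e, e, smul_add, smul_add, ← hx, ← hy]
    abel
  | hmul x y hx hy =>
    have h00 := hx 0 0
    have h01 := hx 0 1
    have h10 := hx 1 0
    have h11 := hx 1 1
    simp only [cupVec, if_true, zero_smul, one_smul, one_ne_zero, zero_ne_one, if_false] at h00 h01 h10 h11
    rw [delta₂_mul, delta₂_mul, ← mul_smul_comm, ← hy]
    have : ∀ p q r s : Uv, p - v • q = r → p = r + v • q := fun p q r s h => by rw [← h]; abel
    rw [this _ _ _ 0 h00, this _ _ _ 0 h01, this _ _ _ 0 h10, this _ _ _ 0 h11]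
    simp only [zero_add, add_mul, smul_add, mul_smul_comm, mul_sub, neg_smul, neg_mul, smul_mul_assoc]
    abel

/-- `delta₂` on the integral form. -/
def delta₂A (u : UA) (b a b' a' : Fin 2) : UA := deltaA (deltaA u b b') a a'

/-- `cupVec` with values in the integral form. -/
def cupVecA (b a : Fin 2) : ℤ[T;T⁻¹] :=
  if b = a then 0 else if b = 0 then -LaurentPolynomial.T 1 else 1

theorem algebraMap_cupVecA (b a : Fin 2) : algebraMap ℤ[T;T⁻¹] Qv (cupVecA b a) = cupVec b a := by
  rw [cupVecA, cupVec]
  split_ifs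
  · simp
  · rw [map_neg]; rfl
  · simp

theorem coe_T_smul (u : UA) (c : ℤ[T;T⁻¹]) : ((c • u : UA) : Uv) = algebraMap ℤ[T;T⁻¹] Qv c • (u : Uv) := by
  rw [algebraMap_smul]; rfl

theorem delta₂A_cup (u : UA) (b a : Fin 2) :
    delta₂A u b a 1 0 - (LaurentPolynomial.T 1 : ℤ[T;T⁻¹]) • delta₂A u b a 0 1 = cupVecA b a • u := by
  apply Subtype.ext
  rw [coe_T_smul, algebraMap_cupVecA]
  refine Eq.trans ?_ (delta₂_cup u b a)
  refine congrArg₂ (fun x y : Uv => x - y) rfl ?_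
  rw [coe_T_smul]; rfl

theorem delta₂A_cap (u : UA) (b a : Fin 2) :
    delta₂A u 1 0 b a - (LaurentPolynomial.T 1 : ℤ[T;T⁻¹]) • delta₂A u 0 1 b a = cupVecA b a • u := by
  apply Subtype.ext
  rw [coe_T_smul, algebraMap_cupVecA]
  refine Eq.trans ?_ (delta₂_cap u b a)
  refine congrArg₂ (fun x y : Uv => x - y) rfl ?_
  rw [coe_T_smul]; rfl

section modules

variable {M : Type*} [AddCommGroup M] [Module 𝕜 M] [Module (Uq 𝕜) M] [IsScalarTower 𝕜 (Uq 𝕜) M]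

theorem toUqHom_T_smul (c : ℤ[T;T⁻¹]) (u : UA) (x : M) :
    toUqHom 𝕜 (c • u) • x = algebraMap ℤ[T;T⁻¹] 𝕜 c • toUqHom 𝕜 u • x := by
  rw [map_smul, ← algebraMap_smul 𝕜 c (toUqHom 𝕜 u), smul_assoc]

theorem TV.TV_smul_apply (u : UA) (y : TV (TV M)) (b a : Fin 2) : (toUqHom 𝕜 u • y) b a =
    toUqHom 𝕜 (delta₂A u b a 0 0) • y 0 0 + toUqHom 𝕜 (delta₂A u b a 0 1) • y 0 1 +
    (toUqHom 𝕜 (delta₂A u b a 1 0) • y 1 0 + toUqHom 𝕜 (delta₂A u b a 1 1) • y 1 1) := by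
  rw [TV.toUqHom_smul_apply u y b, TV.add_apply, TV.toUqHom_smul_apply, TV.toUqHom_smul_apply]
  rfl

variable (𝕜) in
/-- The vector of `M ⊗ V ⊗ V` attached to a vector of `M` by coevaluation. -/
def cupFun (x : M) : TV (TV M) := ![![0, -(qq 𝕜) • x], ![x, 0]]

variable (𝕜 M) in
/-- The coevaluation `M → M ⊗ V ⊗ V`. -/
def cup : M →ₗ[Uq 𝕜] TV (TV M) :=
  mkHom
    { toFun := cupFun 𝕜
      map_add' := fun x y => by
        refine TV.ext (TV.ext ?_ ?_) (TV.ext ?_ ?_)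
        · exact (add_zero (0 : M)).symm
        · exact smul_add _ _ _
        · rfl
        · exact (add_zero (0 : M)).symm
      map_smul' := fun c x => by
        refine TV.ext (TV.ext ?_ ?_) (TV.ext ?_ ?_)
        · exact (smul_zero (A := M) c).symm
        · exact smul_comm _ _ _
        · rfl
        · exact (smul_zero (A := M) c).symm }
    fun u x => by
      have key (b a : Fin 2) : (toUqHom 𝕜 u • cupFun 𝕜 x) b a =
          algebraMap ℤ[T;T⁻¹] 𝕜 (cupVecA b a) • toUqHom 𝕜 u • x := by
        rw [TV.TV_smul_apply, ← toUqHom_T_smul, ← delta₂A_cup]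
        change _ • (0 : M) + toUqHom 𝕜 (delta₂A u b a 0 1) • (-(qq 𝕜) • x) +
          (toUqHom 𝕜 (delta₂A u b a 1 0) • x + _ • (0 : M)) = _
        rw [smul_zero, smul_zero, map_sub, sub_smul, toUqHom_T_smul, smul_algebra_smul_comm,
          neg_smul, zero_add, add_zero]
        abel
      refine TV.ext (TV.ext ?_ ?_) (TV.ext ?_ ?_)
      · exact ((key 0 0).trans (by simp [cupVecA]; rfl)).symm
      · exact ((key 0 1).trans (by simp [cupVecA]; exact (neg_smul _ _).symm)).symm
      · exact ((key 1 0).trans (by simp [cupVecA]; rfl)).symm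
      · exact ((key 1 1).trans (by simp [cupVecA]; rfl)).symm

variable (𝕜 M) in
/-- The evaluation `M ⊗ V ⊗ V → M`. -/
def cap : TV (TV M) →ₗ[Uq 𝕜] M :=
  mkHom
    { toFun := fun y => y 1 0 - qq 𝕜 • y 0 1
      map_add' := fun x y => by
        simp only [TV.add_apply, smul_add]
        abel
      map_smul' := fun c x => by
        simp only [TV.smul_apply', smul_sub, RingHom.id_apply]
        rw [smul_comm] }
    fun u y => by
      have h (b a : Fin 2) : toUqHom 𝕜 (delta₂A u 1 0 b a) • y b a -
          qq 𝕜 • toUqHom 𝕜 (delta₂A u 0 1 b a) • y b a =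
          algebraMap ℤ[T;T⁻¹] 𝕜 (cupVecA b a) • toUqHom 𝕜 u • y b a := by
        rw [← toUqHom_T_smul, ← toUqHom_T_smul, ← sub_smul, ← map_sub, delta₂A_cap]
      change (toUqHom 𝕜 u • y) 1 0 - qq 𝕜 • (toUqHom 𝕜 u • y) 0 1 =
        toUqHom 𝕜 u • (y 1 0 - qq 𝕜 • y 0 1)
      rw [TV.TV_smul_apply, TV.TV_smul_apply]
      have h00 := h 0 0
      have h01 := h 0 1
      have h10 := h 1 0
      have h11 := h 1 1
      simp only [cupVecA, if_true, map_zero, zero_smul, map_one, one_smul, one_ne_zero, zero_ne_one,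
        if_false, map_neg, neg_smul] at h00 h01 h10 h11
      rw [smul_sub, smul_algebra_smul_comm, ← h10, sub_eq_add_neg _ (qq 𝕜 • toUqHom 𝕜 u • _), ← h01]
      rw [sub_eq_zero] at h00 h11
      rw [h00, h11]
      simp only [smul_add]
      abel

theorem cap_apply (y : TV (TV M)) : cap 𝕜 M y = y 1 0 - qq 𝕜 • y 0 1 := rfl

theorem cap_cup (x : M) : cap 𝕜 M (cup 𝕜 M x) = (1 + qq 𝕜 ^ 2) • x := by
  change x - qq 𝕜 • (-(qq 𝕜) • x) = _
  module

theorem cap_map_map {N : Type*} [AddCommGroup N] [Module 𝕜 N] [Module (Uq 𝕜) N]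
    [IsScalarTower 𝕜 (Uq 𝕜) N] (f : M →ₗ[Uq 𝕜] N) (y : TV (TV M)) :
    cap 𝕜 N (TV.map (TV.map f) y) = f (cap 𝕜 M y) := by
  rw [cap_apply, cap_apply, map_sub, mkHom_restrictScalars]; rfl

theorem cup_map {N : Type*} [AddCommGroup N] [Module 𝕜 N] [Module (Uq 𝕜) N]
    [IsScalarTower 𝕜 (Uq 𝕜) N] (f : M →ₗ[Uq 𝕜] N) (x : M) :
    cup 𝕜 N (f x) = TV.map (TV.map f) (cup 𝕜 M x) := by
  refine TV.ext (TV.ext ?_ ?_) (TV.ext ?_ ?_)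
  · exact (map_zero f).symm
  · exact (mkHom_restrictScalars f _ _).symm
  · rfl
  · exact (map_zero f).symm

/-- The vector of `M ⊗ V` with given components. -/
def TV.mk (x y : M) : TV M := ![x, y]

/-- The partial trace of the Casimir element of `M ⊗ V` is a multiple of that of `M`. -/
theorem cap_cas_cup (x : M) : cap 𝕜 M (TV.map (casHom (TV M) (Polynomial.X : Polynomial 𝕜)) (cup 𝕜 M x)) =
    (qq 𝕜 * casVal 𝕜 2) • cas 𝕜 • x := by
  have h1 : (cas 𝕜 • TV.mk x 0) 0 = toUqHom 𝕜 (deltaA casA 0 0) • x := by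
    refine (TV.toUqHom_smul_apply casA _ 0).trans ?_
    change _ + _ • (0 : M) = _
    rw [smul_zero, add_zero]; rfl
  have h2 : (cas 𝕜 • TV.mk 0 (-(qq 𝕜) • x)) 1 = -(qq 𝕜) • toUqHom 𝕜 (deltaA casA 1 1) • x := by
    refine (TV.toUqHom_smul_apply casA _ 1).trans ?_
    change _ • (0 : M) + toUqHom 𝕜 (deltaA casA 1 1) • (-(qq 𝕜) • x) = _
    rw [smul_zero, zero_add, smul_algebra_smul_comm]
  have hX (y : TV M) : casHom (TV M) (Polynomial.X : Polynomial 𝕜) y = cas 𝕜 • y := by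
    rw [casHom_apply, casPoly, Polynomial.aeval_X]
  have h6 : cap 𝕜 M (TV.map (casHom (TV M) (Polynomial.X : Polynomial 𝕜)) (cup 𝕜 M x)) =
      casHom (TV M) (Polynomial.X : Polynomial 𝕜) (TV.mk x 0) 0 -
        qq 𝕜 • casHom (TV M) (Polynomial.X : Polynomial 𝕜) (TV.mk 0 (-(qq 𝕜) • x)) 1 := rfl
  rw [h6, hX, hX, h1, h2]
  have h3 : deltaA casA 0 0 + (LaurentPolynomial.T 2 : ℤ[T;T⁻¹]) • deltaA casA 1 1 =
      (LaurentPolynomial.T 3 + LaurentPolynomial.T (-1) : ℤ[T;T⁻¹]) • casA := by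
    apply Subtype.ext
    refine (congrArg₂ (fun a b : Uv => a + b) (coe_deltaA casA 0 0) (coe_T_smul _ _)).trans ?_
    rw [coe_T_smul, coe_deltaA, map_add, ← v_zpow, ← v_zpow, ← v_zpow]
    change delta casimir 0 0 + v ^ (2 : ℤ) • delta casimir 1 1 = _ • casimir
    rw [delta_casimir, casimir]
    have h := v_ne_zero
    exact (partialTrace_casimir_identity h _ _ _)
  have h4 := congrArg (fun u => toUqHom 𝕜 u • x) h3
  rw [map_add, add_smul, toUqHom_T_smul, toUqHom_T_smul, map_add, algebraMap_T_eq 2,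
    algebraMap_T_eq 3, algebraMap_T_eq (-1)] at h4
  change _ = (qq 𝕜 * casVal 𝕜 2) • toUqHom 𝕜 casA • x
  have h5 : qq 𝕜 * casVal 𝕜 2 = qq 𝕜 ^ (3 : ℤ) + qq 𝕜 ^ (-1 : ℤ) := by
    have := qq_ne_zero (𝕜 := 𝕜)
    rw [casVal, mul_add, mul_comm, ← zpow_add_one₀ this, mul_comm, ← zpow_add_one₀ this]
    norm_num
  rw [h5, ← h4]
  rw [zpow_ofNat, neg_smul, smul_neg, sub_neg_eq_add, smul_smul, ← pow_two]

end modules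

end

section

variable {𝕜 : Type*} [Field 𝕜] [Algebra ℤ[T;T⁻¹] 𝕜]

/-! ### Quantum numbers at a root of unity -/

theorem casVal_mul (m n : ℤ) : casVal 𝕜 m * casVal 𝕜 n = casVal 𝕜 (m + n) + casVal 𝕜 (m - n) := by
  have h := qq_ne_zero (𝕜 := 𝕜)
  simp only [casVal, mul_add, add_mul, ← zpow_add₀ h]
  ring_nf

theorem casVal_zero : casVal 𝕜 0 = 2 := by simp [casVal]; norm_num

theorem casVal_sub (n : ℤ) : casVal 𝕜 (n + 1) - casVal 𝕜 (n - 1) =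
    (qq 𝕜 - (qq 𝕜)⁻¹) * (qq 𝕜 ^ n - qq 𝕜 ^ (-n)) := by
  have h := qq_ne_zero (𝕜 := 𝕜)
  rw [casVal, casVal, show -(n + 1) = -n - 1 by ring, show -(n - 1) = -n + 1 by ring,
    zpow_add_one₀ h, zpow_add_one₀ h, zpow_sub_one₀ h, zpow_sub_one₀ h]
  ring

section root

variable {l : ℕ}

theorem zpow_two_mul_eq_one (hq : IsPrimitiveRoot (qq 𝕜) (2 * l)) (a : ℤ) : qq 𝕜 ^ (2 * l * a) = 1 := by
  rw [zpow_mul, show (2 * l : ℤ) = ((2 * l : ℕ) : ℤ) by push_cast; ring, zpow_natCast, hq.pow_eq_one,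
    one_zpow]

/-- Linkage: weights symmetric with respect to a wall have the same central character. -/
theorem casVal_reflect (hq : IsPrimitiveRoot (qq 𝕜) (2 * l)) (a n : ℤ) : casVal 𝕜 (2 * l * a - n) = casVal 𝕜 n := by
  have h := qq_ne_zero (𝕜 := 𝕜)
  rw [casVal, casVal, zpow_sub₀ h, zpow_two_mul_eq_one hq, neg_sub, zpow_sub₀ h,
    zpow_two_mul_eq_one hq, one_div, div_one, zpow_neg, add_comm]

theorem zpow_sub_zpow_ne_zero (hq : IsPrimitiveRoot (qq 𝕜) (2 * l)) {n : ℤ} (hn : ¬ (l : ℤ) ∣ n) : qq 𝕜 ^ n - qq 𝕜 ^ (-n) ≠ 0 := by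
  have h := qq_ne_zero (𝕜 := 𝕜)
  intro h1
  apply hn
  have h2 : qq 𝕜 ^ (2 * n) = 1 := by
    rw [two_mul, zpow_add₀ h]
    nth_rewrite 1 [sub_eq_zero.1 h1]
    rw [← zpow_add₀ h]
    simp
  have h3 := (hq.zpow_eq_one_iff_dvd _).1 h2
  push_cast at h3
  exact Int.dvd_of_mul_dvd_mul_left (by norm_num) h3

theorem qq_sub_inv_ne_zero (hl₁ : 1 < l) (hq : IsPrimitiveRoot (qq 𝕜) (2 * l)) : qq 𝕜 - (qq 𝕜)⁻¹ ≠ 0 := by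
  have := zpow_sub_zpow_ne_zero hq (n := 1) (by
    intro h
    have := Int.le_of_dvd one_pos h
    omega)
  simpa using this

/-- The two Casimir eigenvalues on `M ⊗ V` differ off the walls. -/
theorem casVal_ne (hl₁ : 1 < l) (hq : IsPrimitiveRoot (qq 𝕜) (2 * l)) {n : ℤ} (hn : ¬ (l : ℤ) ∣ n) : casVal 𝕜 (n + 1) ≠ casVal 𝕜 (n - 1) := by
  rw [← sub_ne_zero, casVal_sub]
  exact mul_ne_zero (qq_sub_inv_ne_zero hl₁ hq) (zpow_sub_zpow_ne_zero hq hn)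

/-- Up to a nonzero factor, this is the scalar by which `M → M ⊗ V ⊗ V → M`, passing through the
eigenspace for `casVal (n + 1)` in the middle, acts on a module `M` with Casimir eigenvalue
`casVal n`. -/
theorem translation_scalar_ne_zero (hl₁ : 1 < l) (hq : IsPrimitiveRoot (qq 𝕜) (2 * l)) {n : ℤ} (hn : ¬ (l : ℤ) ∣ n + 1) :
    qq 𝕜 * casVal 𝕜 2 * casVal 𝕜 n - casVal 𝕜 (n - 1) * (1 + qq 𝕜 ^ 2) ≠ 0 := by
  have h := qq_ne_zero (𝕜 := 𝕜)
  have h1 : 1 + qq 𝕜 ^ 2 = qq 𝕜 * casVal 𝕜 1 := by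
    rw [casVal, zpow_one, zpow_neg_one, mul_add, mul_inv_cancel₀ h]; ring
  have h2 : qq 𝕜 * casVal 𝕜 2 * casVal 𝕜 n - casVal 𝕜 (n - 1) * (1 + qq 𝕜 ^ 2) =
      qq 𝕜 * (casVal 𝕜 (n + 1 + 1) - casVal 𝕜 (n + 1 - 1)) := by
    rw [h1, mul_assoc, casVal_mul, mul_left_comm, casVal_mul, show 2 + n = n + 1 + 1 by ring,
      show (2 : ℤ) - n = -(n - 1 - 1) by ring, casVal_neg, show n - 1 + 1 = n + 1 - 1 by ring]
    ring
  rw [h2]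
  exact mul_ne_zero h (sub_ne_zero.2 (casVal_ne hl₁ hq hn))

theorem qq_pow_eq_neg_one (hl : Odd l) (hl₁ : 1 < l) (hq : IsPrimitiveRoot (qq 𝕜) (2 * l)) : qq 𝕜 ^ l = -1 := by
  have h1 : (qq 𝕜 ^ l) ^ 2 = 1 := by rw [← pow_mul, mul_comm, hq.pow_eq_one]
  refine ((sq_eq_sq_iff_eq_or_eq_neg.1 (h1.trans (one_pow 2).symm))).resolve_left fun h2 => ?_
  have := Nat.le_of_dvd (by omega) (hq.dvd_of_pow_eq_one l h2)
  omega

/-- The factor `(vⁿ - v⁻ⁿ) / (v^l - v^{-l})` if `l` divides `n`, and `vⁿ - v⁻ⁿ` otherwise. -/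
def regFactor (l n : ℕ) : ℤ[T;T⁻¹] :=
  if l ∣ n then ∑ i ∈ Finset.range (n / l), LaurentPolynomial.T ((l : ℤ) * ((n / l : ℕ) - 1 - 2 * i))
  else LaurentPolynomial.T n - LaurentPolynomial.T (-n)

theorem regFactor_mul (l n : ℕ) : v ^ (n : ℤ) - v ^ (-(n : ℤ)) =
    (if l ∣ n then v ^ (l : ℤ) - v ^ (-(l : ℤ)) else 1) * algebraMap ℤ[T;T⁻¹] Qv (regFactor l n) := by
  rw [regFactor]
  split_ifs with h
  · rw [map_sum]
    simp_rw [← v_zpow]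
    have hn : (n : ℤ) = l * (n / l : ℕ) := by exact_mod_cast (Nat.mul_div_cancel' h).symm
    generalize n / l = b at hn ⊢
    rw [hn]
    clear hn
    have key (i : ℕ) : (v ^ (l : ℤ) - v ^ (-(l : ℤ))) * v ^ ((l : ℤ) * (b - 1 - 2 * i)) =
        v ^ ((l : ℤ) * (b - 2 * i)) - v ^ ((l : ℤ) * (b - 2 * (i + 1 : ℕ))) := by
      rw [sub_mul, ← zpow_add₀ v_ne_zero, ← zpow_add₀ v_ne_zero]
      push_cast
      ring_nf
    rw [Finset.mul_sum, Finset.sum_congr rfl fun i _ => key i, Finset.sum_range_sub']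
    congr 2
    ring_nf
  · rw [one_mul, map_sub, v_zpow, v_zpow]

/-- At `v = q` the quotient `(vⁿ - v⁻ⁿ) / (v^l - v^{-l})` for `n = l s` becomes `± s`, which is nonzero
in characteristic zero. -/
theorem regFactor_ne_zero (hl : Odd l) (hl₁ : 1 < l) (hq : IsPrimitiveRoot (qq 𝕜) (2 * l)) [CharZero 𝕜] {n : ℕ} (hn : 0 < n) :
    algebraMap ℤ[T;T⁻¹] 𝕜 (regFactor l n) ≠ 0 := by
  have h := qq_ne_zero (𝕜 := 𝕜)
  rw [regFactor]
  split_ifs with h1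
  · rw [map_sum]
    have key (i : ℕ) : algebraMap ℤ[T;T⁻¹] 𝕜
        (LaurentPolynomial.T ((l : ℤ) * ((n / l : ℕ) - 1 - 2 * i))) = (-1) ^ ((n / l : ℕ) - 1 : ℤ) := by
      rw [algebraMap_T_eq, zpow_mul, zpow_natCast, qq_pow_eq_neg_one hl hl₁ hq,
        zpow_sub₀ (by norm_num), zpow_mul]
      simp
    rw [Finset.sum_congr rfl fun i _ => key i, Finset.sum_const, Finset.card_range, nsmul_eq_mul]
    refine mul_ne_zero ?_ (zpow_ne_zero _ (by norm_num))
    exact_mod_cast (Nat.div_pos (Nat.le_of_dvd hn h1) (by omega)).ne'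
  · rw [map_sub, algebraMap_T_eq, algebraMap_T_eq]
    exact zpow_sub_zpow_ne_zero hq fun h => h1 (by exact_mod_cast h)

/-- The Gaussian binomial coefficients `[m \atop i]`, `i ≤ m`, do not vanish if `m < l` or
`l ∣ m + 1`: the zeros of numerator and denominator cancel. -/
theorem gauss_ne_zero (hl : Odd l) (hl₁ : 1 < l) (hq : IsPrimitiveRoot (qq 𝕜) (2 * l)) [CharZero 𝕜] {m : ℕ} (hm : m < l ∨ l ∣ m + 1) {i : ℕ} (hi : i ≤ m) :
    algebraMap ℤ[T;T⁻¹] 𝕜 (gauss m i) ≠ 0 := by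
  have h1 := gauss_mul m i
  have h2 (s : ℕ) (hs : s ∈ Finset.range i) : v ^ ((m : ℤ) - s) - v ^ (-((m : ℤ) - s)) =
      (if l ∣ s + 1 then v ^ (l : ℤ) - v ^ (-(l : ℤ)) else 1) *
        algebraMap ℤ[T;T⁻¹] Qv (regFactor l (m - s)) := by
    have hs := Finset.mem_range.1 hs
    have e : (m : ℤ) - s = ((m - s : ℕ) : ℤ) := by omega
    rw [e, regFactor_mul l (m - s)]
    have : l ∣ m - s ↔ l ∣ s + 1 := by
      rcases hm with hm | hm
      · constructor <;> intro h <;> have := Nat.le_of_dvd (by omega) h <;> omega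
      · rw [show m + 1 = (m - s) + (s + 1) by omega] at hm
        constructor <;> intro h
        · exact (Nat.dvd_add_right h).1 hm
        · exact (Nat.dvd_add_left h).1 hm
    simp only [this]
  have h3 (s : ℕ) (_ : s ∈ Finset.range i) : v ^ ((s : ℤ) + 1) - v ^ (-((s : ℤ) + 1)) =
      (if l ∣ s + 1 then v ^ (l : ℤ) - v ^ (-(l : ℤ)) else 1) *
        algebraMap ℤ[T;T⁻¹] Qv (regFactor l (s + 1)) := by
    have e : (s : ℤ) + 1 = ((s + 1 : ℕ) : ℤ) := by omega
    rw [e, regFactor_mul l (s + 1)]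
  rw [Finset.prod_congr rfl h2, Finset.prod_congr rfl h3, Finset.prod_mul_distrib,
    Finset.prod_mul_distrib, mul_left_comm] at h1
  have h4 : ∏ s ∈ Finset.range i, (if l ∣ s + 1 then v ^ (l : ℤ) - v ^ (-(l : ℤ)) else 1) ≠ 0 := by
    refine Finset.prod_ne_zero_iff.2 fun s _ => ?_
    split_ifs
    · exact v_zpow_sub_ne_zero (by omega)
    · exact one_ne_zero
  have h5 := mul_left_cancel₀ h4 h1
  rw [← map_prod, ← map_prod, ← map_mul] at h5
  have h6 := congrArg (algebraMap ℤ[T;T⁻¹] 𝕜) (IsFractionRing.injective ℤ[T;T⁻¹] Qv h5)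
  rw [map_mul, map_prod, map_prod] at h6
  intro h7
  rw [h7, zero_mul] at h6
  refine Finset.prod_ne_zero_iff.2 (fun s hs => ?_) h6.symm
  have hs := Finset.mem_range.1 hs
  exact regFactor_ne_zero hl hl₁ hq (by omega)

/-- Weyl modules in the first alcove and on the walls are self-dual. -/
theorem weyl_equiv_dual_of_wall (hl : Odd l) (hl₁ : 1 < l) (hq : IsPrimitiveRoot (qq 𝕜) (2 * l)) [CharZero 𝕜] {m : ℕ} (hm : m < l ∨ l ∣ m + 1) :
    Nonempty (WMod 𝕜 m ≃ₗ[Uq 𝕜] DMod 𝕜 m) :=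
  weyl_equiv_dual fun _ hi => gauss_ne_zero hl hl₁ hq hm hi

end root

/-! ### Generalized eigenspaces of the Casimir element -/

open Polynomial

section part

variable {A M B : Type*} [AddCommGroup A] [Module 𝕜 A] [Module (Uq 𝕜) A] [IsScalarTower 𝕜 (Uq 𝕜) A]
  [AddCommGroup M] [Module 𝕜 M] [Module (Uq 𝕜) M] [IsScalarTower 𝕜 (Uq 𝕜) M]
  [AddCommGroup B] [Module 𝕜 B] [Module (Uq 𝕜) B] [IsScalarTower 𝕜 (Uq 𝕜) B]

variable (M) in
/-- The part of a module on which the projection to the generalized eigenspace of the Casimir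
element for `c₁` (along that for `c₂`) is the identity. -/
def part (c₁ c₂ : 𝕜) : Submodule (Uq 𝕜) M :=
  LinearMap.eqLocus (casHom M (eigProj c₁ c₂)) LinearMap.id

theorem mem_part {c₁ c₂ : 𝕜} {x : M} : x ∈ part M c₁ c₂ ↔ casPoly (eigProj c₁ c₂) • x = x := Iff.rfl

variable (M) in
/-- The module is annihilated by `((C - c₁)(C - c₂))²`. -/
def HasEigenvalues (c₁ c₂ : 𝕜) : Prop :=
  ∀ x : M, casPoly (((X - C c₁) * (X - C c₂)) ^ 2) • x = 0

theorem HasEigenvalues.symm {c₁ c₂ : 𝕜} (h : HasEigenvalues M c₁ c₂) : HasEigenvalues M c₂ c₁ := by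
  intro x
  rw [mul_comm]
  exact h x

/-- On such a module `eigProj` acts by an idempotent. -/
theorem HasEigenvalues.idem {c₁ c₂ : 𝕜} (hc : c₁ ≠ c₂) (h : HasEigenvalues M c₁ c₂) (x : M) :
    casPoly (eigProj c₁ c₂) • casPoly (eigProj c₁ c₂) • x = casPoly (eigProj c₁ c₂) • x := by
  rw [← casPoly_mul_smul, eigProj_mul_self hc, casPoly_add_smul, casPoly_mul_smul _ (_ ^ 2), h x,
    smul_zero, add_zero]

/-- Such a module is the direct sum of its generalized eigenspaces for `c₁` and `c₂`. -/
theorem HasEigenvalues.isCompl {c₁ c₂ : 𝕜} (hc : c₁ ≠ c₂) (h : HasEigenvalues M c₁ c₂) :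
    IsCompl (part M c₁ c₂) (part M c₂ c₁) := by
  have h1 (x : M) : casPoly (eigProj c₁ c₂) • x + casPoly (eigProj c₂ c₁) • x = x := by
    rw [← casPoly_add_smul, eigProj_add_eigProj hc, casPoly_one_smul]
  constructor
  · rw [Submodule.disjoint_def]
    intro x hx hx'
    have := h1 x
    rw [mem_part.1 hx, mem_part.1 hx'] at this
    simpa using this
  · rw [codisjoint_iff, eq_top_iff]
    intro x _
    rw [← h1 x]
    exact Submodule.add_mem_sup (mem_part.2 (h.idem hc x)) (mem_part.2 (h.symm.idem hc.symm x))

/-- The projection to a generalized eigenspace. -/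
def toPart {c₁ c₂ : 𝕜} (hc : c₁ ≠ c₂) (h : HasEigenvalues M c₁ c₂) : M →ₗ[Uq 𝕜] part M c₁ c₂ :=
  (casHom M (eigProj c₁ c₂)).codRestrict _ fun x => mem_part.2 (h.idem hc x)

/-- The functor taking the generalized eigenspace, on morphisms. -/
def partMap (f : A →ₗ[Uq 𝕜] M) (c₁ c₂ : 𝕜) : part A c₁ c₂ →ₗ[Uq 𝕜] part M c₁ c₂ :=
  f.restrict fun x hx => mem_part.2 (by rw [← map_smul, mem_part.1 hx])

/-- Taking a generalized eigenspace is exact. -/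
theorem IsExtension.part (h : IsExtension 𝕜 A M B) {c₁ c₂ : 𝕜} (hc : c₁ ≠ c₂)
    (hM : HasEigenvalues M c₁ c₂) :
    IsExtension 𝕜 (part A c₁ c₂) (QuantumSl2.part M c₁ c₂) (QuantumSl2.part B c₁ c₂) := by
  obtain ⟨f, g, hf, hg, hfg⟩ := h
  refine ⟨partMap f c₁ c₂, partMap g c₁ c₂, ?_, ?_, ?_⟩
  · intro x y hxy
    exact Subtype.ext (hf (congrArg Subtype.val hxy))
  · rintro ⟨b, hb⟩
    obtain ⟨m, rfl⟩ := hg b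
    refine ⟨⟨casPoly (eigProj c₁ c₂) • m, mem_part.2 (hM.idem hc m)⟩, Subtype.ext ?_⟩
    exact (map_smul g _ _).trans (mem_part.1 hb)
  · rintro ⟨m, hm⟩
    constructor
    · intro h
      obtain ⟨a, rfl⟩ := (hfg m).1 (congrArg Subtype.val h)
      refine ⟨⟨a, mem_part.2 (hf ?_)⟩, rfl⟩
      rw [map_smul, mem_part.1 hm]
    · rintro ⟨⟨a, ha⟩, h⟩
      exact Subtype.ext ((hfg m).2 ⟨a, congrArg Subtype.val h⟩)

theorem part_eq_top {c₁ c₂ : 𝕜} (hc : c₁ ≠ c₂) (h : ∀ x : M, cas 𝕜 • x = c₁ • x) :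
    part M c₁ c₂ = ⊤ := by
  rw [eq_top_iff]
  intro x _
  rw [mem_part, casPoly_smul_of_eq (h x), eval_eigProj_left hc, one_smul]

theorem part_eq_bot {c₁ c₂ : 𝕜} (h : ∀ x : M, cas 𝕜 • x = c₂ • x) : part M c₁ c₂ = ⊥ := by
  rw [eq_bot_iff]
  intro x hx
  rw [mem_part, casPoly_smul_of_eq (h x), eval_eigProj_right, zero_smul] at hx
  exact hx.symm

theorem IsExtension.nonempty_equiv_left (h : IsExtension 𝕜 A M B) [Subsingleton B] :
    Nonempty (A ≃ₗ[Uq 𝕜] M) := by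
  obtain ⟨f, g, hf, hg, hfg⟩ := h
  exact ⟨LinearEquiv.ofBijective f ⟨hf, fun y => (hfg y).1 (Subsingleton.elim _ _)⟩⟩

theorem IsExtension.nonempty_equiv_right (h : IsExtension 𝕜 A M B) [Subsingleton A] :
    Nonempty (M ≃ₗ[Uq 𝕜] B) := by
  obtain ⟨f, g, hf, hg, hfg⟩ := h
  refine ⟨LinearEquiv.ofBijective g ⟨?_, hg⟩⟩
  rw [injective_iff_map_eq_zero]
  intro y hy
  obtain ⟨a, rfl⟩ := (hfg y).1 hy
  rw [Subsingleton.elim a 0, map_zero]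

/-- A polynomial in the Casimir element annihilating an extension is obtained by multiplying
polynomials annihilating its ends. -/
theorem IsExtension.casPoly_smul (h : IsExtension 𝕜 A M B) {p r : 𝕜[X]}
    (hA : ∀ x : A, casPoly p • x = 0) (hB : ∀ x : B, casPoly r • x = 0) (x : M) :
    casPoly (p * r) • x = 0 := by
  obtain ⟨f, g, hf, hg, hfg⟩ := h
  rw [casPoly_mul_smul]
  obtain ⟨a, ha⟩ := (hfg (casPoly r • x)).1 (by rw [map_smul, hB])
  rw [← ha, ← map_smul, hA, map_zero]

theorem casPoly_X_sub_C_smul_eq_zero {c : 𝕜} {x : M} (h : cas 𝕜 • x = c • x) :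
    casPoly (X - C c) • x = 0 := by
  rw [casPoly_X_sub_C_smul, h, sub_self]

/-- If the Casimir element acts by `c₁` on `A` and by `c₂` on `B`, an extension splits. -/
theorem IsExtension.nonempty_part_equiv (h : IsExtension 𝕜 A M B) {c₁ c₂ : 𝕜} (hc : c₁ ≠ c₂)
    (hA : ∀ x : A, cas 𝕜 • x = c₁ • x) (hB : ∀ x : B, cas 𝕜 • x = c₂ • x) :
    Nonempty (QuantumSl2.part M c₁ c₂ ≃ₗ[Uq 𝕜] A) ∧
      Nonempty (QuantumSl2.part M c₂ c₁ ≃ₗ[Uq 𝕜] B) := by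
  have hM : HasEigenvalues M c₁ c₂ := fun x => by
    rw [pow_two, casPoly_mul_smul, h.casPoly_smul (fun x => casPoly_X_sub_C_smul_eq_zero (hA x))
      (fun x => casPoly_X_sub_C_smul_eq_zero (hB x))]
  constructor
  · have : Subsingleton (QuantumSl2.part B c₁ c₂) := by
      rw [part_eq_bot hB]; infer_instance
    obtain ⟨e⟩ := (h.part hc hM).nonempty_equiv_left
    exact ⟨e.symm.trans ((LinearEquiv.ofEq _ _ (part_eq_top hc hA)).trans Submodule.topEquiv)⟩
  · have : Subsingleton (QuantumSl2.part A c₂ c₁) := by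
      rw [part_eq_bot hA]; infer_instance
    obtain ⟨e⟩ := (h.part hc.symm hM.symm).nonempty_equiv_right
    exact ⟨e.trans ((LinearEquiv.ofEq _ _ (part_eq_top hc.symm hB)).trans Submodule.topEquiv)⟩

/-- Isomorphic modules have isomorphic generalized eigenspaces. -/
def partCongr (e : A ≃ₗ[Uq 𝕜] M) (c₁ c₂ : 𝕜) : part A c₁ c₂ ≃ₗ[Uq 𝕜] part M c₁ c₂ :=
  LinearEquiv.ofLinearMap (partMap e.toLinearMap c₁ c₂) (partMap e.symm.toLinearMap c₁ c₂)
    (by ext x; simp [partMap]) (by ext x; simp [partMap])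

end part

/-! ### Tensor products of Weyl modules with the two-dimensional module -/

theorem cas_smul_equiv {M N : Type*} [AddCommGroup M] [Module 𝕜 M] [Module (Uq 𝕜) M]
    [IsScalarTower 𝕜 (Uq 𝕜) M] [AddCommGroup N] [Module 𝕜 N] [Module (Uq 𝕜) N]
    [IsScalarTower 𝕜 (Uq 𝕜) N] (e : M ≃ₗ[Uq 𝕜] N) {c : 𝕜} (h : ∀ x : M, cas 𝕜 • x = c • x) (y : N) :
    cas 𝕜 • y = c • y := by
  obtain ⟨x, rfl⟩ := e.surjective y
  rw [← map_smul, h]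
  exact mkHom_restrictScalars e.toLinearMap c x

theorem cas_smul_weyl' {k : ℕ} {c : 𝕜} (h : c = casVal 𝕜 (k + 1)) (x : WMod 𝕜 k) :
    cas 𝕜 • x = c • x := h ▸ cas_smul_weyl k x

theorem cas_smul_dual' {k : ℕ} {c : 𝕜} (h : c = casVal 𝕜 (k + 1)) (x : DMod 𝕜 k) :
    cas 𝕜 • x = c • x := h ▸ cas_smul_dual k x

theorem tv_dual_zero [CharZero 𝕜] : Nonempty (DMod 𝕜 1 ≃ₗ[Uq 𝕜] TV (DMod 𝕜 0)) := by
  have hsurj := projD_surjective (𝕜 := 𝕜) 0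
  refine ⟨(LinearEquiv.ofBijective (projD 𝕜 0) ⟨?_, hsurj⟩).symm⟩
  exact (LinearMap.injective_iff_surjective_of_finrank_eq_finrank
    (f := (projD 𝕜 0).restrictScalars 𝕜)
    (by rw [TV.finrank_eq, finrank_DMod, finrank_DMod])).2 hsurj

theorem casPoly_smul_tv_weyl (k : ℕ) (x : TV (WMod 𝕜 k)) :
    casPoly ((X - C (casVal 𝕜 (k + 2))) * (X - C (casVal 𝕜 k))) • x = 0 := by
  cases k with
  | zero =>
    obtain ⟨e⟩ := tv_weyl_zero 𝕜
    have h : casPoly (X - C (casVal 𝕜 ((0 : ℕ) + 2))) • x = 0 := casPoly_X_sub_C_smul_eq_zero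
      (cas_smul_equiv e (cas_smul_weyl' (by norm_num)) x)
    rw [mul_comm, casPoly_mul_smul, h, smul_zero]
  | succ m =>
    refine (isExtension_weyl 𝕜 m).casPoly_smul (fun x => casPoly_X_sub_C_smul_eq_zero ?_)
      (fun x => casPoly_X_sub_C_smul_eq_zero ?_) x
    · exact cas_smul_weyl' (by push_cast; ring_nf) x
    · exact cas_smul_weyl' (by push_cast; ring_nf) x

/-- The summand `W(k+1)` of `W(k) ⊗ V`, off the walls. -/
theorem part_tv_weyl_up {k : ℕ} {c₁ c₂ : 𝕜} (h₁ : c₁ = casVal 𝕜 (k + 2)) (h₂ : c₂ = casVal 𝕜 k)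
    (hc : c₁ ≠ c₂) : Nonempty (part (TV (WMod 𝕜 k)) c₁ c₂ ≃ₗ[Uq 𝕜] WMod 𝕜 (k + 1)) := by
  cases k with
  | zero =>
    obtain ⟨e⟩ := tv_weyl_zero 𝕜
    have := part_eq_top hc (cas_smul_equiv e (cas_smul_weyl' (h₁.trans (by norm_num))))
    exact ⟨(LinearEquiv.ofEq _ _ this).trans (Submodule.topEquiv.trans e.symm)⟩
  | succ m =>
    exact ((isExtension_weyl 𝕜 m).nonempty_part_equiv hc
      (cas_smul_weyl' (h₁.trans (by push_cast; ring_nf)))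
      (cas_smul_weyl' (h₂.trans (by push_cast; ring_nf)))).1

/-- The summand `W(k)` of `W(k+1) ⊗ V`, off the walls. -/
theorem part_tv_weyl_down {k : ℕ} {c₁ c₂ : 𝕜} (h₁ : c₁ = casVal 𝕜 (k + 3))
    (h₂ : c₂ = casVal 𝕜 (k + 1)) (hc : c₁ ≠ c₂) :
    Nonempty (part (TV (WMod 𝕜 (k + 1))) c₂ c₁ ≃ₗ[Uq 𝕜] WMod 𝕜 k) :=
  ((isExtension_weyl 𝕜 k).nonempty_part_equiv hc
      (cas_smul_weyl' (h₁.trans (by push_cast; ring_nf)))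
      (cas_smul_weyl' (h₂.trans (by push_cast; ring_nf)))).2

theorem part_tv_weyl_zero_down {c₁ c₂ : 𝕜} (h₁ : c₁ = casVal 𝕜 2) :
    part (TV (WMod 𝕜 0)) c₂ c₁ = ⊥ := by
  obtain ⟨e⟩ := tv_weyl_zero 𝕜
  exact part_eq_bot (cas_smul_equiv e (cas_smul_weyl' (h₁.trans (by norm_num))))

/-- The summand `W(k+1)*` of `W(k)* ⊗ V`, off the walls. -/
theorem part_tv_dual_up [CharZero 𝕜] {k : ℕ} {c₁ c₂ : 𝕜} (h₁ : c₁ = casVal 𝕜 (k + 2))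
    (h₂ : c₂ = casVal 𝕜 k) (hc : c₁ ≠ c₂) :
    Nonempty (part (TV (DMod 𝕜 k)) c₁ c₂ ≃ₗ[Uq 𝕜] DMod 𝕜 (k + 1)) := by
  cases k with
  | zero =>
    obtain ⟨e⟩ := tv_dual_zero (𝕜 := 𝕜)
    have := part_eq_top hc (cas_smul_equiv e (cas_smul_dual' (h₁.trans (by norm_num))))
    exact ⟨(LinearEquiv.ofEq _ _ this).trans (Submodule.topEquiv.trans e.symm)⟩
  | succ m =>
    exact ((isExtension_dual 𝕜 m).nonempty_part_equiv hc.symm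
      (cas_smul_dual' (h₂.trans (by push_cast; ring_nf)))
      (cas_smul_dual' (h₁.trans (by push_cast; ring_nf)))).2

/-- The summand `W(k)*` of `W(k+1)* ⊗ V`, off the walls. -/
theorem part_tv_dual_down {k : ℕ} {c₁ c₂ : 𝕜} (h₁ : c₁ = casVal 𝕜 (k + 3))
    (h₂ : c₂ = casVal 𝕜 (k + 1)) (hc : c₁ ≠ c₂) :
    Nonempty (part (TV (DMod 𝕜 (k + 1))) c₂ c₁ ≃ₗ[Uq 𝕜] DMod 𝕜 k) :=
  ((isExtension_dual 𝕜 k).nonempty_part_equiv hc.symm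
      (cas_smul_dual' (h₂.trans (by push_cast; ring_nf)))
      (cas_smul_dual' (h₁.trans (by push_cast; ring_nf)))).1

end

section

/-! ### The quadratic relation of the Casimir element on tensor products -/

section generic

variable {k B : Type*} [Field k] [Ring B] [Algebra k B] {v : k} {e f a b c : B}

theorem casimir_quadratic_zero_zero (hv : v ≠ 0) (hv2 : v - v⁻¹ ≠ 0)
    (h₁ : a * e = v ^ (2 : ℤ) • (e * a)) (hab : b * a = 1) (hca : a * c = c * a)
    (hc : (v - v⁻¹) ^ 2 • (f * e) = c - v • a - v⁻¹ • b) :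
    (v⁻¹ • c + (v ^ 2 - 1) • a) * (v⁻¹ • c + (v ^ 2 - 1) • a) +
      (((v - v⁻¹) ^ 2 * v⁻¹) • (f * a)) * ((v - v⁻¹) ^ 2 • e) =
    (v + v⁻¹) • (c * (v⁻¹ • c + (v ^ 2 - 1) • a)) - (c * c + (v - v⁻¹) ^ 2 • 1) := by
  have h : f * (e * a) = ((v - v⁻¹) ^ 2)⁻¹ • (c * a - v • (a * a) - v⁻¹ • 1) := by
    rw [← hab, ← smul_mul_assoc, ← smul_mul_assoc, ← sub_mul, ← sub_mul, ← hc, smul_mul_assoc,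
      smul_smul, inv_mul_cancel₀ (pow_ne_zero 2 hv2), one_smul, mul_assoc]
  have hv2' : v ^ 2 - 1 ≠ 0 := by
    intro h; apply hv2; field_simp; rw [h, mul_zero]
  simp only [add_mul, mul_add, smul_mul_assoc, mul_smul_comm, mul_assoc, h₁, h, hca]
  match_scalars <;> simp [zpow_ofNat] <;> field_simp <;> ring

theorem casimir_quadratic_one_one (hv : v ≠ 0) (hv2 : v - v⁻¹ ≠ 0)
    (hab : b * a = 1) (hca : a * c = c * a)
    (hc : (v - v⁻¹) ^ 2 • (e * f) = c - v⁻¹ • a - v • b) :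
    ((v - v⁻¹) ^ 2 • e) * (((v - v⁻¹) ^ 2 * v⁻¹) • (f * a)) +
      (v • c + ((v⁻¹) ^ 2 - 1) • a) * (v • c + ((v⁻¹) ^ 2 - 1) • a) =
    (v + v⁻¹) • (c * (v • c + ((v⁻¹) ^ 2 - 1) • a)) - (c * c + (v - v⁻¹) ^ 2 • 1) := by
  have h : e * (f * a) = ((v - v⁻¹) ^ 2)⁻¹ • (c * a - v⁻¹ • (a * a) - v • 1) := by
    rw [← hab, ← smul_mul_assoc, ← smul_mul_assoc, ← sub_mul, ← sub_mul, ← hc, smul_mul_assoc,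
      smul_smul, inv_mul_cancel₀ (pow_ne_zero 2 hv2), one_smul, mul_assoc]
  have hv2' : v ^ 2 - 1 ≠ 0 := by
    intro h; apply hv2; field_simp; rw [h, mul_zero]
  simp only [add_mul, mul_add, smul_mul_assoc, mul_smul_comm, mul_assoc, h, hca]
  match_scalars <;> simp [zpow_ofNat] <;> field_simp <;> ring

theorem casimir_quadratic_one_zero (hv : v ≠ 0)
    (h₁ : a * e = v ^ (2 : ℤ) • (e * a)) (hce : e * c = c * e) :
    ((v - v⁻¹) ^ 2 • e) * (v⁻¹ • c + (v ^ 2 - 1) • a) +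
      (v • c + ((v⁻¹) ^ 2 - 1) • a) * ((v - v⁻¹) ^ 2 • e) =
    (v + v⁻¹) • (c * ((v - v⁻¹) ^ 2 • e)) := by
  simp only [add_mul, mul_add, smul_mul_assoc, mul_smul_comm, mul_assoc, h₁, hce]
  match_scalars <;> simp [zpow_ofNat] <;> field_simp <;> ring

theorem casimir_quadratic_zero_one (hv : v ≠ 0)
    (h₁ : a * f = v ^ (-2 : ℤ) • (f * a)) (hca : a * c = c * a) (hcf : f * c = c * f) :
    (v⁻¹ • c + (v ^ 2 - 1) • a) * (((v - v⁻¹) ^ 2 * v⁻¹) • (f * a)) +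
      (((v - v⁻¹) ^ 2 * v⁻¹) • (f * a)) * (v • c + ((v⁻¹) ^ 2 - 1) • a) =
    (v + v⁻¹) • (c * (((v - v⁻¹) ^ 2 * v⁻¹) • (f * a))) := by
  have h2 : a * (f * a) = v ^ (-2 : ℤ) • (f * (a * a)) := by
    rw [← mul_assoc, h₁, smul_mul_assoc, mul_assoc]
  have h3 : f * (c * a) = c * (f * a) := by
    rw [← mul_assoc, hcf, mul_assoc]
  simp only [add_mul, mul_add, smul_mul_assoc, mul_smul_comm, mul_assoc, h2, hca, h3]
  match_scalars <;> simp [zpow_ofNat] <;> field_simp <;> ring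

theorem casimir_delta_zero_zero (hv : v ≠ 0) (x a b : B) :
    ((v - v⁻¹) ^ 2 * v⁻¹) • x + v ^ 2 • a + (v⁻¹) ^ 2 • b =
      v⁻¹ • ((v - v⁻¹) ^ 2 • x + v • a + v⁻¹ • b) + (v ^ 2 - 1) • a := by
  match_scalars <;> field_simp <;> ring

theorem casimir_delta_one_one (hv : v ≠ 0) (x a b : B) :
    (v - v⁻¹) ^ 2 • (a + v • x) + a + b =
      v • ((v - v⁻¹) ^ 2 • x + v • a + v⁻¹ • b) + ((v⁻¹) ^ 2 - 1) • a := by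
  match_scalars <;> field_simp <;> ring

theorem casimir_eq_mul_e_f (hv : v ≠ 0) (hv2 : v - v⁻¹ ≠ 0) (x a b : B) :
    (v - v⁻¹) ^ 2 • ((v - v⁻¹)⁻¹ • (a - b) + x) =
      (v - v⁻¹) ^ 2 • x + v • a + v⁻¹ • b - v⁻¹ • a - v • b := by
  have h3 : v ^ 2 - 1 ≠ 0 := by
    intro h; apply hv2; field_simp; rw [h, mul_zero]
  match_scalars <;> field_simp <;> ring

end generic

theorem delta_casimir_eq : delta casimir =
    !![v⁻¹ • casimir + (v ^ 2 - 1) • K, ((v - v⁻¹) ^ 2 * v⁻¹) • (F * K);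
      (v - v⁻¹) ^ 2 • E, v • casimir + ((v⁻¹) ^ 2 - 1) • K] := by
  have h := v_ne_zero
  rw [delta_casimir, casimir]
  ext i j
  fin_cases i <;> fin_cases j
  · exact casimir_delta_zero_zero h _ _ _
  · rfl
  · rfl
  · exact casimir_delta_one_one h _ _ _

/-- The Casimir element `X` of `M ⊗ V` and the Casimir element `C` of `M` satisfy
`X² = (v + v⁻¹) C X - (C² + (v - v⁻¹)²)`. -/
theorem delta_casimir_mul (i j : Fin 2) : delta (casimir * casimir) i j =
    (v + v⁻¹) • (casimir * delta casimir i j) -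
      if i = j then casimir * casimir + (v - v⁻¹) ^ 2 • 1 else 0 := by
  have h := v_ne_zero
  have h2 := v_sub_ne_zero
  have hFE : (v - v⁻¹) ^ 2 • (F * E) = casimir - v • K - v⁻¹ • Kinv := by
    rw [casimir]; abel
  have hEF : (v - v⁻¹) ^ 2 • (E * F) = casimir - v⁻¹ • K - v • Kinv := by
    rw [sub_eq_iff_eq_add.1 E_F, casimir]
    exact casimir_eq_mul_e_f h h2 _ _ _
  rw [map_mul, delta_casimir_eq, Matrix.mul_fin_two]
  fin_cases i <;> fin_cases j
  · exact casimir_quadratic_zero_zero h h2 K_mul_E Kinv_mul_K (casimir_commute K).symm hFE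
  · refine (casimir_quadratic_zero_one h K_mul_F (casimir_commute K).symm
      (casimir_commute F).symm).trans (sub_zero _).symm
  · refine (casimir_quadratic_one_zero h K_mul_E (casimir_commute E).symm).trans (sub_zero _).symm
  · exact casimir_quadratic_one_one h h2 Kinv_mul_K (casimir_commute K).symm hEF

theorem deltaA_casA_mul (i j : Fin 2) : deltaA (casA * casA) i j =
    (LaurentPolynomial.T 1 + LaurentPolynomial.T (-1) : ℤ[T;T⁻¹]) • (casA * deltaA casA i j) -
      if i = j then casA * casA +
        ((LaurentPolynomial.T 1 - LaurentPolynomial.T (-1)) ^ 2 : ℤ[T;T⁻¹]) • 1 else 0 := by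
  apply Subtype.ext
  have h := delta_casimir_mul i j
  refine (coe_deltaA _ i j).trans (h.trans ?_)
  have h1 : ((if i = j then casA * casA +
        ((LaurentPolynomial.T 1 - LaurentPolynomial.T (-1)) ^ 2 : ℤ[T;T⁻¹]) • 1 else 0 : UA) : Uv) =
      if i = j then casimir * casimir + (v - v⁻¹) ^ 2 • 1 else 0 := by
    split_ifs
    · refine (congrArg (fun u => casimir * casimir + u) (coe_T_smul 1 _)).trans ?_
      rw [map_pow, map_sub, ← v_zpow, ← v_zpow, zpow_one, zpow_neg_one]
      rfl
    · rfl
  refine (congrArg₂ (fun a b : Uv => a - b) ((coe_T_smul _ _).trans ?_) h1).symm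
  rw [map_add, ← v_zpow, ← v_zpow, zpow_one, zpow_neg_one]
  exact congrArg _ (congrArg (fun u => casimir * u) (coe_deltaA _ i j))

open Polynomial

variable {𝕜 : Type*} [Field 𝕜] [Algebra ℤ[T;T⁻¹] 𝕜]
  {M : Type*} [AddCommGroup M] [Module 𝕜 M] [Module (Uq 𝕜) M] [IsScalarTower 𝕜 (Uq 𝕜) M]

/-- The quadratic relation at `v = q`, for a module on which the Casimir element acts by `c`. -/
theorem cas_smul_cas_smul {c : 𝕜} (h : ∀ x : M, cas 𝕜 • x = c • x) (y : TV M) :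
    cas 𝕜 • cas 𝕜 • y = (casVal 𝕜 1 * c) • cas 𝕜 • y - (c ^ 2 + casVal 𝕜 2 - 2) • y := by
  have h1 : cas 𝕜 • cas 𝕜 • y = toUqHom 𝕜 (casA * casA) • y := by rw [map_mul, mul_smul]; rfl
  have hq := qq_ne_zero (𝕜 := 𝕜)
  have h2 : (qq 𝕜 - (qq 𝕜)⁻¹) ^ 2 = casVal 𝕜 2 - 2 := by
    rw [casVal, zpow_neg, zpow_ofNat]; field_simp; ring
  have key (i j : Fin 2) (x : M) : toUqHom 𝕜 (deltaA (casA * casA) i j) • x =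
      (casVal 𝕜 1 * c) • toUqHom 𝕜 (deltaA casA i j) • x -
        if i = j then (c ^ 2 + casVal 𝕜 2 - 2) • x else 0 := by
    rw [deltaA_casA_mul, map_sub, sub_smul, toUqHom_T_smul, map_mul, mul_smul]
    congr 1
    · rw [mul_smul, map_add, algebraMap_T_eq 1, algebraMap_T_eq (-1)]
      congr 1
      exact h _
    · split_ifs
      · rw [map_add, add_smul, toUqHom_T_smul, map_mul, mul_smul, map_one, one_smul, map_pow, map_sub,
          algebraMap_T_eq 1, algebraMap_T_eq (-1), zpow_one, zpow_neg_one, h2]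
        change cas 𝕜 • cas 𝕜 • x + _ = _
        rw [h, h, smul_smul, ← add_smul]
        congr 1; ring
      · rw [map_zero, zero_smul]
  have hi (i : Fin 2) : (cas 𝕜 • y) i =
      toUqHom 𝕜 (deltaA casA i 0) • y 0 + toUqHom 𝕜 (deltaA casA i 1) • y 1 :=
    TV.toUqHom_smul_apply casA y i
  rw [h1]
  refine TV.ext ?_ ?_
  · refine (TV.toUqHom_smul_apply _ y 0).trans ?_
    rw [key, key]
    change _ = (casVal 𝕜 1 * c) • (cas 𝕜 • y) 0 - (c ^ 2 + casVal 𝕜 2 - 2) • y 0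
    rw [hi, if_pos rfl, if_neg (by decide), smul_add, sub_zero]
    abel
  · refine (TV.toUqHom_smul_apply _ y 1).trans ?_
    rw [key, key]
    change _ = (casVal 𝕜 1 * c) • (cas 𝕜 • y) 1 - (c ^ 2 + casVal 𝕜 2 - 2) • y 1
    rw [hi, if_pos rfl, if_neg (by decide), smul_add, sub_zero]
    abel

/-- If the Casimir element acts on `M` by `qⁿ + q⁻ⁿ`, its eigenvalues on `M ⊗ V` are those
for `n + 1` and `n - 1`. -/
theorem casPoly_smul_tv {n : ℤ} (h : ∀ x : M, cas 𝕜 • x = casVal 𝕜 n • x) (y : TV M) :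
    casPoly ((X - C (casVal 𝕜 (n + 1))) * (X - C (casVal 𝕜 (n - 1)))) • y = 0 := by
  have h1 : casVal 𝕜 (n + 1) + casVal 𝕜 (n - 1) = casVal 𝕜 1 * casVal 𝕜 n := by
    rw [mul_comm, casVal_mul]
  have h2 : casVal 𝕜 (n + 1) * casVal 𝕜 (n - 1) = casVal 𝕜 n ^ 2 + casVal 𝕜 2 - 2 := by
    rw [casVal_mul, pow_two, casVal_mul, sub_self, casVal_zero]
    ring_nf
  rw [casPoly_mul_smul, casPoly_X_sub_C_smul, casPoly_X_sub_C_smul, smul_sub, cas_smul_cas_smul h,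
    smul_algebra_smul_comm, smul_sub, smul_smul, h2, ← h1, add_smul]
  abel

end

section

/-! ### Translation to an alcove and back -/

open Polynomial

variable {𝕜 : Type*} [Field 𝕜] [Algebra ℤ[T;T⁻¹] 𝕜]

section translation

variable {M N : Type*} [AddCommGroup M] [Module 𝕜 M] [Module (Uq 𝕜) M] [IsScalarTower 𝕜 (Uq 𝕜) M]
  [AddCommGroup N] [Module 𝕜 N] [Module (Uq 𝕜) N] [IsScalarTower 𝕜 (Uq 𝕜) N]

instance (P : Submodule (Uq 𝕜) M) [FiniteDimensional 𝕜 M] : FiniteDimensional 𝕜 P :=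
  Module.Finite.of_injective (P.subtype.restrictScalars 𝕜) P.subtype_injective

variable (M) in
/-- The endomorphism `M → M ⊗ V ⊗ V → M ⊗ V ⊗ V → M`, the middle arrow being a polynomial in the
Casimir element of `M ⊗ V`. -/
def partialTrace (p : 𝕜[X]) : M →ₗ[Uq 𝕜] M :=
  cap 𝕜 M ∘ₗ TV.map (casHom (TV M) p) ∘ₗ cup 𝕜 M

/-- Partial traces are natural in the module. -/
theorem partialTrace_map (p : 𝕜[X]) (f : M →ₗ[Uq 𝕜] N) (x : M) :
    partialTrace N p (f x) = f (partialTrace M p x) := by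
  rw [partialTrace, LinearMap.comp_apply, LinearMap.comp_apply, cup_map]
  have h : TV.map (casHom (TV N) p) (TV.map (TV.map f) (cup 𝕜 M x)) =
      TV.map (TV.map f) (TV.map (casHom (TV M) p) (cup 𝕜 M x)) :=
    TV.ext (map_smul (TV.map f) _ (cup 𝕜 M x 0)).symm (map_smul (TV.map f) _ (cup 𝕜 M x 1)).symm
  rw [h, cap_map_map]
  rfl

/-- The partial trace of the projection to an eigenspace of `M ⊗ V` is a scalar, if the Casimir element
is scalar on `M`. -/
theorem partialTrace_eigProj {c c₁ c₂ : 𝕜} (hc : c₁ ≠ c₂) (h : ∀ x : M, cas 𝕜 • x = c • x)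
    (hTV : ∀ y : TV M, casPoly ((X - C c₁) * (X - C c₂)) • y = 0) (x : M) :
    partialTrace M (eigProj c₁ c₂) x =
      ((c₁ - c₂)⁻¹ * (qq 𝕜 * casVal 𝕜 2 * c - c₂ * (1 + qq 𝕜 ^ 2))) • x := by
  have h1 (y : TV M) : casHom (TV M) (eigProj c₁ c₂) y =
      (c₁ - c₂)⁻¹ • (casHom (TV M) (X : 𝕜[X]) y - c₂ • y) := by
    rw [casHom_apply, casHom_apply, eigProj_eq hc, casPoly_add_smul, casPoly_mul_smul _ (_ * _), hTV,
      smul_zero, add_zero, casPoly_mul_smul, casPoly_C_smul, casPoly_X_sub_C_smul]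
    congr 2
    rw [casPoly, aeval_X]
  have h2 (z : TV (TV M)) : TV.map (casHom (TV M) (eigProj c₁ c₂)) z =
      (c₁ - c₂)⁻¹ • (TV.map (casHom (TV M) (X : 𝕜[X])) z - c₂ • z) := TV.ext (h1 _) (h1 _)
  rw [partialTrace, LinearMap.comp_apply, LinearMap.comp_apply, h2, mkHom_restrictScalars, map_sub,
    mkHom_restrictScalars, cap_cas_cup, cap_cup, h, smul_smul, smul_smul, ← sub_smul, smul_smul]

/-- By naturality, a partial trace which is injective on the ends of an extension is injective. -/
theorem IsExtension.partialTrace_injective {A B : Type*} [AddCommGroup A] [Module 𝕜 A]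
    [Module (Uq 𝕜) A] [IsScalarTower 𝕜 (Uq 𝕜) A] [AddCommGroup B] [Module 𝕜 B] [Module (Uq 𝕜) B]
    [IsScalarTower 𝕜 (Uq 𝕜) B] (h : IsExtension 𝕜 A M B) {p : 𝕜[X]}
    (hA : Function.Injective (partialTrace A p)) (hB : Function.Injective (partialTrace B p)) :
    Function.Injective (partialTrace M p) := by
  obtain ⟨f, g, hf, hg, hfg⟩ := h
  rw [injective_iff_map_eq_zero] at *
  intro x hx
  have h1 := hB (g x) (by rw [partialTrace_map, hx, map_zero])
  obtain ⟨a, rfl⟩ := (hfg x).1 h1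
  rw [hA a (hf _ (by rw [← partialTrace_map, hx])), map_zero]

/-- If the partial trace through an eigenspace of `M ⊗ V` is injective, translating to this eigenspace
and back yields a module containing `M`. -/
theorem exists_injective_tv_part {c₁ c₂ : 𝕜} (hc : c₁ ≠ c₂) (h : HasEigenvalues (TV M) c₁ c₂)
    (hM : Function.Injective (partialTrace M (eigProj c₁ c₂))) :
    ∃ f : M →ₗ[Uq 𝕜] TV (part (TV M) c₁ c₂), Function.Injective f :=
  ⟨TV.map (toPart hc h) ∘ₗ cup 𝕜 M, Function.Injective.of_comp
    (f := fun z => cap 𝕜 M (TV.map (part (TV M) c₁ c₂).subtype z)) hM⟩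

theorem casPoly_eigProj_smul {c c₂ : 𝕜} (hc : c ≠ c₂) {x : M}
    (hx : casPoly ((X - C c) ^ 2) • x = 0) : casPoly (eigProj c c₂) • x = x := by
  have h1 : eigProj c c₂ = 1 + (-(3 * C (c₂ - c)⁻¹ ^ 2) + 2 * C (c₂ - c)⁻¹ ^ 3 * (X - C c)) *
      (X - C c) ^ 2 := by
    rw [eq_sub_of_add_eq (eigProj_add_eigProj hc), eigProj]
    ring
  rw [h1, casPoly_add_smul, casPoly_one_smul, casPoly_mul_smul, hx, smul_zero, add_zero]

/-- An injective map into a module `N` whose image lies in a generalized eigenspace of `N` is an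
isomorphism onto it if the dimensions agree. -/
theorem nonempty_equiv_part [FiniteDimensional 𝕜 M] [FiniteDimensional 𝕜 N] {c c₂ : 𝕜}
    (hc : c ≠ c₂) (hM : ∀ x : M, casPoly ((X - C c) ^ 2) • x = 0)
    {f : M →ₗ[Uq 𝕜] N} (hf : Function.Injective f)
    (h : Module.finrank 𝕜 M = Module.finrank 𝕜 (part N c c₂)) :
    Nonempty (M ≃ₗ[Uq 𝕜] part N c c₂) := by
  let g : M →ₗ[Uq 𝕜] part N c c₂ := f.codRestrict _ fun x => mem_part.2 (by
    rw [← map_smul, casPoly_eigProj_smul hc (hM x)])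
  have hg : Function.Injective g := fun x y hxy => hf (congrArg Subtype.val hxy)
  exact ⟨LinearEquiv.ofBijective g ⟨hg,
    (LinearMap.injective_iff_surjective_of_finrank_eq_finrank
      (f := g.restrictScalars 𝕜) h).1 hg⟩⟩

/-- A module with a filtration by `W(m)`, `W(n)` and one by the duals splits if `W(m)` is self-dual
and `n < m`. -/
theorem nonempty_equiv_prod {m n : ℕ} (hnm : n < m) (e : WMod 𝕜 m ≃ₗ[Uq 𝕜] DMod 𝕜 m)
    (h₁ : IsExtension 𝕜 (WMod 𝕜 m) M (WMod 𝕜 n)) (h₂ : IsExtension 𝕜 (DMod 𝕜 n) M (DMod 𝕜 m)) :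
    Nonempty (M ≃ₗ[Uq 𝕜] (WMod 𝕜 m × WMod 𝕜 n)) := by
  obtain ⟨f, g, hf, hg, hfg⟩ := h₁
  obtain ⟨f', g', hf', hg', hfg'⟩ := h₂
  -- The composition `W(m) → M → W(m)* ≅ W(m)` does not annihilate the highest weight vector, as
  -- `E⁽ᵐ⁾F⁽ᵐ⁾` annihilates the kernel `W(n)*` of `M → W(m)*`.
  let φ : WMod 𝕜 m →ₗ[Uq 𝕜] WMod 𝕜 m := e.symm.toLinearMap ∘ₗ g' ∘ₗ f
  have h0 : φ (hwv 𝕜 m) ≠ 0 := by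
    intro h
    have h1 : g' (f (hwv 𝕜 m)) = 0 := (LinearEquiv.map_eq_zero_iff e.symm).1 h
    obtain ⟨d, hd⟩ := (hfg' _).1 h1
    have h2 : f (hwv 𝕜 m) = 0 := by
      rw [← topElt_smul_hwv m, map_smul, ← hd, ← map_smul, topElt_smul_dual_eq_zero hnm, map_zero]
    exact hwv_ne_zero m ((map_eq_zero_iff f hf).1 h2)
  have h1 : φ (hwv 𝕜 m) = wCoord (φ (hwv 𝕜 m)) 0 • hwv 𝕜 m := by
    rw [← topElt_smul_weyl, ← map_smul, topElt_smul_hwv]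
  generalize wCoord (φ (hwv 𝕜 m)) 0 = c at h1
  have hc : c ≠ 0 := by
    rintro rfl
    exact h0 (by rw [h1, zero_smul])
  have hφ : Function.Surjective φ := by
    rw [← LinearMap.range_eq_top]
    refine mem_of_hwv_mem ⟨c⁻¹ • hwv 𝕜 m, ?_⟩
    rw [mkHom_restrictScalars, h1, smul_smul, inv_mul_cancel₀ hc, one_smul]
  have hφ' : Function.Injective φ :=
    (LinearMap.injective_iff_surjective (f := φ.restrictScalars 𝕜)).2 hφ
  let Φ := LinearEquiv.ofBijective φ ⟨hφ', hφ⟩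
  -- Hence the inclusion `W(m) → M` has a retraction.
  let r : M →ₗ[Uq 𝕜] WMod 𝕜 m := Φ.symm.toLinearMap ∘ₗ e.symm.toLinearMap ∘ₗ g'
  have hr (a) : r (f a) = a := Φ.symm_apply_apply a
  have hgf (a) : g (f a) = 0 := (hfg _).2 ⟨a, rfl⟩
  refine ⟨LinearEquiv.ofBijective (r.prod g) ⟨?_, ?_⟩⟩
  · rw [injective_iff_map_eq_zero]
    intro x hx
    obtain ⟨a, rfl⟩ := (hfg x).1 (congrArg Prod.snd hx)
    have : r (f a) = 0 := congrArg Prod.fst hx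
    rw [← hr a, this, map_zero]
  · rintro ⟨a, b⟩
    obtain ⟨x, rfl⟩ := hg b
    refine ⟨x + f (a - r x), Prod.ext ?_ ?_⟩
    · change r (x + f (a - r x)) = a
      rw [map_add, hr, add_sub_cancel]
    · change g (x + f (a - r x)) = g x
      rw [map_add, hgf, add_zero]

end translation

/-! ### Modules glued from two Weyl modules -/

section glued

variable {M N : Type*} [AddCommGroup M] [Module 𝕜 M] [Module (Uq 𝕜) M] [IsScalarTower 𝕜 (Uq 𝕜) M]
  [AddCommGroup N] [Module 𝕜 N] [Module (Uq 𝕜) N] [IsScalarTower 𝕜 (Uq 𝕜) N]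
  {l k k' : ℕ} {a : ℤ}

variable (𝕜 M) in
/-- `M` is an extension of `W(k')` by `W(k)` and of `W(k)*` by `W(k')*`, on which the Casimir
element does not act by a scalar. -/
def IsGlued (k k' : ℕ) : Prop :=
  IsExtension 𝕜 (WMod 𝕜 k) M (WMod 𝕜 k') ∧ IsExtension 𝕜 (DMod 𝕜 k') M (DMod 𝕜 k) ∧
    ∃ x : M, cas 𝕜 • x ≠ casVal 𝕜 (k + 1) • x

theorem IsGlued.congr (h : IsGlued 𝕜 M k k') (e : M ≃ₗ[Uq 𝕜] N) : IsGlued 𝕜 N k k' := by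
  refine ⟨h.1.congr (.refl _ _) e (.refl _ _), h.2.1.congr (.refl _ _) e (.refl _ _), ?_⟩
  obtain ⟨x, hx⟩ := h.2.2
  refine ⟨e x, fun h1 => hx (e.injective ?_)⟩
  rw [map_smul, h1]
  exact (mkHom_restrictScalars e.toLinearMap _ _).symm

/-- The highest weights `k` and `k'` are symmetric with respect to a wall, hence have the same central
character; so have their neighbours. -/
theorem casVal_linked (hq : IsPrimitiveRoot (qq 𝕜) (2 * l)) (hk : (k : ℤ) + k' + 2 = 2 * l * a)
    (i : ℤ) : casVal 𝕜 (k' + i) = casVal 𝕜 (k + 2 - i) := by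
  rw [show (k' : ℤ) + i = 2 * l * a - (k + 2 - i) by linarith, casVal_reflect hq]

/-- On an extension of linked Weyl modules the Casimir element has a single eigenvalue, at most a double
root of its minimal polynomial. -/
theorem IsExtension.cas_sq_smul (hq : IsPrimitiveRoot (qq 𝕜) (2 * l))
    (hk : (k : ℤ) + k' + 2 = 2 * l * a) (h : IsExtension 𝕜 (WMod 𝕜 k) M (WMod 𝕜 k')) (x : M) :
    casPoly ((X - C (casVal 𝕜 (k + 1))) ^ 2) • x = 0 := by
  rw [pow_two]
  refine h.casPoly_smul (fun x => casPoly_X_sub_C_smul_eq_zero (cas_smul_weyl k x))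
    (fun x => casPoly_X_sub_C_smul_eq_zero (cas_smul_weyl' ?_ x)) x
  rw [casVal_linked hq hk]
  ring_nf

theorem IsExtension.hasEigenvalues_tv (hq : IsPrimitiveRoot (qq 𝕜) (2 * l))
    (hk : (k : ℤ) + k' + 2 = 2 * l * a) (h : IsExtension 𝕜 (WMod 𝕜 k) M (WMod 𝕜 k')) :
    HasEigenvalues (TV M) (casVal 𝕜 (k + 2)) (casVal 𝕜 k) := by
  intro x
  rw [pow_two]
  refine h.tv.casPoly_smul (casPoly_smul_tv_weyl k) (fun x => ?_) x
  have h1 := casPoly_smul_tv_weyl k' x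
  have h2 := casVal_linked hq hk 0
  rw [add_zero, sub_zero] at h2
  rwa [casVal_linked hq hk, h2, mul_comm, add_sub_cancel_right] at h1

/-- The part of `M ⊗ V` away from the wall. -/
theorem IsExtension.tv_up (hl₁ : 1 < l) (hq : IsPrimitiveRoot (qq 𝕜) (2 * l))
    (hk : (k : ℤ) + (k' + 1 : ℕ) + 2 = 2 * l * a) (h1 : ¬ (l : ℤ) ∣ k + 1)
    (h : IsExtension 𝕜 (WMod 𝕜 k) M (WMod 𝕜 (k' + 1))) :
    IsExtension 𝕜 (WMod 𝕜 (k + 1)) (QuantumSl2.part (TV M) (casVal 𝕜 (k + 2)) (casVal 𝕜 k))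
      (WMod 𝕜 k') := by
  have hc : casVal 𝕜 ((k : ℤ) + 2) ≠ casVal 𝕜 k := by
    have := casVal_ne hl₁ hq h1
    rwa [add_assoc, add_sub_cancel_right] at this
  have e1 := casVal_linked hq hk 0
  have e2 := casVal_linked hq hk 2
  push_cast at e1 e2
  rw [add_zero, sub_zero] at e1
  rw [add_sub_cancel_right, add_assoc] at e2
  obtain ⟨A⟩ := part_tv_weyl_up rfl rfl hc
  obtain ⟨B⟩ := part_tv_weyl_down (k := k') e2.symm e1.symm hc.symm
  exact (h.tv.part hc (h.hasEigenvalues_tv hq hk)).congr A (.refl _ _) B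

/-- The part of `M ⊗ V` away from the wall, with the dual filtration. -/
theorem IsExtension.tv_up_dual [CharZero 𝕜] (hl₁ : 1 < l) (hq : IsPrimitiveRoot (qq 𝕜) (2 * l))
    (hk : (k : ℤ) + (k' + 1 : ℕ) + 2 = 2 * l * a) (h1 : ¬ (l : ℤ) ∣ k + 1)
    (h : IsExtension 𝕜 (WMod 𝕜 k) M (WMod 𝕜 (k' + 1)))
    (h' : IsExtension 𝕜 (DMod 𝕜 (k' + 1)) M (DMod 𝕜 k)) :
    IsExtension 𝕜 (DMod 𝕜 k') (QuantumSl2.part (TV M) (casVal 𝕜 (k + 2)) (casVal 𝕜 k))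
      (DMod 𝕜 (k + 1)) := by
  have hc : casVal 𝕜 ((k : ℤ) + 2) ≠ casVal 𝕜 k := by
    have := casVal_ne hl₁ hq h1
    rwa [add_assoc, add_sub_cancel_right] at this
  have e1 := casVal_linked hq hk 0
  have e2 := casVal_linked hq hk 2
  push_cast at e1 e2
  rw [add_zero, sub_zero] at e1
  rw [add_sub_cancel_right, add_assoc] at e2
  obtain ⟨A⟩ := part_tv_dual_up rfl rfl hc
  obtain ⟨B⟩ := part_tv_dual_down (k := k') e2.symm e1.symm hc.symm
  exact (h'.tv.part hc (h.hasEigenvalues_tv hq hk)).congr B (.refl _ _) A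

/-- The part of `M ⊗ V` towards the wall. -/
theorem IsExtension.tv_down (hl₁ : 1 < l) (hq : IsPrimitiveRoot (qq 𝕜) (2 * l))
    (hk : ((k + 1 : ℕ) : ℤ) + k' + 2 = 2 * l * a) (h1 : ¬ (l : ℤ) ∣ k + 2)
    (h : IsExtension 𝕜 (WMod 𝕜 (k + 1)) M (WMod 𝕜 k')) :
    IsExtension 𝕜 (WMod 𝕜 k) (QuantumSl2.part (TV M) (casVal 𝕜 (k + 1)) (casVal 𝕜 (k + 3)))
      (WMod 𝕜 (k' + 1)) := by
  have hc : casVal 𝕜 ((k : ℤ) + 1) ≠ casVal 𝕜 (k + 3) := by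
    have := casVal_ne hl₁ hq h1
    rw [add_assoc, add_sub_assoc] at this
    exact this.symm
  have e0 := h.hasEigenvalues_tv hq hk
  have e1 := casVal_linked hq hk 0
  have e2 := casVal_linked hq hk 2
  push_cast at e0 e1 e2
  rw [add_zero, sub_zero] at e1
  rw [add_sub_cancel_right] at e2
  rw [add_assoc] at e0 e1
  obtain ⟨A⟩ := part_tv_weyl_down (k := k) rfl rfl hc.symm
  obtain ⟨B⟩ := part_tv_weyl_up (k := k') e2.symm e1.symm hc
  exact (h.tv.part hc e0.symm).congr A (.refl _ _) B

/-- The partial trace acts on `W(k)` and on `W(k')` by the same nonzero scalar. -/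
theorem IsExtension.partialTrace_injective_of_linked (hl₁ : 1 < l)
    (hq : IsPrimitiveRoot (qq 𝕜) (2 * l))
    (hk : (k : ℤ) + k' + 2 = 2 * l * a) (h1 : ¬ (l : ℤ) ∣ k + 1) (h2 : ¬ (l : ℤ) ∣ k + 2)
    (h : IsExtension 𝕜 (WMod 𝕜 k) M (WMod 𝕜 k')) :
    Function.Injective (partialTrace M (eigProj (casVal 𝕜 (k + 2)) (casVal 𝕜 k))) := by
  have hc : casVal 𝕜 ((k : ℤ) + 2) ≠ casVal 𝕜 k := by
    have := casVal_ne hl₁ hq h1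
    rwa [add_assoc, add_sub_cancel_right] at this
  have key : ((casVal 𝕜 ((k : ℤ) + 2) - casVal 𝕜 k)⁻¹ *
      (qq 𝕜 * casVal 𝕜 2 * casVal 𝕜 (k + 1) - casVal 𝕜 k * (1 + qq 𝕜 ^ 2))) ≠ 0 := by
    refine mul_ne_zero (inv_ne_zero (sub_ne_zero.2 hc)) ?_
    have := translation_scalar_ne_zero hl₁ hq (n := k + 1) (by rwa [add_assoc])
    rwa [add_sub_cancel_right] at this
  have e0 := casVal_linked hq hk 0
  have e1 := casVal_linked hq hk 1
  have e2 := casVal_linked hq hk 2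
  rw [add_zero, sub_zero] at e0
  rw [add_sub_cancel_right] at e2
  rw [show (k : ℤ) + 2 - 1 = k + 1 by ring] at e1
  refine h.partialTrace_injective ?_ ?_
  · intro x y hxy
    rw [partialTrace_eigProj hc (cas_smul_weyl k) (casPoly_smul_tv_weyl k),
      partialTrace_eigProj hc (cas_smul_weyl k) (casPoly_smul_tv_weyl k)] at hxy
    exact smul_right_injective _ key hxy
  · have h3 (y : TV (WMod 𝕜 k')) : casPoly ((X - C (casVal 𝕜 ((k : ℤ) + 2))) *
        (X - C (casVal 𝕜 k))) • y = 0 := by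
      rw [← e0, ← e2, mul_comm]
      exact casPoly_smul_tv_weyl k' y
    intro x y hxy
    rw [partialTrace_eigProj hc (cas_smul_weyl' e1.symm) h3,
      partialTrace_eigProj hc (cas_smul_weyl' e1.symm) h3] at hxy
    exact smul_right_injective _ key hxy

/-- The part away from the wall of `M ⊗ V` is glued again, and `M` is recovered from it. -/
theorem IsGlued.up [CharZero 𝕜] [FiniteDimensional 𝕜 M] (hl₁ : 1 < l)
    (hq : IsPrimitiveRoot (qq 𝕜) (2 * l))
    (hk : (k : ℤ) + (k' + 1 : ℕ) + 2 = 2 * l * a) (h1 : ¬ (l : ℤ) ∣ k + 1) (h2 : ¬ (l : ℤ) ∣ k + 2)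
    (h : IsGlued 𝕜 M k (k' + 1)) :
    IsGlued 𝕜 (part (TV M) (casVal 𝕜 (k + 2)) (casVal 𝕜 k)) (k + 1) k' ∧
      Nonempty (M ≃ₗ[Uq 𝕜] part (TV (part (TV M) (casVal 𝕜 (k + 2)) (casVal 𝕜 k)))
        (casVal 𝕜 (k + 1)) (casVal 𝕜 (k + 3))) := by
  have hc : casVal 𝕜 ((k : ℤ) + 2) ≠ casVal 𝕜 k := by
    have := casVal_ne hl₁ hq h1
    rwa [add_assoc, add_sub_cancel_right] at this
  have hc' : casVal 𝕜 ((k : ℤ) + 1) ≠ casVal 𝕜 (k + 3) := by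
    have := casVal_ne hl₁ hq h2
    rw [add_assoc, add_sub_assoc] at this
    exact this.symm
  have hk' : ((k + 1 : ℕ) : ℤ) + k' + 2 = 2 * l * a := by rw [← hk]; push_cast; ring
  have hup := h.1.tv_up hl₁ hq hk h1
  obtain ⟨f, hf⟩ := exists_injective_tv_part hc (h.1.hasEigenvalues_tv hq hk)
    (h.1.partialTrace_injective_of_linked hl₁ hq hk h1 h2)
  refine ⟨⟨hup, h.1.tv_up_dual hl₁ hq hk h1 h.2.1, ?_⟩, ?_⟩
  · by_contra! hcon
    obtain ⟨x, hx⟩ := h.2.2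
    -- If the Casimir element `C` were scalar on the part of `M ⊗ V`, then `M`, embedded into the tensor
    -- product of this part with `V`, would be annihilated by `(C - c)(C - c')` with `c ≠ c'`, as well as
    -- by `(C - c)²`, hence by `C - c`.
    refine hx ?_
    have h3 := casPoly_smul_tv (n := (k : ℤ) + 2) (fun x => by
      have := hcon x
      push_cast at this
      rwa [add_assoc] at this) (f x)
    rw [← map_smul, map_eq_zero_iff f hf, casPoly_mul_smul, add_assoc,
      show (k : ℤ) + 2 - 1 = k + 1 by ring] at h3
    have h4 := h.1.cas_sq_smul hq hk x
    rw [pow_two, casPoly_mul_smul] at h4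
    have h5 := casPoly_X_sub_C_smul (casVal 𝕜 ((k : ℤ) + 1)) x
    generalize casPoly (X - C (casVal 𝕜 ((k : ℤ) + 1))) • x = y at h3 h4 h5
    rw [casPoly_X_sub_C_smul] at h3 h4
    have h6 : (casVal 𝕜 ((k : ℤ) + 1) - casVal 𝕜 (k + 3)) • y = 0 := by
      rw [sub_smul, ← sub_eq_zero.1 h4]
      exact h3
    rw [(smul_eq_zero_iff_right (sub_ne_zero.2 hc')).1 h6] at h5
    exact sub_eq_zero.1 h5.symm
  · refine nonempty_equiv_part hc' (h.1.cas_sq_smul hq hk) hf ?_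
    rw [(hup.tv_down hl₁ hq hk' h2).finrank_eq, h.1.finrank_eq]

/-- Past the last step of an alcove the module splits. -/
theorem IsGlued.up_wall [CharZero 𝕜] (hl : Odd l) (hl₁ : 1 < l) (hq : IsPrimitiveRoot (qq 𝕜) (2 * l))
    (hk : (k : ℤ) + (k' + 1 : ℕ) + 2 = 2 * l * a) (h1 : ¬ (l : ℤ) ∣ k + 1) (h2 : l ∣ k + 2)
    (hkk : k' ≤ k) (h : IsGlued 𝕜 M k (k' + 1)) :
    Nonempty (part (TV M) (casVal 𝕜 (k + 2)) (casVal 𝕜 k) ≃ₗ[Uq 𝕜]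
      (WMod 𝕜 (k + 1) × WMod 𝕜 k')) := by
  obtain ⟨e⟩ := weyl_equiv_dual_of_wall (𝕜 := 𝕜) hl hl₁ hq (m := k + 1) (.inr h2)
  exact nonempty_equiv_prod (by omega) e (h.1.tv_up hl₁ hq hk h1) (h.1.tv_up_dual hl₁ hq hk h1 h.2.1)

/-- Past the last step of an alcove, when the lower Weyl module `W(0)` has no neighbour below. -/
theorem IsGlued.up_wall_zero (hl₁ : 1 < l) (hq : IsPrimitiveRoot (qq 𝕜) (2 * l))
    (hk : (k : ℤ) + (0 : ℕ) + 2 = 2 * l * a) (h1 : ¬ (l : ℤ) ∣ k + 1) (h : IsGlued 𝕜 M k 0) :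
    Nonempty (part (TV M) (casVal 𝕜 (k + 2)) (casVal 𝕜 k) ≃ₗ[Uq 𝕜] WMod 𝕜 (k + 1)) := by
  have hc : casVal 𝕜 ((k : ℤ) + 2) ≠ casVal 𝕜 k := by
    have := casVal_ne hl₁ hq h1
    rwa [add_assoc, add_sub_cancel_right] at this
  obtain ⟨A⟩ := part_tv_weyl_up rfl rfl hc
  have e2 := casVal_linked hq hk 2
  rw [add_sub_cancel_right] at e2
  have : Subsingleton (part (TV (WMod 𝕜 0)) (casVal 𝕜 ((k : ℤ) + 2)) (casVal 𝕜 k)) := by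
    rw [part_tv_weyl_zero_down e2.symm]
    infer_instance
  obtain ⟨e⟩ := (h.1.tv.part hc (h.1.hasEigenvalues_tv hq hk)).nonempty_equiv_left
  exact ⟨e.symm.trans A⟩

end glued

/-! ### Crossing a wall -/

section wall

variable {l m : ℕ}

/-- The two eigenvalues of the Casimir element on `W(m+1) ⊗ V` coincide if `m + 1` is on a wall. -/
theorem casVal_wall (hq : IsPrimitiveRoot (qq 𝕜) (2 * l)) (hm : l ∣ m + 2) :
    casVal 𝕜 (m + 3) = casVal 𝕜 (m + 1) := by
  obtain ⟨b, hb⟩ := hm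
  have hb' : (m : ℤ) + 2 = l * b := by exact_mod_cast hb
  rw [← casVal_reflect hq b (m + 1)]
  congr 1
  linarith

theorem translation_scalar_wall_ne_zero (hl₁ : 1 < l) (hq : IsPrimitiveRoot (qq 𝕜) (2 * l))
    (hm : l ∣ m + 2) :
    qq 𝕜 * casVal 𝕜 2 * casVal 𝕜 (m + 2) - casVal 𝕜 (m + 1) * (1 + qq 𝕜 ^ 2) ≠ 0 := by
  have h := translation_scalar_ne_zero hl₁ hq (n := m + 2) (by
    intro h
    have h2 : (l : ℤ) ∣ m + 2 := by exact_mod_cast hm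
    have h3 := Int.le_of_dvd one_pos ((Int.dvd_add_right h2).1 h)
    omega)
  rwa [show (m : ℤ) + 2 - 1 = m + 1 by ring] at h

/-- If `m + 1` is on a wall, `W(m+1) ⊗ V` is glued from `W(m+2)` and `W(m)`. The Casimir element is not
a scalar, since the partial trace of `X - casVal (m+1)` is nonzero. -/
theorem isGlued_tv_weyl [CharZero 𝕜] (hl : Odd l) (hl₁ : 1 < l) (hq : IsPrimitiveRoot (qq 𝕜) (2 * l))
    (hm : l ∣ m + 2) : IsGlued 𝕜 (TV (WMod 𝕜 (m + 1))) (m + 2) m := by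
  obtain ⟨e⟩ := weyl_equiv_dual_of_wall (𝕜 := 𝕜) hl hl₁ hq (m := m + 1) (.inr hm)
  refine ⟨isExtension_weyl 𝕜 m,
    (isExtension_dual 𝕜 m).congr (.refl _ _) (TV.congr e.symm) (.refl _ _), ?_⟩
  by_contra! hcon
  have h1 := cap_cas_cup (𝕜 := 𝕜) (hwv 𝕜 (m + 1))
  have h2 (y : TV (WMod 𝕜 (m + 1))) : casHom _ (X : 𝕜[X]) y = casVal 𝕜 (m + 1) • y := by
    rw [casHom_apply, casPoly, aeval_X, hcon, ← casVal_wall hq hm]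
    push_cast
    ring_nf
  have h3 (z : TV (TV (WMod 𝕜 (m + 1)))) : TV.map (casHom _ (X : 𝕜[X])) z =
      casVal 𝕜 (m + 1) • z := TV.ext (h2 _) (h2 _)
  rw [h3, mkHom_restrictScalars, cap_cup, smul_smul, cas_smul_weyl' (c := casVal 𝕜 (m + 2))
    (by push_cast; ring_nf), smul_smul, ← sub_eq_zero, ← sub_smul] at h1
  refine smul_ne_zero ?_ (hwv_ne_zero (𝕜 := 𝕜) (m + 1)) h1
  rw [← neg_sub, neg_ne_zero]
  exact translation_scalar_wall_ne_zero hl₁ hq hm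

/-- Both copies of `W(m + 1)` in `W(m + 1) ⊗ V ⊗ V`: the images of the coevaluation and of its
composition with the Casimir element of `W(m + 1) ⊗ V`. -/
theorem part_tv_tv_weyl [CharZero 𝕜] (hl : Odd l) (hl₁ : 1 < l)
    (hq : IsPrimitiveRoot (qq 𝕜) (2 * l)) (hm : l ∣ m + 2) :
    Nonempty ((WMod 𝕜 (m + 1) × WMod 𝕜 (m + 1)) ≃ₗ[Uq 𝕜]
      part (TV (TV (WMod 𝕜 (m + 1)))) (casVal 𝕜 (m + 2)) (casVal 𝕜 (m + 4))) := by
  set W := WMod 𝕜 (m + 1)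
  have hκ := translation_scalar_wall_ne_zero hl₁ hq hm
  have h3 : ¬ (l : ℤ) ∣ m + 3 := by
    intro h
    have h2 : (l : ℤ) ∣ m + 2 := by exact_mod_cast hm
    have h3 := Int.le_of_dvd one_pos ((Int.dvd_add_right h2).1 h)
    omega
  have hc : casVal 𝕜 ((m : ℤ) + 2) ≠ casVal 𝕜 (m + 4) := by
    have := casVal_ne hl₁ hq h3
    rw [add_assoc, add_sub_assoc] at this
    exact this.symm
  have hcas (x : W) : cas 𝕜 • x = casVal 𝕜 (m + 2) • x := cas_smul_weyl' (by push_cast; ring_nf) x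
  -- The Casimir element `ξ` of `W ⊗ V` satisfies `(ξ - c₁)² = 0`.
  let ξ : TV W →ₗ[Uq 𝕜] TV W := casHom (TV W) (X : 𝕜[X])
  have hξ (y : TV W) : ξ (ξ y) = (2 * casVal 𝕜 (m + 1)) • ξ y - (casVal 𝕜 (m + 1) ^ 2) • y := by
    have h1 := casPoly_smul_tv (M := W) (n := m + 2) hcas y
    rw [show (m : ℤ) + 2 + 1 = m + 3 by ring, show (m : ℤ) + 2 - 1 = m + 1 by ring,
      casVal_wall hq hm, show (X - C (casVal 𝕜 (m + 1))) * (X - C (casVal 𝕜 (m + 1))) =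
        X * X + (C (-(2 * casVal 𝕜 (m + 1))) * X + C (casVal 𝕜 (m + 1) ^ 2)) by
        simp only [C_neg, C_mul, C_pow, C_ofNat]; ring,
      casPoly_add_smul, casPoly_add_smul, casPoly_mul_smul, casPoly_mul_smul, casPoly_C_smul,
      casPoly_C_smul] at h1
    change ξ (ξ y) + (-(2 * casVal 𝕜 (m + 1)) • ξ y + casVal 𝕜 (m + 1) ^ 2 • y) = 0 at h1
    rw [eq_neg_of_add_eq_zero_left h1]
    module
  -- Composing `i` with `cap` and with `cap ∘ ξ` gives a `2 × 2` matrix of scalars, whose determinant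
  -- `-(w - c₁ u)²` is nonzero by `translation_scalar_wall_ne_zero`.
  let i : W × W →ₗ[Uq 𝕜] TV (TV W) :=
    (cup 𝕜 W).coprod (TV.map ξ ∘ₗ cup 𝕜 W)
  have hi : Function.Injective i := by
    rw [injective_iff_map_eq_zero]
    rintro ⟨x, y⟩ h
    replace h : cup 𝕜 W x + TV.map ξ (cup 𝕜 W y) = 0 := h
    have h1 := congrArg (cap 𝕜 W) h
    have h2 := congrArg (fun z => cap 𝕜 W (TV.map ξ z)) h
    have h4 : TV.map ξ (TV.map ξ (cup 𝕜 W y)) = (2 * casVal 𝕜 (m + 1)) • TV.map ξ (cup 𝕜 W y) -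
        (casVal 𝕜 (m + 1) ^ 2) • cup 𝕜 W y := TV.ext (hξ _) (hξ _)
    have h5 (x : W) : cap 𝕜 W (TV.map ξ (cup 𝕜 W x)) =
        (qq 𝕜 * casVal 𝕜 2 * casVal 𝕜 (m + 2)) • x := by
      rw [← smul_smul, ← hcas]
      exact cap_cas_cup x
    simp only [map_add, map_zero, h4, map_sub, mkHom_restrictScalars, h5, cap_cup, smul_smul,
      ← sub_smul] at h1 h2
    generalize qq 𝕜 * casVal 𝕜 2 * casVal 𝕜 (m + 2) = w at hκ h1 h2
    generalize casVal 𝕜 (m + 1) = c₁ at hκ h1 h2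
    generalize (1 + qq 𝕜 ^ 2 : 𝕜) = u at hκ h1 h2
    have h6 : (-(w - c₁ * u) ^ 2) • y = 0 := by
      calc (-(w - c₁ * u) ^ 2) • y = u • (w • x + (2 * c₁ * w - c₁ ^ 2 * u) • y) - w • (u • x + w • y) := by
            module
        _ = 0 := by rw [h1, h2, smul_zero, smul_zero, sub_zero]
    have hy := (smul_eq_zero_iff_right (neg_ne_zero.2 (pow_ne_zero 2 hκ))).1 h6
    rw [hy, smul_zero, add_zero] at h1 h2
    have h7 : (w - c₁ * u) • x = 0 := by rw [sub_smul, h2, mul_smul, h1, smul_zero, sub_zero]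
    exact Prod.ext ((smul_eq_zero_iff_right hκ).1 h7) hy
  refine nonempty_equiv_part hc (fun x => ?_) hi ?_
  · have h1 : cas 𝕜 • x = casVal 𝕜 (m + 2) • x := Prod.ext (hcas x.1) (hcas x.2)
    rw [pow_two, casPoly_mul_smul, casPoly_X_sub_C_smul_eq_zero h1, smul_zero]
  · obtain ⟨b, hb⟩ := hm
    have hb' : (m : ℤ) + 2 = l * b := by exact_mod_cast hb
    have h1 := (isExtension_weyl 𝕜 m).tv_down (k := m + 1) hl₁ hq (a := b)
      (by push_cast; linarith) (by push_cast; rwa [add_assoc])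
    have e1 : (((m + 1 : ℕ) : ℤ) + 1) = m + 2 := by push_cast; ring
    have e2 : (((m + 1 : ℕ) : ℤ) + 3) = m + 4 := by push_cast; ring
    rw [e1, e2] at h1
    exact (Module.finrank_prod (R := 𝕜) (M := W) (M' := W)).trans h1.finrank_eq.symm

end wall

end

section

variable {𝕜 : Type*} [Field 𝕜] [Algebra ℤ[T;T⁻¹] 𝕜]

/-! ### Direct summands -/

section summand

variable {A B M : Type*} [AddCommGroup A] [Module (Uq 𝕜) A]
  [AddCommGroup B] [Module (Uq 𝕜) B] [AddCommGroup M] [Module (Uq 𝕜) M]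

variable (𝕜 A B) in
/-- `A` is isomorphic to a direct summand of `B`. -/
def IsSummand : Prop :=
  ∃ (i : A →ₗ[Uq 𝕜] B) (p : B →ₗ[Uq 𝕜] A), p ∘ₗ i = LinearMap.id

theorem IsSummand.of_equiv (e : A ≃ₗ[Uq 𝕜] B) : IsSummand 𝕜 A B :=
  ⟨e.toLinearMap, e.symm.toLinearMap, LinearMap.ext e.symm_apply_apply⟩

theorem IsSummand.trans (h : IsSummand 𝕜 A B) (h' : IsSummand 𝕜 B M) : IsSummand 𝕜 A M := by
  obtain ⟨i, p, h⟩ := h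
  obtain ⟨i', p', h'⟩ := h'
  refine ⟨i' ∘ₗ i, p ∘ₗ p', LinearMap.ext fun x => ?_⟩
  exact (congrArg p (LinearMap.congr_fun h' (i x))).trans (LinearMap.congr_fun h x)

theorem IsSummand.prod_left : IsSummand 𝕜 A (A × B) :=
  ⟨LinearMap.inl _ _ _, LinearMap.fst _ _ _, LinearMap.fst_comp_inl _ _ _⟩

theorem IsSummand.of_isCompl {P Q : Submodule (Uq 𝕜) M} (h : IsCompl P Q) : IsSummand 𝕜 P M :=
  ⟨P.subtype, P.projectionOnto Q h, LinearMap.ext fun x => Submodule.projectionOnto_apply_left h x⟩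

theorem IsSummand.exists_submodule (h : IsSummand 𝕜 A B) :
    ∃ P : Submodule (Uq 𝕜) B, Nonempty (A ≃ₗ[Uq 𝕜] P) ∧ ∃ Q, IsCompl P Q := by
  obtain ⟨i, p, h⟩ := h
  have hpi (x : A) : p (i x) = x := LinearMap.congr_fun h x
  have hi : Function.Injective i := Function.LeftInverse.injective hpi
  refine ⟨i.range, ⟨LinearEquiv.ofInjective i hi⟩, p.ker, ?_, ?_⟩
  · rw [Submodule.disjoint_def]
    rintro _ ⟨x, rfl⟩ hx
    rw [LinearMap.mem_ker, hpi] at hx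
    rw [hx, map_zero]
  · rw [codisjoint_iff, eq_top_iff]
    intro y _
    refine Submodule.mem_sup.2 ⟨i (p y), ⟨_, rfl⟩, y - i (p y), ?_, add_sub_cancel _ _⟩
    rw [LinearMap.mem_ker, map_sub, hpi, sub_self]

/-- The functor `- ⊗ V` preserves direct summands. -/
theorem IsSummand.tv [Module 𝕜 A] [IsScalarTower 𝕜 (Uq 𝕜) A] [Module 𝕜 B]
    [IsScalarTower 𝕜 (Uq 𝕜) B] (h : IsSummand 𝕜 A B) : IsSummand 𝕜 (TV A) (TV B) := by
  obtain ⟨i, p, h⟩ := h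
  exact ⟨TV.map i, TV.map p, by rw [← TV.map_comp, h, TV.map_id]⟩

theorem isSummand_part [Module 𝕜 M] [IsScalarTower 𝕜 (Uq 𝕜) M] {c₁ c₂ : 𝕜} (hc : c₁ ≠ c₂)
    (h : HasEigenvalues M c₁ c₂) : IsSummand 𝕜 (part M c₁ c₂) M :=
  .of_isCompl (h.isCompl hc)

/-- `M` is the direct sum of its two generalized eigenspaces. -/
theorem HasEigenvalues.nonempty_equiv [Module 𝕜 M] [IsScalarTower 𝕜 (Uq 𝕜) M] {c₁ c₂ : 𝕜}
    (hc : c₁ ≠ c₂) (h : HasEigenvalues M c₁ c₂) :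
    Nonempty (M ≃ₗ[Uq 𝕜] (part M c₁ c₂ × part M c₂ c₁)) :=
  ⟨(Submodule.prodEquivOfIsCompl _ _ (h.isCompl hc)).symm⟩

end summand

/-! ### Filtrations -/

section filtration

variable {M : Type*} [AddCommGroup M] [Module (Uq 𝕜) M]

theorem hasFiltration_of_isExtension {S : ℕ → LatticeRep} {a b : ℕ}
    (h : IsExtension 𝕜 ((S a).Mod 𝕜) M ((S b).Mod 𝕜)) : HasFiltration 𝕜 M S [a, b] := by
  obtain ⟨f, g, hf, hg, hfg⟩ := h
  refine ⟨fun i => if i = 0 then ⊥ else if i = 1 then f.range else ⊤, rfl, rfl, ?_⟩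
  intro i hi
  have hi : i < 2 := hi
  interval_cases i
  · refine ⟨bot_le, ⟨(Submodule.quotEquivOfEqBot _ ?_).trans (LinearEquiv.ofInjective f hf).symm⟩⟩
    rw [Submodule.submoduleOf]
    exact Submodule.ker_subtype _
  · refine ⟨le_top, ?_⟩
    let g' : (⊤ : Submodule (Uq 𝕜) M) →ₗ[Uq 𝕜] (S b).Mod 𝕜 := g ∘ₗ Submodule.subtype ⊤
    have hg' : Function.Surjective g' := fun y => by
      obtain ⟨x, rfl⟩ := hg y
      exact ⟨⟨x, trivial⟩, rfl⟩
    have hk : f.range.submoduleOf ⊤ = g'.ker := by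
      ext x
      exact (hfg x).symm
    exact ⟨(Submodule.quotEquivOfEq _ _ hk).trans (g'.quotKerEquivOfSurjective hg')⟩

theorem hasFiltration_of_equiv {S : ℕ → LatticeRep} {a : ℕ} (e : M ≃ₗ[Uq 𝕜] (S a).Mod 𝕜) :
    HasFiltration 𝕜 M S [a] := by
  refine ⟨fun i => if i = 0 then ⊥ else ⊤, rfl, rfl, ?_⟩
  intro i hi
  have hi : i < 1 := hi
  interval_cases i
  refine ⟨bot_le, ⟨(Submodule.quotEquivOfEqBot _ ?_).trans (Submodule.topEquiv.trans e)⟩⟩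
  exact Submodule.ker_subtype _

/-- The element `E^{(k)} F^{(k)}` does not act nilpotently on a module with `W(k)` in a Weyl
filtration. -/
theorem exists_topElt_smul_ne_zero {w : List ℕ} {k : ℕ} (h : HasFiltration 𝕜 M weyl w)
    (hk : k ∈ w) : ∃ x : M, topElt 𝕜 k • topElt 𝕜 k • x ≠ 0 := by
  obtain ⟨Fil, -, -, h⟩ := h
  obtain ⟨i, hi, rfl⟩ := List.mem_iff_getElem.1 hk
  obtain ⟨-, ⟨e⟩⟩ := h i hi
  obtain ⟨y, hy⟩ := e.surjective (hwv 𝕜 w[i])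
  obtain ⟨x, rfl⟩ := Submodule.Quotient.mk_surjective _ y
  refine ⟨x, fun hx => hwv_ne_zero (𝕜 := 𝕜) w[i] ?_⟩
  rw [← topElt_smul_hwv, ← topElt_smul_hwv, ← hy, ← map_smul, ← map_smul, ← Submodule.Quotient.mk_smul,
    ← Submodule.Quotient.mk_smul]
  have : topElt 𝕜 w[i] • topElt 𝕜 w[i] • x = 0 := Subtype.ext hx
  rw [this, Submodule.Quotient.mk_zero, map_zero]

end filtration

/-! ### Indecomposable tilting modules -/

section indecomposable

variable {M N : Type*} [AddCommGroup M] [Module 𝕜 M] [Module (Uq 𝕜) M] [IsScalarTower 𝕜 (Uq 𝕜) M]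
  [AddCommGroup N] [Module 𝕜 N] [Module (Uq 𝕜) N] [IsScalarTower 𝕜 (Uq 𝕜) N]

/-- `z` spans the image of `E^{(k)} F^{(k)}`, which fixes it. -/
def IsTopVector (k : ℕ) (z : M) : Prop :=
  z ≠ 0 ∧ topElt 𝕜 k • z = z ∧ ∀ x : M, ∃ c : 𝕜, topElt 𝕜 k • x = c • z

theorem isTopVector_hwv (k : ℕ) : IsTopVector (𝕜 := 𝕜) k (hwv 𝕜 k) :=
  ⟨hwv_ne_zero k, topElt_smul_hwv k, fun x => ⟨_, topElt_smul_weyl k x⟩⟩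

/-- In a submodule of `V^{⊗k}` containing `W(k)`, the highest weight vector spans the image of
`E⁽ᵏ⁾F⁽ᵏ⁾`, which factors through the weight space of `V^{⊗k}` for `-k`, a line. -/
theorem isTopVector_map {k : ℕ} {f : WMod 𝕜 k →ₗ[Uq 𝕜] M} (hf : Function.Injective f)
    {i : M →ₗ[Uq 𝕜] TensorPower 𝕜 k} (hi : Function.Injective i) :
    IsTopVector (𝕜 := 𝕜) k (f (hwv 𝕜 k)) := by
  have h0 : f (hwv 𝕜 k) ≠ 0 := fun h => hwv_ne_zero (𝕜 := 𝕜) k ((map_eq_zero_iff f hf).1 h)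
  have h1 : topElt 𝕜 k • f (hwv 𝕜 k) = f (hwv 𝕜 k) := by rw [← map_smul, topElt_smul_hwv]
  refine ⟨h0, h1, fun x => ?_⟩
  obtain ⟨z, hz⟩ := exists_topElt_smul_tensorPower (𝕜 := 𝕜) k
  obtain ⟨c, hc⟩ := hz (i x)
  obtain ⟨d, hd⟩ := hz (i (f (hwv 𝕜 k)))
  rw [← map_smul] at hc
  rw [← map_smul, h1] at hd
  have hd0 : d ≠ 0 := by
    rintro rfl
    rw [zero_smul] at hd
    exact h0 ((map_eq_zero_iff i hi).1 hd)
  refine ⟨c * d⁻¹, hi ?_⟩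
  rw [mkHom_restrictScalars, hc, hd, smul_smul, mul_assoc, inv_mul_cancel₀ hd0, mul_one]

/-- The vector `z` lies in one of two submodules if it lies in their sum. -/
theorem IsTopVector.mem_or_mem {k : ℕ} {z : M} (hz : IsTopVector (𝕜 := 𝕜) k z)
    {P Q : Submodule (Uq 𝕜) M} (h : z ∈ P ⊔ Q) : z ∈ P ∨ z ∈ Q := by
  obtain ⟨p, hp, q, hq, rfl⟩ := Submodule.mem_sup.1 h
  obtain ⟨c, hc⟩ := hz.2.2 p
  obtain ⟨d, hd⟩ := hz.2.2 q
  have key (c : 𝕜) (hc : c ≠ 0) (P : Submodule (Uq 𝕜) M) {x z : M} (hx : x ∈ P)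
      (h : topElt 𝕜 k • x = c • z) : z ∈ P := by
    have h1 : z = c⁻¹ • topElt 𝕜 k • x := by rw [h, smul_smul, inv_mul_cancel₀ hc, one_smul]
    rw [h1, ← smul_assoc]
    exact P.smul_mem _ hx
  by_cases h0 : c = 0
  · refine .inr (key d ?_ Q hq hd)
    rintro rfl
    apply hz.1
    rw [← hz.2.1, smul_add, hc, hd, h0, zero_smul, add_zero]
  · exact .inl (key c h0 P hp hc)

/-- Weyl modules are indecomposable, since the highest weight vector generates. -/
theorem weyl_eq_top_or {k : ℕ} {P Q : Submodule (Uq 𝕜) (WMod 𝕜 k)} (h : P ⊔ Q = ⊤) :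
    P = ⊤ ∨ Q = ⊤ :=
  ((isTopVector_hwv k).mem_or_mem (h ▸ trivial)).imp mem_of_hwv_mem mem_of_hwv_mem

theorem isIndecomposable_of_equiv_weyl {k : ℕ} (e : M ≃ₗ[Uq 𝕜] WMod 𝕜 k) :
    IsIndecomposable 𝕜 M := by
  have : Nontrivial (WMod 𝕜 k) := ⟨_, _, hwv_ne_zero k⟩
  refine ⟨e.toEquiv.nontrivial, fun P Q h => ?_⟩
  have h1 : P.map e.toLinearMap ⊔ Q.map e.toLinearMap = ⊤ := by
    rw [← Submodule.map_sup, h.sup_eq_top, Submodule.map_top, LinearEquiv.range]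
  have key (P Q : Submodule (Uq 𝕜) M) (h : IsCompl P Q) (hP : P.map e.toLinearMap = ⊤) : Q = ⊥ := by
    have : P = ⊤ := by
      rw [← Submodule.comap_map_eq_of_injective e.injective P]
      exact (congrArg _ hP).trans (Submodule.comap_top _)
    rw [this] at h
    exact eq_bot_of_top_isCompl h
  exact (weyl_eq_top_or h1).symm.imp (key Q P h.symm) (key P Q h)

/-- A glued module inside `V^{⊗k}` is indecomposable: one of two complements contains `W(k)`, and if the
other one were nonzero, it would map onto `W(k')`, so that the Casimir element would be a scalar. -/
theorem IsGlued.isIndecomposable {l k k' : ℕ} {a : ℤ} (hq : IsPrimitiveRoot (qq 𝕜) (2 * l))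
    (hk : (k : ℤ) + k' + 2 = 2 * l * a) (h : IsGlued 𝕜 M k k')
    {i : M →ₗ[Uq 𝕜] TensorPower 𝕜 k} (hi : Function.Injective i) : IsIndecomposable 𝕜 M := by
  obtain ⟨⟨f, g, hf, hg, hfg⟩, -, x₀, hx₀⟩ := h
  have hz := isTopVector_map hf hi
  refine ⟨⟨_, _, hz.1⟩, ?_⟩
  have hcas : ∀ x : WMod 𝕜 k', cas 𝕜 • x = casVal 𝕜 (k + 1) • x := by
    refine cas_smul_weyl' ?_
    rw [casVal_linked hq hk]
    ring_nf
  have key (P Q : Submodule (Uq 𝕜) M) (h : IsCompl P Q) (hP : f (hwv 𝕜 k) ∈ P) : Q = ⊥ := by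
    have h1 : P.comap f = ⊤ := mem_of_hwv_mem hP
    have h1' (a) : f a ∈ P := h1.ge (Submodule.mem_top (x := a))
    have h2 : P.map g ⊔ Q.map g = ⊤ := by
      rw [← Submodule.map_sup, h.sup_eq_top, Submodule.map_top, LinearMap.range_eq_top.2 hg]
    rcases weyl_eq_top_or h2 with h3 | h3
    · have : P = ⊤ := by
        rw [eq_top_iff]
        intro x _
        obtain ⟨p, hp, hpx⟩ := h3.ge (Submodule.mem_top (x := g x))
        obtain ⟨a, ha⟩ := (hfg (x - p)).1 (by rw [map_sub, hpx, sub_self])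
        rw [← sub_add_cancel x p, ← ha]
        exact P.add_mem (h1' a) hp
      rw [this] at h
      exact eq_bot_of_top_isCompl h
    · refine absurd ?_ hx₀
      obtain ⟨q, hq, hqx⟩ := h3.ge (Submodule.mem_top (x := g x₀))
      obtain ⟨a, ha⟩ := (hfg (x₀ - q)).1 (by rw [map_sub, hqx, sub_self])
      have h4 : cas 𝕜 • f a = casVal 𝕜 (k + 1) • f a := by
        rw [← map_smul, cas_smul_weyl, mkHom_restrictScalars]
      have h5 : cas 𝕜 • q - casVal 𝕜 (k + 1) • q ∈ Q := by
        rw [← algebraMap_smul (Uq 𝕜) (casVal 𝕜 (k + 1)) q]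
        exact Q.sub_mem (Q.smul_mem _ hq) (Q.smul_mem _ hq)
      obtain ⟨b, hb⟩ := (hfg (cas 𝕜 • q - casVal 𝕜 (k + 1) • q)).1 (by
        rw [map_sub, map_smul, hcas, mkHom_restrictScalars, sub_self])
      have h6 := Submodule.disjoint_def.1 h.disjoint _ (hb ▸ h1' b) h5
      rw [← sub_add_cancel x₀ q, ← ha, smul_add, smul_add, h4, sub_eq_zero.1 h6]
  intro P Q h
  exact (hz.mem_or_mem (h.sup_eq_top ▸ Submodule.mem_top)).symm.imp (key Q P h.symm) (key P Q h)

/-- Fitting's lemma: an endomorphism of an indecomposable module which fixes a nonzero vector is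
bijective. -/
theorem IsIndecomposable.bijective [FiniteDimensional 𝕜 M] (h : IsIndecomposable 𝕜 M)
    {f : M →ₗ[Uq 𝕜] M} {z : M} (hz : z ≠ 0) (hf : f z = z) : Function.Bijective f := by
  have : IsArtinian (Uq 𝕜) M := isArtinian_of_tower 𝕜 inferInstance
  have : IsNoetherian (Uq 𝕜) M := isNoetherian_of_tower 𝕜 inferInstance
  obtain ⟨n, hn⟩ := (f.eventually_isCompl_ker_pow_range_pow).exists_forall_of_atTop
  have h1 := hn (n + 1) (by omega)
  have h2 (m : ℕ) : (f ^ m) z = z := by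
    induction m with
    | zero => rfl
    | succ m ih => rw [pow_succ, Module.End.mul_apply, hf, ih]
  have h3 : Function.Injective f := by
    rcases h.2 _ _ h1 with h4 | h4
    · rw [pow_succ] at h4
      have := LinearMap.ker_eq_bot.1 h4
      exact Function.Injective.of_comp this
    · have : (f ^ (n + 1)) z ∈ (f ^ (n + 1)).range := ⟨z, rfl⟩
      rw [h4, h2, Submodule.mem_bot] at this
      exact absurd this hz
  exact ⟨h3, (LinearMap.injective_iff_surjective (f := f.restrictScalars 𝕜)).1 h3⟩

/-- A summand of `V^{⊗k}` with `W(k)` in a Weyl filtration contains the image of `E⁽ᵏ⁾F⁽ᵏ⁾`. -/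
theorem IsIndecTilting.exists_apply_eq {k : ℕ} {z : TensorPower 𝕜 k}
    (hz : ∀ x : TensorPower 𝕜 k, ∃ c : 𝕜, topElt 𝕜 k • x = c • z) (hM : IsIndecTilting 𝕜 M k)
    {i : M →ₗ[Uq 𝕜] TensorPower 𝕜 k} {p : TensorPower 𝕜 k →ₗ[Uq 𝕜] M} (hip : ∀ x, p (i x) = x) :
    z ≠ 0 ∧ ∃ x, i x = z := by
  obtain ⟨w, hw, hk, -⟩ := hM.2.2
  obtain ⟨x, hx⟩ := exists_topElt_smul_ne_zero hw
    (List.one_le_count_iff.1 hk.ge)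
  have hx' : topElt 𝕜 k • x ≠ 0 := fun h => hx (by rw [h, smul_zero])
  obtain ⟨c, hc⟩ := hz (i x)
  rw [← map_smul] at hc
  have h0 : i (topElt 𝕜 k • x) ≠ 0 := fun h => hx' (by rw [← hip (_ • _), h, map_zero])
  have hc0 : c ≠ 0 := by
    rintro rfl
    exact h0 (by rw [hc, zero_smul])
  refine ⟨fun h => h0 (by rw [hc, h, smul_zero]), c⁻¹ • topElt 𝕜 k • x, ?_⟩
  rw [mkHom_restrictScalars, hc, smul_smul, inv_mul_cancel₀ hc0, one_smul]

/-- The indecomposable tilting module of highest weight `k` in `V^{⊗k}` is unique. -/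
theorem IsIndecTilting.nonempty_equiv [FiniteDimensional 𝕜 M] [FiniteDimensional 𝕜 N] {k : ℕ}
    (hM : IsIndecTilting 𝕜 M k) (hN : IsIndecTilting 𝕜 N k)
    (hM' : IsSummand 𝕜 M (TensorPower 𝕜 k)) (hN' : IsSummand 𝕜 N (TensorPower 𝕜 k)) :
    Nonempty (M ≃ₗ[Uq 𝕜] N) := by
  obtain ⟨i, p, hip⟩ := hM'
  obtain ⟨i', p', hip'⟩ := hN'
  replace hip (x) : p (i x) = x := LinearMap.congr_fun hip x
  replace hip' (x) : p' (i' x) = x := LinearMap.congr_fun hip' x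
  obtain ⟨z, hz⟩ := exists_topElt_smul_tensorPower (𝕜 := 𝕜) k
  obtain ⟨hz0, x, hx⟩ := hM.exists_apply_eq hz hip
  obtain ⟨-, y, hy⟩ := hN.exists_apply_eq hz hip'
  have hx0 : x ≠ 0 := by
    rintro rfl
    exact hz0 (by rw [← hx, map_zero])
  have hy0 : y ≠ 0 := by
    rintro rfl
    exact hz0 (by rw [← hy, map_zero])
  have hpx : p z = x := by rw [← hx, hip]
  have hpy : p' z = y := by rw [← hy, hip']
  have h1 : Function.Bijective ((p ∘ₗ i') ∘ₗ (p' ∘ₗ i)) :=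
    hM.1.bijective hx0 (by simp only [LinearMap.comp_apply]; rw [hx, hpy, hy, hpx])
  have h2 : Function.Bijective ((p' ∘ₗ i) ∘ₗ (p ∘ₗ i')) :=
    hN.1.bijective hy0 (by simp only [LinearMap.comp_apply]; rw [hy, hpx, hx, hpy])
  exact ⟨LinearEquiv.ofBijective (p' ∘ₗ i)
    ⟨Function.Injective.of_comp (f := p ∘ₗ i') (g := p' ∘ₗ i) h1.1,
      Function.Surjective.of_comp (f := p' ∘ₗ i) (g := p ∘ₗ i') h2.2⟩⟩

end indecomposable

end

section

variable {𝕜 : Type*} [Field 𝕜] [Algebra ℤ[T;T⁻¹] 𝕜]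

/-! ### The structure of the indecomposable tilting modules -/

section shape

variable {M N : Type*} [AddCommGroup M] [Module 𝕜 M] [Module (Uq 𝕜) M] [IsScalarTower 𝕜 (Uq 𝕜) M]
  [AddCommGroup N] [Module 𝕜 N] [Module (Uq 𝕜) N] [IsScalarTower 𝕜 (Uq 𝕜) N] {l k : ℕ}

variable (𝕜 M) in
/-- `M` has the structure of `T(k)`: it is the Weyl module `W(k)` if `k < l` or `l ∣ k + 1`, and
for `k = a l + j` with `1 ≤ a`, `0 ≤ j ≤ l - 2`, it is glued from `W(k)` and `W(a l - j - 2)`. -/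
def HasShape (l k : ℕ) : Prop :=
  ((k < l ∨ l ∣ k + 1) ∧ Nonempty (M ≃ₗ[Uq 𝕜] WMod 𝕜 k)) ∨
    ∃ a j k' : ℕ, 1 ≤ a ∧ j + 2 ≤ l ∧ k = a * l + j ∧ k' + j + 2 = a * l ∧ IsGlued 𝕜 M k k'

theorem HasShape.congr (h : HasShape 𝕜 M l k) (e : M ≃ₗ[Uq 𝕜] N) : HasShape 𝕜 N l k := by
  rcases h with ⟨h, ⟨f⟩⟩ | ⟨a, j, k', h₁, h₂, h₃, h₄, h⟩
  · exact .inl ⟨h, ⟨e.symm.trans f⟩⟩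
  · exact .inr ⟨a, j, k', h₁, h₂, h₃, h₄, h.congr e⟩

theorem not_dvd_mul_add {l : ℕ} (a : ℕ) {r : ℕ} (hr : 0 < r) (hr' : r < l) : ¬ l ∣ a * l + r := by
  intro h
  exact absurd (Nat.le_of_dvd hr ((Nat.dvd_add_right (dvd_mul_left l a)).1 h)) (by omega)

theorem not_dvd_int {l n : ℕ} (h : ¬ l ∣ n) {m : ℤ} (hm : m = n) : ¬ (l : ℤ) ∣ m := by
  rw [hm]
  exact_mod_cast h

/-- A submodule of `V^{⊗k}` with the structure of `T(k)` is an indecomposable tilting module of highest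
weight `k`. -/
theorem HasShape.isIndecTilting [CharZero 𝕜] (hl : Odd l) (hl₁ : 1 < l)
    (hq : IsPrimitiveRoot (qq 𝕜) (2 * l)) (h : HasShape 𝕜 M l k)
    {i : M →ₗ[Uq 𝕜] TensorPower 𝕜 k} (hi : Function.Injective i) : IsIndecTilting 𝕜 M k := by
  rcases h with ⟨h, ⟨e⟩⟩ | ⟨a, j, k', h₁, h₂, h₃, h₄, h⟩
  · obtain ⟨d⟩ := weyl_equiv_dual_of_wall (𝕜 := 𝕜) hl hl₁ hq h
    have hw := hasFiltration_of_equiv (S := weyl) e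
    exact ⟨isIndecomposable_of_equiv_weyl e, ⟨⟨_, hw⟩, _,
      hasFiltration_of_equiv (S := fun m => (weyl m).dual) (e.trans d)⟩, _, hw, by simp, by simp⟩
  · have hw := hasFiltration_of_isExtension (S := weyl) h.1
    have hk : k' < k := by omega
    refine ⟨h.isIndecomposable hq (a := a) ?_ hi, ⟨⟨_, hw⟩, _,
      hasFiltration_of_isExtension (S := fun m => (weyl m).dual) h.2.1⟩, _, hw, ?_, ?_⟩
    · have h₃' : (k : ℤ) = a * l + j := by exact_mod_cast h₃
      have h₄' : (k' : ℤ) + j + 2 = a * l := by exact_mod_cast h₄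
      linarith
    · rw [List.count_cons_self, List.count_cons_of_ne hk.ne, List.count_nil]
    · intro m hm
      simp only [List.mem_cons, List.not_mem_nil, or_false] at hm
      omega

theorem IsSummand.exists_hasShape (hs : IsSummand 𝕜 M N) (h : HasShape 𝕜 M l k) :
    ∃ P : Submodule (Uq 𝕜) N, HasShape 𝕜 P l k ∧ ∃ Q, IsCompl P Q := by
  obtain ⟨P, ⟨e⟩, hP⟩ := hs.exists_submodule
  exact ⟨P, h.congr e, hP⟩

theorem hasEigenvalues_tv_weyl (k : ℕ) :
    HasEigenvalues (TV (WMod 𝕜 k)) (casVal 𝕜 (k + 2)) (casVal 𝕜 k) := fun x => by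
  rw [pow_two, casPoly_mul_smul, casPoly_smul_tv_weyl]

theorem casVal_add_two_ne (hl₁ : 1 < l) (hq : IsPrimitiveRoot (qq 𝕜) (2 * l)) (h : ¬ l ∣ k + 1) :
    casVal 𝕜 ((k : ℤ) + 2) ≠ casVal 𝕜 k := by
  have := casVal_ne hl₁ hq (not_dvd_int h (m := k + 1) (by push_cast; ring))
  rwa [add_assoc, add_sub_cancel_right] at this

/-- If `M` has the structure of `T(k)`, a summand of `M ⊗ V` has that of `T(k+1)`. -/
theorem HasShape.next [CharZero 𝕜] [FiniteDimensional 𝕜 M] (hl : Odd l) (hl₁ : 1 < l)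
    (hq : IsPrimitiveRoot (qq 𝕜) (2 * l)) (h : HasShape 𝕜 M l k) :
    ∃ P : Submodule (Uq 𝕜) (TV M), HasShape 𝕜 P l (k + 1) ∧ ∃ Q, IsCompl P Q := by
  rcases h with ⟨h, ⟨e⟩⟩ | ⟨a, j, k', h₁, h₂, h₃, h₄, h⟩
  · by_cases hk : l ∣ k + 1
    · obtain ⟨m, rfl⟩ : ∃ m, k = m + 1 := ⟨k - 1, by have := Nat.le_of_dvd (by omega) hk; omega⟩
      refine (IsSummand.of_equiv (TV.congr e.symm)).exists_hasShape (.inr ?_)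
      obtain ⟨b, hb⟩ := hk
      refine ⟨b, 0, m, ?_, by omega, by rw [mul_comm, ← hb], by rw [mul_comm, ← hb],
        isGlued_tv_weyl hl hl₁ hq ⟨b, hb⟩⟩
      rcases Nat.eq_zero_or_pos b with rfl | h
      · omega
      · exact h
    · have hk' : k + 1 < l := by
        rcases h with h | h
        · rcases Nat.lt_or_ge (k + 1) l with h' | h'
          · exact h'
          · exact absurd (by rw [show k + 1 = l by omega]) hk
        · exact absurd h hk
      have hc := casVal_add_two_ne hl₁ hq hk
      obtain ⟨f⟩ := part_tv_weyl_up (𝕜 := 𝕜) rfl rfl hc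
      exact (((IsSummand.of_equiv f.symm).trans (isSummand_part hc (hasEigenvalues_tv_weyl k))).trans
        (IsSummand.of_equiv (TV.congr e.symm))).exists_hasShape (.inl ⟨.inl hk', ⟨.refl _ _⟩⟩)
  · have h₃' : (k : ℤ) = a * l + j := by exact_mod_cast h₃
    have h₄' : (k' : ℤ) + j + 2 = a * l := by exact_mod_cast h₄
    have h5 : ¬ l ∣ k + 1 := by
      rw [h₃, add_assoc]
      exact not_dvd_mul_add a (by omega) (by omega)
    have hc := casVal_add_two_ne hl₁ hq h5
    have hs := isSummand_part hc (h.1.hasEigenvalues_tv hq (a := a) (by linarith))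
    have h5' := not_dvd_int h5 (m := k + 1) (by push_cast; ring)
    rcases k' with _ | k'
    · have h6 : l ∣ k + 2 := ⟨2 * a, by rw [h₃]; linarith⟩
      obtain ⟨f⟩ := h.up_wall_zero hl₁ hq (a := a) (by push_cast at *; linarith) h5'
      exact ((IsSummand.of_equiv f.symm).trans hs).exists_hasShape (.inl ⟨.inr h6, ⟨.refl _ _⟩⟩)
    · by_cases hj : j + 2 = l
      · have h6 : l ∣ k + 2 := ⟨a + 1, by rw [h₃, add_assoc, hj]; ring⟩
        obtain ⟨f⟩ := h.up_wall hl hl₁ hq (a := a) (by push_cast at *; linarith) h5' h6 (by omega)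
        exact ((IsSummand.prod_left.trans (IsSummand.of_equiv f.symm)).trans hs).exists_hasShape
          (.inl ⟨.inr h6, ⟨.refl _ _⟩⟩)
      · have h6 : ¬ l ∣ k + 2 := by
          rw [h₃, add_assoc]
          exact not_dvd_mul_add a (by omega) (by omega)
        have h7 := h.up hl₁ hq (a := a) (by push_cast at *; linarith) h5'
          (not_dvd_int h6 (by push_cast; ring))
        exact hs.exists_hasShape (.inr ⟨a, j + 1, k', h₁, by omega, by omega, by omega, h7.1⟩)

end shape

section tilting

variable {l : ℕ}

variable (𝕜) in
/-- `V^{⊗(N+1)} = V^{⊗N} ⊗ V`. -/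
def tensorPowerSucc (N : ℕ) : TensorPower 𝕜 (N + 1) ≃ₗ[Uq 𝕜] TV (TensorPower 𝕜 N) :=
  LatticeRep.tensorEquiv ((weyl 1).tensorPow N)

/-- A summand of `V^{⊗k}` has the structure of `T(k)`. -/
theorem exists_hasShape_tensorPower [CharZero 𝕜] (hl : Odd l) (hl₁ : 1 < l)
    (hq : IsPrimitiveRoot (qq 𝕜) (2 * l)) (k : ℕ) :
    ∃ P : Submodule (Uq 𝕜) (TensorPower 𝕜 k), HasShape 𝕜 P l k ∧ ∃ Q, IsCompl P Q := by
  induction k with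
  | zero =>
    exact (IsSummand.of_equiv (.refl (Uq 𝕜) (TensorPower 𝕜 0))).exists_hasShape
      (.inl ⟨.inl (by omega), ⟨.refl (Uq 𝕜) (WMod 𝕜 0)⟩⟩)
  | succ k ih =>
    obtain ⟨P, hP, Q, hPQ⟩ := ih
    obtain ⟨P', hP', Q', hPQ'⟩ := hP.next hl hl₁ hq
    exact (((IsSummand.of_isCompl hPQ').trans (IsSummand.of_isCompl hPQ).tv).trans
      (IsSummand.of_equiv (tensorPowerSucc 𝕜 k).symm)).exists_hasShape hP'

variable [CharZero 𝕜]

/-- The module `T(k)`, which is chosen by `Classical.epsilon`, is indeed an indecomposable tilting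
summand of `V^{⊗k}`. -/
theorem tiltingSubmodule_spec (hl : Odd l) (hl₁ : 1 < l)
    (hq : IsPrimitiveRoot (qq 𝕜) (2 * l)) (k : ℕ) :
    IsIndecTilting 𝕜 (TiltingModule 𝕜 k) k ∧ IsSummand 𝕜 (TiltingModule 𝕜 k) (TensorPower 𝕜 k) := by
  obtain ⟨P, hP, hPQ⟩ := exists_hasShape_tensorPower (𝕜 := 𝕜) hl hl₁ hq k
  have h := Classical.epsilon_spec (p := fun P : Submodule (Uq 𝕜) (TensorPower 𝕜 k) =>
    IsIndecTilting 𝕜 P k ∧ ∃ Q, IsCompl P Q)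
    ⟨P, hP.isIndecTilting hl hl₁ hq P.subtype_injective, hPQ⟩
  obtain ⟨h1, Q, hQ⟩ := h
  exact ⟨h1, .of_isCompl hQ⟩

theorem HasShape.nonempty_equiv (hl : Odd l) (hl₁ : 1 < l)
    (hq : IsPrimitiveRoot (qq 𝕜) (2 * l)) {M : Type*} [AddCommGroup M] [Module 𝕜 M] [Module (Uq 𝕜) M]
    [IsScalarTower 𝕜 (Uq 𝕜) M] [FiniteDimensional 𝕜 M] {k : ℕ} (h : HasShape 𝕜 M l k)
    (hs : IsSummand 𝕜 M (TensorPower 𝕜 k)) : Nonempty (M ≃ₗ[Uq 𝕜] TiltingModule 𝕜 k) := by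
  obtain ⟨h1, h2⟩ := tiltingSubmodule_spec (𝕜 := 𝕜) hl hl₁ hq k
  refine IsIndecTilting.nonempty_equiv ?_ h1 hs h2
  obtain ⟨i, p, hip⟩ := hs
  exact h.isIndecTilting hl hl₁ hq (Function.LeftInverse.injective (LinearMap.congr_fun hip))

/-- The structure of `T(k)`; the choice of `T(k)` does not matter by
`IsIndecTilting.nonempty_equiv`. -/
theorem hasShape_tiltingModule (hl : Odd l) (hl₁ : 1 < l)
    (hq : IsPrimitiveRoot (qq 𝕜) (2 * l)) (k : ℕ) : HasShape 𝕜 (TiltingModule 𝕜 k) l k := by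
  obtain ⟨P, hP, Q, hPQ⟩ := exists_hasShape_tensorPower (𝕜 := 𝕜) hl hl₁ hq k
  obtain ⟨e⟩ := hP.nonempty_equiv hl hl₁ hq (.of_isCompl hPQ)
  exact hP.congr e

theorem nonempty_tilting_equiv_weyl (hl : Odd l) (hl₁ : 1 < l)
    (hq : IsPrimitiveRoot (qq 𝕜) (2 * l)) {k : ℕ} (hk : k < l ∨ l ∣ k + 1) :
    Nonempty (TiltingModule 𝕜 k ≃ₗ[Uq 𝕜] WMod 𝕜 k) := by
  rcases hasShape_tiltingModule (𝕜 := 𝕜) hl hl₁ hq k with ⟨-, h⟩ | ⟨a, j, k', h₁, h₂, h₃, h₄, h⟩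
  · exact h
  · rcases hk with hk | hk
    · have := Nat.le_mul_of_pos_left l h₁
      omega
    · rw [h₃, add_assoc] at hk
      exact absurd hk (not_dvd_mul_add a (by omega) (by omega))

theorem isGlued_tilting (hl : Odd l) (hl₁ : 1 < l)
    (hq : IsPrimitiveRoot (qq 𝕜) (2 * l)) {k k' a j : ℕ} (h₁ : 1 ≤ a) (h₂ : j + 2 ≤ l) (h₃ : k = a * l + j)
    (h₄ : k' + j + 2 = a * l) : IsGlued 𝕜 (TiltingModule 𝕜 k) k k' := by
  rcases hasShape_tiltingModule (𝕜 := 𝕜) hl hl₁ hq k with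
    ⟨hk, -⟩ | ⟨a', j', k'', h₁', h₂', h₃', h₄', h⟩
  · rcases hk with hk | hk
    · have := Nat.le_mul_of_pos_left l h₁
      omega
    · rw [h₃, add_assoc] at hk
      exact absurd hk (not_dvd_mul_add a (by omega) (by omega))
  · have e1 : k / l = a := by
      rw [h₃, mul_comm, Nat.mul_add_div (by omega), Nat.div_eq_of_lt (by omega), add_zero]
    have e2 : k / l = a' := by
      rw [h₃', mul_comm, Nat.mul_add_div (by omega), Nat.div_eq_of_lt (by omega), add_zero]
    obtain rfl : a = a' := e1.symm.trans e2
    obtain rfl : k' = k'' := by omega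
    exact h

end tilting

/-! ### Decomposition of the tensor powers -/

section decomposition

variable {l : ℕ} {M N : Type*} [AddCommGroup M] [Module (Uq 𝕜) M] [AddCommGroup N] [Module (Uq 𝕜) N]

variable (𝕜 M) in
/-- `M` is a finite direct sum of modules `T(k)`. -/
def IsSumOfTilting : Prop :=
  ∃ (ι : Type) (_ : Finite ι) (κ : ι → ℕ), Nonempty (M ≃ₗ[Uq 𝕜] ∀ i, TiltingModule 𝕜 (κ i))

theorem IsSumOfTilting.congr (h : IsSumOfTilting 𝕜 M) (e : M ≃ₗ[Uq 𝕜] N) : IsSumOfTilting 𝕜 N := by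
  obtain ⟨ι, h, κ, ⟨f⟩⟩ := h
  exact ⟨ι, h, κ, ⟨e.symm.trans f⟩⟩

theorem isSumOfTilting_tilting (k : ℕ) : IsSumOfTilting 𝕜 (TiltingModule 𝕜 k) :=
  ⟨Unit, inferInstance, fun _ => k, ⟨(LinearEquiv.funUnique Unit (Uq 𝕜) _).symm⟩⟩

theorem IsSumOfTilting.prod (hM : IsSumOfTilting 𝕜 M) (hN : IsSumOfTilting 𝕜 N) :
    IsSumOfTilting 𝕜 (M × N) := by
  obtain ⟨ι, h, κ, ⟨f⟩⟩ := hM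
  obtain ⟨ι', h', κ', ⟨f'⟩⟩ := hN
  exact ⟨ι ⊕ ι', inferInstance, Sum.elim κ κ', ⟨(LinearEquiv.prodCongr f f').trans
    (LinearEquiv.sumPiEquivProdPi (Uq 𝕜) ι ι' fun i => TiltingModule 𝕜 (Sum.elim κ κ' i)).symm⟩⟩

theorem IsSumOfTilting.pi {ι : Type} [Finite ι] {M : ι → Type*} [∀ i, AddCommGroup (M i)]
    [∀ i, Module (Uq 𝕜) (M i)] (h : ∀ i, IsSumOfTilting 𝕜 (M i)) : IsSumOfTilting 𝕜 (∀ i, M i) := by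
  choose β hβ κ f using h
  exact ⟨Σ i, β i, inferInstance, fun x => κ x.1 x.2,
    ⟨(LinearEquiv.piCongrRight fun i => (f i).some).trans
      (LinearEquiv.piCurry (Uq 𝕜) fun i j => TiltingModule 𝕜 (κ i j)).symm⟩⟩

/-- `(⨁ Mᵢ) ⊗ V = ⨁ (Mᵢ ⊗ V)`. -/
def TV.piEquiv {ι : Type} {M : ι → Type*} [∀ i, AddCommGroup (M i)] [∀ i, Module 𝕜 (M i)]
    [∀ i, Module (Uq 𝕜) (M i)] [∀ i, IsScalarTower 𝕜 (Uq 𝕜) (M i)] :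
    TV (∀ i, M i) ≃ₗ[Uq 𝕜] ∀ i, TV (M i) :=
  let f : TV (∀ i, M i) →ₗ[Uq 𝕜] ∀ i, TV (M i) := LinearMap.pi fun i => TV.map (LinearMap.proj i)
  have hf (x : TV (∀ i, M i)) (i : ι) (a : Fin 2) : f x i a = x a i := rfl
  LinearEquiv.ofBijective f
    ⟨fun x y h => TV.ext
      (funext fun i => ((hf x i 0).symm.trans (congrArg (fun z => z i 0) h)).trans (hf y i 0))
      (funext fun i => ((hf x i 1).symm.trans (congrArg (fun z => z i 1) h)).trans (hf y i 1)), fun y => ⟨fun a i => y i a, rfl⟩⟩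

variable [CharZero 𝕜]

theorem isSumOfTilting_weyl (hl : Odd l) (hl₁ : 1 < l)
    (hq : IsPrimitiveRoot (qq 𝕜) (2 * l)) {k : ℕ} (hk : k < l ∨ l ∣ k + 1) : IsSumOfTilting 𝕜 (WMod 𝕜 k) := by
  obtain ⟨e⟩ := nonempty_tilting_equiv_weyl (𝕜 := 𝕜) hl hl₁ hq hk
  exact (isSumOfTilting_tilting k).congr e

theorem isSummand_tv_tilting (hl : Odd l) (hl₁ : 1 < l)
    (hq : IsPrimitiveRoot (qq 𝕜) (2 * l)) {k : ℕ} :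
    IsSummand 𝕜 (TV (TiltingModule 𝕜 k)) (TensorPower 𝕜 (k + 1)) :=
  (tiltingSubmodule_spec (𝕜 := 𝕜) hl hl₁ hq k).2.tv.trans
    (IsSummand.of_equiv (tensorPowerSucc 𝕜 k).symm)

/-- The part of `T(k) ⊗ V` away from the wall is `T(k + 1)`, and conversely the part of
`T(k + 1) ⊗ V` towards the wall is `T(k)`. -/
theorem nonempty_tilting_up (hl : Odd l) (hl₁ : 1 < l)
    (hq : IsPrimitiveRoot (qq 𝕜) (2 * l)) {k k' a j : ℕ} (h₁ : 1 ≤ a) (h₂ : j + 3 ≤ l) (h₃ : k = a * l + j)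
    (h₄ : k' + j + 2 = a * l) :
    Nonempty (part (TV (TiltingModule 𝕜 k)) (casVal 𝕜 (k + 2)) (casVal 𝕜 k) ≃ₗ[Uq 𝕜]
      TiltingModule 𝕜 (k + 1)) ∧
    Nonempty (TiltingModule 𝕜 k ≃ₗ[Uq 𝕜] part (TV (TiltingModule 𝕜 (k + 1)))
      (casVal 𝕜 (k + 1)) (casVal 𝕜 (k + 3))) := by
  have hla := Nat.le_mul_of_pos_left l h₁
  obtain ⟨k', rfl⟩ : ∃ n, k' = n + 1 := ⟨k' - 1, by omega⟩
  have h₃' : (k : ℤ) = a * l + j := by exact_mod_cast h₃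
  have h₄' : ((k' + 1 : ℕ) : ℤ) + j + 2 = a * l := by exact_mod_cast h₄
  have h5 : ¬ l ∣ k + 1 := by
    rw [h₃, add_assoc]
    exact not_dvd_mul_add a (by omega) (by omega)
  have h6 : ¬ l ∣ k + 2 := by
    rw [h₃, add_assoc]
    exact not_dvd_mul_add a (by omega) (by omega)
  have hg := isGlued_tilting (𝕜 := 𝕜) hl hl₁ hq h₁ (by omega) h₃ h₄
  have hk : (k : ℤ) + (k' + 1 : ℕ) + 2 = 2 * l * a := by linarith
  obtain ⟨h7, ⟨e⟩⟩ := hg.up hl₁ hq hk (not_dvd_int h5 (by push_cast; ring))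
    (not_dvd_int h6 (by push_cast; ring))
  have hc := casVal_add_two_ne hl₁ hq h5
  have h8 : HasShape 𝕜 (part (TV (TiltingModule 𝕜 k)) (casVal 𝕜 (k + 2)) (casVal 𝕜 k)) l (k + 1) :=
    .inr ⟨a, j + 1, k', h₁, by omega, by omega, by omega, h7⟩
  obtain ⟨f⟩ := h8.nonempty_equiv hl hl₁ hq
    ((isSummand_part hc (hg.1.hasEigenvalues_tv hq hk)).trans (isSummand_tv_tilting hl hl₁ hq))
  exact ⟨⟨f⟩, ⟨e.trans (partCongr (TV.congr f) _ _)⟩⟩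

/-- `T(k) ⊗ V` is a direct sum of modules `T(k')`. -/
theorem isSumOfTilting_tv_tilting (hl : Odd l) (hl₁ : 1 < l)
    (hq : IsPrimitiveRoot (qq 𝕜) (2 * l)) (k : ℕ) : IsSumOfTilting 𝕜 (TV (TiltingModule 𝕜 k)) := by
  have hsum : HasShape 𝕜 (TiltingModule 𝕜 k) l k := hasShape_tiltingModule hl hl₁ hq k
  rcases hsum with ⟨hk, ⟨e⟩⟩ | ⟨a, j, k', h₁, h₂, h₃, h₄, h⟩
  · by_cases hw : l ∣ k + 1
    · obtain ⟨m, rfl⟩ : ∃ m, k = m + 1 := ⟨k - 1, by have := Nat.le_of_dvd (by omega) hw; omega⟩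
      obtain ⟨b, hb⟩ := hw
      have hb1 : 1 ≤ b := by
        rcases Nat.eq_zero_or_pos b with rfl | h
        · omega
        · exact h
      -- On a wall, `T(k) ⊗ V = T(k+1)`.
      have h8 : HasShape 𝕜 (TV (TiltingModule 𝕜 (m + 1))) l (m + 2) :=
        .inr ⟨b, 0, m, hb1, by omega, by rw [mul_comm, ← hb], by rw [mul_comm, ← hb],
          (isGlued_tv_weyl hl hl₁ hq ⟨b, hb⟩).congr (TV.congr e.symm)⟩
      obtain ⟨f⟩ := h8.nonempty_equiv hl hl₁ hq (isSummand_tv_tilting hl hl₁ hq)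
      exact (isSumOfTilting_tilting _).congr f.symm
    · -- Inside the first alcove, `T(k) ⊗ V = W(k+1) ⊕ W(k-1)`, where `W(-1) = 0`.
      have hk' : k + 1 < l := by
        rcases hk with h | h
        · rcases Nat.lt_or_ge (k + 1) l with h' | h'
          · exact h'
          · exact absurd (by rw [show k + 1 = l by omega]) hw
        · exact absurd h hw
      refine IsSumOfTilting.congr ?_ (TV.congr e.symm)
      have hc := casVal_add_two_ne hl₁ hq hw
      have hup := isSumOfTilting_weyl (𝕜 := 𝕜) hl hl₁ hq (.inl hk')
      rcases k with _ | m
      · obtain ⟨f⟩ := tv_weyl_zero 𝕜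
        exact hup.congr f
      · obtain ⟨f⟩ := (hasEigenvalues_tv_weyl (𝕜 := 𝕜) (m + 1)).nonempty_equiv hc
        refine IsSumOfTilting.congr (IsSumOfTilting.prod ?_ ?_) f.symm
        · obtain ⟨f⟩ := part_tv_weyl_up (𝕜 := 𝕜) rfl rfl hc
          exact hup.congr f.symm
        · obtain ⟨f⟩ := part_tv_weyl_down (𝕜 := 𝕜) (k := m) (by push_cast; ring_nf)
            (by push_cast; rfl) hc
          exact (isSumOfTilting_weyl (𝕜 := 𝕜) hl hl₁ hq (.inl (by omega))).congr f.symm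
  · have hla := Nat.le_mul_of_pos_left l h₁
    have h₃' : (k : ℤ) = a * l + j := by exact_mod_cast h₃
    have h₄' : (k' : ℤ) + j + 2 = a * l := by exact_mod_cast h₄
    have h5 : ¬ l ∣ k + 1 := by
      rw [h₃, add_assoc]
      exact not_dvd_mul_add a (by omega) (by omega)
    have hc := casVal_add_two_ne hl₁ hq h5
    have hk : (k : ℤ) + k' + 2 = 2 * l * a := by linarith
    have h5' := not_dvd_int h5 (m := k + 1) (by push_cast; ring)
    obtain ⟨f⟩ := (h.1.hasEigenvalues_tv hq hk).nonempty_equiv hc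
    refine IsSumOfTilting.congr (IsSumOfTilting.prod ?_ ?_) f.symm
    · -- The part away from the wall is `T(k+1)`, except that past the last step of an alcove it is
      -- `W(k+1) ⊕ W(k'-1)` or, if `k' = 0`, `W(k+1)`.
      by_cases hj : j + 2 = l
      · have h6 : l ∣ k + 2 := ⟨a + 1, by rw [h₃, add_assoc, hj]; ring⟩
        have hup := isSumOfTilting_weyl (𝕜 := 𝕜) hl hl₁ hq (k := k + 1) (.inr h6)
        rcases k' with _ | k'
        · obtain ⟨f⟩ := h.up_wall_zero hl₁ hq hk h5'
          exact hup.congr f.symm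
        · obtain ⟨f⟩ := h.up_wall hl hl₁ hq hk h5' h6 (by omega)
          refine IsSumOfTilting.congr (hup.prod (isSumOfTilting_weyl (𝕜 := 𝕜) hl hl₁ hq (.inr ?_)))
            f.symm
          refine ⟨a - 1, ?_⟩
          obtain ⟨a, rfl⟩ : ∃ b, a = b + 1 := ⟨a - 1, by omega⟩
          rw [add_mul, one_mul] at h₄
          rw [Nat.add_sub_cancel, mul_comm]
          omega
      · obtain ⟨⟨f⟩, -⟩ := nonempty_tilting_up (𝕜 := 𝕜) hl hl₁ hq h₁ (by omega) h₃ h₄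
        exact (isSumOfTilting_tilting _).congr f.symm
    · -- The part towards the wall is `T(k-1)`, except that it consists of two copies of `T(k-1)` if `k-1`
      -- is on the wall.
      rcases j with _ | j
      · obtain ⟨m, rfl⟩ : ∃ m, k = m + 2 := ⟨k - 2, by omega⟩
        obtain rfl : k' = m := by omega
        have hw : l ∣ k' + 2 := ⟨a, by rw [mul_comm]; omega⟩
        obtain ⟨e⟩ := nonempty_tilting_equiv_weyl (𝕜 := 𝕜) hl hl₁ hq (k := k' + 1) (.inr hw)
        have h8 : HasShape 𝕜 (TV (WMod 𝕜 (k' + 1))) l (k' + 2) :=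
          .inr ⟨a, 0, k', h₁, h₂, h₃, h₄, isGlued_tv_weyl hl hl₁ hq hw⟩
        obtain ⟨f⟩ := h8.nonempty_equiv hl hl₁ hq ((IsSummand.of_equiv (TV.congr e.symm)).trans
          (isSummand_tv_tilting hl hl₁ hq))
        obtain ⟨g⟩ := part_tv_tv_weyl (𝕜 := 𝕜) hl hl₁ hq hw
        have hW := isSumOfTilting_weyl (𝕜 := 𝕜) hl hl₁ hq (k := k' + 1) (.inr hw)
        have e1 : casVal 𝕜 (((k' + 2 : ℕ) : ℤ)) = casVal 𝕜 ((k' : ℤ) + 2) := by push_cast; rfl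
        have e2 : casVal 𝕜 (((k' + 2 : ℕ) : ℤ) + 2) = casVal 𝕜 ((k' : ℤ) + 4) := by
          push_cast; ring_nf
        rw [e1, e2]
        exact (hW.prod hW).congr (g.trans (partCongr (TV.congr f) _ _))
      · obtain ⟨m, rfl⟩ : ∃ m, k = m + 1 := ⟨k - 1, by omega⟩
        obtain ⟨-, ⟨f⟩⟩ := nonempty_tilting_up (𝕜 := 𝕜) (k := m) (k' := k' + 1) (j := j) hl hl₁ hq h₁
          (by omega) (by omega) (by omega)
        have e1 : casVal 𝕜 (((m + 1 : ℕ) : ℤ)) = casVal 𝕜 ((m : ℤ) + 1) := by push_cast; rfl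
        have e2 : casVal 𝕜 (((m + 1 : ℕ) : ℤ) + 2) = casVal 𝕜 ((m : ℤ) + 3) := by
          push_cast; ring_nf
        rw [e1, e2]
        exact (isSumOfTilting_tilting m).congr f

/-- `V^{⊗N}` is a direct sum of modules `T(k)`. -/
theorem isSumOfTilting_tensorPower (hl : Odd l) (hl₁ : 1 < l)
    (hq : IsPrimitiveRoot (qq 𝕜) (2 * l)) (N : ℕ) : IsSumOfTilting 𝕜 (TensorPower 𝕜 N) := by
  induction N with
  | zero => exact isSumOfTilting_weyl hl hl₁ hq (k := 0) (.inl (by omega))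
  | succ N ih =>
    obtain ⟨ι, h, κ, ⟨e⟩⟩ := ih
    exact (IsSumOfTilting.pi fun i => isSumOfTilting_tv_tilting hl hl₁ hq (κ i)).congr
      (((tensorPowerSucc 𝕜 N).trans (TV.congr e)).trans TV.piEquiv).symm

end decomposition

end

/-! ### Multiplicities -/

section multiplicity

variable {𝕜 : Type*} [Field 𝕜] [Algebra ℤ[T;T⁻¹] 𝕜] [CharZero 𝕜] {l : ℕ}

/-- `T(k)` has a highest weight line, on which `E⁽ᵏ⁾F⁽ᵏ⁾` projects. -/
theorem exists_isTopVector_tilting (hl : Odd l) (hl₁ : 1 < l)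
    (hq : IsPrimitiveRoot (qq 𝕜) (2 * l)) (k : ℕ) :
    ∃ z : TiltingModule 𝕜 k, IsTopVector (𝕜 := 𝕜) k z := by
  obtain ⟨f, hf⟩ : ∃ f : WMod 𝕜 k →ₗ[Uq 𝕜] TiltingModule 𝕜 k, Function.Injective f := by
    rcases hasShape_tiltingModule (𝕜 := 𝕜) hl hl₁ hq k with ⟨-, ⟨e⟩⟩ | ⟨a, j, k', -, -, -, -, h⟩
    · exact ⟨e.symm.toLinearMap, e.symm.injective⟩
    · obtain ⟨f, g, hf, -, -⟩ := h.1
      exact ⟨f, hf⟩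
  exact ⟨_, isTopVector_map hf (Submodule.subtype_injective _)⟩

theorem topElt_smul_tilting {k k' : ℕ} (h : k < k') (x : TiltingModule 𝕜 k) :
    topElt 𝕜 k' • x = 0 :=
  Subtype.ext (topElt_smul_tensorPower h x.1)

/-- The modules `T(k)` are pairwise not isomorphic, being distinguished by the elements `E⁽ᵏ⁾F⁽ᵏ⁾`. -/
theorem tilting_equiv_eq (hl : Odd l) (hl₁ : 1 < l) (hq : IsPrimitiveRoot (qq 𝕜) (2 * l))
    {k k' : ℕ} (e : TiltingModule 𝕜 k ≃ₗ[Uq 𝕜] TiltingModule 𝕜 k') : k = k' := by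
  have key {k k' : ℕ} (e : TiltingModule 𝕜 k ≃ₗ[Uq 𝕜] TiltingModule 𝕜 k') : ¬ k < k' := by
    intro h
    obtain ⟨z, hz⟩ := exists_isTopVector_tilting (𝕜 := 𝕜) hl hl₁ hq k'
    apply hz.1
    rw [← hz.2.1, ← e.apply_symm_apply z, ← map_smul, topElt_smul_tilting h, map_zero]
  have h1 := key e
  have h2 := key e.symm
  omega

/-- A composition `T(k) → T(k') → T(k)` with `k ≠ k'` annihilates the highest weight line. -/
theorem comp_topVector_eq_zero (hl : Odd l) (hl₁ : 1 < l) (hq : IsPrimitiveRoot (qq 𝕜) (2 * l))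
    {k k' : ℕ} (hk : k ≠ k') {z : TiltingModule 𝕜 k} (hz : IsTopVector (𝕜 := 𝕜) k z)
    (g : TiltingModule 𝕜 k →ₗ[Uq 𝕜] TiltingModule 𝕜 k')
    (p : TiltingModule 𝕜 k' →ₗ[Uq 𝕜] TiltingModule 𝕜 k) : p (g z) = 0 := by
  obtain ⟨c, hc⟩ := hz.2.2 (p (g z))
  rw [← map_smul, ← map_smul, hz.2.1] at hc
  by_contra h
  have hc0 : c ≠ 0 := by
    rintro rfl
    exact h (by rw [hc, zero_smul])
  have hk1 := (tiltingSubmodule_spec (𝕜 := 𝕜) hl hl₁ hq k).1.1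
  have hk2 := (tiltingSubmodule_spec (𝕜 := 𝕜) hl hl₁ hq k').1.1
  have hb : Function.Bijective ((c⁻¹ • p) ∘ₗ g) := hk1.bijective hz.1 (by
    rw [LinearMap.comp_apply, LinearMap.smul_apply, hc, smul_smul, inv_mul_cancel₀ hc0, one_smul])
  have hs : IsSummand 𝕜 (TiltingModule 𝕜 k) (TiltingModule 𝕜 k') :=
    ⟨g, (LinearEquiv.ofBijective _ hb).symm.toLinearMap ∘ₗ (c⁻¹ • p),
      LinearMap.ext fun x => (LinearEquiv.ofBijective _ hb).symm_apply_apply x⟩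
  obtain ⟨P, ⟨e⟩, Q, hPQ⟩ := hs.exists_submodule
  rcases hk2.2 P Q hPQ with rfl | rfl
  · exact hz.1 (e.injective (Subsingleton.elim _ _))
  · obtain rfl := eq_top_of_isCompl_bot hPQ
    exact hk (tilting_equiv_eq hl hl₁ hq (e.trans Submodule.topEquiv))

/-- A partial direct sum is a direct summand. -/
theorem isSummand_subtype {ι : Type} {M : ι → Type*} [∀ i, AddCommGroup (M i)]
    [∀ i, Module (Uq 𝕜) (M i)] (p : ι → Prop) :
    IsSummand 𝕜 (∀ i : {i // p i}, M i) (∀ i, M i) := by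
  classical
  refine ⟨LinearMap.pi fun i => if h : p i then LinearMap.proj (⟨i, h⟩ : {i // p i}) else 0,
    LinearMap.pi fun i => LinearMap.proj i.1, LinearMap.ext fun x => funext fun i => ?_⟩
  simp [i.2]

/-- Krull–Schmidt for the tilting modules in question: the multiplicity is read off from any
decomposition. -/
theorem multiplicity_eq (hl : Odd l) (hl₁ : 1 < l) (hq : IsPrimitiveRoot (qq 𝕜) (2 * l)) {N : ℕ}
    {ι : Type} [Finite ι] {κ : ι → ℕ}
    (e : TensorPower 𝕜 N ≃ₗ[Uq 𝕜] ∀ i, TiltingModule 𝕜 (κ i)) (k : ℕ) :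
    multiplicity 𝕜 k N = Nat.card {i // κ i = k} := by
  refine IsGreatest.csSup_eq ⟨?_, ?_⟩
  · have h1 : IsSummand 𝕜 (∀ i : {i // κ i = k}, TiltingModule 𝕜 (κ i)) (TensorPower 𝕜 N) :=
      (isSummand_subtype _).trans (.of_equiv e.symm)
    have h2 (i : {i // κ i = k}) : Nonempty (TiltingModule 𝕜 k ≃ₗ[Uq 𝕜] TiltingModule 𝕜 (κ i)) := by
      rw [i.2]
      exact ⟨.refl _ _⟩
    exact ((IsSummand.of_equiv ((LinearEquiv.funCongrLeft (Uq 𝕜) (TiltingModule 𝕜 k)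
      (Finite.equivFin {i // κ i = k})).trans (LinearEquiv.piCongrRight fun i => (h2 i).some))).trans h1)
  · rintro m ⟨i, p, hip⟩
    obtain ⟨z, hz⟩ := exists_isTopVector_tilting (𝕜 := 𝕜) hl hl₁ hq k
    choose y hy using fun j => exists_isTopVector_tilting (𝕜 := 𝕜) hl hl₁ hq (κ j)
    -- `v ⊗ z`, a vector in `𝕜^m ⊗ T(k)`, is determined by the components of its image in the
    -- highest weight lines of the summands `T(k)`.
    let s : (Fin m → 𝕜) → TiltingModule 𝕜 k →ₗ[Uq 𝕜] (Fin m → TiltingModule 𝕜 k) :=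
      fun v => LinearMap.pi fun t => v t • LinearMap.id
    have hs (v : Fin m → 𝕜) (t : Fin m) : s v z t = v t • z := rfl
    let L : (Fin m → 𝕜) →ₗ[𝕜] ∀ j : {j // κ j = k}, Submodule.span 𝕜 {y j.1} :=
      LinearMap.pi fun j => LinearMap.codRestrict _
        { toFun := fun v => e (i (s v z)) j.1
          map_add' := fun v w => by
            have : s (v + w) z = s v z + s w z := funext fun t => by
              rw [Pi.add_apply, hs, hs, hs, Pi.add_apply, add_smul]
            rw [this, map_add, map_add, Pi.add_apply]
          map_smul' := fun c v => by
            have : s (c • v) z = c • s v z := funext fun t => by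
              rw [Pi.smul_apply, hs, hs, Pi.smul_apply, smul_eq_mul, mul_smul]
            rw [this, mkHom_restrictScalars]
            exact congrFun (mkHom_restrictScalars e.toLinearMap c (i (s v z))) j.1 }
        (fun v => by
          obtain ⟨c, hc⟩ := (hy j.1).2.2 (e (i (s v z)) j.1)
          have h1 : topElt 𝕜 (κ j.1) • e (i (s v z)) j.1 = e (i (s v z)) j.1 := by
            have h2 : topElt 𝕜 (κ j.1) • s v z = s v z := by rw [j.2, ← map_smul, hz.2.1]
            have h3 := congrArg (fun x => e (i x)) h2
            simp only [map_smul] at h3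
            exact congrFun h3 j.1
          exact Submodule.mem_span_singleton.2 ⟨c, (h1.symm.trans hc).symm⟩)
    have hL : Function.Injective L := by
      rw [injective_iff_map_eq_zero]
      intro v hv
      have hv' (j : ι) (hj : κ j = k) : e (i (s v z)) j = 0 :=
        congrArg Subtype.val (congrFun hv ⟨j, hj⟩)
      have h1 : s v z = 0 := by
        have h2 : s v z = p (e.symm (e (i (s v z)))) := by
          rw [e.symm_apply_apply]
          exact (LinearMap.congr_fun hip _).symm
        classical
        have := Fintype.ofFinite ι
        rw [h2, ← Finset.univ_sum_single (e (i (s v z))), map_sum, map_sum]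
        refine Finset.sum_eq_zero fun j _ => funext fun t => ?_
        by_cases hj : κ j = k
        · rw [hv' j hj, Pi.single_zero, map_zero, map_zero]
        · exact comp_topVector_eq_zero hl hl₁ hq (Ne.symm hj) hz
            (LinearMap.proj j ∘ₗ e.toLinearMap ∘ₗ i ∘ₗ s v)
            (LinearMap.proj t ∘ₗ p ∘ₗ e.symm.toLinearMap ∘ₗ
              LinearMap.single (Uq 𝕜) (fun j => TiltingModule 𝕜 (κ j)) j)
      refine funext fun t => ?_
      have h3 : v t • z = 0 := congrFun h1 t
      exact (smul_eq_zero.1 h3).resolve_right hz.1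
    have h1 := LinearMap.finrank_le_finrank_of_injective hL
    have := Fintype.ofFinite {j // κ j = k}
    rw [Module.finrank_fin_fun, Module.finrank_pi_fintype,
      Finset.sum_congr rfl fun j _ => finrank_span_singleton (hy j.1).1] at h1
    simpa using h1

end multiplicity

/-! ### Weight spaces -/

section weights

/-- The Pascal rule for Gaussian binomial coefficients. -/
theorem gauss_succ_succ (n : ℤ) (t : ℕ) : gauss (n + 1) (t + 1) =
    LaurentPolynomial.T ((t : ℤ) + 1) * gauss n (t + 1) +
      LaurentPolynomial.T ((t : ℤ) - n) * gauss n t := by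
  apply IsFractionRing.injective ℤ[T;T⁻¹] Qv
  have h0 : ∏ s ∈ Finset.range (t + 1), (v ^ ((s : ℤ) + 1) - v ^ (-((s : ℤ) + 1))) ≠ 0 :=
    Finset.prod_ne_zero_iff.2 fun s _ => v_zpow_sub_ne_zero (by omega)
  refine mul_right_cancel₀ h0 ?_
  rw [gauss_mul, Finset.prod_range_succ' (n := t) (f := fun s : ℕ => v ^ (n + 1 - s) - _)]
  have h3 : ∏ s ∈ Finset.range t, (v ^ (n + 1 - ((s + 1 : ℕ) : ℤ)) -
      v ^ (-(n + 1 - ((s + 1 : ℕ) : ℤ)))) =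
      ∏ s ∈ Finset.range t, (v ^ (n - s) - v ^ (-(n - s))) := by
    refine Finset.prod_congr rfl fun s _ => ?_
    congr 2 <;> push_cast <;> ring
  have h1 := gauss_mul n (t + 1)
  rw [Finset.prod_range_succ (n := t) (f := fun s : ℕ => v ^ (n - s) - _), ← gauss_mul] at h1
  rw [h3, ← gauss_mul, map_add, map_mul, map_mul, ← v_zpow, ← v_zpow, add_mul,
    mul_assoc (v ^ _), h1, Finset.prod_range_succ]
  have e1 : v ^ ((t : ℤ) + 1) * (v ^ (n - t) - v ^ (-(n - t))) +
      v ^ ((t : ℤ) - n) * (v ^ ((t : ℤ) + 1) - v ^ (-((t : ℤ) + 1))) =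
      v ^ (n + 1 - ((0 : ℕ) : ℤ)) - v ^ (-(n + 1 - ((0 : ℕ) : ℤ))) := by
    simp only [mul_sub, ← zpow_add₀ v_ne_zero]
    push_cast
    ring_nf
  rw [← e1]
  ring

variable (𝕜 : Type*) [Field 𝕜] [Algebra ℤ[T;T⁻¹] 𝕜]

/-- The elements `K` and `[K; 0 \atop t]`. -/
def cartan : Option ℕ → Uq 𝕜
  | none => toUq 𝕜 KA
  | some t => toUq 𝕜 (kbinA t)

/-- The values of `K` and `[K; 0 \atop t]` on vectors of weight `n`. -/
def cartanVal (n : ℤ) : Option ℕ → 𝕜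
  | none => algebraMap ℤ[T;T⁻¹] 𝕜 (LaurentPolynomial.T n)
  | some t => algebraMap ℤ[T;T⁻¹] 𝕜 (gauss n t)

/-- Weights are determined by the eigenvalues of `K` and `[K; 0 \atop t]`: by the Pascal rule both
weights may be shifted upwards, and for `0 ≤ n < m` one has `[n \atop m] = 0`, `[m \atop m] = 1`. -/
theorem cartanVal_injective : Function.Injective (cartanVal 𝕜) := by
  have key (n m : ℤ) (h : cartanVal 𝕜 n = cartanVal 𝕜 m) (r : ℕ) :
      ∀ t, algebraMap ℤ[T;T⁻¹] 𝕜 (gauss (n + r) t) = algebraMap ℤ[T;T⁻¹] 𝕜 (gauss (m + r) t) := by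
    induction r with
    | zero =>
      intro t
      rw [Nat.cast_zero, add_zero, add_zero]
      exact congrFun h (some t)
    | succ r ih =>
      rintro (_ | t)
      · have (n : ℤ) : gauss n 0 = 1 := by cases n <;> simp [gauss, gaussNat]
        rw [this, this]
      · have h1 : algebraMap ℤ[T;T⁻¹] 𝕜 (LaurentPolynomial.T ((t : ℤ) - (n + r))) =
            algebraMap ℤ[T;T⁻¹] 𝕜 (LaurentPolynomial.T ((t : ℤ) - (m + r))) := by
          have h2 : qq 𝕜 ^ n = qq 𝕜 ^ m := by
            rw [← algebraMap_T_eq, ← algebraMap_T_eq]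
            exact congrFun h none
          have hq := qq_ne_zero (𝕜 := 𝕜)
          rw [algebraMap_T_eq, algebraMap_T_eq, zpow_sub₀ hq, zpow_sub₀ hq, zpow_add₀ hq,
            zpow_add₀ hq, h2]
        push_cast
        rw [← add_assoc, ← add_assoc, gauss_succ_succ, gauss_succ_succ, map_add, map_add, map_mul,
          map_mul, map_mul, map_mul, ih, ih, h1]
  have key' (n m : ℤ) (h : cartanVal 𝕜 n = cartanVal 𝕜 m) : ¬ n < m := by
    intro hnm
    obtain ⟨a, ha⟩ : ∃ a : ℕ, n + (n.natAbs : ℕ) = a := ⟨(n + n.natAbs).toNat, by omega⟩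
    obtain ⟨b, hb⟩ : ∃ b : ℕ, m + (n.natAbs : ℕ) = b := ⟨(m + n.natAbs).toNat, by omega⟩
    have h1 := key n m h n.natAbs b
    rw [ha, hb] at h1
    change algebraMap ℤ[T;T⁻¹] 𝕜 (gaussNat a b) = algebraMap ℤ[T;T⁻¹] 𝕜 (gaussNat b b) at h1
    rw [gaussNat_self, gaussNat_eq_zero (by omega), map_zero, map_one] at h1
    exact zero_ne_one h1
  intro n m h
  have h1 := key' n m h
  have h2 := key' m n h.symm
  omega

variable {𝕜}

section modules

variable {M B : Type*} [AddCommGroup M] [Module 𝕜 M] [Module (Uq 𝕜) M] [IsScalarTower 𝕜 (Uq 𝕜) M]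
  [AddCommGroup B] [Module 𝕜 B] [Module (Uq 𝕜) B] [IsScalarTower 𝕜 (Uq 𝕜) B]

theorem mem_weightSpace {n : ℤ} {x : M} :
    x ∈ weightSpace 𝕜 M n ↔ ∀ i, cartan 𝕜 i • x = cartanVal 𝕜 n i • x :=
  ⟨fun h i => by cases i with
    | none => exact h.1
    | some t => exact h.2 t, fun h => ⟨h none, fun t => h (some t)⟩⟩

theorem map_mem_weightSpace (f : M →ₗ[Uq 𝕜] B) {n : ℤ} {x : M} (hx : x ∈ weightSpace 𝕜 M n) :
    f x ∈ weightSpace 𝕜 B n := by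
  rw [mem_weightSpace] at *
  intro i
  rw [← map_smul, hx, mkHom_restrictScalars]

theorem mem_weightSpace_of_injective {f : M →ₗ[Uq 𝕜] B} (hf : Function.Injective f) {n : ℤ} {x : M}
    (hx : f x ∈ weightSpace 𝕜 B n) : x ∈ weightSpace 𝕜 M n := by
  rw [mem_weightSpace] at *
  intro i
  apply hf
  rw [map_smul, hx, mkHom_restrictScalars]

theorem exists_cartanVal_ne {n m : ℤ} (h : n ≠ m) : ∃ i, cartanVal 𝕜 n i ≠ cartanVal 𝕜 m i := by
  by_contra! h1
  exact h (cartanVal_injective 𝕜 (funext h1))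

variable (𝕜) in
/-- An element acting by `1` on vectors of weight `n` and by `0` on vectors of weight `m ≠ n`. -/
def sepElt (n m : ℤ) : Uq 𝕜 :=
  if h : n = m then 1 else
    let i := (exists_cartanVal_ne (𝕜 := 𝕜) h).choose
    (cartanVal 𝕜 n i - cartanVal 𝕜 m i)⁻¹ •
      (cartan 𝕜 i - algebraMap 𝕜 (Uq 𝕜) (cartanVal 𝕜 m i))

theorem sepElt_smul_self {n : ℤ} (m : ℤ) {x : M} (hx : x ∈ weightSpace 𝕜 M n) :
    sepElt 𝕜 n m • x = x := by
  rw [sepElt]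
  split_ifs with h
  · rw [one_smul]
  · have h1 := (exists_cartanVal_ne (𝕜 := 𝕜) h).choose_spec
    dsimp only
    generalize (exists_cartanVal_ne (𝕜 := 𝕜) h).choose = i at h1
    rw [smul_assoc, sub_smul, mem_weightSpace.1 hx, algebraMap_smul, ← sub_smul, smul_smul,
      inv_mul_cancel₀ (sub_ne_zero.2 h1), one_smul]

theorem sepElt_smul_eq_zero {n m : ℤ} (h : n ≠ m) {x : M} (hx : x ∈ weightSpace 𝕜 M m) :
    sepElt 𝕜 n m • x = 0 := by
  rw [sepElt, dif_neg h]
  dsimp only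
  rw [smul_assoc, sub_smul, mem_weightSpace.1 hx, algebraMap_smul, sub_self, smul_zero]

theorem smul_mem_weightSpace {n m n' : ℤ} {x : M} (hx : x ∈ weightSpace 𝕜 M n) :
    sepElt 𝕜 m n' • x ∈ weightSpace 𝕜 M n := by
  have h (i : Option ℕ) : cartan 𝕜 i • x ∈ weightSpace 𝕜 M n := by
    rw [mem_weightSpace.1 hx]
    exact Submodule.smul_mem _ _ hx
  rw [sepElt]
  split_ifs
  · rwa [one_smul]
  · dsimp only
    rw [smul_assoc, sub_smul, algebraMap_smul]
    exact Submodule.smul_mem _ _ (Submodule.sub_mem _ (h _) (Submodule.smul_mem _ _ hx))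

variable (𝕜) in
/-- On modules with weights in `S`, the projection to the weight space of `n ∈ S`. -/
def weightProj (S : Finset ℤ) (n : ℤ) : Uq 𝕜 := (S.toList.map (sepElt 𝕜 n)).prod

theorem weightProj_smul_self (S : Finset ℤ) {n : ℤ} {x : M} (hx : x ∈ weightSpace 𝕜 M n) :
    weightProj 𝕜 S n • x = x := by
  rw [weightProj]
  induction S.toList with
  | nil => rw [List.map_nil, List.prod_nil, one_smul]
  | cons m L ih => rw [List.map_cons, List.prod_cons, mul_smul, ih, sepElt_smul_self m hx]

theorem weightProj_smul_eq_zero {S : Finset ℤ} {n m : ℤ} (hm : m ∈ S) (h : n ≠ m) {x : M}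
    (hx : x ∈ weightSpace 𝕜 M m) : weightProj 𝕜 S n • x = 0 := by
  have key (L : List ℤ) : (L.map (sepElt 𝕜 n)).prod • x ∈ weightSpace 𝕜 M m ∧
      (m ∈ L → (L.map (sepElt 𝕜 n)).prod • x = 0) := by
    induction L with
    | nil => simpa using hx
    | cons a L ih =>
      rw [List.map_cons, List.prod_cons, mul_smul]
      refine ⟨smul_mem_weightSpace ih.1, fun h1 => ?_⟩
      rcases List.mem_cons.1 h1 with rfl | h1
      · exact sepElt_smul_eq_zero h ih.1
      · rw [ih.2 h1, smul_zero]
  exact (key S.toList).2 (Finset.mem_toList.2 hm)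

variable (𝕜 M) in
/-- `M` is spanned by vectors with weights in `S`. -/
def HasWeights (S : Finset ℤ) : Prop :=
  ∀ x : M, ∃ y : ℤ → M, (∀ n, y n ∈ weightSpace 𝕜 M n) ∧ x = ∑ n ∈ S, y n

theorem HasWeights.mono {S S' : Finset ℤ} (h : HasWeights 𝕜 M S) (hS : S ⊆ S') :
    HasWeights 𝕜 M S' := by
  intro x
  obtain ⟨y, hy, rfl⟩ := h x
  refine ⟨fun n => if n ∈ S then y n else 0, fun n => ?_, ?_⟩
  · dsimp only
    split_ifs
    · exact hy n
    · exact Submodule.zero_mem _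
  · rw [Finset.sum_ite_mem, Finset.inter_eq_right.2 hS]

theorem HasWeights.of_surjective {S : Finset ℤ} (h : HasWeights 𝕜 M S) {f : M →ₗ[Uq 𝕜] B}
    (hf : Function.Surjective f) : HasWeights 𝕜 B S := by
  intro b
  obtain ⟨x, rfl⟩ := hf b
  obtain ⟨y, hy, rfl⟩ := h x
  exact ⟨fun n => f (y n), fun n => map_mem_weightSpace f (hy n), map_sum _ _ _⟩

theorem HasWeights.weightProj_smul_mem {S : Finset ℤ} (h : HasWeights 𝕜 M S) {n : ℤ} (hn : n ∈ S)
    (x : M) : weightProj 𝕜 S n • x ∈ weightSpace 𝕜 M n := by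
  obtain ⟨y, hy, rfl⟩ := h x
  rw [Finset.smul_sum, Finset.sum_eq_single_of_mem n hn fun m hm hmn =>
    weightProj_smul_eq_zero hm hmn.symm (hy m), weightProj_smul_self S (hy n)]
  exact hy n

/-- Dimensions of weight spaces are additive in short exact sequences. -/
theorem IsExtension.finrank_weightSpace {A : Type*} [AddCommGroup A] [Module 𝕜 A] [Module (Uq 𝕜) A]
    [IsScalarTower 𝕜 (Uq 𝕜) A] [FiniteDimensional 𝕜 M] {S : Finset ℤ} (hM : HasWeights 𝕜 M S)
    (h : IsExtension 𝕜 A M B) (n : ℤ) : Module.finrank 𝕜 (weightSpace 𝕜 M n) =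
      Module.finrank 𝕜 (weightSpace 𝕜 A n) + Module.finrank 𝕜 (weightSpace 𝕜 B n) := by
  obtain ⟨f, g, hf, hg, hfg⟩ := h
  replace hM := hM.mono (Finset.subset_insert n S)
  have hn := Finset.mem_insert_self n S
  generalize insert n S = S at hM hn
  let f' : weightSpace 𝕜 A n →ₗ[𝕜] weightSpace 𝕜 M n :=
    (f.restrictScalars 𝕜).restrict fun x hx => map_mem_weightSpace f hx
  let g' : weightSpace 𝕜 M n →ₗ[𝕜] weightSpace 𝕜 B n :=
    (g.restrictScalars 𝕜).restrict fun x hx => map_mem_weightSpace g hx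
  have hf' : Function.Injective f' := fun x y hxy => Subtype.ext (hf (congrArg Subtype.val hxy))
  have hg' : Function.Surjective g' := by
    rintro ⟨b, hb⟩
    obtain ⟨x, rfl⟩ := hg b
    refine ⟨⟨weightProj 𝕜 S n • x, hM.weightProj_smul_mem hn x⟩, Subtype.ext ?_⟩
    exact (map_smul g _ _).trans (weightProj_smul_self S hb)
  have hex : f'.range = g'.ker := by
    ext ⟨x, hx⟩
    constructor
    · rintro ⟨a, ha⟩
      exact Subtype.ext ((hfg x).2 ⟨a.1, congrArg Subtype.val ha⟩)
    · intro h
      obtain ⟨a, rfl⟩ := (hfg x).1 (congrArg Subtype.val h)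
      exact ⟨⟨a, mem_weightSpace_of_injective hf hx⟩, rfl⟩
  have h3 := g'.finrank_range_add_finrank_ker
  rw [LinearMap.range_eq_top.2 hg', finrank_top, ← hex, LinearMap.finrank_range_of_inj hf'] at h3
  omega

theorem finrank_weightSpace_equiv (e : M ≃ₗ[Uq 𝕜] B) (n : ℤ) :
    Module.finrank 𝕜 (weightSpace 𝕜 M n) = Module.finrank 𝕜 (weightSpace 𝕜 B n) :=
  LinearEquiv.finrank_eq (LinearEquiv.ofLinearMap
    ((e.toLinearMap.restrictScalars 𝕜).restrict fun _ hx => map_mem_weightSpace e.toLinearMap hx)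
    ((e.symm.toLinearMap.restrictScalars 𝕜).restrict
      fun _ hx => map_mem_weightSpace e.symm.toLinearMap hx)
    (LinearMap.ext fun x => Subtype.ext (e.apply_symm_apply x.1))
    (LinearMap.ext fun x => Subtype.ext (e.symm_apply_apply x.1)))

theorem finrank_weightSpace_pi {ι : Type} [Fintype ι] {M : ι → Type*} [∀ i, AddCommGroup (M i)]
    [∀ i, Module 𝕜 (M i)] [∀ i, Module (Uq 𝕜) (M i)] [∀ i, IsScalarTower 𝕜 (Uq 𝕜) (M i)]
    [∀ i, FiniteDimensional 𝕜 (M i)] (n : ℤ) :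
    Module.finrank 𝕜 (weightSpace 𝕜 (∀ i, M i) n) =
      ∑ i, Module.finrank 𝕜 (weightSpace 𝕜 (M i) n) := by
  rw [← Module.finrank_pi_fintype]
  refine LinearEquiv.finrank_eq (LinearEquiv.ofLinearMap
    (LinearMap.pi fun i => ((LinearMap.proj i : (∀ i, M i) →ₗ[Uq 𝕜] M i).restrictScalars 𝕜).restrict
      fun _ hx => map_mem_weightSpace _ hx)
    (LinearMap.codRestrict _ (LinearMap.pi fun i => Submodule.subtype _ ∘ₗ LinearMap.proj i)
      fun x => mem_weightSpace.2 fun i => funext fun j => mem_weightSpace.1 (x j).2 i) ?_ ?_)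
  · exact LinearMap.ext fun x => funext fun i => Subtype.ext rfl
  · exact LinearMap.ext fun x => Subtype.ext rfl

end modules

/-! ### Weights of lattice representations -/

namespace LatticeRep

variable (V : LatticeRep)

theorem cartan_smul (i : Option ℕ) (x : V.Mod 𝕜) (a : V.ι) :
    coord (cartan 𝕜 i • x) a = cartanVal 𝕜 (V.wt a) i * coord x a := by
  have key (u : UA) (d : V.ι → ℤ[T;T⁻¹])
      (h : V.toHom u = Matrix.diagonal fun a => algebraMap ℤ[T;T⁻¹] Qv (d a)) :
      coord (toUq 𝕜 u • x) a = algebraMap ℤ[T;T⁻¹] 𝕜 (d a) * coord x a := by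
    have h1 : V.intHom u = Matrix.diagonal d := by
      refine Matrix.ext fun i j => ?_
      apply IsFractionRing.injective ℤ[T;T⁻¹] Qv
      refine (V.algebraMap_intHom _ _ _).trans ?_
      rw [h]
      rcases eq_or_ne i j with rfl | hij
      · rw [Matrix.diagonal_apply_eq, Matrix.diagonal_apply_eq]
      · rw [Matrix.diagonal_apply_ne _ hij, Matrix.diagonal_apply_ne _ hij, map_zero]
    refine (congrFun (V.toUqHom_smul u x) a).trans ?_
    rw [h1, Matrix.diagonal_map (map_zero _)]
    exact Matrix.mulVec_diagonal _ (coord x) a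
  cases i with
  | none =>
    refine key KA (fun a => LaurentPolynomial.T (V.wt a)) ?_
    refine V.map_K.trans ?_
    simp_rw [v_zpow]
  | some t => exact key (kbinA t) (fun a => gauss (V.wt a) t) (V.map_kbin t)

theorem mem_weightSpace_iff {n : ℤ} {x : V.Mod 𝕜} :
    x ∈ weightSpace 𝕜 (V.Mod 𝕜) n ↔ ∀ a, V.wt a ≠ n → coord x a = 0 := by
  rw [mem_weightSpace]
  constructor
  · intro h a ha
    obtain ⟨i, hi⟩ := exists_cartanVal_ne (𝕜 := 𝕜) ha
    have h1 : coord (cartan 𝕜 i • x) a = coord (cartanVal 𝕜 n i • x) a := by rw [h]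
    rw [cartan_smul] at h1
    have h2 : coord (cartanVal 𝕜 n i • x) a = cartanVal 𝕜 n i * coord x a := rfl
    rw [h2, ← sub_eq_zero, ← sub_mul] at h1
    exact (mul_eq_zero.1 h1).resolve_left (sub_ne_zero.2 hi)
  · intro h i
    refine funext fun a => (cartan_smul V i x a).trans ?_
    change _ = cartanVal 𝕜 n i * coord x a
    by_cases ha : V.wt a = n
    · rw [ha]
    · rw [h a ha, mul_zero, mul_zero]

/-- The weight spaces of the module attached to a lattice have the expected dimensions also at `v = q`. -/
theorem finrank_weightSpace (n : ℤ) :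
    Module.finrank 𝕜 (weightSpace 𝕜 (V.Mod 𝕜) n) = Fintype.card {a // V.wt a = n} := by
  rw [← Module.finrank_fintype_fun_eq_card 𝕜]
  let e : weightSpace 𝕜 (V.Mod 𝕜) n ≃ₗ[𝕜] ({a // V.wt a = n} → 𝕜) :=
    { toFun := fun x a => coord x.1 a.1
      map_add' := fun _ _ => rfl
      map_smul' := fun _ _ => rfl
      invFun := fun y => ⟨fun a => if h : V.wt a = n then y ⟨a, h⟩ else 0,
        V.mem_weightSpace_iff.2 fun a ha => dif_neg ha⟩
      left_inv := fun x => Subtype.ext (funext fun a => by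
        change (if h : V.wt a = n then coord x.1 a else 0) = coord x.1 a
        split_ifs with h
        · rfl
        · exact (V.mem_weightSpace_iff.1 x.2 a h).symm)
      right_inv := fun y => funext fun a => by
        change (if h : V.wt a.1 = n then y ⟨a.1, h⟩ else 0) = y a
        rw [dif_pos a.2] }
  exact e.finrank_eq

theorem hasWeights : HasWeights 𝕜 (V.Mod 𝕜) (Finset.univ.image V.wt) := by
  intro x
  refine ⟨fun n a => if V.wt a = n then coord x a else 0, fun n => ?_, ?_⟩
  · exact V.mem_weightSpace_iff.2 fun a ha => if_neg ha
  · refine funext fun a => ?_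
    refine Eq.trans ?_ (Finset.sum_apply a (Finset.univ.image V.wt)
      fun n a => if V.wt a = n then coord x a else 0).symm
    rw [Finset.sum_ite_eq, if_pos (Finset.mem_image_of_mem _ (Finset.mem_univ _))]
    rfl

/-- The character of the module attached to a lattice. -/
theorem character_eq (x : ℝ) : character 𝕜 (V.Mod 𝕜) x = ∑ a, x ^ V.wt a := by
  rw [character, finsum_eq_sum_of_support_subset (s := Finset.univ.image V.wt)]
  · rw [← Finset.sum_fiberwise_of_maps_to (g := V.wt) (t := Finset.univ.image V.wt)
      fun a _ => Finset.mem_image_of_mem _ (Finset.mem_univ _)]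
    refine Finset.sum_congr rfl fun n _ => ?_
    rw [Finset.sum_congr rfl (g := fun _ => x ^ n) fun a ha => by rw [(Finset.mem_filter.1 ha).2],
      Finset.sum_const, V.finrank_weightSpace, Fintype.card_subtype, nsmul_eq_mul]
  · intro n hn
    rw [Function.mem_support, V.finrank_weightSpace] at hn
    have : Fintype.card {a // V.wt a = n} ≠ 0 := fun h => hn (by rw [h, Nat.cast_zero, zero_mul])
    obtain ⟨a, ha⟩ := (Fintype.card_pos_iff.1 (Nat.pos_of_ne_zero this))
    exact Finset.mem_coe.2 (Finset.mem_image.2 ⟨a, Finset.mem_univ _, ha⟩)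

end LatticeRep

end weights

/-! ### Counting weights -/

section counting

/-- The dimension of the weight space of weight `n` in `V^{⊗N}`: the number of walks of length `N`
on `ℤ` with steps `±1` from `0` to `n`. -/
def walkCount (N : ℕ) (n : ℤ) : ℕ :=
  Fintype.card {a : ((weyl 1).tensorPow N).ι // ((weyl 1).tensorPow N).wt a = n}

theorem LatticeRep.card_wt (V : LatticeRep) (n : ℤ) :
    Fintype.card {a // V.wt a = n} = ∑ a, if V.wt a = n then 1 else 0 := by
  rw [Fintype.card_subtype, Finset.card_filter]

theorem walkCount_zero (n : ℤ) : walkCount 0 n = if n = 0 then 1 else 0 := by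
  rw [walkCount, LatticeRep.card_wt]
  refine (Fin.sum_univ_one (fun i : Fin 1 =>
    if ((0 : ℕ) : ℤ) - 2 * (i : ℕ) = n then 1 else 0)).trans ?_
  simp [eq_comm]

theorem walkCount_succ (N : ℕ) (n : ℤ) :
    walkCount (N + 1) n = walkCount N (n - 1) + walkCount N (n + 1) := by
  rw [walkCount, walkCount, walkCount, LatticeRep.card_wt, LatticeRep.card_wt, LatticeRep.card_wt,
    ← Finset.sum_add_distrib]
  refine (Fintype.sum_prod_type (fun x : ((weyl 1).tensorPow N).ι × Fin 2 =>
    if ((weyl 1).tensorPow N).wt x.1 + (((1 : ℕ) : ℤ) - 2 * (x.2 : ℕ)) = n then 1 else 0)).trans ?_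
  refine Finset.sum_congr rfl fun a _ => ?_
  rw [Fin.sum_univ_two]
  congr 2 <;> refine propext ⟨fun h => ?_, fun h => ?_⟩ <;> simp at h ⊢ <;> omega

theorem card_weyl_wt (k n : ℕ) : Fintype.card {a // (weyl k).wt a = n} =
    if n ≤ k ∧ 2 ∣ k - n then 1 else 0 := by
  split_ifs with h
  · obtain ⟨h1, i, h2⟩ := h
    rw [Fintype.card_eq_one_iff]
    refine ⟨⟨(⟨i, by omega⟩ : Fin (k + 1)), ?_⟩, ?_⟩
    · change (k : ℤ) - 2 * i = n
      omega
    · rintro ⟨(b : Fin (k + 1)), hb⟩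
      replace hb : (k : ℤ) - 2 * (b : ℕ) = n := hb
      exact Subtype.ext (Fin.ext (show (b : ℕ) = i by omega))
  · rw [Fintype.card_eq_zero_iff]
    refine ⟨?_⟩
    rintro ⟨(b : Fin (k + 1)), hb⟩
    replace hb : (k : ℤ) - 2 * (b : ℕ) = n := hb
    exact h ⟨by omega, b, by omega⟩

/-- The difference of the dimensions of the weight spaces for `n` and `n + 2` counts occurrences of
`W(n)`. -/
theorem card_weyl_wt_sub (k n : ℕ) : Fintype.card {a // (weyl k).wt a = n} =
    Fintype.card {a // (weyl k).wt a = n + 2} + if k = n then 1 else 0 := by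
  have h := card_weyl_wt k (n + 2)
  push_cast at h
  rw [h, card_weyl_wt]
  split_ifs <;> omega

end counting

/-! ### Characters and multiplicities of the tilting modules -/

section tilting

variable {𝕜 : Type*} [Field 𝕜] [Algebra ℤ[T;T⁻¹] 𝕜] [CharZero 𝕜] {l : ℕ}

theorem hasWeights_tilting (hl : Odd l) (hl₁ : 1 < l) (hq : IsPrimitiveRoot (qq 𝕜) (2 * l)) (k : ℕ) :
    ∃ S, HasWeights 𝕜 (TiltingModule 𝕜 k) S := by
  obtain ⟨i, p, hip⟩ := (tiltingSubmodule_spec (𝕜 := 𝕜) hl hl₁ hq k).2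
  exact ⟨_, (LatticeRep.hasWeights _).of_surjective (f := p)
    (Function.RightInverse.surjective (LinearMap.congr_fun hip))⟩

theorem finrank_weightSpace_glued (hl : Odd l) (hl₁ : 1 < l) (hq : IsPrimitiveRoot (qq 𝕜) (2 * l))
    {k k' : ℕ} (h : IsGlued 𝕜 (TiltingModule 𝕜 k) k k') (n : ℤ) :
    Module.finrank 𝕜 (weightSpace 𝕜 (TiltingModule 𝕜 k) n) =
      Fintype.card {a // (weyl k).wt a = n} + Fintype.card {a // (weyl k').wt a = n} := by
  obtain ⟨S, hS⟩ := hasWeights_tilting (𝕜 := 𝕜) hl hl₁ hq k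
  rw [h.1.finrank_weightSpace hS, LatticeRep.finrank_weightSpace, LatticeRep.finrank_weightSpace]

theorem finrank_weightSpace_wall (hl : Odd l) (hl₁ : 1 < l) (hq : IsPrimitiveRoot (qq 𝕜) (2 * l))
    {k : ℕ} (hk : k < l ∨ l ∣ k + 1) (n : ℤ) :
    Module.finrank 𝕜 (weightSpace 𝕜 (TiltingModule 𝕜 k) n) =
      Fintype.card {a // (weyl k).wt a = n} := by
  obtain ⟨e⟩ := nonempty_tilting_equiv_weyl (𝕜 := 𝕜) hl hl₁ hq hk
  rw [finrank_weightSpace_equiv e, LatticeRep.finrank_weightSpace]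

/-- The character of the Weyl module `W(k)`. -/
def weylChar (k : ℕ) (x : ℝ) : ℝ := ∑ i ∈ Finset.range (k + 1), x ^ ((k : ℤ) - 2 * i)

theorem character_weyl (k : ℕ) (x : ℝ) : character 𝕜 (WMod 𝕜 k) x = weylChar k x := by
  rw [LatticeRep.character_eq, weylChar]
  exact Fin.sum_univ_eq_sum_range (fun i => x ^ ((k : ℤ) - 2 * i)) (k + 1)

theorem LatticeRep.finite_support (V : LatticeRep) (x : ℝ) :
    (Function.support fun n : ℤ => (Fintype.card {a // V.wt a = n} : ℝ) * x ^ n).Finite := by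
  refine Set.Finite.subset (Finset.univ.image V.wt).finite_toSet fun n hn => ?_
  rw [Function.mem_support] at hn
  have : Fintype.card {a // V.wt a = n} ≠ 0 := fun h => hn (by rw [h, Nat.cast_zero, zero_mul])
  obtain ⟨a, ha⟩ := (Fintype.card_pos_iff.1 (Nat.pos_of_ne_zero this))
  exact Finset.mem_coe.2 (Finset.mem_image.2 ⟨a, Finset.mem_univ _, ha⟩)

theorem character_tilting_wall (hl : Odd l) (hl₁ : 1 < l) (hq : IsPrimitiveRoot (qq 𝕜) (2 * l))
    {k : ℕ} (hk : k < l ∨ l ∣ k + 1) (x : ℝ) :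
    character 𝕜 (TiltingModule 𝕜 k) x = weylChar k x := by
  rw [character, ← character_weyl (𝕜 := 𝕜), character]
  simp_rw [finrank_weightSpace_wall hl hl₁ hq hk, LatticeRep.finrank_weightSpace]

theorem character_tilting_glued (hl : Odd l) (hl₁ : 1 < l) (hq : IsPrimitiveRoot (qq 𝕜) (2 * l))
    {k k' a j : ℕ} (h₁ : 1 ≤ a) (h₂ : j + 2 ≤ l) (h₃ : k = a * l + j)
    (h₄ : k' + j + 2 = a * l) (x : ℝ) :
    character 𝕜 (TiltingModule 𝕜 k) x = weylChar k x + weylChar k' x := by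
  rw [← character_weyl (𝕜 := 𝕜), ← character_weyl (𝕜 := 𝕜), character, character, character]
  simp_rw [finrank_weightSpace_glued hl hl₁ hq (isGlued_tilting (𝕜 := 𝕜) hl hl₁ hq h₁ h₂ h₃ h₄),
    LatticeRep.finrank_weightSpace, Nat.cast_add, add_mul]
  exact finsum_add_distrib (LatticeRep.finite_support _ x) (LatticeRep.finite_support _ x)

/-- Dimensions of weight spaces of `V^{⊗N}`, computed from a decomposition. -/
theorem walkCount_eq_sum {N : ℕ} {ι : Type} [Fintype ι] {κ : ι → ℕ}
    (e : TensorPower 𝕜 N ≃ₗ[Uq 𝕜] ∀ i, TiltingModule 𝕜 (κ i)) (n : ℤ) :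
    walkCount N n = ∑ i, Module.finrank 𝕜 (weightSpace 𝕜 (TiltingModule 𝕜 (κ i)) n) := by
  rw [walkCount, ← LatticeRep.finrank_weightSpace (𝕜 := 𝕜), finrank_weightSpace_equiv e,
    finrank_weightSpace_pi]

/-- If `n` is on a wall, `T(n)` is the only `T(k)` with `W(n)` in its Weyl filtration. -/
theorem finrank_weightSpace_sub_wall (hl : Odd l) (hl₁ : 1 < l)
    (hq : IsPrimitiveRoot (qq 𝕜) (2 * l)) {n : ℕ} (hn : l ∣ n + 1) (k : ℕ) :
    Module.finrank 𝕜 (weightSpace 𝕜 (TiltingModule 𝕜 k) n) =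
      Module.finrank 𝕜 (weightSpace 𝕜 (TiltingModule 𝕜 k) (n + 2)) + if k = n then 1 else 0 := by
  rcases hasShape_tiltingModule (𝕜 := 𝕜) hl hl₁ hq k with ⟨h, -⟩ | ⟨a, j, k', h₁, h₂, h₃, h₄, h⟩
  · rw [finrank_weightSpace_wall hl hl₁ hq h, finrank_weightSpace_wall hl hl₁ hq h, card_weyl_wt_sub]
  · have hk' : k' ≠ n := by
      rintro rfl
      have h5 : k' + 1 + (j + 1) = a * l := by omega
      have h6 : l ∣ j + 1 := (Nat.dvd_add_right hn).1 (h5 ▸ dvd_mul_left l a)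
      have := Nat.le_of_dvd (by omega) h6
      omega
    rw [finrank_weightSpace_glued hl hl₁ hq h, finrank_weightSpace_glued hl hl₁ hq h,
      card_weyl_wt_sub, card_weyl_wt_sub k', if_neg hk']
    ring

/-- If `n` is not on a wall, `W(n)` occurs in the Weyl filtrations of `T(n)` and `T(n')` only, where `n'`
is the reflection of `n` at the wall above `n`. -/
theorem finrank_weightSpace_sub (hl : Odd l) (hl₁ : 1 < l)
    (hq : IsPrimitiveRoot (qq 𝕜) (2 * l)) {n n' a j : ℕ} (hj : j + 2 ≤ l) (hn : n = a * l + j)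
    (hn' : n' + j + 2 = (a + 2) * l) (k : ℕ) :
    Module.finrank 𝕜 (weightSpace 𝕜 (TiltingModule 𝕜 k) n) =
      Module.finrank 𝕜 (weightSpace 𝕜 (TiltingModule 𝕜 k) (n + 2)) + ((if k = n then 1 else 0) +
        if k = n' then 1 else 0) := by
  have e1 : (a + 1) * l = a * l + l := by ring
  have e2 : (a + 2) * l = a * l + 2 * l := by ring
  rcases hasShape_tiltingModule (𝕜 := 𝕜) hl hl₁ hq k with ⟨h, -⟩ | ⟨b, i, k', h₁, h₂, h₃, h₄, h⟩
  · have hk : k ≠ n' := by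
      rintro rfl
      rcases h with h | h
      · omega
      · rw [show k + 1 = (a + 1) * l + (l - 1 - j) by omega] at h
        exact not_dvd_mul_add (a + 1) (by omega) (by omega) h
    rw [finrank_weightSpace_wall hl hl₁ hq h, finrank_weightSpace_wall hl hl₁ hq h, card_weyl_wt_sub,
      if_neg hk, add_zero]
  · have hk : k' = n ↔ k = n' := by
      rcases Nat.lt_trichotomy b (a + 1) with hb | rfl | hb
      · have := Nat.mul_le_mul_right l (show b ≤ a by omega)
        omega
      · omega
      · have := Nat.mul_le_mul_right l (show a + 2 ≤ b by omega)
        omega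
    rw [finrank_weightSpace_glued hl hl₁ hq h, finrank_weightSpace_glued hl hl₁ hq h,
      card_weyl_wt_sub, card_weyl_wt_sub k']
    simp only [hk]
    ring

/-- The multiplicity of `T(n)` for `n` on a wall. -/
theorem multiplicity_wall (hl : Odd l) (hl₁ : 1 < l) (hq : IsPrimitiveRoot (qq 𝕜) (2 * l)) (N : ℕ)
    {n : ℕ} (hn : l ∣ n + 1) :
    multiplicity 𝕜 n N + walkCount N (n + 2) = walkCount N n := by
  obtain ⟨ι, h, κ, ⟨e⟩⟩ := isSumOfTilting_tensorPower (𝕜 := 𝕜) hl hl₁ hq N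
  have := Fintype.ofFinite ι
  rw [multiplicity_eq hl hl₁ hq e, walkCount_eq_sum e, walkCount_eq_sum e,
    Finset.sum_congr rfl fun i _ => finrank_weightSpace_sub_wall hl hl₁ hq hn (κ i),
    Finset.sum_add_distrib, Nat.card_eq_fintype_card, Fintype.card_subtype, Finset.card_filter,
    add_comm]

/-- The multiplicities of `T(n)` and of `T(n')`, where `n` and `n'` are symmetric with respect to
the wall above `n`. -/
theorem multiplicity_add (hl : Odd l) (hl₁ : 1 < l) (hq : IsPrimitiveRoot (qq 𝕜) (2 * l)) (N : ℕ)
    {n n' a j : ℕ} (hj : j + 2 ≤ l) (hn : n = a * l + j) (hn' : n' + j + 2 = (a + 2) * l) :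
    multiplicity 𝕜 n N + multiplicity 𝕜 n' N + walkCount N (n + 2) = walkCount N n := by
  obtain ⟨ι, h, κ, ⟨e⟩⟩ := isSumOfTilting_tensorPower (𝕜 := 𝕜) hl hl₁ hq N
  have := Fintype.ofFinite ι
  rw [multiplicity_eq hl hl₁ hq e, multiplicity_eq hl hl₁ hq e, walkCount_eq_sum e,
    walkCount_eq_sum e,
    Finset.sum_congr rfl fun i _ => finrank_weightSpace_sub hl hl₁ hq hj hn hn' (κ i),
    Finset.sum_add_distrib, Finset.sum_add_distrib, Nat.card_eq_fintype_card,
    Nat.card_eq_fintype_card, Fintype.card_subtype, Fintype.card_subtype, Finset.card_filter,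
    Finset.card_filter, add_comm]

/-- The character of `V^{⊗N}` is the `N`-th power of that of `V`. -/
theorem character_tensorPower (N : ℕ) (x : ℝ) (hx : x ≠ 0) :
    character 𝕜 (TensorPower 𝕜 N) x = (x + x⁻¹) ^ N := by
  rw [LatticeRep.character_eq]
  induction N with
  | zero =>
    refine (Fin.sum_univ_one (fun i : Fin 1 => x ^ (((0 : ℕ) : ℤ) - 2 * (i : ℕ)))).trans ?_
    simp
  | succ N ih =>
    refine (Fintype.sum_prod_type (fun y : ((weyl 1).tensorPow N).ι × Fin 2 =>
      x ^ (((weyl 1).tensorPow N).wt y.1 + (((1 : ℕ) : ℤ) - 2 * (y.2 : ℕ))))).trans ?_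
    rw [pow_succ, ← ih, Finset.sum_mul]
    refine Finset.sum_congr rfl fun a _ => ?_
    rw [Fin.sum_univ_two, zpow_add₀ hx, zpow_add₀ hx, mul_add]
    norm_num

theorem character_weyl_one (x : ℝ) : character 𝕜 ((weyl 1).Mod 𝕜) x = x + x⁻¹ := by
  refine (character_weyl 1 x).trans ?_
  rw [weylChar, Finset.sum_range_succ, Finset.sum_range_one]
  norm_num

theorem tilting_finite_support (hl : Odd l) (hl₁ : 1 < l)
    (hq : IsPrimitiveRoot (qq 𝕜) (2 * l)) (k : ℕ) (x : ℝ) : (Function.support fun n : ℤ =>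
      (Module.finrank 𝕜 (weightSpace 𝕜 (TiltingModule 𝕜 k) n) : ℝ) * x ^ n).Finite := by
  rcases hasShape_tiltingModule (𝕜 := 𝕜) hl hl₁ hq k with ⟨h, -⟩ | ⟨b, i, k', h₁, h₂, h₃, h₄, h⟩
  · simp_rw [finrank_weightSpace_wall hl hl₁ hq h]
    exact LatticeRep.finite_support _ x
  · simp_rw [finrank_weightSpace_glued hl hl₁ hq h, Nat.cast_add, add_mul]
    exact ((LatticeRep.finite_support _ x).union (LatticeRep.finite_support _ x)).subset
      (Function.support_add _ _)

/-- The characters of the summands of `V^{⊗N}` add up to that of `V^{⊗N}`: the character measure has total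
mass one. -/
theorem hasSum_multiplicity (hl : Odd l) (hl₁ : 1 < l) (hq : IsPrimitiveRoot (qq 𝕜) (2 * l)) (N : ℕ)
    {x : ℝ} (hx : x ≠ 0) :
    HasSum (fun k => multiplicity 𝕜 k N * character 𝕜 (TiltingModule 𝕜 k) x) ((x + x⁻¹) ^ N) := by
  obtain ⟨ι, h, κ, ⟨e⟩⟩ := isSumOfTilting_tensorPower (𝕜 := 𝕜) hl hl₁ hq N
  have := Fintype.ofFinite ι
  have h1 : (x + x⁻¹) ^ N = ∑ i, character 𝕜 (TiltingModule 𝕜 (κ i)) x := by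
    rw [← character_tensorPower (𝕜 := 𝕜) N x hx, character]
    simp_rw [finrank_weightSpace_equiv e, finrank_weightSpace_pi, Nat.cast_sum, Finset.sum_mul]
    exact finsum_sum_comm _ _ fun i _ => tilting_finite_support hl hl₁ hq (κ i) x
  rw [h1, ← Finset.sum_fiberwise_of_maps_to (g := κ) (t := Finset.univ.image κ)
    fun i _ => Finset.mem_image_of_mem _ (Finset.mem_univ _)]
  have h2 (k : ℕ) : ∑ i with κ i = k, character 𝕜 (TiltingModule 𝕜 (κ i)) x =
      multiplicity 𝕜 k N * character 𝕜 (TiltingModule 𝕜 k) x := by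
    rw [Finset.sum_congr rfl (g := fun _ => character 𝕜 (TiltingModule 𝕜 k) x)
      fun i hi => by rw [(Finset.mem_filter.1 hi).2], Finset.sum_const, nsmul_eq_mul,
      multiplicity_eq hl hl₁ hq e, Nat.card_eq_fintype_card, Fintype.card_subtype]
  rw [Finset.sum_congr rfl fun k _ => h2 k]
  refine hasSum_sum_of_ne_finset_zero fun k hk => ?_
  rw [← h2, Finset.sum_eq_zero]
  intro i hi
  rw [Finset.mem_filter] at hi
  exact absurd (hi.2 ▸ Finset.mem_image_of_mem κ (Finset.mem_univ i)) hk

end tilting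

section

/-! ### The biased random walk on `ℤ` -/

/-- The distribution after `N` steps of the walk on `ℤ` starting at `0`, which steps by `+1` with
probability `p` and by `-1` with probability `r`. -/
def walkProb (p r : ℝ) : ℕ → ℤ → ℝ
  | 0, n => if n = 0 then 1 else 0
  | N + 1, n => p * walkProb p r N (n - 1) + r * walkProb p r N (n + 1)

variable {p r : ℝ}

theorem walkProb_nonneg (hp : 0 ≤ p) (hr : 0 ≤ r) (N : ℕ) (n : ℤ) : 0 ≤ walkProb p r N n := by
  induction N generalizing n with
  | zero => rw [walkProb]; split_ifs <;> norm_num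
  | succ N ih =>
    rw [walkProb]
    exact add_nonneg (mul_nonneg hp (ih _)) (mul_nonneg hr (ih _))

theorem walkProb_eq_zero {N : ℕ} {n : ℤ} (h : N < |n|) : walkProb p r N n = 0 := by
  induction N generalizing n with
  | zero => rw [walkProb, if_neg]; rintro rfl; simp at h
  | succ N ih =>
    rw [walkProb, ih, ih, mul_zero, mul_zero, add_zero] <;>
    · push_cast at h
      rcases lt_abs.1 h with h | h <;> rw [lt_abs] <;> omega

theorem hasFiniteSupport_walkProb (N : ℕ) : (walkProb p r N).HasFiniteSupport := by
  refine (Set.finite_Icc (-(N : ℤ)) N).subset fun n hn => ?_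
  by_contra h
  refine hn (walkProb_eq_zero (lt_abs.2 ?_))
  rw [Set.mem_Icc] at h
  omega

theorem summable_walkProb_smul {E : Type*} [NormedAddCommGroup E] [NormedSpace ℝ E] (N : ℕ) (c : ℤ)
    (f : ℤ → E) : Summable fun n => walkProb p r N (n + c) • f n := by
  refine summable_of_hasFiniteSupport ?_
  refine ((hasFiniteSupport_walkProb (p := p) (r := r) N).preimage
    ((add_left_injective c).injOn)).subset fun n hn h => hn ?_
  change walkProb p r N (n + c) • f n = 0
  rw [show walkProb p r N (n + c) = 0 from h, zero_smul]

theorem summable_walkProb_mul (N : ℕ) (f : ℤ → ℝ) : Summable fun n => walkProb p r N n * f n := by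
  simpa using summable_walkProb_smul (p := p) (r := r) N 0 f

theorem summable_walkProb (N : ℕ) : Summable (walkProb p r N) :=
  summable_of_hasFiniteSupport (hasFiniteSupport_walkProb N)

/-- Conditioning the walk on its last step. -/
theorem tsum_walkProb_succ {E : Type*} [NormedAddCommGroup E] [NormedSpace ℝ E] (N : ℕ)
    (f : ℤ → E) : ∑' n, walkProb p r (N + 1) n • f n =
      ∑' n, walkProb p r N n • (p • f (n + 1) + r • f (n - 1)) := by
  have h₁ : ∑' n, walkProb p r N (n - 1) • p • f n = ∑' n, walkProb p r N n • p • f (n + 1) := by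
    rw [← Equiv.tsum_eq (Equiv.addRight (1 : ℤ))]
    simp
  have h₂ : ∑' n, walkProb p r N (n + 1) • r • f n = ∑' n, walkProb p r N n • r • f (n - 1) := by
    rw [← Equiv.tsum_eq (Equiv.addRight (1 : ℤ)) fun n => walkProb p r N n • r • f (n - 1)]
    simp
  have s (g : ℤ → E) : Summable fun n => walkProb p r N n • g n := by
    simpa using summable_walkProb_smul (p := p) (r := r) N 0 g
  simp_rw [smul_add]
  rw [(s _).tsum_add (s _), ← h₁, ← h₂,
    ← (by simpa [sub_eq_add_neg] using summable_walkProb_smul (p := p) (r := r) N (-1) fun n => p • f n :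
      Summable fun n => walkProb p r N (n - 1) • p • f n).tsum_add (summable_walkProb_smul N 1 _)]
  refine tsum_congr fun n => ?_
  rw [walkProb, add_smul, mul_smul, mul_smul, smul_comm p, smul_comm r]

theorem tsum_walkProb_zero {E : Type*} [NormedAddCommGroup E] [NormedSpace ℝ E] (f : ℤ → E) :
    ∑' n, walkProb p r 0 n • f n = f 0 := by
  rw [tsum_eq_single 0 fun n hn => by rw [walkProb, if_neg hn, zero_smul], walkProb, if_pos rfl,
    one_smul]

theorem tsum_walkProb (h : p + r = 1) (N : ℕ) : ∑' n, walkProb p r N n = 1 := by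
  suffices ∑' n, walkProb p r N n • (1 : ℝ) = 1 by simpa using this
  induction N with
  | zero => rw [tsum_walkProb_zero]
  | succ N ih => rw [tsum_walkProb_succ, smul_eq_mul, smul_eq_mul, mul_one, mul_one, h, ih]

/-- The variance of the walk. -/
theorem tsum_walkProb_sq (h : p + r = 1) (N : ℕ) :
    ∑' n : ℤ, walkProb p r N n * (n - N * (p - r)) ^ 2 = 4 * p * r * N := by
  induction N with
  | zero =>
    have := tsum_walkProb_zero (p := p) (r := r) fun n : ℤ => ((n : ℝ) - (0 : ℕ) * (p - r)) ^ 2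
    simpa using this
  | succ N ih =>
    have := tsum_walkProb_succ (p := p) (r := r) N
      fun n : ℤ => ((n : ℝ) - (N + 1 : ℕ) * (p - r)) ^ 2
    simp only [smul_eq_mul] at this
    rw [this]
    have e (n : ℤ) : walkProb p r N n * (p * (((n + 1 : ℤ) : ℝ) - (N + 1 : ℕ) * (p - r)) ^ 2 +
        r * (((n - 1 : ℤ) : ℝ) - (N + 1 : ℕ) * (p - r)) ^ 2) =
        walkProb p r N n * (n - N * (p - r)) ^ 2 + walkProb p r N n * (4 * p * r) := by
      obtain rfl : r = 1 - p := by linarith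
      push_cast
      ring
    rw [tsum_congr e, (summable_walkProb_mul _ _).tsum_add (summable_walkProb_mul _ _), ih,
      tsum_mul_right, tsum_walkProb h]
    push_cast
    ring

/-- The characteristic function of the walk. -/
theorem tsum_walkProb_exp (N : ℕ) (z : ℂ) :
    ∑' n : ℤ, walkProb p r N n • Complex.exp (n * z) =
      (p * Complex.exp z + r * Complex.exp (-z)) ^ N := by
  induction N with
  | zero => rw [tsum_walkProb_zero]; simp
  | succ N ih =>
    have e (n : ℤ) : p • Complex.exp ((n + 1 : ℤ) * z) + r • Complex.exp ((n - 1 : ℤ) * z) =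
        (p * Complex.exp z + r * Complex.exp (-z)) * Complex.exp (n * z) := by
      push_cast
      rw [add_mul, sub_mul, one_mul, sub_eq_add_neg, Complex.exp_add, Complex.exp_add,
        Complex.real_smul, Complex.real_smul]
      ring
    rw [tsum_walkProb_succ, pow_succ', ← ih, ← tsum_mul_left]
    refine tsum_congr fun n => ?_
    rw [e, mul_smul_comm]

/-- For `P(n) = \binom{N}{(N+n)/2} p^{(N+n)/2} r^{(N-n)/2}`, the absorption identities of binomial
coefficients. -/
theorem mul_walkProb (N : ℕ) (n : ℤ) :
    2 * (N + 1) * p * walkProb p r N n = (N + n + 2) * walkProb p r (N + 1) (n + 1) ∧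
    2 * (N + 1) * r * walkProb p r N n = (N - n + 2) * walkProb p r (N + 1) (n - 1) := by
  induction N generalizing n with
  | zero =>
    simp only [walkProb]
    rcases eq_or_ne n 0 with rfl | h0
    · norm_num
    rcases eq_or_ne n (-2) with rfl | h1
    · norm_num
    rcases eq_or_ne n 2 with rfl | h2
    · norm_num
    have h3 : n + 1 + 1 ≠ 0 := by omega
    have h4 : n - 1 - 1 ≠ 0 := by omega
    simp [h0, h3, h4]
  | succ N ih =>
    have a := (ih (n + 1)).1
    have b := (ih (n - 1)).1
    have c := (ih (n + 1)).2
    have d := (ih (n - 1)).2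
    have e₀ : walkProb p r (N + 1) n = p * walkProb p r N (n - 1) + r * walkProb p r N (n + 1) := rfl
    have e₁ : walkProb p r (N + 1 + 1) (n + 1) = p * walkProb p r (N + 1) (n + 1 - 1) +
      r * walkProb p r (N + 1) (n + 1 + 1) := rfl
    have e₂ : walkProb p r (N + 1 + 1) (n - 1) = p * walkProb p r (N + 1) (n - 1 - 1) +
      r * walkProb p r (N + 1) (n - 1 + 1) := rfl
    simp only [add_sub_cancel_right, sub_add_cancel] at a b c d e₁ e₂
    push_cast at a b c d ⊢
    rw [e₁, e₂]
    constructor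
    · linear_combination p * b + r * a + 2 * (N + 1) * p * e₀
    · linear_combination p * d + r * c + 2 * (N + 1) * r * e₀

/-- The discrete derivative of the distribution of the walk. -/
theorem walkProb_sub (h : p + r = 1) (hp : p ≠ 0) (hr : r ≠ 0) (N : ℕ) (n : ℤ) :
    walkProb p r N n - walkProb p r N (n + 2) =
      walkProb p r (N + 1) (n + 1) * (((n + 1 : ℤ) : ℝ) - (N + 1 : ℕ) * (p - r)) /
        (2 * (N + 1) * (p * r)) := by
  have a := (mul_walkProb (p := p) (r := r) N n).1
  have b := (mul_walkProb (p := p) (r := r) N (n + 2)).2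
  rw [show n + 2 - 1 = n + 1 by ring] at b
  have hN : (N : ℝ) + 1 ≠ 0 := by positivity
  rw [eq_div_iff (by positivity)]
  obtain rfl : r = 1 - p := by linarith
  push_cast at a b ⊢
  linear_combination (1 - p) * a - p * b

/-- The absolute differences of the distribution at distance two are summable. -/
theorem summable_abs_walkProb_sub (N : ℕ) :
    Summable fun n => |walkProb p r N n - walkProb p r N (n + 2)| := by
  have := (summable_walkProb (p := p) (r := r) N).sub
    (by simpa using summable_walkProb_smul (p := p) (r := r) N 2 fun _ => (1 : ℝ))
  exact this.abs

/-- The total variation of the distribution of the walk is `O(N^{-1/2})`. -/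
theorem tsum_abs_walkProb_sub_le (h : p + r = 1) (hp : 0 < p) (hr : 0 < r) (N : ℕ) :
    ∑' n, |walkProb p r N n - walkProb p r N (n + 2)| ≤ 1 / √((N + 1) * (p * r)) := by
  set s := √((N + 1) * (p * r)) with hs
  have hs0 : 0 < s := Real.sqrt_pos.2 (by positivity)
  have hs2 : s ^ 2 = (N + 1) * (p * r) := Real.sq_sqrt (by positivity)
  let z (n : ℤ) : ℝ := n - (N + 1 : ℕ) * (p - r)
  have hle (n : ℤ) : |walkProb p r N n - walkProb p r N (n + 2)| ≤
      (fun n => walkProb p r (N + 1) n * z n ^ 2 / (8 * s ^ 3) +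
        walkProb p r (N + 1) n / (2 * s)) (n + 1) := by
    have h0 := walkProb_nonneg hp.le hr.le (N + 1) (n + 1)
    rw [walkProb_sub h hp.ne' hr.ne', show 2 * ((N : ℝ) + 1) * (p * r) = 2 * s ^ 2 by rw [hs2]; ring,
      abs_div, abs_mul, abs_of_nonneg h0, abs_of_pos (by positivity : 0 < 2 * s ^ 2)]
    change _ * |z (n + 1)| / _ ≤ _
    -- The inequality of arithmetic and geometric means; the weight `s` is of the order of the standard
    -- deviation, so that both terms contribute equally after summation.
    have h1 : |z (n + 1)| ≤ z (n + 1) ^ 2 / (4 * s) + s := by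
      rw [← sub_nonneg, ← sq_abs (z (n + 1))]
      have : |z (n + 1)| ^ 2 / (4 * s) + s - |z (n + 1)| = (|z (n + 1)| - 2 * s) ^ 2 / (4 * s) := by
        field_simp
        ring
      rw [this]
      positivity
    calc _ ≤ walkProb p r (N + 1) (n + 1) * (z (n + 1) ^ 2 / (4 * s) + s) / (2 * s ^ 2) := by
          gcongr
      _ = _ := by field_simp; ring
  have s1 : Summable fun n => walkProb p r (N + 1) n * z n ^ 2 / (8 * s ^ 3) :=
    (summable_walkProb_mul _ _).div_const _
  have s2 : Summable fun n => walkProb p r (N + 1) n / (2 * s) := (summable_walkProb _).div_const _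
  refine (Summable.tsum_le_tsum hle (summable_abs_walkProb_sub N)
    ((Equiv.addRight (1 : ℤ)).summable_iff.2 (s1.add s2))).trans_eq ?_
  refine (Equiv.tsum_eq (Equiv.addRight (1 : ℤ)) fun n => walkProb p r (N + 1) n * z n ^ 2 /
    (8 * s ^ 3) + walkProb p r (N + 1) n / (2 * s)).trans ?_
  rw [s1.tsum_add s2, tsum_div_const, tsum_div_const,
    tsum_walkProb h, tsum_walkProb_sq h, show 4 * p * r * (N + 1 : ℕ) = 4 * s ^ 2 by
      rw [hs2]; push_cast; ring]
  field_simp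
  norm_num

/-- A difference at distance `2 i` is bounded by differences at distance two. -/
theorem abs_sub_add_le_sum (P : ℤ → ℝ) (n : ℤ) (i : ℕ) :
    |P n - P (n + 2 * i)| ≤ ∑ j ∈ Finset.range i, |P (n + 2 * j) - P (n + 2 * j + 2)| := by
  induction i with
  | zero => simp
  | succ i ih =>
    rw [Finset.sum_range_succ]
    refine (abs_sub_le _ (P (n + 2 * i)) _).trans (add_le_add ih (le_of_eq ?_))
    congr 3
    push_cast
    ring_nf

/-- A finitely supported function is bounded by its total variation. -/
theorem walkProb_le_tsum (hp : 0 ≤ p) (hr : 0 ≤ r) (N : ℕ) (n : ℤ) :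
    walkProb p r N n ≤ ∑' n, |walkProb p r N n - walkProb p r N (n + 2)| := by
  have h := abs_sub_add_le_sum (walkProb p r N) n (N + n.natAbs + 1)
  have h0 : walkProb p r N (n + 2 * (N + n.natAbs + 1 : ℕ)) = 0 :=
    walkProb_eq_zero (lt_abs.2 (by omega))
  rw [h0, sub_zero,
    abs_of_nonneg (walkProb_nonneg hp hr _ _)] at h
  refine h.trans ?_
  have inj : Function.Injective fun j : ℕ => n + 2 * (j : ℤ) := fun a b h => by
    simp only at h
    omega
  refine (((summable_abs_walkProb_sub N).comp_injective inj).sum_le_tsum _ fun _ _ =>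
    abs_nonneg _).trans ?_
  exact tsum_comp_le_tsum_of_inj (summable_abs_walkProb_sub N) (fun _ => abs_nonneg _) inj

/-- The walk with positive drift is rarely negative, by Chebyshev's inequality. -/
theorem tsum_walkProb_neg_le (h : p + r = 1) (hp : 0 < p) (hr : 0 < r) (hd : r < p) {N : ℕ}
    (hN : 0 < N) :
    ∑' n : ℤ, (if n < 0 then walkProb p r N n else 0) ≤ 4 * p * r / (p - r) ^ 2 / N := by
  have hN' : (0 : ℝ) < N := by exact_mod_cast hN
  have hd' : 0 < p - r := by linarith
  have hle (n : ℤ) : (if n < 0 then walkProb p r N n else 0) ≤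
      walkProb p r N n * (n - N * (p - r)) ^ 2 / (N * (p - r)) ^ 2 := by
    have h0 := walkProb_nonneg hp.le hr.le N n
    split_ifs with hn
    · have hn' : (n : ℝ) < 0 := by exact_mod_cast hn
      rw [le_div_iff₀ (by positivity)]
      refine mul_le_mul_of_nonneg_left ?_ h0
      have : 0 < N * (p - r) := by positivity
      nlinarith
    · positivity
  have s : Summable fun n : ℤ => if n < 0 then walkProb p r N n else 0 := by
    refine (summable_walkProb_mul (p := p) (r := r) N fun n => if n < 0 then 1 else 0).congr ?_
    intro n
    simp
  refine (Summable.tsum_le_tsum hle s ((summable_walkProb_mul _ _).div_const _)).trans_eq ?_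
  rw [tsum_div_const, tsum_walkProb_sq h]
  field_simp

end

/-! ### Comparing the multiplicities with the distribution of the walk -/

/-- The reflection of `k` at the first wall above `k`; walls are the `k` with `l ∣ k + 1`, and these
are fixed. -/
def wallReflection (l k : ℕ) : ℕ := if l ∣ k + 1 then k else k + 2 * (l - 1 - k % l)

/-- The limit of the ratio of `m(k) = M_k(N) x^k / (x + x⁻¹)^N` and the distribution `P(k)` of the biased
walk after `N` steps, as a function of the residue `j` of `k` modulo `l`; here `y = x⁻²`. -/
def leadingFactor (l : ℕ) (y : ℝ) (j : ℕ) : ℝ :=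
  if j + 1 = l then 1 - y else (1 - y) * (1 - y ^ (l - 1 - j)) / (1 - y ^ l)

theorem dvd_add_one_iff {l k : ℕ} (hl : 0 < l) : l ∣ k + 1 ↔ k % l + 1 = l := by
  have h1 := Nat.mod_lt k hl
  have h2 := Nat.div_add_mod k l
  constructor
  · intro h
    rw [← h2, add_assoc, Nat.dvd_add_right (dvd_mul_right _ _)] at h
    have := Nat.le_of_dvd (by omega) h
    omega
  · intro h
    rw [← h2, add_assoc, h]
    exact (dvd_mul_right _ _).add dvd_rfl

theorem wallReflection_mul_add {l a j : ℕ} (hj : j + 2 ≤ l) :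
    wallReflection l (a * l + j) = (a + 1) * l + (l - 2 - j) := by
  have h1 : (a * l + j) % l = j := by
    rw [mul_comm, Nat.mul_add_mod, Nat.mod_eq_of_lt (by omega)]
  rw [wallReflection, if_neg (by rw [dvd_add_one_iff (by omega), h1]; omega), h1, add_mul]
  omega

/-- Different weights have different reflections: the reflection maps each alcove to the next one. -/
theorem wallReflection_injective {l : ℕ} (hl : 0 < l) : Function.Injective (wallReflection l) := by
  have key (k : ℕ) (hk : ¬l ∣ k + 1) : wallReflection l k / l = k / l + 1 ∧
      wallReflection l k % l + 2 + k % l = l := by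
    have h1 := Nat.mod_lt k hl
    have h2 := Nat.div_add_mod' k l
    rw [dvd_add_one_iff hl] at hk
    have h3 := wallReflection_mul_add (l := l) (a := k / l) (j := k % l) (by omega)
    rw [h2] at h3
    have h4 : l - 2 - k % l < l := by omega
    rw [h3, mul_comm (k / l + 1), Nat.mul_add_div hl, Nat.mul_add_mod, Nat.div_eq_of_lt h4,
      Nat.mod_eq_of_lt h4]
    omega
  have wall (k : ℕ) (hk : l ∣ k + 1) : wallReflection l k = k := if_pos hk
  have cross (a b : ℕ) (ha : l ∣ a + 1) (hb : ¬l ∣ b + 1)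
      (h : wallReflection l a = wallReflection l b) : False := by
    have := (key b hb).2
    rw [← h, wall a ha] at this
    rw [dvd_add_one_iff hl] at ha
    omega
  intro a b h
  by_cases ha : l ∣ a + 1 <;> by_cases hb : l ∣ b + 1
  · rwa [wall a ha, wall b hb] at h
  · exact (cross a b ha hb h).elim
  · exact (cross b a hb ha h.symm).elim
  · have h1 := key a ha
    have h2 := key b hb
    rw [h] at h1
    rw [← Nat.div_add_mod' a l, ← Nat.div_add_mod' b l, show a / l = b / l by omega,
      show a % l = b % l by omega]

section

variable {l : ℕ} {y : ℝ}

/-- The limit form of the relation between `m(k)` and `m` at the reflection of `k`, with all values of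
`P` replaced by one. -/
theorem leadingFactor_add (hy0 : 0 < y) (hy1 : y < 1) {j : ℕ} (hj : j + 2 ≤ l) :
    leadingFactor l y j + y ^ (l - 1 - j) * leadingFactor l y (l - 2 - j) = 1 - y := by
  have h1 : y ^ l < 1 := pow_lt_one₀ hy0.le hy1 (by omega)
  have h2 : y ^ l = y ^ (l - 1 - j) * y ^ (j + 1) := by rw [← pow_add]; congr 1; omega
  rw [leadingFactor, leadingFactor, if_neg (by omega), if_neg (by omega),
    show l - 1 - (l - 2 - j) = j + 1 by omega]
  have h3 : 1 - y ^ l ≠ 0 := by linarith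
  rw [h2] at h3 ⊢
  field_simp
  ring

theorem leadingFactor_nonneg (hy0 : 0 < y) (hy1 : y < 1) (j : ℕ) : 0 ≤ leadingFactor l y j := by
  have h (n : ℕ) : 0 ≤ 1 - y ^ n := sub_nonneg.2 (pow_le_one₀ hy0.le hy1.le)
  rw [leadingFactor]
  split_ifs
  · linarith
  · exact div_nonneg (mul_nonneg (by linarith) (h _)) (h _)

theorem leadingFactor_le_one (hy0 : 0 < y) (hy1 : y < 1) (j : ℕ) : leadingFactor l y j ≤ 1 := by
  rw [leadingFactor]
  split_ifs
  · linarith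
  · have h1 : y ^ l ≤ y ^ (l - 1 - j) := pow_le_pow_of_le_one hy0.le hy1.le (by omega)
    have h2 (n : ℕ) : 0 ≤ 1 - y ^ n := sub_nonneg.2 (pow_le_one₀ hy0.le hy1.le)
    refine div_le_one_of_le₀ ?_ (h2 _)
    calc (1 - y) * (1 - y ^ (l - 1 - j)) ≤ 1 * (1 - y ^ (l - 1 - j)) :=
          mul_le_mul_of_nonneg_right (by linarith) (h2 _)
      _ ≤ 1 - y ^ l := by linarith

variable {P : ℤ → ℝ} {m : ℕ → ℝ}

/-- The relations between the `m(k)` and `P`, read as a contraction for the error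
`m(k) - leadingFactor · P(k)`. -/
theorem abs_sub_leadingFactor_mul_le (hl : 0 < l) (hy0 : 0 < y) (hy1 : y < 1)
    (hwall : ∀ k : ℕ, l ∣ k + 1 → m k + y * P (k + 2) = P k)
    (hglue : ∀ a j : ℕ, j + 2 ≤ l → m (a * l + j) + y ^ (l - 1 - j) *
      m ((a + 1) * l + (l - 2 - j)) + y * P ((a * l + j : ℕ) + 2) = P (a * l + j : ℕ)) (k : ℕ) :
    |m k - leadingFactor l y (k % l) * P k| ≤
      y * |m (wallReflection l k) -
        leadingFactor l y (wallReflection l k % l) * P (wallReflection l k)| +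
      2 * ∑ i ∈ Finset.range l, |P (k + 2 * i) - P (k + 2 * i + 2)| := by
  set S := ∑ i ∈ Finset.range l, |P (k + 2 * i) - P (k + 2 * i + 2)| with hS
  have hS1 (i : ℕ) (hi : i ≤ l) : |P k - P (k + 2 * i)| ≤ S :=
    (abs_sub_add_le_sum P k i).trans (Finset.sum_le_sum_of_subset_of_nonneg
      (Finset.range_subset_range.2 hi) fun _ _ _ => abs_nonneg _)
  have hS0 : 0 ≤ S := Finset.sum_nonneg fun _ _ => abs_nonneg _
  have hS2 : |P k - P (k + 2)| ≤ S := by simpa using hS1 1 hl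
  have hyS : |y * (P k - P (k + 2))| ≤ S := by
    rw [abs_mul, abs_of_pos hy0]
    nlinarith
  have hkl := Nat.mod_lt k hl
  by_cases hk : l ∣ k + 1
  · have h1 := hwall k hk
    rw [wallReflection, if_pos hk]
    have h2 : m k - leadingFactor l y (k % l) * P k = y * (P k - P (k + 2)) := by
      rw [leadingFactor, if_pos ((dvd_add_one_iff hl).1 hk)]
      linarith
    rw [h2]
    have := mul_nonneg hy0.le (abs_nonneg (y * (P k - P (k + 2))))
    linarith
  · have hk' := hk
    rw [dvd_add_one_iff hl] at hk'
    have hj : k % l + 2 ≤ l := by omega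
    have h1 := hglue (k / l) (k % l) hj
    have h2 := wallReflection_mul_add (a := k / l) hj
    rw [← h2, Nat.div_add_mod'] at h1
    have h3 : wallReflection l k % l = l - 2 - k % l := by
      rw [Nat.div_add_mod'] at h2
      rw [h2, mul_comm, Nat.mul_add_mod, Nat.mod_eq_of_lt (by omega)]
    have h4 := leadingFactor_add hy0 hy1 hj
    have h5 : wallReflection l k = k + 2 * (l - 1 - k % l) := if_neg hk
    have h6 := hS1 (l - 1 - k % l) (by omega)
    rw [h3]
    set d := l - 1 - k % l with hd
    set h' := leadingFactor l y (l - 2 - k % l)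
    have hP : P (wallReflection l k) = P (k + 2 * d) := by rw [h5]; push_cast; rfl
    rw [hP]
    -- All terms but the error at the reflection are differences of values of `P`.
    have h7 : m k - leadingFactor l y (k % l) * P k = y * (P k - P (k + 2)) -
        y ^ d * (m (wallReflection l k) - h' * P (k + 2 * d)) +
        y ^ d * h' * (P k - P (k + 2 * d)) := by
      linear_combination h1 - P k * h4
    have hyd : y ^ d ≤ y := pow_le_of_le_one hy0.le hy1.le (by omega)
    have hyd0 : 0 < y ^ d := pow_pos hy0 _
    have hh0 : 0 ≤ h' := leadingFactor_nonneg hy0 hy1 _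
    have hh1 : h' ≤ 1 := leadingFactor_le_one hy0 hy1 _
    have h8 : |y ^ d * h' * (P k - P (k + 2 * d))| ≤ S := by
      rw [abs_mul, abs_of_nonneg (by positivity : 0 ≤ y ^ d * h')]
      have : y ^ d * h' ≤ 1 := mul_le_one₀ (by linarith) hh0 hh1
      nlinarith [abs_nonneg (P k - P (k + 2 * d))]
    have h9 : |y ^ d * (m (wallReflection l k) - h' * P (k + 2 * d))| ≤
        y * |m (wallReflection l k) - h' * P (k + 2 * d)| := by
      rw [abs_mul, abs_of_pos hyd0]
      exact mul_le_mul_of_nonneg_right hyd (abs_nonneg _)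
    rw [h7]
    refine (abs_add_le _ _).trans ?_
    have := abs_sub (y * (P k - P (k + 2)))
      (y ^ d * (m (wallReflection l k) - h' * P (k + 2 * d)))
    linarith

/-- The multiplicities are close in `ℓ¹` to the distribution of the walk, weighted by
`leadingFactor`. -/
theorem tsum_abs_sub_leadingFactor_mul_le (hl : 0 < l) (hy0 : 0 < y) (hy1 : y < 1)
    (hP : Summable P) (hm : Summable m)
    (hwall : ∀ k : ℕ, l ∣ k + 1 → m k + y * P (k + 2) = P k)
    (hglue : ∀ a j : ℕ, j + 2 ≤ l → m (a * l + j) + y ^ (l - 1 - j) *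
      m ((a + 1) * l + (l - 2 - j)) + y * P ((a * l + j : ℕ) + 2) = P (a * l + j : ℕ)) :
    (Summable fun k : ℕ => |m k - leadingFactor l y (k % l) * P k|) ∧
    ∑' k : ℕ, |m k - leadingFactor l y (k % l) * P k| ≤
      2 * l / (1 - y) * ∑' n, |P n - P (n + 2)| := by
  have hPn : Summable fun k : ℕ => P k := hP.comp_injective Nat.cast_injective
  have hsum : Summable fun k : ℕ => |m k - leadingFactor l y (k % l) * P k| := by
    refine (hm.sub ?_).abs
    refine Summable.of_norm_bounded hPn.abs fun k => ?_
    rw [Real.norm_eq_abs, abs_mul, abs_of_nonneg (leadingFactor_nonneg hy0 hy1 _)]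
    exact mul_le_of_le_one_left (abs_nonneg _) (leadingFactor_le_one hy0 hy1 _)
  have hD : Summable fun n => |P n - P (n + 2)| :=
    (hP.sub ((Equiv.addRight (2 : ℤ)).summable_iff.2 hP)).abs
  have inj (i : ℕ) : Function.Injective fun k : ℕ => (k : ℤ) + 2 * i := fun a b h => by
    simp only at h
    omega
  have hDi (i : ℕ) : Summable fun k : ℕ => |P (k + 2 * i) - P (k + 2 * i + 2)| :=
    hD.comp_injective (inj i)
  have hDi' (i : ℕ) : ∑' k : ℕ, |P (k + 2 * i) - P (k + 2 * i + 2)| ≤ ∑' n, |P n - P (n + 2)| :=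
    tsum_comp_le_tsum_of_inj hD (fun _ => abs_nonneg _) (inj i)
  refine ⟨hsum, ?_⟩
  -- As the reflection is injective, summation over `k` bounds the total error `s` by
  -- `y s + 2 l T`, with `T` the total variation of `P`.
  have hr := hsum.comp_injective (wallReflection_injective hl)
  have hr' := tsum_comp_le_tsum_of_inj hsum (fun _ => abs_nonneg _) (wallReflection_injective hl)
  simp only [Function.comp_def] at hr hr'
  have h1 := Summable.tsum_le_tsum (abs_sub_leadingFactor_mul_le hl hy0 hy1 hwall hglue) hsum
    ((hr.mul_left y).add ((summable_sum fun i _ => hDi i).mul_left 2))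
  rw [(hr.mul_left y).tsum_add ((summable_sum fun i _ => hDi i).mul_left 2), tsum_mul_left,
    tsum_mul_left, Summable.tsum_finsetSum fun i _ => hDi i] at h1
  have h2 := Finset.sum_le_sum fun i (_ : i ∈ Finset.range l) => hDi' i
  rw [Finset.sum_const, Finset.card_range, nsmul_eq_mul] at h2
  have h3 := mul_le_mul_of_nonneg_left hr' hy0.le
  rw [div_mul_eq_mul_div, le_div_iff₀ (by linarith)]
  linarith

/-- The limit of `x^{-k} ch_{T(k)}(x)`, `y = x⁻²`, as `k → ∞` in the residue class `j`
modulo `l`. -/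
def characterFactor (l : ℕ) (y : ℝ) (j : ℕ) : ℝ :=
  if j + 1 = l then 1 / (1 - y) else (1 + y ^ (j + 1)) / (1 - y)

/-- The ratio of the character measure and the distribution of the walk, in the limit, as a
function of the residue `j` modulo `l`. -/
def limitRatio (l : ℕ) (y : ℝ) (j : ℕ) : ℝ :=
  if j + 1 = l then 1 else (1 + y ^ (j + 1)) * (1 - y ^ (l - 1 - j)) / (1 - y ^ l)

theorem leadingFactor_mul_characterFactor (hy1 : y < 1) (j : ℕ) :
    leadingFactor l y j * characterFactor l y j = limitRatio l y j := by
  have : 1 - y ≠ 0 := by linarith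
  rw [leadingFactor, characterFactor, limitRatio]
  split_ifs
  · rw [mul_one_div_cancel this]
  · field_simp

theorem characterFactor_nonneg (hy0 : 0 < y) (hy1 : y < 1) (j : ℕ) :
    0 ≤ characterFactor l y j := by
  have : 0 < 1 - y := by linarith
  rw [characterFactor]
  split_ifs <;> positivity

theorem characterFactor_le (hy0 : 0 < y) (hy1 : y < 1) (j : ℕ) :
    characterFactor l y j ≤ 2 / (1 - y) := by
  have : 0 < 1 - y := by linarith
  have h : y ^ (j + 1) ≤ 1 := pow_le_one₀ hy0.le hy1.le
  rw [characterFactor]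
  split_ifs <;> gcongr <;> linarith

/-- The character measure is close in `ℓ¹` to the distribution of the walk, weighted by
`limitRatio`. -/
theorem tsum_abs_mul_sub_limitRatio_mul_le (hl : 0 < l) (hy0 : 0 < y) (hy1 : y < 1)
    (hP : Summable P) (hP0 : ∀ n, 0 ≤ P n) (hPT : ∀ n, P n ≤ ∑' n, |P n - P (n + 2)|)
    (hm0 : ∀ k, 0 ≤ m k) (hmP : ∀ k : ℕ, m k ≤ P k)
    (hwall : ∀ k : ℕ, l ∣ k + 1 → m k + y * P (k + 2) = P k)
    (hglue : ∀ a j : ℕ, j + 2 ≤ l → m (a * l + j) + y ^ (l - 1 - j) *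
      m ((a + 1) * l + (l - 2 - j)) + y * P ((a * l + j : ℕ) + 2) = P (a * l + j : ℕ))
    {c : ℕ → ℝ} {C : ℝ} (hc : ∀ k, |c k - characterFactor l y (k % l)| ≤ C * y ^ k) :
    (Summable fun k : ℕ => |m k * c k - limitRatio l y (k % l) * P k|) ∧
    ∑' k : ℕ, |m k * c k - limitRatio l y (k % l) * P k| ≤
      (4 * l / (1 - y) ^ 2 + C / (1 - y)) * ∑' n, |P n - P (n + 2)| := by
  have hPn : Summable fun k : ℕ => P k := hP.comp_injective Nat.cast_injective
  have hm : Summable m := Summable.of_nonneg_of_le hm0 hmP hPn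
  obtain ⟨h1, h2⟩ := tsum_abs_sub_leadingFactor_mul_le hl hy0 hy1 hP hm hwall hglue
  set T := ∑' n, |P n - P (n + 2)| with hT
  have hy : 0 < 1 - y := by linarith
  have hC : 0 ≤ C := by simpa using (abs_nonneg _).trans (hc 0)
  have hT0 : 0 ≤ T := (hP0 0).trans (hPT 0)
  have hle (k : ℕ) : |m k * c k - limitRatio l y (k % l) * P k| ≤
      2 / (1 - y) * |m k - leadingFactor l y (k % l) * P k| + T * C * y ^ k := by
    have e : m k * c k - limitRatio l y (k % l) * P k =
        characterFactor l y (k % l) * (m k - leadingFactor l y (k % l) * P k) +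
        m k * (c k - characterFactor l y (k % l)) := by
      rw [← leadingFactor_mul_characterFactor hy1]
      ring
    rw [e]
    refine (abs_add_le _ _).trans (add_le_add ?_ ?_)
    · rw [abs_mul, abs_of_nonneg (characterFactor_nonneg hy0 hy1 _)]
      exact mul_le_mul_of_nonneg_right (characterFactor_le hy0 hy1 _) (abs_nonneg _)
    · rw [abs_mul, abs_of_nonneg (hm0 k), mul_assoc]
      exact mul_le_mul ((hmP k).trans (hPT k)) (hc k) (abs_nonneg _) hT0
  have s := (h1.mul_left (2 / (1 - y))).add
    ((summable_geometric_of_lt_one hy0.le hy1).mul_left (T * C))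
  have s' : Summable fun k : ℕ => |m k * c k - limitRatio l y (k % l) * P k| :=
    Summable.of_nonneg_of_le (fun _ => abs_nonneg _) hle s
  refine ⟨s', (Summable.tsum_le_tsum hle s' s).trans ?_⟩
  rw [(h1.mul_left _).tsum_add ((summable_geometric_of_lt_one hy0.le hy1).mul_left _),
    tsum_mul_left, tsum_mul_left, tsum_geometric_of_lt_one hy0.le hy1]
  calc _ ≤ 2 / (1 - y) * (2 * l / (1 - y) * T) + T * C * (1 - y)⁻¹ := by gcongr
    _ = _ := by field_simp; ring

end

section

/-! ### Discrete measures -/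

/-- A countable convex combination of point masses is a probability measure. -/
theorem isProbabilityMeasure_sum_dirac {ι X : Type*} [MeasurableSpace X] {w : ι → ℝ}
    (hw : ∀ i, 0 ≤ w i) (h : HasSum w 1) (x : ι → X) :
    IsProbabilityMeasure (Measure.sum fun i => ENNReal.ofReal (w i) • Measure.dirac (x i)) := by
  refine ⟨?_⟩
  rw [Measure.sum_apply _ MeasurableSet.univ]
  simp only [Measure.smul_apply, measure_univ, smul_eq_mul, mul_one]
  rw [← ENNReal.ofReal_tsum_of_nonneg hw h.summable, h.tsum_eq, ENNReal.ofReal_one]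

theorem integral_sum_ofReal_dirac {ι X E : Type*} [Countable ι] [MeasurableSpace X]
    [MeasurableSingletonClass X] [NormedAddCommGroup E] [NormedSpace ℝ E] [FiniteDimensional ℝ E]
    {w : ι → ℝ} (hw : ∀ i, 0 ≤ w i) (x : ι → X) (f : X → E) :
    ∫ a, f a ∂(Measure.sum fun i => ENNReal.ofReal (w i) • Measure.dirac (x i)) =
      ∑' i, w i • f (x i) := by
  rw [integral_sum_dirac fun _ => ENNReal.ofReal_ne_top]
  simp_rw [ENNReal.toReal_ofReal (hw _)]

/-! ### The central limit theorem for the walk -/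

variable {p r : ℝ}

theorem tendsto_scale (l : ℕ) : Filter.Tendsto (fun N : ℕ => 1 / ((l : ℝ) * √(2 * (N : ℝ))))
    Filter.atTop (nhds 0) := by
  have h : Filter.Tendsto (fun N : ℕ => (√(2 * (N : ℝ)))⁻¹) Filter.atTop (nhds 0) :=
    tendsto_inv_atTop_zero.comp (Real.tendsto_sqrt_atTop.comp
      (tendsto_natCast_atTop_atTop.const_mul_atTop two_pos))
  simpa [mul_comm] using h.mul_const (l : ℝ)⁻¹

/-- The second order expansion of the characteristic function of a centred step of the walk. -/
theorem norm_exp_step_sub_le (h : p + r = 1) (hp : 0 ≤ p) (hr : 0 ≤ r) (z : ℂ) :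
    ‖(p * Complex.exp z + r * Complex.exp (-z)) * Complex.exp (-((p - r : ℝ) * z)) - 1 -
      2 * p * r * z ^ 2‖ ≤ 8 * ‖z‖ ^ 3 * Real.exp (2 * ‖z‖) := by
  have hE (a : ℝ) (ha0 : 0 ≤ a) (ha : a ≤ 2) (w : ℂ) (hw : ‖w‖ = a * ‖z‖) :
      ‖Complex.exp w - (1 + w + w ^ 2 / 2)‖ ≤ 8 * ‖z‖ ^ 3 * Real.exp (2 * ‖z‖) := by
    have h1 := Complex.norm_exp_sub_sum_le_norm_mul_exp w 3
    simp only [Finset.sum_range_succ, Finset.sum_range_zero, Nat.factorial] at h1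
    norm_num at h1
    refine h1.trans ?_
    rw [hw, mul_pow]
    have h2 : a ^ 3 ≤ 8 := by
      calc a ^ 3 ≤ 2 ^ 3 := by gcongr
        _ = 8 := by norm_num
    gcongr
  have hr' : (r : ℂ) = 1 - p := by
    rw [← Complex.ofReal_one, ← h]
    push_cast
    ring
  have e1 : (p * Complex.exp z + r * Complex.exp (-z)) * Complex.exp (-((p - r : ℝ) * z)) - 1 -
      2 * p * r * z ^ 2 =
      p * (Complex.exp (2 * r * z) - (1 + 2 * r * z + (2 * r * z) ^ 2 / 2)) +
      r * (Complex.exp (-(2 * p * z)) - (1 + -(2 * p * z) + (-(2 * p * z)) ^ 2 / 2)) := by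
    rw [add_mul, mul_assoc, mul_assoc, ← Complex.exp_add, ← Complex.exp_add]
    push_cast
    rw [show z + -((p - r) * z) = 2 * r * z by rw [hr']; ring,
      show -z + -((p - r) * z) = -(2 * p * z) by rw [hr']; ring, hr']
    ring
  rw [e1]
  refine (norm_add_le _ _).trans ?_
  rw [norm_mul, norm_mul, Complex.norm_real, Complex.norm_real, Real.norm_of_nonneg hp,
    Real.norm_of_nonneg hr]
  have h1 := hE (2 * r) (by linarith) (by linarith) (2 * r * z)
    (by simp [abs_of_nonneg hr])
  have h2 := hE (2 * p) (by linarith) (by linarith) (-(2 * p * z))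
    (by simp [abs_of_nonneg hp])
  calc _ ≤ p * (8 * ‖z‖ ^ 3 * Real.exp (2 * ‖z‖)) + r * (8 * ‖z‖ ^ 3 * Real.exp (2 * ‖z‖)) := by
        gcongr
    _ = _ := by rw [← add_mul, h, one_mul]

/-- The rescaled position `(n / l - 2 N₁ (p - r)) / √(2 N₁)` of the walk. -/
def walkScale (p r : ℝ) (l N₁ : ℕ) (n : ℤ) : ℝ :=
  ((n : ℝ) / l - 2 * N₁ * (p - r)) / √(2 * (N₁ : ℝ))

/-- The law of the rescaled walk after `2 l N₁ + N₀` steps. -/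
def walkLaw (p r : ℝ) (l N₀ N₁ : ℕ) : Measure ℝ :=
  Measure.sum fun n : ℤ => ENNReal.ofReal (walkProb p r (2 * l * N₁ + N₀) n) •
    Measure.dirac (walkScale p r l N₁ n)

theorem isProbabilityMeasure_walkLaw (h : p + r = 1) (hp : 0 ≤ p) (hr : 0 ≤ r) (l N₀ N₁ : ℕ) :
    IsProbabilityMeasure (walkLaw p r l N₀ N₁) :=
  isProbabilityMeasure_sum_dirac (walkProb_nonneg hp hr _)
    (tsum_walkProb h (2 * l * N₁ + N₀) ▸ (summable_walkProb _).hasSum) _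

/-- The characteristic function of the rescaled walk, split into `2 l N₁` centred steps and `N₀` further
ones. -/
theorem charFun_walkLaw (hp : 0 ≤ p) (hr : 0 ≤ r) {l : ℕ} (hl : 0 < l) (N₀ N₁ : ℕ) (s : ℝ)
    {z : ℂ} (hz : z = (s * (1 / (l * √(2 * (N₁ : ℝ)))) : ℝ) * Complex.I) :
    charFun (walkLaw p r l N₀ N₁) s =
      (((p * Complex.exp z + r * Complex.exp (-z)) * Complex.exp (-((p - r : ℝ) * z))) ^ N₁) ^
        (2 * l) * (p * Complex.exp z + r * Complex.exp (-z)) ^ N₀ := by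
  rw [charFun_apply_real, walkLaw, integral_sum_ofReal_dirac (walkProb_nonneg hp hr _)]
  have e (n : ℤ) : Complex.exp (s * (walkScale p r l N₁ n : ℝ) * Complex.I) =
      Complex.exp (n * z) * Complex.exp (-((p - r : ℝ) * z)) ^ (N₁ * (2 * l)) := by
    rw [← Complex.exp_nat_mul, ← Complex.exp_add]
    congr 1
    have hl' : (l : ℂ) ≠ 0 := by exact_mod_cast hl.ne'
    rw [hz, walkScale]
    push_cast
    field_simp
    ring
  simp_rw [e, ← smul_mul_assoc]
  rw [tsum_mul_right, tsum_walkProb_exp, mul_pow, mul_pow, ← pow_mul, ← pow_mul,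
    show 2 * l * N₁ = N₁ * (2 * l) by ring, pow_add]
  ring

/-- The central limit theorem for the walk, in terms of characteristic functions. -/
theorem tendsto_charFun_walkLaw (h : p + r = 1) (hp : 0 ≤ p) (hr : 0 ≤ r) {l : ℕ} (hl : 0 < l)
    (N₀ : ℕ) (s : ℝ) :
    Filter.Tendsto (fun N₁ => charFun (walkLaw p r l N₀ N₁) s) Filter.atTop
      (nhds (charFun (ProbabilityTheory.gaussianReal 0 (4 * p * r / l).toNNReal) s)) := by
  simp only [fun N₁ => charFun_walkLaw hp hr hl N₀ N₁ s rfl]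
  let z (N : ℕ) : ℂ := (s * (1 / (l * √(2 * (N : ℝ)))) : ℝ) * Complex.I
  have hz : Filter.Tendsto z Filter.atTop (nhds 0) := by
    have h1 := (tendsto_scale l).const_mul s
    have h2 := ((Complex.continuous_ofReal.tendsto _).comp h1).mul_const Complex.I
    simpa [z] using h2
  have hzN (N : ℕ) (hN : 0 < N) : (N : ℂ) * z N ^ 2 = -(s ^ 2 / (2 * l ^ 2) : ℝ) := by
    have h2 : (0 : ℝ) < 2 * N := by positivity
    have h1 : (N : ℝ) * (s * (1 / (l * √(2 * (N : ℝ))))) ^ 2 = s ^ 2 / (2 * l ^ 2) := by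
      rw [mul_pow, div_pow, mul_pow, Real.sq_sqrt h2.le]
      field_simp
    rw [← h1]
    simp only [z, mul_pow, Complex.I_sq]
    push_cast
    ring
  have hzN' (N : ℕ) (hN : 0 < N) : (N : ℝ) * ‖z N‖ ^ 2 = s ^ 2 / (2 * l ^ 2) := by
    have := congrArg norm (hzN N hN)
    rw [norm_mul, norm_pow, Complex.norm_natCast, norm_neg, Complex.norm_real,
      Real.norm_of_nonneg (by positivity)] at this
    exact this
  let g (N : ℕ) : ℂ := (p * Complex.exp (z N) + r * Complex.exp (-z N)) *
    Complex.exp (-((p - r : ℝ) * z N)) - 1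
  have hg : Filter.Tendsto (fun N : ℕ => (N : ℂ) * g N) Filter.atTop
      (nhds (-(2 * p * r * (s ^ 2 / (2 * l ^ 2))))) := by
    have h1 : Filter.Tendsto (fun N : ℕ => (N : ℂ) * (g N - 2 * p * r * z N ^ 2)) Filter.atTop
        (nhds 0) := by
      have hb : Filter.Tendsto (fun N => s ^ 2 / (2 * (l : ℝ) ^ 2) * (8 * ‖z N‖ *
          Real.exp (2 * ‖z N‖))) Filter.atTop (nhds 0) := by
        have h2 := tendsto_norm_zero.comp hz
        have h3 := ((h2.const_mul 8).mul (Real.continuous_exp.tendsto _ |>.comp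
          (h2.const_mul 2))).const_mul (s ^ 2 / (2 * (l : ℝ) ^ 2))
        simpa using h3
      refine squeeze_zero_norm' ?_ hb
      filter_upwards [Filter.eventually_gt_atTop 0] with N hN
      rw [norm_mul, Complex.norm_natCast, ← hzN' N hN]
      calc (N : ℝ) * ‖g N - 2 * p * r * z N ^ 2‖ ≤
            N * (8 * ‖z N‖ ^ 3 * Real.exp (2 * ‖z N‖)) := by
            gcongr
            exact norm_exp_step_sub_le h hp hr (z N)
        _ = _ := by ring
    have h2 := h1.add_const (-(2 * p * r * (s ^ 2 / (2 * l ^ 2)) : ℂ))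
    rw [zero_add] at h2
    refine h2.congr' ?_
    filter_upwards [Filter.eventually_gt_atTop 0] with N hN
    have := hzN N hN
    push_cast at this
    linear_combination -(2 * p * r : ℂ) * this
  have h1 := (Complex.tendsto_one_add_pow_exp_of_tendsto hg).pow (2 * l)
  have h2 : Filter.Tendsto (fun N => (p * Complex.exp (z N) + r * Complex.exp (-z N)) ^ N₀)
      Filter.atTop (nhds 1) := by
    have hc : Continuous fun w : ℂ => (p * Complex.exp w + r * Complex.exp (-w)) ^ N₀ := by fun_prop
    have := (hc.tendsto 0).comp hz
    have h1' : (p + r : ℂ) = 1 := by exact_mod_cast h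
    simpa [h1', Function.comp_def] using this
  have h3 := h1.mul h2
  simp only [g, z, add_sub_cancel] at h3
  have hl' : (l : ℂ) ≠ 0 := by exact_mod_cast hl.ne'
  convert h3 using 2
  rw [ProbabilityTheory.charFun_gaussianReal, mul_one, ← Complex.exp_nat_mul,
    Real.coe_toNNReal _ (by positivity)]
  congr 1
  push_cast
  field_simp
  ring

/-- The central limit theorem for the walk, in terms of bounded continuous test functions. -/
theorem tendsto_tsum_walkProb (h : p + r = 1) (hp : 0 ≤ p) (hr : 0 ≤ r) {l : ℕ} (hl : 0 < l)
    (N₀ : ℕ) {f : ℝ → ℝ} {B : ℝ} (hB : ∀ a, |f a| ≤ B) (hf : Continuous f) :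
    Filter.Tendsto (fun N₁ : ℕ => ∑' n : ℤ, walkProb p r (2 * l * N₁ + N₀) n *
      f (walkScale p r l N₁ n)) Filter.atTop
      (nhds (∫ a, f a ∂(ProbabilityTheory.gaussianReal 0 (4 * p * r / l).toNNReal))) := by
  let μ (N₁ : ℕ) : ProbabilityMeasure ℝ :=
    ⟨walkLaw p r l N₀ N₁, isProbabilityMeasure_walkLaw h hp hr l N₀ N₁⟩
  let ν : ProbabilityMeasure ℝ :=
    ⟨ProbabilityTheory.gaussianReal 0 (4 * p * r / l).toNNReal, inferInstance⟩
  have h1 : Filter.Tendsto μ Filter.atTop (nhds ν) :=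
    ProbabilityMeasure.tendsto_iff_tendsto_charFun.2 (tendsto_charFun_walkLaw h hp hr hl N₀)
  have h2 := ProbabilityMeasure.tendsto_iff_forall_integral_tendsto.1 h1
    (BoundedContinuousFunction.ofNormedAddCommGroup f hf B hB)
  refine h2.congr fun N₁ => ?_
  change ∫ a, f a ∂(walkLaw p r l N₀ N₁) = _
  rw [walkLaw, integral_sum_ofReal_dirac (walkProb_nonneg hp hr _)]
  rfl

end

section

/-! ### Equidistribution of the walk modulo `l` -/

variable {p r : ℝ}

/-- A function on `ℤ / l`, `l` odd, which changes little under the shift by `2` is nearly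
constant. -/
theorem abs_mul_sub_sum_le {l : ℕ} [NeZero l] (hl : Odd l) {A : ZMod l → ℝ} {δ : ℝ}
    (h : ∀ c, |A (c + 2) - A c| ≤ δ) (c : ZMod l) :
    |l * A c - ∑ c', A c'| ≤ l * (l * δ) := by
  have hδ : 0 ≤ δ := (abs_nonneg _).trans (h c)
  have h1 (i : ℕ) : |A (c + 2 * i) - A c| ≤ i * δ := by
    induction i with
    | zero => simp
    | succ i ih =>
      have := h (c + 2 * i)
      rw [show c + 2 * ((i + 1 : ℕ) : ZMod l) = c + 2 * i + 2 by push_cast; ring]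
      refine (abs_sub_le _ (A (c + 2 * i)) _).trans ?_
      push_cast
      linarith
  have h2 (c' : ZMod l) : |A c' - A c| ≤ l * δ := by
    -- As `l` is odd, any two residues are connected by less than `l` shifts by `2`.
    let u := ZMod.unitOfCoprime 2 (Nat.coprime_two_left.2 hl)
    have hu : (2 : ZMod l) * (↑u⁻¹ * (c' - c)) = c' - c := by
      rw [← mul_assoc, show (2 : ZMod l) = u from (ZMod.coe_unitOfCoprime 2 _).symm,
        Units.mul_inv, one_mul]
    have h3 := h1 (↑u⁻¹ * (c' - c) : ZMod l).val
    rw [ZMod.natCast_zmod_val, hu, add_sub_cancel] at h3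
    exact h3.trans (mul_le_mul_of_nonneg_right (by exact_mod_cast (ZMod.val_lt _).le) hδ)
  have h4 : l * A c - ∑ c', A c' = ∑ c', (A c - A c') := by
    rw [Finset.sum_sub_distrib, Finset.sum_const, Finset.card_univ, ZMod.card, nsmul_eq_mul]
  rw [h4]
  refine (Finset.abs_sum_le_sum_abs _ _).trans ?_
  refine (Finset.sum_le_sum fun c' _ => (abs_sub_comm _ _).trans_le (h2 c')).trans_eq ?_
  rw [Finset.sum_const, Finset.card_univ, ZMod.card, nsmul_eq_mul]

/-- The contributions of the residue classes modulo `l` to an expectation of the walk are nearly equal,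
since the distribution changes little under the shift by `2`. -/
theorem abs_mul_tsum_residue_sub_le (h : p + r = 1) (hp : 0 ≤ p) (hr : 0 ≤ r) {l : ℕ} [NeZero l]
    (hl : Odd l) (N : ℕ) {g : ℤ → ℝ} {B ε : ℝ} (hB : ∀ n, |g n| ≤ B)
    (hε : ∀ n, |g (n + 2) - g n| ≤ ε) (c : ZMod l) :
    |l * ∑' n : ℤ, walkProb p r N n * (if (n : ZMod l) = c then g n else 0) -
      ∑' n : ℤ, walkProb p r N n * g n| ≤
      l * (l * ((∑' n, |walkProb p r N n - walkProb p r N (n + 2)|) * B + ε)) := by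
  let A (c : ZMod l) : ℝ := ∑' n : ℤ, walkProb p r N n * (if (n : ZMod l) = c then g n else 0)
  have hs : ∑' n : ℤ, walkProb p r N n * g n = ∑ c, A c := by
    rw [← Summable.tsum_finsetSum fun c _ => summable_walkProb_mul _ _]
    refine tsum_congr fun n => ?_
    rw [← Finset.mul_sum, Finset.sum_ite_eq, if_pos (Finset.mem_univ _)]
  rw [hs]
  refine abs_mul_sub_sum_le hl (A := A) (fun c => ?_) c
  have h1 : A (c + 2) = ∑' n : ℤ, walkProb p r N (n + 2) *
      (if (n : ZMod l) = c then g (n + 2) else 0) := by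
    refine (Equiv.tsum_eq (Equiv.addRight (2 : ℤ)) _).symm.trans (tsum_congr fun n => ?_)
    simp only [Equiv.coe_addRight, Int.cast_add, Int.cast_ofNat, add_left_inj]
  have s1 : Summable fun n : ℤ => walkProb p r N (n + 2) *
      (if (n : ZMod l) = c then g (n + 2) else 0) := summable_walkProb_smul N 2 _
  rw [h1, ← s1.tsum_sub (summable_walkProb_mul _ _)]
  have s2 := (summable_abs_walkProb_sub (p := p) (r := r) N).mul_right B
  have s3 := (summable_walkProb (p := p) (r := r) N).mul_right ε
  have hle (n : ℤ) : ‖walkProb p r N (n + 2) * (if (n : ZMod l) = c then g (n + 2) else 0) -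
      walkProb p r N n * (if (n : ZMod l) = c then g n else 0)‖ ≤
      |walkProb p r N n - walkProb p r N (n + 2)| * B + walkProb p r N n * ε := by
    have hP := walkProb_nonneg hp hr N n
    have hB0 : 0 ≤ B := (abs_nonneg _).trans (hB 0)
    have hε0 : 0 ≤ ε := (abs_nonneg _).trans (hε 0)
    split_ifs
    · rw [show walkProb p r N (n + 2) * g (n + 2) - walkProb p r N n * g n =
        -((walkProb p r N n - walkProb p r N (n + 2)) * g (n + 2)) +
          walkProb p r N n * (g (n + 2) - g n) by ring]
      refine (norm_add_le _ _).trans ?_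
      rw [norm_neg, Real.norm_eq_abs, Real.norm_eq_abs, abs_mul, abs_mul, abs_of_nonneg hP]
      gcongr
      · exact hB _
      · exact hε _
    · simp only [mul_zero, sub_zero, norm_zero]
      positivity
  have s4 := Summable.of_nonneg_of_le (fun _ => norm_nonneg _) hle (s2.add s3)
  refine (norm_tsum_le_tsum_norm s4).trans ((s4.tsum_le_tsum hle (s2.add s3)).trans_eq ?_)
  rw [s2.tsum_add s3, tsum_mul_right, tsum_mul_right, tsum_walkProb h, one_mul]

theorem tendsto_mul_add_atTop {a : ℕ} (ha : 0 < a) (b : ℕ) :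
    Filter.Tendsto (fun N : ℕ => a * N + b) Filter.atTop Filter.atTop :=
  Filter.tendsto_atTop_mono (fun N => by
    have := Nat.le_mul_of_pos_left N ha
    simp only [id]
    omega) Filter.tendsto_id

theorem tendsto_tsum_abs_walkProb_sub (h : p + r = 1) (hp : 0 < p) (hr : 0 < r) :
    Filter.Tendsto (fun N => ∑' n, |walkProb p r N n - walkProb p r N (n + 2)|) Filter.atTop
      (nhds 0) := by
  refine squeeze_zero (fun N => tsum_nonneg fun _ => abs_nonneg _)
    (tsum_abs_walkProb_sub_le h hp hr) ?_
  simp_rw [one_div]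
  refine tendsto_inv_atTop_zero.comp (Real.tendsto_sqrt_atTop.comp ?_)
  exact (Filter.tendsto_atTop_add_const_right _ 1 tendsto_natCast_atTop_atTop).atTop_mul_const
    (mul_pos hp hr)

/-- Under the walk, the residue modulo `l` and the rescaled position are asymptotically
independent, and the residue is asymptotically uniform. -/
theorem tendsto_tsum_walkProb_residue (h : p + r = 1) (hp : 0 < p) (hr : 0 < r) {l : ℕ} [NeZero l]
    (hl : Odd l) (N₀ : ℕ) {f : ZMod l → ℝ → ℝ} {B L : ℝ} (hB : ∀ c a, |f c a| ≤ B)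
    (hL : ∀ c a b, |f c a - f c b| ≤ L * |a - b|) :
    Filter.Tendsto (fun N₁ : ℕ => ∑' n : ℤ, walkProb p r (2 * l * N₁ + N₀) n *
      f n (walkScale p r l N₁ n)) Filter.atTop
      (nhds (∑ c, (l : ℝ)⁻¹ *
        ∫ a, f c a ∂(ProbabilityTheory.gaussianReal 0 (4 * p * r / l).toNNReal))) := by
  have hl0 : 0 < l := hl.pos
  have hl0' : (0 : ℝ) < l := by exact_mod_cast hl0
  have hc (c : ZMod l) : Filter.Tendsto (fun N₁ : ℕ => ∑' n : ℤ,
      walkProb p r (2 * l * N₁ + N₀) n * (if (n : ZMod l) = c then f c (walkScale p r l N₁ n) else 0))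
      Filter.atTop (nhds ((l : ℝ)⁻¹ *
        ∫ a, f c a ∂(ProbabilityTheory.gaussianReal 0 (4 * p * r / l).toNNReal))) := by
    have hcont : Continuous (f c) := by
      have : LipschitzWith L.toNNReal (f c) := LipschitzWith.of_dist_le_mul fun a b => by
        rw [Real.dist_eq, Real.dist_eq]
        exact (hL c a b).trans (mul_le_mul_of_nonneg_right (Real.le_coe_toNNReal _) (abs_nonneg _))
      exact this.continuous
    have h1 := tendsto_tsum_walkProb h hp.le hr.le hl0 N₀ (hB c) hcont
    have hT := (tendsto_tsum_abs_walkProb_sub h hp hr).comp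
      (tendsto_mul_add_atTop (a := 2 * l) (by omega) N₀)
    have h2 : Filter.Tendsto (fun N₁ : ℕ => l * (l * ((∑' n,
        |walkProb p r (2 * l * N₁ + N₀) n - walkProb p r (2 * l * N₁ + N₀) (n + 2)|) * B +
          L * (2 * (1 / ((l : ℝ) * √(2 * (N₁ : ℝ)))))))) Filter.atTop (nhds 0) := by
      have := (((hT.mul_const B).add (((tendsto_scale l).const_mul 2).const_mul L)).const_mul
        (l : ℝ)).const_mul (l : ℝ)
      simpa using this
    have hε (N₁ : ℕ) (n : ℤ) : |f c (walkScale p r l N₁ (n + 2)) - f c (walkScale p r l N₁ n)| ≤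
        L * (2 * (1 / ((l : ℝ) * √(2 * (N₁ : ℝ))))) := by
      refine (hL c _ _).trans_eq ?_
      rw [show walkScale p r l N₁ (n + 2) - walkScale p r l N₁ n =
        2 * (1 / ((l : ℝ) * √(2 * (N₁ : ℝ)))) by
          rw [walkScale, walkScale, ← sub_div, one_div, mul_inv]
          push_cast
          field_simp
          ring, abs_of_nonneg (by positivity)]
    have h3 : Filter.Tendsto (fun N₁ : ℕ => l * ∑' n : ℤ, walkProb p r (2 * l * N₁ + N₀) n *
        (if (n : ZMod l) = c then f c (walkScale p r l N₁ n) else 0) -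
        ∑' n : ℤ, walkProb p r (2 * l * N₁ + N₀) n * f c (walkScale p r l N₁ n)) Filter.atTop
        (nhds 0) :=
      squeeze_zero_norm (fun N₁ => (Real.norm_eq_abs _).trans_le
        (abs_mul_tsum_residue_sub_le h hp.le hr.le hl _ (fun n => hB c _) (hε N₁) c)) h2
    have h4 := ((h3.add h1).const_mul (l : ℝ)⁻¹)
    rw [zero_add] at h4
    refine h4.congr fun N₁ => ?_
    rw [sub_add_cancel, inv_mul_cancel_left₀ hl0'.ne']
  refine (tendsto_finsetSum _ fun c _ => hc c).congr fun N₁ => ?_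
  rw [← Summable.tsum_finsetSum fun c _ => summable_walkProb_mul _ _]
  refine tsum_congr fun n => ?_
  rw [← Finset.mul_sum, Finset.sum_ite_eq, if_pos (Finset.mem_univ _)]

/-- Restricting the walk to `ℕ` changes expectations by at most its mass on negative numbers. -/
theorem abs_tsum_nat_sub_tsum_int_le (hp : 0 ≤ p) (hr : 0 ≤ r) (N : ℕ) {g : ℤ → ℝ} {B : ℝ}
    (hB : ∀ n, |g n| ≤ B) :
    |∑' k : ℕ, walkProb p r N k * g k - ∑' n : ℤ, walkProb p r N n * g n| ≤
      B * ∑' n : ℤ, (if n < 0 then walkProb p r N n else 0) := by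
  have h1 : ∑' k : ℕ, walkProb p r N k * g k =
      ∑' n : ℤ, walkProb p r N n * (if n < 0 then 0 else g n) := by
    rw [← Nat.cast_injective.tsum_eq (f := fun n : ℤ => walkProb p r N n *
      (if n < 0 then 0 else g n))]
    · exact tsum_congr fun k => by rw [if_neg (by omega)]
    · intro n hn
      by_contra h
      refine hn ?_
      have : n < 0 := by
        by_contra h'
        exact h ⟨n.toNat, by omega⟩
      simp [this]
  rw [h1, ← (summable_walkProb_mul _ _).tsum_sub (summable_walkProb_mul _ _), ← tsum_mul_left]
  have s : Summable fun n : ℤ => B * (if n < 0 then walkProb p r N n else 0) := by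
    refine (summable_walkProb_mul (p := p) (r := r) N fun n => B * if n < 0 then 1 else 0).congr ?_
    intro n
    split_ifs <;> ring
  have hle (n : ℤ) : ‖walkProb p r N n * (if n < 0 then 0 else g n) - walkProb p r N n * g n‖ ≤
      B * (if n < 0 then walkProb p r N n else 0) := by
    split_ifs
    · rw [mul_zero, zero_sub, norm_neg, Real.norm_eq_abs, abs_mul,
        abs_of_nonneg (walkProb_nonneg hp hr N n), mul_comm]
      exact mul_le_mul_of_nonneg_right (hB n) (walkProb_nonneg hp hr N n)
    · simp
  have s' := Summable.of_nonneg_of_le (fun _ => norm_nonneg _) hle s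
  exact (norm_tsum_le_tsum_norm s').trans (s'.tsum_le_tsum hle s)

/-- A family of densities on `ℕ` which is `ℓ¹`-close to the distribution of the walk, weighted by a
function of the residue modulo `l`, has the same kind of limit law. -/
theorem tendsto_tsum_residue_of_close (h : p + r = 1) (hr : 0 < r) (hd : r < p) {l : ℕ}
    [NeZero l] (hl : Odd l) (N₀ : ℕ) {W : ZMod l → ℝ} {C : ℝ} (hW : ∀ c, |W c| ≤ C)
    {π : ℕ → ℕ → ℝ}
    (hs : ∀ N₁, Summable fun k : ℕ => |π N₁ k - W k * walkProb p r (2 * l * N₁ + N₀) k|)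
    (hπ : Filter.Tendsto (fun N₁ : ℕ => ∑' k : ℕ,
      |π N₁ k - W k * walkProb p r (2 * l * N₁ + N₀) k|) Filter.atTop (nhds 0))
    {f : ZMod l → ℝ → ℝ} {B L : ℝ} (hB : ∀ c a, |f c a| ≤ B)
    (hL : ∀ c a b, |f c a - f c b| ≤ L * |a - b|) :
    Filter.Tendsto (fun N₁ : ℕ => ∑' k : ℕ, π N₁ k *
      f k ((((k / l : ℕ) : ℝ) - 2 * (N₁ : ℝ) * (p - r)) / √(2 * (N₁ : ℝ)))) Filter.atTop
      (nhds (∑ c, (l : ℝ)⁻¹ * W c *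
        ∫ a, f c a ∂(ProbabilityTheory.gaussianReal 0 (4 * p * r / l).toNNReal))) := by
  have hp : 0 < p := hr.trans hd
  have hl0 : 0 < l := hl.pos
  have hl0' : (0 : ℝ) < l := by exact_mod_cast hl0
  have hC0 : 0 ≤ C := (abs_nonneg _).trans (hW 0)
  have hB0 : 0 ≤ B := (abs_nonneg _).trans (hB 0 0)
  have hL0 : 0 ≤ L := by simpa using (abs_nonneg _).trans (hL 0 0 1)
  have hWB (c : ZMod l) (a : ℝ) : |W c * f c a| ≤ C * B := by
    rw [abs_mul]
    exact mul_le_mul (hW c) (hB c a) (abs_nonneg _) hC0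
  have hmain := tendsto_tsum_walkProb_residue h hp hr hl N₀ (f := fun c a => W c * f c a) hWB
    (L := C * L) fun c a b => by
      rw [← mul_sub, abs_mul, mul_assoc]
      exact mul_le_mul (hW c) (hL c a b) (abs_nonneg _) hC0
  simp_rw [integral_const_mul, ← mul_assoc] at hmain
  let N (N₁ : ℕ) := 2 * l * N₁ + N₀
  let α (N₁ k : ℕ) : ℝ := (((k / l : ℕ) : ℝ) - 2 * (N₁ : ℝ) * (p - r)) / √(2 * (N₁ : ℝ))
  have hα (N₁ k : ℕ) : |α N₁ k - walkScale p r l N₁ k| ≤ l * (1 / (l * √(2 * (N₁ : ℝ)))) := by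
    simp only [α]
    rw [walkScale, ← sub_div, abs_div, abs_of_nonneg (Real.sqrt_nonneg _), one_div, mul_inv,
      mul_inv_cancel_left₀ hl0'.ne', div_eq_mul_inv]
    refine mul_le_of_le_one_left (by positivity) ?_
    have h1 : (l : ℝ) * (k / l : ℕ) + (k % l : ℕ) = k := by exact_mod_cast Nat.div_add_mod k l
    have h2 : ((k % l : ℕ) : ℝ) < l := by exact_mod_cast Nat.mod_lt k hl0
    have h3 : (0 : ℝ) ≤ (k % l : ℕ) := by positivity
    have h4 : ((k / l : ℕ) : ℝ) - 2 * N₁ * (p - r) - (((k : ℤ) : ℝ) / l - 2 * N₁ * (p - r)) =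
        -((k % l : ℕ) / l) := by
      rw [Int.cast_natCast, ← h1]
      field_simp
      ring
    rw [h4, abs_neg, abs_of_nonneg (by positivity)]
    exact (div_le_one hl0').2 h2.le
  have hsP (N₁ : ℕ) (g : ℕ → ℝ) : Summable fun k : ℕ => walkProb p r (N N₁) k * g k := by
    simpa [Function.comp_def] using (summable_walkProb_mul (p := p) (r := r) (N N₁)
      fun n : ℤ => g n.toNat).comp_injective Nat.cast_injective
  have hnat (N₁ : ℕ) : ∑' k : ℕ, walkProb p r (N N₁) k ≤ 1 := by
    rw [← tsum_walkProb h (N N₁)]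
    exact tsum_comp_le_tsum_of_inj (summable_walkProb _) (walkProb_nonneg hp.le hr.le _)
      Nat.cast_injective
  let tail (N₁ : ℕ) := ∑' n : ℤ, (if n < 0 then walkProb p r (N N₁) n else 0)
  have htail : Filter.Tendsto tail Filter.atTop (nhds 0) := by
    have h1 : Filter.Tendsto (fun N₁ => 4 * p * r / (p - r) ^ 2 / (N N₁ : ℝ)) Filter.atTop
        (nhds 0) := (tendsto_const_nhds (x := 4 * p * r / (p - r) ^ 2)).div_atTop
      (tendsto_natCast_atTop_atTop.comp (tendsto_mul_add_atTop (by omega) N₀))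
    refine squeeze_zero' (.of_forall fun N₁ => tsum_nonneg fun n => ?_) ?_ h1
    · split_ifs
      exacts [walkProb_nonneg hp.le hr.le _ _, le_rfl]
    · filter_upwards [Filter.eventually_gt_atTop 0] with N₁ hN₁
      exact tsum_walkProb_neg_le h hp hr hd (by positivity)
  have hbound : Filter.Tendsto (fun N₁ => (∑' k : ℕ, |π N₁ k - W k * walkProb p r (N N₁) k|) * B +
      C * (L * (l * (1 / (l * √(2 * (N₁ : ℝ)))))) + C * B * tail N₁) Filter.atTop (nhds 0) := by
    have := ((hπ.mul_const B).add ((((tendsto_scale l).const_mul (l : ℝ)).const_mul L).const_mul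
      C)).add (htail.const_mul (C * B))
    simpa using this
  have hdiff : Filter.Tendsto (fun N₁ => ∑' k : ℕ, π N₁ k * f k (α N₁ k) -
      ∑' n : ℤ, walkProb p r (N N₁) n * (W n * f n (walkScale p r l N₁ n))) Filter.atTop
      (nhds 0) := by
    refine squeeze_zero_norm (fun N₁ => ?_) hbound
    -- The error consists of the `ℓ¹`-distance of the densities (`a`), the effect of rounding `k / l`
    -- (`b`), and the part of the walk on negative numbers, missing in `∑ d`.
    let a (k : ℕ) := (π N₁ k - W k * walkProb p r (N N₁) k) * f k (α N₁ k)
    let b (k : ℕ) := walkProb p r (N N₁) k * (W k * (f k (α N₁ k) - f k (walkScale p r l N₁ k)))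
    let d (k : ℕ) := walkProb p r (N N₁) k * (W k * f k (walkScale p r l N₁ k))
    have ha (k : ℕ) : ‖a k‖ ≤ |π N₁ k - W k * walkProb p r (N N₁) k| * B := by
      rw [Real.norm_eq_abs, abs_mul]
      exact mul_le_mul_of_nonneg_left (hB _ _) (abs_nonneg _)
    have hb (k : ℕ) : ‖b k‖ ≤
        walkProb p r (N N₁) k * (C * (L * (l * (1 / (l * √(2 * (N₁ : ℝ))))))) := by
      have hP := walkProb_nonneg hp.le hr.le (N N₁) k
      rw [Real.norm_eq_abs, abs_mul, abs_mul, abs_of_nonneg hP]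
      refine mul_le_mul_of_nonneg_left (mul_le_mul (hW _) ?_ (abs_nonneg _) hC0) hP
      exact (hL _ _ _).trans (mul_le_mul_of_nonneg_left (hα N₁ k) hL0)
    have sa' := (hs N₁).mul_right B
    have sa : Summable a := Summable.of_norm_bounded sa' ha
    have sb' := hsP N₁ fun _ => C * (L * (l * (1 / (l * √(2 * (N₁ : ℝ))))))
    have sb : Summable b := hsP N₁ _
    have sd : Summable d := hsP N₁ _
    have e : ∑' k : ℕ, π N₁ k * f k (α N₁ k) = ∑' k, a k + ∑' k, b k + ∑' k, d k := by
      rw [← sa.tsum_add sb, ← (sa.add sb).tsum_add sd]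
      refine tsum_congr fun k => ?_
      simp only [a, b, d]
      ring
    rw [e, add_sub_assoc]
    refine (norm_add_le _ _).trans (add_le_add ((norm_add_le _ _).trans (add_le_add ?_ ?_)) ?_)
    · exact (tsum_of_norm_bounded sa'.hasSum ha).trans_eq tsum_mul_right
    · refine (tsum_of_norm_bounded sb'.hasSum hb).trans ?_
      rw [tsum_mul_right]
      exact mul_le_of_le_one_left (by positivity) (hnat N₁)
    · have := abs_tsum_nat_sub_tsum_int_le hp.le hr.le (N N₁)
        (g := fun n => W n * f n (walkScale p r l N₁ n)) (B := C * B) fun n => hWB _ _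
      simp only [Int.cast_natCast] at this
      exact this
  have := hdiff.add hmain
  rw [zero_add] at this
  refine this.congr fun N₁ => ?_
  have e : ∑' n : ℤ, walkProb p r (N N₁) n * (W n * f n (walkScale p r l N₁ n)) =
      ∑' n : ℤ, walkProb p r (2 * l * N₁ + N₀) n * W n * f n (walkScale p r l N₁ n) :=
    tsum_congr fun n => (mul_assoc _ _ _).symm
  rw [e, sub_add_cancel]

end

section

/-! ### The character measure and the walk -/

section

variable {x : ℝ}

/-- Tilting the number of walks by `xⁿ` gives the walk with steps of probabilities proportional to `x`
and `x⁻¹`. -/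
theorem walkCount_mul_zpow_div_pow (hx : 0 < x) (N : ℕ) (n : ℤ) :
    walkProb (x / (x + x⁻¹)) (x⁻¹ / (x + x⁻¹)) N n = walkCount N n * x ^ n / (x + x⁻¹) ^ N := by
  have hZ : x + x⁻¹ ≠ 0 := by positivity
  generalize x + x⁻¹ = Z at hZ ⊢
  induction N generalizing n with
  | zero =>
    rw [walkProb, walkCount_zero]
    split_ifs with h
    · simp [h]
    · simp
  | succ N ih =>
    rw [walkProb, ih, ih, walkCount_succ, zpow_sub_one₀ hx.ne', zpow_add_one₀ hx.ne']
    push_cast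
    field_simp
    ring

theorem weylChar_eq (hx : 0 < x) (hx1 : x ≠ 1) (k : ℕ) :
    weylChar k x = x ^ k * ((1 - (x ^ 2)⁻¹ ^ (k + 1)) / (1 - (x ^ 2)⁻¹)) := by
  have h1 : (x ^ 2)⁻¹ ≠ 1 := by
    rwa [ne_eq, inv_eq_one, pow_eq_one_iff_of_nonneg hx.le two_ne_zero]
  rw [← neg_div_neg_eq, neg_sub, neg_sub, ← geom_sum_eq h1, weylChar, Finset.mul_sum]
  refine Finset.sum_congr rfl fun i _ => ?_
  rw [zpow_sub₀ hx.ne', zpow_natCast, zpow_mul, zpow_natCast, inv_pow, div_eq_mul_inv]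
  norm_cast

end

variable {𝕜 : Type*} [Field 𝕜] [CharZero 𝕜] [Algebra ℤ[T;T⁻¹] 𝕜] {l : ℕ} {x : ℝ}

/-- The leading term of the character of `T(k)`, with an exponentially small error. -/
theorem abs_character_tilting_sub_le (hl : Odd l) (hl₁ : 1 < l)
    (hq : IsPrimitiveRoot (qq 𝕜) (2 * l)) (hx : 1 < x) (k : ℕ) :
    |(x ^ k)⁻¹ * character 𝕜 (TiltingModule 𝕜 k) x - characterFactor l (x ^ 2)⁻¹ (k % l)| ≤
      2 / ((x ^ 2)⁻¹ ^ l * (1 - (x ^ 2)⁻¹)) * (x ^ 2)⁻¹ ^ k := by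
  have hx0 : 0 < x := by linarith
  set y := (x ^ 2)⁻¹ with hy
  have hy0 : 0 < y := by positivity
  have hy1 : y < 1 := inv_lt_one_of_one_lt₀ (one_lt_pow₀ hx two_ne_zero)
  have h1y : 0 < 1 - y := by linarith
  have hxk : x ^ k ≠ 0 := by positivity
  have hyl : y ^ l ≤ 1 := pow_le_one₀ hy0.le hy1.le
  have hyl0 : 0 < y ^ l := pow_pos hy0 l
  have hyk : y ^ (k + 1) ≤ y ^ k / y ^ l := by
    rw [le_div_iff₀ hyl0]
    calc y ^ (k + 1) * y ^ l ≤ y ^ (k + 1) * 1 := by gcongr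
      _ ≤ y ^ k := by rw [mul_one]; exact pow_le_pow_of_le_one hy0.le hy1.le (by omega)
  have hgoal : 2 / (y ^ l * (1 - y)) * y ^ k = (y ^ k / y ^ l + y ^ k / y ^ l) / (1 - y) := by
    field_simp
    ring
  have hmod := Nat.mod_lt k hl.pos
  rw [hgoal]
  by_cases hk : l ∣ k + 1
  · rw [character_tilting_wall hl hl₁ hq (.inr hk), weylChar_eq hx0 hx.ne', inv_mul_cancel_left₀ hxk,
      characterFactor, if_pos ((dvd_add_one_iff hl.pos).1 hk), ← sub_div, abs_div,
      abs_of_pos h1y, sub_sub_cancel_left, abs_neg, abs_of_pos (by positivity)]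
    have : 0 ≤ y ^ k / y ^ l := by positivity
    gcongr
    linarith
  have hk' := hk
  rw [dvd_add_one_iff hl.pos] at hk'
  rcases lt_or_ge k l with hkl | hkl
  · rw [character_tilting_wall hl hl₁ hq (.inl hkl), weylChar_eq hx0 hx.ne',
      inv_mul_cancel_left₀ hxk, characterFactor, if_neg hk', ← sub_div, abs_div,
      abs_of_pos h1y, Nat.mod_eq_of_lt hkl,
      show 1 - y ^ (k + 1) - (1 + y ^ (k + 1)) = -(y ^ (k + 1) + y ^ (k + 1)) by ring, abs_neg,
      abs_of_pos (by positivity)]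
    gcongr
  · have ha : 1 ≤ k / l := (Nat.one_le_div_iff hl.pos).2 hkl
    have h1 := Nat.div_add_mod' k l
    have h2 : l ≤ k / l * l := Nat.le_mul_of_pos_left l ha
    have h3 : k = (k / l * l - k % l - 2) + 2 * (k % l + 1) := by omega
    rw [character_tilting_glued hl hl₁ hq ha (by omega) h1.symm
      (k' := k / l * l - k % l - 2) (by omega), weylChar_eq hx0 hx.ne', weylChar_eq hx0 hx.ne',
      characterFactor, if_neg hk']
    set j := k % l
    set k' := k / l * l - j - 2
    have h4 : (x ^ k)⁻¹ * x ^ k' = y ^ (j + 1) := by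
      rw [h3, pow_add, pow_mul, hy, inv_pow]
      field_simp
    have h5 : y ^ (j + 1) * y ^ (k' + 1) = y ^ (k / l * l) := by
      rw [← pow_add]
      congr 1
      omega
    have h6 : y ^ (k / l * l) ≤ y ^ k / y ^ l := by
      rw [le_div_iff₀ hyl0, ← pow_add]
      exact pow_le_pow_of_le_one hy0.le hy1.le (by omega)
    have e : (x ^ k)⁻¹ * (x ^ k * ((1 - y ^ (k + 1)) / (1 - y)) +
        x ^ k' * ((1 - y ^ (k' + 1)) / (1 - y))) - (1 + y ^ (j + 1)) / (1 - y) =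
        -(y ^ (k + 1) + y ^ (k / l * l)) / (1 - y) := by
      rw [mul_add, inv_mul_cancel_left₀ hxk, ← mul_assoc, h4, ← h5]
      ring
    rw [e, abs_div, abs_of_pos h1y, abs_neg, abs_of_pos (by positivity)]
    gcongr

theorem multiplicity_le_walkCount (hl : Odd l) (hl₁ : 1 < l)
    (hq : IsPrimitiveRoot (qq 𝕜) (2 * l)) (N k : ℕ) : multiplicity 𝕜 k N ≤ walkCount N k := by
  by_cases hk : l ∣ k + 1
  · have := multiplicity_wall (𝕜 := 𝕜) hl hl₁ hq N hk
    omega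
  · have hk' := hk
    rw [dvd_add_one_iff hl.pos] at hk'
    have hmod := Nat.mod_lt k hl.pos
    have h2 := Nat.mul_le_mul_right l (Nat.le_add_left 2 (k / l))
    have := multiplicity_add (𝕜 := 𝕜) hl hl₁ hq N (j := k % l) (a := k / l)
      (n' := (k / l + 2) * l - k % l - 2) (by omega) (Nat.div_add_mod' k l).symm (by omega)
    omega

/-- The character measure is asymptotically `limitRatio` times the distribution of the walk. -/
theorem tsum_abs_charDensity_sub_le (hl : Odd l) (hl₁ : 1 < l)
    (hq : IsPrimitiveRoot (qq 𝕜) (2 * l)) {t : ℝ} (hx : 1 < x) (ht : x = Real.exp t) {p r : ℝ}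
    (hp : p = x / (x + x⁻¹)) (hr : r = x⁻¹ / (x + x⁻¹)) (N : ℕ) :
    (Summable fun k : ℕ => |charDensity 𝕜 N k t - limitRatio l (x ^ 2)⁻¹ (k % l) *
      walkProb p r N k|) ∧
    ∑' k : ℕ, |charDensity 𝕜 N k t - limitRatio l (x ^ 2)⁻¹ (k % l) * walkProb p r N k| ≤
      (4 * l / (1 - (x ^ 2)⁻¹) ^ 2 + 2 / ((x ^ 2)⁻¹ ^ l * (1 - (x ^ 2)⁻¹)) / (1 - (x ^ 2)⁻¹)) *
        ∑' n, |walkProb p r N n - walkProb p r N (n + 2)| := by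
  have hx0 : 0 < x := by linarith
  have hZ : 0 < x + x⁻¹ := by positivity
  have hp0 : 0 ≤ p := by rw [hp]; positivity
  have hr0 : 0 ≤ r := by rw [hr]; positivity
  have hP (n : ℤ) : walkProb p r N n = walkCount N n * x ^ n / (x + x⁻¹) ^ N := by
    rw [hp, hr, walkCount_mul_zpow_div_pow hx0]
  have hP2 (n : ℕ) : (x ^ 2)⁻¹ * walkProb p r N (n + 2) =
      walkCount N (n + 2) * x ^ n / (x + x⁻¹) ^ N := by
    rw [hP, zpow_add₀ hx0.ne', zpow_natCast]
    norm_cast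
    field_simp
  let m (k : ℕ) : ℝ := multiplicity 𝕜 k N * x ^ k / (x + x⁻¹) ^ N
  have hd (k : ℕ) : charDensity 𝕜 N k t =
      m k * ((x ^ k)⁻¹ * character 𝕜 (TiltingModule 𝕜 k) x) := by
    have : x ^ k ≠ 0 := by positivity
    rw [charDensity, ← ht, character_weyl_one]
    simp only [m]
    field_simp
  simp_rw [hd]
  refine tsum_abs_mul_sub_limitRatio_mul_le hl.pos (by positivity)
    (inv_lt_one_of_one_lt₀ (one_lt_pow₀ hx two_ne_zero)) (summable_walkProb N)
    (walkProb_nonneg hp0 hr0 N) (walkProb_le_tsum hp0 hr0 N) (fun k => by positivity)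
    (fun k => ?_) (fun k hk => ?_) (fun a j hj => ?_)
    (abs_character_tilting_sub_le hl hl₁ hq hx)
  · rw [hP, zpow_natCast]
    have : (multiplicity 𝕜 k N : ℝ) ≤ walkCount N k := by
      exact_mod_cast multiplicity_le_walkCount hl hl₁ hq N k
    simp only [m]
    gcongr
  · have : (multiplicity 𝕜 k N : ℝ) + walkCount N (k + 2) = walkCount N k := by
      exact_mod_cast multiplicity_wall hl hl₁ hq N hk
    rw [hP2, hP, zpow_natCast, ← this]
    simp only [m]
    ring
  · have e2 : (a + 2) * l = (a + 1) * l + l := by ring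
    have e1 : (a + 1) * l = a * l + l := by ring
    have : (multiplicity 𝕜 (a * l + j) N : ℝ) + multiplicity 𝕜 ((a + 1) * l + (l - 2 - j)) N +
        walkCount N ((a * l + j : ℕ) + 2) = walkCount N (a * l + j : ℕ) := by
      exact_mod_cast multiplicity_add hl hl₁ hq N hj rfl (by omega)
    rw [hP2, hP, zpow_natCast, ← this]
    have e3 : (x ^ 2)⁻¹ ^ (l - 1 - j) * x ^ ((a + 1) * l + (l - 2 - j)) = x ^ (a * l + j) := by
      rw [show (a + 1) * l + (l - 2 - j) = 2 * (l - 1 - j) + (a * l + j) by omega, pow_add, pow_mul,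
        inv_pow]
      field_simp
    simp only [m]
    linear_combination (multiplicity 𝕜 ((a + 1) * l + (l - 2 - j)) N / (x + x⁻¹) ^ N : ℝ) * e3

end

section

/-! ### The limit distributions -/

section

variable {l : ℕ} {t : ℝ}

/-- The distribution `p₁` in terms of `y = e^{-2t}`. -/
theorem mul_p₁ (ht : 0 < t) (k : Fin l) :
    l * p₁ l t k = limitRatio l (Real.exp t ^ 2)⁻¹ k := by
  have hl : 0 < l := k.pos
  have hl' : (l : ℝ) ≠ 0 := by exact_mod_cast hl.ne'
  have hk := k.isLt
  rw [p₁, limitRatio]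
  by_cases h : (k : ℕ) = l - 1
  · rw [if_pos h, if_pos (by omega), mul_one_div_cancel hl']
  · rw [if_neg h, if_neg (by omega)]
    have hx1 : 1 < Real.exp t := Real.one_lt_exp_iff.2 ht
    set x := Real.exp t with hx
    have hx0 : 0 < x := by positivity
    have e1 (n : ℕ) : Real.exp (t * n) = x ^ n := by rw [mul_comm, Real.exp_nat_mul]
    have e2 (n : ℕ) : Real.exp (-(t * n)) = x ^ n * (x ^ 2)⁻¹ ^ n := by
      rw [Real.exp_neg, e1, inv_pow, ← pow_mul, mul_comm 2 n, pow_mul]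
      field_simp
    have h1 : (l : ℝ) - 1 - (k : ℕ) = (l - 1 - k : ℕ) := by
      rw [Nat.cast_sub (by omega), Nat.cast_sub (by omega), Nat.cast_one]
    have h2 : ((k : ℕ) : ℝ) + 1 = (k + 1 : ℕ) := by push_cast; ring
    rw [h1, h2, e1, e1, e1, e2, e2, e2]
    have h3 : x ^ l = x ^ (k + 1 : ℕ) * x ^ (l - 1 - k : ℕ) := by
      rw [← pow_add]
      congr 1
      omega
    have h4 : 1 - (x ^ 2)⁻¹ ^ l ≠ 0 := by
      have := pow_lt_one₀ (by positivity) (inv_lt_one_of_one_lt₀ (one_lt_pow₀ hx1 two_ne_zero))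
        hl.ne'
      linarith
    rw [show x ^ l - x ^ l * (x ^ 2)⁻¹ ^ l = x ^ l * (1 - (x ^ 2)⁻¹ ^ l) by ring, h3]
    generalize 1 - (x ^ 2)⁻¹ ^ l = d at h4
    have h5 : x ^ (k + 1 : ℕ) ≠ 0 := by positivity
    have h6 : x ^ (l - 1 - k : ℕ) ≠ 0 := by positivity
    generalize x ^ (k + 1 : ℕ) = a at h5 ⊢
    generalize x ^ (l - 1 - k : ℕ) = b at h6 ⊢
    rw [mul_div_assoc', div_eq_div_iff (by positivity) h4]
    ring

theorem limitRatio_nonneg {y : ℝ} (hy0 : 0 < y) (hy1 : y < 1) (j : ℕ) : 0 ≤ limitRatio l y j := by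
  rw [← leadingFactor_mul_characterFactor hy1]
  exact mul_nonneg (leadingFactor_nonneg hy0 hy1 j) (characterFactor_nonneg hy0 hy1 j)

theorem limitRatio_le {y : ℝ} (hy0 : 0 < y) (hy1 : y < 1) (j : ℕ) :
    limitRatio l y j ≤ 2 / (1 - y) := by
  rw [← leadingFactor_mul_characterFactor hy1]
  exact (mul_le_of_le_one_left (characterFactor_nonneg hy0 hy1 j)
    (leadingFactor_le_one hy0 hy1 j)).trans (characterFactor_le hy0 hy1 j)

/-- The density averages to one over the residues: the terms `y^{j+1}` and `y^{l-1-j}` cancel when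
summed. -/
theorem sum_limitRatio {y : ℝ} (hy0 : 0 < y) (hy1 : y < 1) (s : ℕ) :
    ∑ j ∈ Finset.range (s + 1), limitRatio (s + 1) y j = s + 1 := by
  have hy : 1 - y ^ (s + 1) ≠ 0 := by
    have := pow_lt_one₀ hy0.le hy1 s.succ_ne_zero
    rw [Nat.succ_eq_add_one] at this
    linarith
  have h1 (j : ℕ) (hj : j ∈ Finset.range s) : limitRatio (s + 1) y j =
      1 + (y ^ (j + 1) - y ^ (s - 1 - j + 1)) / (1 - y ^ (s + 1)) := by
    rw [Finset.mem_range] at hj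
    rw [limitRatio, if_neg (by omega), show s + 1 - 1 - j = s - 1 - j + 1 by omega]
    have h2 : y ^ (s + 1) = y ^ (j + 1) * y ^ (s - 1 - j + 1) := by
      rw [← pow_add]
      congr 1
      omega
    rw [div_eq_iff hy, add_mul 1 (_ / _), div_mul_cancel₀ _ hy, h2]
    ring
  rw [Finset.sum_range_succ, limitRatio, if_pos rfl, Finset.sum_congr rfl h1,
    Finset.sum_add_distrib, ← Finset.sum_div, Finset.sum_sub_distrib,
    Finset.sum_range_reflect fun j => y ^ (j + 1)]
  simp

theorem p₁_nonneg (ht : 0 < t) (k : Fin l) : 0 ≤ p₁ l t k := by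
  have hl : (0 : ℝ) < l := by exact_mod_cast k.pos
  refine nonneg_of_mul_nonneg_right (a := (l : ℝ)) ?_ hl
  rw [mul_p₁ ht]
  exact limitRatio_nonneg (by positivity)
    (inv_lt_one_of_one_lt₀ (one_lt_pow₀ (Real.one_lt_exp_iff.2 ht) two_ne_zero)) _

theorem sum_p₁ (hl : 0 < l) (ht : 0 < t) : ∑ k, p₁ l t k = 1 := by
  have hl' : (l : ℝ) ≠ 0 := by exact_mod_cast hl.ne'
  refine mul_left_cancel₀ hl' ?_
  obtain ⟨s, rfl⟩ : ∃ s, l = s + 1 := ⟨l - 1, by omega⟩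
  rw [Finset.mul_sum, Finset.sum_congr rfl fun k _ => mul_p₁ ht k,
    Fin.sum_univ_eq_sum_range fun j => limitRatio (s + 1) (Real.exp t ^ 2)⁻¹ j,
    sum_limitRatio (by positivity)
      (inv_lt_one_of_one_lt₀ (one_lt_pow₀ (Real.one_lt_exp_iff.2 ht) two_ne_zero))]
  push_cast
  ring

/-- The density `p₂` is that of the centred normal distribution with variance `1 / (l cosh² t)`. -/
theorem p₂Measure_eq (hl : 0 < l) (t : ℝ) :
    p₂Measure l t = ProbabilityTheory.gaussianReal 0 (Real.toNNReal (1 / (l * Real.cosh t ^ 2))) := by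
  have hl' : (0 : ℝ) < l := by exact_mod_cast hl
  have hc := Real.cosh_pos t
  have hv : 0 < 1 / (l * Real.cosh t ^ 2) := by positivity
  rw [ProbabilityTheory.gaussianReal_of_var_ne_zero _ (Real.toNNReal_pos.2 hv).ne', p₂Measure]
  congr 1
  ext a
  rw [ProbabilityTheory.gaussianPDF, ProbabilityTheory.gaussianPDFReal, p₂,
    Real.coe_toNNReal _ hv.le]
  congr 2
  · rw [← Real.sqrt_inv, ← Real.sqrt_sq hc.le, ← Real.sqrt_mul (by positivity), Real.sqrt_sq hc.le]
    congr 1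
    field_simp
  · congr 1
    field_simp
    ring

end

/-! ### The limit law -/

variable {𝕜 : Type*} [Field 𝕜] [CharZero 𝕜] [Algebra ℤ[T;T⁻¹] 𝕜] {l : ℕ} {t : ℝ}

/-- The character measure has total mass one. -/
theorem hasSum_charDensity (hl : Odd l) (hl₁ : 1 < l) (hq : IsPrimitiveRoot (qq 𝕜) (2 * l)) (N : ℕ)
    (t : ℝ) : HasSum (fun k => charDensity 𝕜 N k t) 1 := by
  have h := (hasSum_multiplicity (𝕜 := 𝕜) hl hl₁ hq N (Real.exp_ne_zero t)).div_const
    ((Real.exp t + (Real.exp t)⁻¹) ^ N)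
  rw [div_self (by positivity)] at h
  simpa only [charDensity, character_weyl_one] using h

theorem charDensity_nonneg (N k : ℕ) (t : ℝ) : 0 ≤ charDensity 𝕜 N k t := by
  have h {M : Type _} [AddCommGroup M] [Module 𝕜 M] [Module (Uq 𝕜) M] [IsScalarTower 𝕜 (Uq 𝕜) M] :
      0 ≤ character 𝕜 M (Real.exp t) := finsum_nonneg fun n => by positivity
  exact div_nonneg (mul_nonneg (by positivity) h) (pow_nonneg h _)

theorem isProbabilityMeasure_rescaledCharMeasure (hl : Odd l) (hl₁ : 1 < l)
    (hq : IsPrimitiveRoot (qq 𝕜) (2 * l)) (N₀ N₁ : ℕ) (t : ℝ) :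
    IsProbabilityMeasure (rescaledCharMeasure 𝕜 l hl.pos N₀ N₁ t) := by
  have : IsProbabilityMeasure (charMeasure 𝕜 (2 * l * N₁ + N₀) t) :=
    isProbabilityMeasure_sum_dirac (fun k => charDensity_nonneg _ k t)
      (hasSum_charDensity hl hl₁ hq _ t) _
  exact Measure.isProbabilityMeasure_map (measurable_of_countable _).aemeasurable

theorem isProbabilityMeasure_p₁Measure (hl : 0 < l) (ht : 0 < t) :
    IsProbabilityMeasure (p₁Measure l t) :=
  isProbabilityMeasure_sum_dirac (p₁_nonneg ht) (sum_p₁ hl ht ▸ hasSum_fintype _) _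

/-- The metric of `ℕ` on `Fin l`, inducing the discrete topology of `Fin l`. -/
abbrev finPseudoMetric (l : ℕ) : PseudoMetricSpace (Fin l) :=
  (PseudoMetricSpace.induced Fin.val inferInstance).replaceTopology
    (@DiscreteTopology.of_continuous_injective _ _ (.induced Fin.val inferInstance) _ _ _
      continuous_induced_dom Fin.val_injective).eq_bot.symm

/-- Convergence of the integrals of bounded functions which are Lipschitz in the second argument. -/
theorem tendsto_integral_rescaledCharMeasure (hl : Odd l) (hl₁ : 1 < l)
    (hq : IsPrimitiveRoot (qq 𝕜) (2 * l)) (ht : 0 < t) (N₀ : ℕ) {f : Fin l × ℝ → ℝ} {B : ℝ}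
    {L : NNReal} (hB : ∀ a, |f a| ≤ B) (hL : ∀ k, LipschitzWith L fun a => f (k, a)) :
    Filter.Tendsto (fun N₁ => ∫ a, f a ∂(rescaledCharMeasure 𝕜 l hl.pos N₀ N₁ t)) Filter.atTop
      (nhds (∫ a, f a ∂((p₁Measure l t).prod (p₂Measure l t)))) := by
  have hl0 : (0 : ℝ) < l := by exact_mod_cast hl.pos
  have : NeZero l := ⟨hl.pos.ne'⟩
  have := isProbabilityMeasure_p₁Measure hl.pos ht
  have hx1 : 1 < Real.exp t := Real.one_lt_exp_iff.2 ht
  obtain ⟨x, hx⟩ : ∃ x, x = Real.exp t := ⟨_, rfl⟩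
  rw [← hx] at hx1
  have hx0 : 0 < x := by linarith
  have hZ : x + x⁻¹ ≠ 0 := by positivity
  have hy0 : 0 < (x ^ 2)⁻¹ := by positivity
  have hy1 : (x ^ 2)⁻¹ < 1 := inv_lt_one_of_one_lt₀ (one_lt_pow₀ hx1 two_ne_zero)
  obtain ⟨p, hp⟩ : ∃ p, p = x / (x + x⁻¹) := ⟨_, rfl⟩
  obtain ⟨r, hr⟩ : ∃ r, r = x⁻¹ / (x + x⁻¹) := ⟨_, rfl⟩
  have hpr : p + r = 1 := by rw [hp, hr, ← add_div, div_self hZ]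
  have hcosh : Real.cosh t = (x + x⁻¹) / 2 := by rw [Real.cosh_eq, Real.exp_neg, ← hx]
  have hsinh : Real.sinh t = (x - x⁻¹) / 2 := by rw [Real.sinh_eq, Real.exp_neg, ← hx]
  have htanh : Real.tanh t = p - r := by
    rw [Real.tanh_eq_sinh_div_cosh, hcosh, hsinh, hp, hr, ← sub_div,
      div_div_div_cancel_right₀ two_ne_zero]
  have hvar : 1 / (l * Real.cosh t ^ 2) = 4 * p * r / l := by
    rw [hcosh, hp, hr]
    field_simp
    ring
  have hr0 : 0 < r := by rw [hr]; positivity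
  have hrp : r < p := by
    rw [hr, hp]
    have : x⁻¹ < 1 := inv_lt_one_of_one_lt₀ hx1
    gcongr
    linarith
  have hp0 : 0 < p := hr0.trans hrp
  have hclose (N : ℕ) := tsum_abs_charDensity_sub_le (𝕜 := 𝕜) hl hl₁ hq hx1 hx hp hr N
  have hlim := tendsto_tsum_residue_of_close hpr hr0 hrp hl N₀
    (W := fun c => limitRatio l (x ^ 2)⁻¹ c.val) (C := 2 / (1 - (x ^ 2)⁻¹))
    (fun c => (abs_of_nonneg (limitRatio_nonneg hy0 hy1 _)).trans_le (limitRatio_le hy0 hy1 _))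
    (π := fun N₁ k => charDensity 𝕜 (2 * l * N₁ + N₀) k t)
    (fun N₁ => by
      simp only [ZMod.val_natCast]
      exact (hclose _).1)
    (by
      simp only [ZMod.val_natCast]
      refine squeeze_zero (fun N₁ => tsum_nonneg fun _ => abs_nonneg _) (fun N₁ => (hclose _).2) ?_
      have := ((tendsto_tsum_abs_walkProb_sub hpr hp0 hr0).comp
        (tendsto_mul_add_atTop (a := 2 * l) (by have := hl.pos; omega) N₀)).const_mul
          (4 * l / (1 - (x ^ 2)⁻¹) ^ 2 + 2 / ((x ^ 2)⁻¹ ^ l * (1 - (x ^ 2)⁻¹)) / (1 - (x ^ 2)⁻¹))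
      rwa [mul_zero] at this)
    (f := fun c a => f (⟨c.val, c.val_lt⟩, a)) (fun c a => hB _) (L := L) fun c a b => by
      have := (hL ⟨c.val, c.val_lt⟩).dist_le_mul a b
      rwa [Real.dist_eq, Real.dist_eq] at this
  have hcont : Continuous f := continuous_prod_of_discrete_left.2 fun k => (hL k).continuous
  convert hlim using 1
  · ext N₁
    rw [rescaledCharMeasure, integral_map (measurable_of_countable _).aemeasurable
      hcont.aestronglyMeasurable, charMeasure,
      integral_sum_ofReal_dirac (fun k => charDensity_nonneg _ k t)]
    refine tsum_congr fun k => ?_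
    simp only [htanh, smul_eq_mul, ZMod.val_natCast]
  · have hint : Integrable f ((p₁Measure l t).prod
        (ProbabilityTheory.gaussianReal 0 (4 * p * r / l).toNNReal)) :=
      Integrable.of_bound hcont.aestronglyMeasurable B (.of_forall hB)
    rw [p₂Measure_eq hl.pos, hvar, integral_prod _ hint, p₁Measure,
      integral_sum_ofReal_dirac (p₁_nonneg ht), tsum_fintype]
    congr 1
    symm
    refine Finset.sum_bij' (fun c _ => ⟨c.val, c.val_lt⟩) (fun k _ => ((k : ℕ) : ZMod l))
      (fun _ _ => Finset.mem_univ _) (fun _ _ => Finset.mem_univ _)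
      (fun c _ => ZMod.natCast_zmod_val c)
      (fun k _ => Fin.ext (by simp [ZMod.val_natCast, Nat.mod_eq_of_lt k.isLt])) fun c _ => ?_
    rw [smul_eq_mul]
    congr 1
    rw [hx, ← mul_p₁ ht ⟨c.val, c.val_lt⟩, inv_mul_cancel_left₀ hl0.ne']

end

end QuantumSl2
end

open scoped LaurentPolynomial in
theorem theorem8p2 {𝕜 : Type*} [Field 𝕜] [CharZero 𝕜] [Algebra ℤ[T;T⁻¹] 𝕜]
    (l : ℕ) (hl : Odd l) (hl₁ : 1 < l) (q : 𝕜)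
    (hv : algebraMap ℤ[T;T⁻¹] 𝕜 (LaurentPolynomial.T 1) = q) (hq : IsPrimitiveRoot q (2 * l))
    (t : ℝ) (ht : 0 < t) (N₀ : ℕ) (hN₀ : N₀ < 2 * l) :
    ((∀ k₀, 0 ≤ QuantumSl2.p₁ l t k₀) ∧ ∑ k₀, QuantumSl2.p₁ l t k₀ = 1) ∧
    QuantumSl2.p₂Measure l t =
      ProbabilityTheory.gaussianReal 0 (Real.toNNReal (1 / (l * Real.cosh t ^ 2))) ∧
    ∃ (μ : ℕ → MeasureTheory.ProbabilityMeasure (Fin l × ℝ))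
      (ν : MeasureTheory.ProbabilityMeasure (Fin l × ℝ)),
      (∀ N₁, (μ N₁ : MeasureTheory.Measure (Fin l × ℝ)) =
        QuantumSl2.rescaledCharMeasure 𝕜 l hl.pos N₀ N₁ t) ∧
      (ν : MeasureTheory.Measure (Fin l × ℝ)) =
        (QuantumSl2.p₁Measure l t).prod (QuantumSl2.p₂Measure l t) ∧
      Filter.Tendsto μ Filter.atTop (nhds ν) := by
  have hq' : IsPrimitiveRoot (QuantumSl2.qq 𝕜) (2 * l) := by
    rw [← hv] at hq
    exact hq
  have hp₂ := QuantumSl2.p₂Measure_eq hl.pos t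
  have := QuantumSl2.isProbabilityMeasure_p₁Measure hl.pos ht
  have : MeasureTheory.IsProbabilityMeasure (QuantumSl2.p₂Measure l t) := by
    rw [hp₂]
    infer_instance
  refine ⟨⟨QuantumSl2.p₁_nonneg ht, QuantumSl2.sum_p₁ hl.pos ht⟩, hp₂,
    fun N₁ => ⟨_, QuantumSl2.isProbabilityMeasure_rescaledCharMeasure hl hl₁ hq' N₀ N₁ t⟩,
    ⟨_, inferInstance⟩, fun N₁ => rfl, rfl, ?_⟩
  -- The criterion by Lipschitz functions requires a metric inducing the discrete topology of `Fin l`.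
  let := QuantumSl2.finPseudoMetric l
  refine tendsto_iff_forall_lipschitz_integral_tendsto.2 ?_
  rintro f ⟨C, hC⟩ ⟨L, hL⟩
  let a₀ : Fin l × ℝ := (⟨0, hl.pos⟩, 0)
  have hB (a : Fin l × ℝ) : |f a| ≤ |f a₀| + C := by
    have h1 := hC a a₀
    have h2 := abs_sub_abs_le_abs_sub (f a) (f a₀)
    rw [Real.dist_eq] at h1
    linarith
  exact QuantumSl2.tendsto_integral_rescaledCharMeasure hl hl₁ hq' ht N₀ hB fun k =>
    LipschitzWith.of_dist_le_mul fun a b => by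
      have := hL.dist_le_mul (k, a) (k, b)
      rwa [dist_prod_same_left] at this
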